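/- **Setting.** Let $0<\gamma<1$, $2\gamma<d$, $\delta>0$, $T>0$, and let $p$ be a real number with $2<p+1\le \frac{2d}{d-2\gamma}$. Let $\mathcal O\subset\mathbb R^d$ be a bounded open set, $\mathbb H=\{u\in L^2(\mathbb R^d):u=0\text{ a.e. in }\mathbb R^d\setminus\mathcal O\}$ with norm $|\cdot|$, and $\mathbb V=\{u\in\mathbb H:\iint\frac{|u(x)-u(y)|^2}{|x-y|^{d+2\gamma}}dx\,dy<\infty\}$. Let $A:\mathbb V\to\mathbb V^*$ be given by $$\langle Av_1,v_2\rangle=\delta(v_1,v_2)+\tfrac12C(d,\gamma)\iint\frac{(v_1(x)-v_1(y))(v_2(x)-v_2(y))}{|x-y|^{d+2\gamma}}\,dx\,dy,\qquad C(d,\gamma)=\frac{\gamma4^\gamma\Gamma(\frac{d+2\gamma}2)}{\pi^{d/2}\Gamma(1-\gamma)}.$$ Let $U$ be a separable real Hilbert space, $E$ a locally compact Polish space, $\lambda$ a Borel measure on $E$ that is finite on compact sets, $E_T=[0,T]\times E$ and $\lambda_T=dt\otimes\lambda$. Assume: * $F\in C^1(\mathbb R)$, and for some $k_1,\dots,k_4>0$: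 $|F(r)|\le k_1(1+|r|^p)$, $rF(r)\ge -k_2+k_3|r|^{p+1}$ and $F'(r)\ge -k_4$ for all $r\in\mathbb R$. * $g:[0,T]\times\mathbb H\to\mathcal L_2(U;\mathbb H)$ (Hilbert–Schmidt operators) is measurable in $t$; for every $r>0$ there is $L_g(r)>0$ with $\|g(t,u_1)-g(t,u_2)\|^2_{\mathcal L_2}\le L_g(r)|u_1-u_2|^2$ whenever $|u_1|,|u_2|\le r$; and $\|g(t,u)\|^2_{\mathcal L_2}\le C_g(1+|u|^2)$ for some $C_g>0$, all uniformly in $t$. * $h:[0,T]\times\mathbb H\times E\to\mathbb H$ is measurable, and for some $L,C>0$ and all $t,u,u_1,u_2$: $\int_E|h(t,u_1,\xi)-h(t,u_2,\xi)|^2\lambda(d\xi)\le L|u_1-u_2|^2$ and $\int_E|h(t,u,\xi)|^2\lambda(d\xi)\le C(1+|u|^2)$. * With $\|h(t,\xi)\|_{0}=\sup_u\frac{|h(t,u,\xi)|}{1+|u|}$ and $\|h(t,\xi)\|_{1}=\sup_{u_1\ne u_2}\frac{|h(t,u_1,\xi)-h(t,u_2,\xi)|}{|u_1-u_2|}$: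 for $i=0,1$ there is $\delta_i>0$ such that $\int_{B}e^{\delta_i\|h(s,\xi)\|_{i}^2}\lambda(d\xi)\,ds<\infty$ for every Borel set $B\subset E_T$ with $\lambda_T(B)<\infty$. For $\Upsilon\in\mathbb N$ let $S^\Upsilon$ be the set of pairs $\pi=(\sigma,\rho)$ with $\sigma\in L^2(0,T;U)$, $\frac12\int_0^T\|\sigma(t)\|_U^2dt\le\Upsilon$, and $\rho:E_T\to[0,\infty)$ measurable with $\int_{E_T}(\rho\log\rho-\rho+1)\,d\lambda_T\le\Upsilon$; put $\mathbb S=\bigcup_\Upsilon S^\Upsilon$ and $\lambda_T^\rho(B)=\int_B\rho\,d\lambda_T$. Convergence $(\sigma_n,\rho_n)\to(\sigma,\rho)$ in $S^\Upsilon$ means that $\sigma_n\to\sigma$ weakly in $L^2(0,T;U)$ and $\int f\,d\lambda_T^{\rho_n}\to\int f\,d\lambda_T^{\rho}$ for every continuous $f:E_T\to\mathbb R$ with compact support. Fix $u_0\in\mathbb H$. For $\pi=(\sigma,\rho)\in\mathbb S$ let $u^\pi\in C([0,T];\mathbb H)\cap L^2(0,T;\mathbb V)\cap L^{p+1}(0,T;L^{p+1}(\mathbb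 R^d))$ be the solution of the skeleton equation $$u^\pi(t)=u_0-\int_0^tAu^\pi(s)\,ds-\int_0^tF(u^\pi(s))\,ds+\int_0^tg(s,u^\pi(s))\sigma(s)\,ds+\int_0^t\!\int_Eh(s,u^\pi(s),\xi)(\rho(s,\xi)-1)\,\lambda(d\xi)\,ds,\quad t\in[0,T],$$ understood in the dual of $\mathbb V\cap L^{p+1}(\mathbb R^d)$ (that is, tested against every element of this space), and put $\mathcal G^0\left(\int_0^\cdot\sigma(s)ds,\lambda_T^\rho\right)=u^\pi$. **Proposition.** Fix $\Upsilon\in\mathbb N$. For every $\pi\in S^\Upsilon$ the solution $u^\pi$ exists and is unique, and $\mathcal G^0$ is well defined. If $\pi_n=(\sigma_n,\rho_n)$ and $\pi=(\sigma,\rho)$ lie in $S^\Upsilon$ and $\pi_n\to\pi$ in $S^\Upsilon$, then $$\mathcal G^0\Big(\int_0^\cdot\sigma_n(s)ds,\lambda_T^{\rho_n}\Big)=u^{\pi_n}\longrightarrow u^\pi=\mathcal G^0\Big(\int_0^\cdot\sigma(s)ds,\lambda_T^{\rho}\Big)\qquad\text{in } C([0,T];\mathbb H).$$ -/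

import Mathlib

open MeasureTheory Filter Topology
open scoped ENNReal NNReal CompactlySupported

noncomputable section

namespace FracSkeleton

/-! ### Function spaces -/

/-- The space `ℝ^d` with its Euclidean norm. -/
abbrev Space (d : ℕ) : Type := EuclideanSpace ℝ (Fin d)

/-- `{u ∈ L²(ℝ^d) : u = 0 a.e. in ℝ^d \ O}`, as a subspace of `L²(ℝ^d)`. -/
def hSub {d : ℕ} (O : Set (Space d)) : Submodule ℝ (Lp ℝ 2 (volume : Measure (Space d))) where
  carrier := {u | ∀ᵐ x ∂(volume : Measure (Space d)), x ∉ O → u x = 0}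
  zero_mem' := by
    filter_upwards [Lp.coeFn_zero ℝ 2 (volume : Measure (Space d))] with x hx _
    simp
  add_mem' := by
    intro u v hu hv
    filter_upwards [hu, hv, Lp.coeFn_add u v] with x h1 h2 h3 hx
    rw [h3, Pi.add_apply, h1 hx, h2 hx, add_zero]
  smul_mem' := by
    intro c u hu
    filter_upwards [hu, Lp.coeFn_smul c u] with x h1 h2 hx
    rw [h2, Pi.smul_apply, h1 hx, smul_zero]

/-- The Hilbert space `ℍ`, with the norm and inner product of `L²(ℝ^d)`. -/
abbrev HSpace {d : ℕ} (O : Set (Space d)) : Type := ↥(hSub O)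

instance {d : ℕ} (O : Set (Space d)) : MeasurableSpace (HSpace O) := borel _

instance {d : ℕ} (O : Set (Space d)) : BorelSpace (HSpace O) := ⟨rfl⟩

/-- The representative on `ℝ^d` of an element of `ℍ`. -/
def rep {d : ℕ} {O : Set (Space d)} (u : HSpace O) : Space d → ℝ :=
  ((u : Lp ℝ 2 (volume : Measure (Space d))) : Space d → ℝ)

/-- The squared Gagliardo seminorm `∬ |u(x) - u(y)|² / |x - y|^(d + 2γ) dx dy ∈ [0, ∞]`. -/
def gagliardoSq {d : ℕ} {O : Set (Space d)} (γ : ℝ) (u : HSpace O) : ℝ≥0∞ :=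
  ∫⁻ x : Space d, ∫⁻ y : Space d,
    ENNReal.ofReal ((rep u x - rep u y) ^ 2 / ‖x - y‖ ^ ((d : ℝ) + 2 * γ))

/-- Membership in `𝕍 = {u ∈ H^γ(ℝ^d) : u = 0 a.e. in ℝ^d \ O}`. -/
def MemV {d : ℕ} {O : Set (Space d)} (γ : ℝ) (u : HSpace O) : Prop :=
  gagliardoSq γ u < ∞

/-- The constant `C(d, γ)` of the integral fractional Laplacian. -/
def fracConst (d : ℕ) (γ : ℝ) : ℝ :=
  γ * (4 : ℝ) ^ γ * Real.Gamma (((d : ℝ) + 2 * γ) / 2) /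
    (Real.pi ^ ((d : ℝ) / 2) * Real.Gamma (1 - γ))

/-- The bilinear form `a(v₁, v₂) = ⟨A v₁, v₂⟩` on `𝕍 × 𝕍`, where `A = (-Δ)^γ + δ`. -/
def formA {d : ℕ} {O : Set (Space d)} (γ δ : ℝ) (v₁ v₂ : HSpace O) : ℝ :=
  δ * inner ℝ v₁ v₂ +
    1 / 2 * fracConst d γ *
      ∫ z : Space d × Space d,
        (rep v₁ z.1 - rep v₁ z.2) * (rep v₂ z.1 - rep v₂ z.2) /
          ‖z.1 - z.2‖ ^ ((d : ℝ) + 2 * γ)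

/-! ### Assumptions on the coefficients -/

/-- `F` is `C¹` and satisfies (F₁)-(F₃) with growth exponent `p`. -/
def CondF (p : ℝ) (F : ℝ → ℝ) : Prop :=
  ContDiff ℝ 1 F ∧
  (∃ k₁ > 0, ∀ r, |F r| ≤ k₁ * (1 + |r| ^ p)) ∧
  (∃ k₂ > 0, ∃ k₃ > 0, ∀ r, -k₂ + k₃ * |r| ^ (p + 1) ≤ r * F r) ∧
  (∃ k₄ > 0, ∀ r, -k₄ ≤ deriv F r)

/-- The squared Hilbert-Schmidt norm `∑ᵢ |G aᵢ|²`, for an orthonormal basis `a`; it is `∞` if `G`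
is not Hilbert-Schmidt. -/
def hsNormSq {ι U K : Type*} [NormedAddCommGroup U] [InnerProductSpace ℝ U]
    [NormedAddCommGroup K] [InnerProductSpace ℝ K]
    (a : HilbertBasis ι ℝ U) (G : U →L[ℝ] K) : ℝ≥0∞ :=
  ∑' i, ‖G (a i)‖ₑ ^ 2

/-- Conditions (g₁)-(g₃) on `[0, T]`: `g(t, ·)` is locally Lipschitz and of linear growth in the
Hilbert-Schmidt norm, uniformly in `t`, and `g(·, u)` is measurable. As `ℒ₂(U; ℍ)` is separable,
measurability into it is measurability of `t ↦ g(t, u) x` for every `x ∈ U`. -/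
def CondG {ι U : Type*} [NormedAddCommGroup U] [InnerProductSpace ℝ U]
    {d : ℕ} {O : Set (Space d)} (T : ℝ) (a : HilbertBasis ι ℝ U)
    (g : Set.Icc (0 : ℝ) T → HSpace O → U →L[ℝ] HSpace O) : Prop :=
  (∀ r : ℝ, 0 < r → ∃ L : ℝ, 0 < L ∧ ∀ t u₁ u₂, ‖u₁‖ ≤ r → ‖u₂‖ ≤ r →
    hsNormSq a (g t u₁ - g t u₂) ≤ ENNReal.ofReal (L * ‖u₁ - u₂‖ ^ 2)) ∧
  (∃ C : ℝ, 0 < C ∧ ∀ t u, hsNormSq a (g t u) ≤ ENNReal.ofReal (C * (1 + ‖u‖ ^ 2))) ∧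
  (∀ u x, Measurable fun t => g t u x)

/-- `h` is jointly measurable, and Lipschitz and of linear growth in `L²(E, lam; ℍ)`, uniformly in
`t`. -/
def CondH {E : Type*} [MeasurableSpace E] {d : ℕ} {O : Set (Space d)} (T : ℝ)
    (lam : Measure E) (h : Set.Icc (0 : ℝ) T → HSpace O → E → HSpace O) : Prop :=
  (Measurable fun z : Set.Icc (0 : ℝ) T × HSpace O × E => h z.1 z.2.1 z.2.2) ∧
  (∃ L : ℝ, 0 < L ∧ ∀ t u₁ u₂,
    ∫⁻ ξ, ‖h t u₁ ξ - h t u₂ ξ‖ₑ ^ 2 ∂lam ≤ ENNReal.ofReal (L * ‖u₁ - u₂‖ ^ 2)) ∧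
  (∃ C : ℝ, 0 < C ∧ ∀ t u, ∫⁻ ξ, ‖h t u ξ‖ₑ ^ 2 ∂lam ≤ ENNReal.ofReal (C * (1 + ‖u‖ ^ 2)))

/-- `‖h(t, ξ)‖_{0,ℍ} = sup_u |h(t, u, ξ)| / (1 + |u|) ∈ [0, ∞]`. -/
def hNorm0 {E : Type*} {d : ℕ} {O : Set (Space d)} {T : ℝ}
    (h : Set.Icc (0 : ℝ) T → HSpace O → E → HSpace O) (z : Set.Icc (0 : ℝ) T × E) : ℝ≥0∞ :=
  ⨆ u : HSpace O, ‖h z.1 u z.2‖ₑ / (1 + ‖u‖ₑ)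

/-- `‖h(t, ξ)‖_{1,ℍ} = sup_{u₁ ≠ u₂} |h(t, u₁, ξ) - h(t, u₂, ξ)| / |u₁ - u₂| ∈ [0, ∞]`. -/
def hNorm1 {E : Type*} {d : ℕ} {O : Set (Space d)} {T : ℝ}
    (h : Set.Icc (0 : ℝ) T → HSpace O → E → HSpace O) (z : Set.Icc (0 : ℝ) T × E) : ℝ≥0∞ :=
  ⨆ (u₁ : HSpace O) (u₂ : HSpace O) (_ : u₁ ≠ u₂),
    ‖h z.1 u₁ z.2 - h z.1 u₂ z.2‖ₑ / ‖u₁ - u₂‖ₑ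

/-- Lebesgue measure `L_T` on `[0, T]`. -/
def timeVol (T : ℝ) : Measure (Set.Icc (0 : ℝ) T) :=
  Measure.comap Subtype.val (volume : Measure ℝ)

/-- The measure `lam_T = L_T ⊗ lam` on `E_T = [0, T] × E`. -/
def lamT {E : Type*} [MeasurableSpace E] (T : ℝ) (lam : Measure E) :
    Measure (Set.Icc (0 : ℝ) T × E) :=
  (timeVol T).prod lam

/-- For some `δ₁ > 0`, `exp(δ₁ N²)` is integrable over every measurable set of finite measure.
That `N` is measurable up to null sets is what gives these integrals their meaning. -/
def ExpIntegrable {X : Type*} [MeasurableSpace X] (m : Measure X) (N : X → ℝ≥0∞) : Prop :=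
  AEMeasurable N m ∧
  ∃ δ₁ : ℝ, 0 < δ₁ ∧ ∀ B : Set X, MeasurableSet B → m B < ∞ →
    ∫⁻ z in B, EReal.exp ((ENNReal.ofReal δ₁ * N z ^ 2 : ℝ≥0∞) : EReal) ∂m < ∞

/-! ### Controls -/

/-- `L²(0, T; U)`. -/
abbrev L2Time (T : ℝ) (U : Type*) [NormedAddCommGroup U] : Type _ :=
  Lp U 2 (timeVol T)

/-- `(σ, ρ) ∈ S^Υ`: `½ ∫₀ᵀ |σ|² ≤ Υ`, and `ρ : E_T → [0, ∞)` is measurable with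
`∫ ℓ(ρ) dlam_T ≤ Υ`, where `ℓ(r) = r log r - r + 1`. -/
def MemS {U E : Type*} [NormedAddCommGroup U] [MeasurableSpace E] {T : ℝ}
    (lam : Measure E) (Υ : ℕ) (σ : L2Time T U) (ρ : Set.Icc (0 : ℝ) T × E → ℝ≥0) : Prop :=
  1 / 2 * (∫ t, ‖σ t‖ ^ 2 ∂(timeVol T)) ≤ (Υ : ℝ) ∧
  Measurable ρ ∧
  ∫⁻ z, ENNReal.ofReal (InformationTheory.klFun (ρ z)) ∂(lamT T lam) ≤ (Υ : ℝ≥0∞)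

/-- The measure `lam_T^ρ(B) = ∫_B ρ dlam_T`. -/
def ctrlMeasure {E : Type*} [MeasurableSpace E] {T : ℝ}
    (lam : Measure E) (ρ : Set.Icc (0 : ℝ) T × E → ℝ≥0) : Measure (Set.Icc (0 : ℝ) T × E) :=
  (lamT T lam).withDensity fun z => (ρ z : ℝ≥0∞)

/-- Convergence in the weakest topology on measures for which all maps `m ↦ ∫ f dm`, with `f`
continuous of compact support, are continuous. -/
def VagueTendsto {X : Type*} [TopologicalSpace X] [MeasurableSpace X]
    (m : ℕ → Measure X) (m₀ : Measure X) : Prop :=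
  ∀ f : X →C_c ℝ, Tendsto (fun n => ∫ x, f x ∂(m n)) atTop (𝓝 (∫ x, f x ∂m₀))

/-- Convergence `(σₙ, ρₙ) → (σ, ρ)` of controls: weakly in `L²(0, T; U)`, and
`lam_T^{ρₙ} → lam_T^ρ` vaguely. -/
def CtrlTendsto {U E : Type*} [NormedAddCommGroup U] [InnerProductSpace ℝ U]
    [TopologicalSpace E] [MeasurableSpace E] {T : ℝ} (lam : Measure E)
    (σs : ℕ → L2Time T U) (ρs : ℕ → Set.Icc (0 : ℝ) T × E → ℝ≥0)
    (σ : L2Time T U) (ρ : Set.Icc (0 : ℝ) T × E → ℝ≥0) : Prop :=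
  (∀ φ : L2Time T U, Tendsto (fun n => inner ℝ (σs n) φ) atTop (𝓝 (inner ℝ σ φ))) ∧
  VagueTendsto (fun n => ctrlMeasure lam (ρs n)) (ctrlMeasure lam ρ)

instance instFiniteTime (T : ℝ) : IsFiniteMeasure (timeVol T) := by
  refine ⟨?_⟩
  rw [timeVol, comap_subtype_coe_apply measurableSet_Icc, Set.image_univ, Subtype.range_coe]
  exact measure_Icc_lt_top

instance instNullSingletonTime (T : ℝ) : NullSingletonClass (timeVol T) := by
  refine ⟨fun t => ?_⟩
  rw [timeVol, comap_subtype_coe_apply measurableSet_Icc]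
  simp

/-- The path `t ↦ ∫₀ᵗ σ(s) ds` in `C([0, T]; U)`. -/
def primitive {U : Type*} [NormedAddCommGroup U] [NormedSpace ℝ U] {T : ℝ}
    (σ : L2Time T U) : C(Set.Icc (0 : ℝ) T, U) where
  toFun t := ∫ s in Set.Iic t, σ s ∂(timeVol T)
  continuous_toFun := by
    have hσ : Integrable (fun s => σ s) (timeVol T) :=
      (Lp.memLp σ).integrable one_le_two
    simp_rw [← integral_indicator measurableSet_Iic]
    refine continuous_iff_continuousAt.2 fun t => ?_
    refine tendsto_integral_filter_of_dominated_convergence (fun s => ‖σ s‖) ?_ ?_ hσ.norm ?_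
    · exact Eventually.of_forall fun r => hσ.aestronglyMeasurable.indicator measurableSet_Iic
    · exact Eventually.of_forall fun r => Eventually.of_forall fun s => norm_indicator_le_norm_self _ _
    · have hne : ∀ᵐ s ∂(timeVol T), s ≠ t := by
        simp [ae_iff]
      filter_upwards [hne] with s hs
      rcases lt_or_gt_of_ne hs with hlt | hgt
      · refine tendsto_const_nhds.congr' ?_
        filter_upwards [lt_mem_nhds hlt] with r hr
        simp [Set.indicator, hr.le, hlt.le]
      · refine tendsto_const_nhds.congr' ?_
        filter_upwards [gt_mem_nhds hgt] with r hr
        simp [Set.indicator, not_le.2 hr, not_le.2 hgt]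

/-! ### The skeleton equation -/

/-- `u ∈ C([0,T]; ℍ) ∩ L²(0,T; 𝕍) ∩ L^{p+1}(0,T; L^{p+1}(ℝ^d))` solves
`u(t) = u₀ - ∫₀ᵗ A u ds - ∫₀ᵗ F(u) ds + ∫₀ᵗ g(s,u) σ ds + ∫₀ᵗ ∫_E h(s,u,ξ)(ρ(s,ξ) - 1) lam(dξ) ds`
in the dual of `𝕍 ∩ L^{p+1}(ℝ^d)`, for all `t ∈ [0, T]`. For `u` continuous into `ℍ`, measurability
into `𝕍` and into `L^{p+1}` is automatic, because both norms are lower semicontinuous on `ℍ`. -/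
structure IsSkeletonSolution {U E : Type*} [NormedAddCommGroup U] [InnerProductSpace ℝ U]
    [MeasurableSpace E] {d : ℕ} {O : Set (Space d)} {T : ℝ} (γ δ p : ℝ) (F : ℝ → ℝ)
    (g : Set.Icc (0 : ℝ) T → HSpace O → U →L[ℝ] HSpace O)
    (lam : Measure E) (h : Set.Icc (0 : ℝ) T → HSpace O → E → HSpace O) (u₀ : HSpace O)
    (σ : L2Time T U) (ρ : Set.Icc (0 : ℝ) T × E → ℝ≥0)
    (u : C(Set.Icc (0 : ℝ) T, HSpace O)) : Prop where
  mem_L2V : ∫⁻ t, gagliardoSq γ (u t) ∂(timeVol T) < ∞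
  mem_Lp : ∫⁻ t, (∫⁻ x, ‖rep (u t) x‖ₑ ^ (p + 1)) ∂(timeVol T) < ∞
  eqn : ∀ (t : Set.Icc (0 : ℝ) T) (v : HSpace O), MemV γ v →
    MemLp (rep v) (ENNReal.ofReal (p + 1)) (volume : Measure (Space d)) →
    inner ℝ (u t) v =
      inner ℝ u₀ v
      - ∫ s in Set.Iic t, formA γ δ (u s) v ∂(timeVol T)
      - ∫ s in Set.Iic t, (∫ x, F (rep (u s) x) * rep v x) ∂(timeVol T)
      + ∫ s in Set.Iic t, inner ℝ (g s (u s) (σ s)) v ∂(timeVol T)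
      + ∫ s in Set.Iic t, (∫ ξ, inner ℝ (h s (u s) ξ) v * ((ρ (s, ξ) : ℝ) - 1) ∂lam)
          ∂(timeVol T)

/-- The map `𝒢⁰`: at `(w, m) = (∫₀^· σ ds, lam_T^ρ)` with `(σ, ρ) ∈ 𝕊 = ⋃_Υ S^Υ` its value is a
solution of the skeleton equation with control `(σ, ρ)`; elsewhere the value is arbitrary. -/
def skeletonMap {U E : Type*} [NormedAddCommGroup U] [InnerProductSpace ℝ U]
    [MeasurableSpace E] {d : ℕ} {O : Set (Space d)} {T : ℝ} (γ δ p : ℝ) (F : ℝ → ℝ)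
    (g : Set.Icc (0 : ℝ) T → HSpace O → U →L[ℝ] HSpace O)
    (lam : Measure E) (h : Set.Icc (0 : ℝ) T → HSpace O → E → HSpace O) (u₀ : HSpace O)
    (w : C(Set.Icc (0 : ℝ) T, U)) (m : Measure (Set.Icc (0 : ℝ) T × E)) :
    C(Set.Icc (0 : ℝ) T, HSpace O) :=
  Classical.epsilon fun u => ∃ (Υ : ℕ) (σ : L2Time T U) (ρ : Set.Icc (0 : ℝ) T × E → ℝ≥0),
    MemS lam Υ σ ρ ∧ w = primitive σ ∧ m = ctrlMeasure lam ρ ∧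
      IsSkeletonSolution γ δ p F g lam h u₀ σ ρ u

end FracSkeleton

end

noncomputable section

namespace FracSkeleton

variable {d : ℕ} {O : Set (Space d)} {γ : ℝ}

/-! ### Representatives of elements of `ℍ` -/

lemma measurable_rep (u : HSpace O) : Measurable (rep u) :=
  (Lp.stronglyMeasurable (u : Lp ℝ 2 (volume : Measure (Space d)))).measurable

lemma memLp_rep (u : HSpace O) : MemLp (rep u) 2 (volume : Measure (Space d)) :=
  Lp.memLp (u : Lp ℝ 2 (volume : Measure (Space d)))

lemma rep_eq_zero (u : HSpace O) : ∀ᵐ x ∂(volume : Measure (Space d)), x ∉ O → rep u x = 0 :=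
  u.2

lemma rep_add (u v : HSpace O) : rep (u + v) =ᵐ[volume] fun x => rep u x + rep v x :=
  Lp.coeFn_add (u : Lp ℝ 2 (volume : Measure (Space d))) v

lemma rep_sub (u v : HSpace O) : rep (u - v) =ᵐ[volume] fun x => rep u x - rep v x :=
  Lp.coeFn_sub (u : Lp ℝ 2 (volume : Measure (Space d))) v

lemma rep_smul (c : ℝ) (u : HSpace O) : rep (c • u) =ᵐ[volume] fun x => c * rep u x :=
  Lp.coeFn_smul c (u : Lp ℝ 2 (volume : Measure (Space d)))

lemma rep_zero : rep (0 : HSpace O) =ᵐ[volume] fun _ => 0 :=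
  Lp.coeFn_zero ℝ 2 (volume : Measure (Space d))

lemma ext_rep {u v : HSpace O} (h : rep u =ᵐ[volume] rep v) : u = v :=
  Subtype.ext (Lp.ext h)

lemma inner_eq_integral (u v : HSpace O) : inner ℝ u v = ∫ x, rep u x * rep v x := by
  rw [Submodule.coe_inner, L2.inner_def]
  refine integral_congr_ae (Eventually.of_forall fun x => ?_)
  simp [rep, mul_comm]

lemma norm_sq_eq_integral (u : HSpace O) : ‖u‖ ^ 2 = ∫ x, rep u x ^ 2 := by
  rw [← real_inner_self_eq_norm_sq, inner_eq_integral]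
  simp [sq]

lemma integrable_rep_mul (u v : HSpace O) :
    Integrable (fun x => rep u x * rep v x) (volume : Measure (Space d)) :=
  (memLp_rep u).integrable_mul (memLp_rep v)

/-- The element of `ℍ` represented by a square integrable function vanishing off `O`. -/
def ofFun (f : Space d → ℝ) (hf : MemLp f 2 volume) (h0 : ∀ x, x ∉ O → f x = 0) : HSpace O :=
  ⟨hf.toLp f, by
    change ∀ᵐ x ∂(volume : Measure (Space d)), x ∉ O → (hf.toLp f) x = 0
    filter_upwards [hf.coeFn_toLp] with x hx hxO
    rw [hx, h0 x hxO]⟩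

lemma rep_ofFun (f : Space d → ℝ) (hf : MemLp f 2 volume) (h0 : ∀ x, x ∉ O → f x = 0) :
    rep (ofFun f hf h0) =ᵐ[volume] f :=
  hf.coeFn_toLp

lemma exists_subseq_rep_tendsto {u : ℕ → HSpace O} {v : HSpace O}
    (h : Tendsto u atTop (𝓝 v)) :
    ∃ ns : ℕ → ℕ, StrictMono ns ∧ ∀ᵐ x ∂(volume : Measure (Space d)),
      Tendsto (fun n => rep (u (ns n)) x) atTop (𝓝 (rep v x)) := by
  have h' : Tendsto (fun n => (u n : Lp ℝ 2 (volume : Measure (Space d)))) atTop (𝓝 v) :=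
    (continuous_subtype_val.tendsto _).comp h
  exact (tendstoInMeasure_of_tendsto_Lp h').exists_seq_tendsto_ae

lemma ae_prod_of_ae {P : Space d → Prop} (h : ∀ᵐ x ∂(volume : Measure (Space d)), P x) :
    ∀ᵐ z ∂(volume : Measure (Space d × Space d)), P z.1 ∧ P z.2 :=
  (Measure.quasiMeasurePreserving_fst.ae h).and (Measure.quasiMeasurePreserving_snd.ae h)

/-! ### The difference quotient operator -/

/-- `L²(ℝ^d × ℝ^d)`. -/
abbrev KSpace (d : ℕ) : Type := Lp ℝ 2 (volume : Measure (Space d × Space d))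

lemma fracConst_pos (hγ₀ : 0 < γ) (hγ₁ : γ < 1) : 0 < fracConst d γ := by
  have h1 : 0 < Real.Gamma (((d : ℝ) + 2 * γ) / 2) := Real.Gamma_pos_of_pos (by positivity)
  have h2 : 0 < Real.Gamma (1 - γ) := Real.Gamma_pos_of_pos (by linarith)
  have h3 := Real.pi_pos
  unfold fracConst
  positivity

/-- The weighted difference quotient of a function on `ℝ^d`. -/
def quot (γ : ℝ) (f : Space d → ℝ) (z : Space d × Space d) : ℝ :=
  √(fracConst d γ / 2) * (f z.1 - f z.2) / ‖z.1 - z.2‖ ^ (((d : ℝ) + 2 * γ) / 2)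

lemma measurable_quot {f : Space d → ℝ} (hf : Measurable f) : Measurable (quot γ f) := by
  unfold quot
  have : Measurable fun z : Space d × Space d => ‖z.1 - z.2‖ ^ (((d : ℝ) + 2 * γ) / 2) :=
    ((measurable_fst.sub measurable_snd).norm).pow_const _
  exact ((((hf.comp measurable_fst).sub (hf.comp measurable_snd)).const_mul _)).div this

lemma quot_mul (hγ₀ : 0 < γ) (hγ₁ : γ < 1) (f g : Space d → ℝ) (z : Space d × Space d) :
    quot γ f z * quot γ g z = fracConst d γ / 2 *
      ((f z.1 - f z.2) * (g z.1 - g z.2) / ‖z.1 - z.2‖ ^ ((d : ℝ) + 2 * γ)) := by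
  have h1 : √(fracConst d γ / 2) * √(fracConst d γ / 2) = fracConst d γ / 2 :=
    Real.mul_self_sqrt (by have := fracConst_pos (d := d) hγ₀ hγ₁; positivity)
  have h2 : ‖z.1 - z.2‖ ^ (((d : ℝ) + 2 * γ) / 2) * ‖z.1 - z.2‖ ^ (((d : ℝ) + 2 * γ) / 2)
      = ‖z.1 - z.2‖ ^ ((d : ℝ) + 2 * γ) := by
    rw [← sq, ← Real.rpow_natCast, ← Real.rpow_mul (norm_nonneg _)]
    congr 1
    push_cast
    ring
  unfold quot
  rw [div_mul_div_comm, h2, mul_mul_mul_comm, h1, mul_div_assoc]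

lemma quot_congr {f g : Space d → ℝ} (h : f =ᵐ[volume] g) :
    quot γ f =ᵐ[volume] quot γ g := by
  filter_upwards [ae_prod_of_ae h] with z hz
  simp [quot, hz.1, hz.2]

lemma lintegral_quot_sq (hγ₀ : 0 < γ) (hγ₁ : γ < 1) (u : HSpace O) :
    ∫⁻ z, ‖quot γ (rep u) z‖ₑ ^ 2 = ENNReal.ofReal (fracConst d γ / 2) * gagliardoSq γ u := by
  have hC := fracConst_pos (d := d) hγ₀ hγ₁
  have h1 : ∀ z : Space d × Space d, ‖quot γ (rep u) z‖ₑ ^ 2 = ENNReal.ofReal (fracConst d γ / 2) *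
      ENNReal.ofReal ((rep u z.1 - rep u z.2) ^ 2 / ‖z.1 - z.2‖ ^ ((d : ℝ) + 2 * γ)) := by
    intro z
    rw [← ENNReal.ofReal_mul (by positivity), ← enorm_pow, sq, quot_mul hγ₀ hγ₁,
      Real.enorm_eq_ofReal]
    · congr 3
      ring
    · have : 0 ≤ (rep u z.1 - rep u z.2) * (rep u z.1 - rep u z.2) := mul_self_nonneg _
      positivity
  have hm : Measurable fun z : Space d × Space d =>
      ENNReal.ofReal ((rep u z.1 - rep u z.2) ^ 2 / ‖z.1 - z.2‖ ^ ((d : ℝ) + 2 * γ)) := by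
    refine ENNReal.measurable_ofReal.comp (Measurable.div ?_ ?_)
    · exact (((measurable_rep u).comp measurable_fst).sub
        ((measurable_rep u).comp measurable_snd)).pow_const 2
    · exact ((measurable_fst.sub measurable_snd).norm).pow_const _
  simp_rw [h1]
  rw [lintegral_const_mul _ hm, gagliardoSq, ← lintegral_prod _ hm.aemeasurable]
  rfl

lemma memLp_two_iff {α Y : Type*} [MeasurableSpace α] [NormedAddCommGroup Y] {μ : Measure α}
    {f : α → Y}
    (hf : AEStronglyMeasurable f μ) : MemLp f 2 μ ↔ ∫⁻ z, ‖f z‖ₑ ^ 2 ∂μ < ∞ := by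
  rw [MemLp, eLpNorm_lt_top_iff_lintegral_rpow_enorm_lt_top (by simp) (by simp)]
  simp [hf]

lemma memV_iff (hγ₀ : 0 < γ) (hγ₁ : γ < 1) (u : HSpace O) :
    MemV γ u ↔ MemLp (quot γ (rep u)) 2 (volume : Measure (Space d × Space d)) := by
  rw [memLp_two_iff (measurable_quot (measurable_rep u)).aestronglyMeasurable,
    lintegral_quot_sq hγ₀ hγ₁, MemV]
  have hC := fracConst_pos (d := d) hγ₀ hγ₁
  constructor
  · exact fun h => ENNReal.mul_lt_top ENNReal.ofReal_lt_top h
  · intro h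
    by_contra hn
    rw [not_lt, top_le_iff] at hn
    rw [hn, ENNReal.mul_top (by simpa using hC)] at h
    exact lt_irrefl _ h

open Classical in
/-- The weighted difference quotient as an element of `L²(ℝ^d × ℝ^d)`; it is `0` off `𝕍`. -/
def Dop (γ : ℝ) (u : HSpace O) : KSpace d :=
  if h : MemLp (quot γ (rep u)) 2 (volume : Measure (Space d × Space d)) then h.toLp _ else 0

section
variable (hγ₀ : 0 < γ) (hγ₁ : γ < 1)
include hγ₀ hγ₁

lemma coeFn_Dop {u : HSpace O} (hu : MemV γ u) : Dop γ u =ᵐ[volume] quot γ (rep u) := by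
  rw [memV_iff hγ₀ hγ₁] at hu
  rw [Dop, dif_pos hu]
  exact hu.coeFn_toLp

lemma memV_of_ae_eq {u : HSpace O} (k : KSpace d) (h : k =ᵐ[volume] quot γ (rep u)) :
    MemV γ u ∧ Dop γ u = k := by
  have hu : MemV γ u := (memV_iff hγ₀ hγ₁ u).2 ((Lp.memLp k).ae_eq h)
  exact ⟨hu, Lp.ext ((coeFn_Dop hγ₀ hγ₁ hu).trans h.symm)⟩

lemma memV_add {u v : HSpace O} (hu : MemV γ u) (hv : MemV γ v) :
    MemV γ (u + v) ∧ Dop γ (u + v) = Dop γ u + Dop γ v := by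
  refine memV_of_ae_eq hγ₀ hγ₁ _ ?_
  filter_upwards [Lp.coeFn_add (Dop γ u) (Dop γ v), coeFn_Dop hγ₀ hγ₁ hu, coeFn_Dop hγ₀ hγ₁ hv,
    quot_congr (γ := γ) (rep_add u v)] with z h1 h2 h3 h4
  rw [h1, Pi.add_apply, h2, h3, h4]
  simp only [quot]
  ring

lemma memV_smul (c : ℝ) {u : HSpace O} (hu : MemV γ u) :
    MemV γ (c • u) ∧ Dop γ (c • u) = c • Dop γ u := by
  refine memV_of_ae_eq hγ₀ hγ₁ _ ?_
  filter_upwards [Lp.coeFn_smul c (Dop γ u), coeFn_Dop hγ₀ hγ₁ hu,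
    quot_congr (γ := γ) (rep_smul c u)] with z h1 h2 h4
  rw [h1, Pi.smul_apply, h2, h4]
  simp only [quot, smul_eq_mul]
  ring

lemma memV_sub {u v : HSpace O} (hu : MemV γ u) (hv : MemV γ v) :
    MemV γ (u - v) ∧ Dop γ (u - v) = Dop γ u - Dop γ v := by
  have h1 := memV_smul hγ₀ hγ₁ (-1) hv
  have h2 := memV_add hγ₀ hγ₁ hu h1.1
  rw [h1.2] at h2
  simpa [sub_eq_add_neg] using h2

lemma memV_zero : MemV γ (0 : HSpace O) ∧ Dop γ (0 : HSpace O) = 0 := by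
  refine memV_of_ae_eq hγ₀ hγ₁ _ ?_
  filter_upwards [Lp.coeFn_zero ℝ 2 (volume : Measure (Space d × Space d)),
    quot_congr (γ := γ) (rep_zero (O := O))] with z h1 h2
  rw [h1, h2]
  simp [quot]

lemma memV_of_tendsto {u : ℕ → HSpace O} {v : HSpace O} {k : KSpace d}
    (hu : ∀ n, MemV γ (u n)) (h1 : Tendsto u atTop (𝓝 v))
    (h2 : Tendsto (fun n => Dop γ (u n)) atTop (𝓝 k)) : MemV γ v ∧ Dop γ v = k := by
  refine memV_of_ae_eq hγ₀ hγ₁ _ ?_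
  obtain ⟨ns, hns, ha⟩ := exists_subseq_rep_tendsto h1
  obtain ⟨ms, hms, hb⟩ := (tendstoInMeasure_of_tendsto_Lp
    (h2.comp hns.tendsto_atTop)).exists_seq_tendsto_ae
  have hc := ae_all_iff.2 fun n => coeFn_Dop hγ₀ hγ₁ (hu (ns (ms n)))
  filter_upwards [hb, hc, ae_prod_of_ae ha] with z h3 h4 h5
  refine tendsto_nhds_unique h3 ?_
  have h6 : Tendsto (fun n => quot γ (rep (u (ns (ms n)))) z) atTop (𝓝 (quot γ (rep v) z)) := by
    unfold quot
    exact (((h5.1.comp hms.tendsto_atTop).sub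
      (h5.2.comp hms.tendsto_atTop)).const_mul _).div_const _
  exact h6.congr fun n => (h4 n).symm

lemma gagliardoSq_eq {u : HSpace O} (hu : MemV γ u) :
    ENNReal.ofReal (fracConst d γ / 2) * gagliardoSq γ u = ‖Dop γ u‖ₑ ^ 2 := by
  rw [← lintegral_quot_sq hγ₀ hγ₁, Lp.enorm_def, eLpNorm_eq_lintegral_rpow_enorm_toReal (by simp)
    (by simp)]
  simp only [ENNReal.toReal_ofNat, ENNReal.rpow_ofNat, one_div]
  rw [← ENNReal.rpow_ofNat, ← ENNReal.rpow_mul]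
  simp only [isUnit_iff_ne_zero, ne_eq, OfNat.ofNat_ne_zero, not_false_eq_true,
    IsUnit.inv_mul_cancel, ENNReal.rpow_one]
  refine lintegral_congr_ae ?_
  filter_upwards [coeFn_Dop hγ₀ hγ₁ hu] with z hz
  rw [hz]

lemma formA_eq (δ : ℝ) {u v : HSpace O} (hu : MemV γ u) (hv : MemV γ v) :
    formA γ δ u v = δ * inner ℝ u v + inner ℝ (Dop γ u) (Dop γ v) := by
  rw [formA, L2.inner_def, mul_comm (1 / 2 : ℝ), mul_one_div, ← integral_const_mul]
  congr 1
  refine integral_congr_ae ?_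
  filter_upwards [coeFn_Dop hγ₀ hγ₁ hu, coeFn_Dop hγ₀ hγ₁ hv] with z h1 h2
  rw [h1, h2, ← quot_mul hγ₀ hγ₁]
  simp [mul_comm]

/-- The graph of `c • D`, as a subspace of `ℍ × L²(ℝ^d × ℝ^d)`. -/
def graphD (c : ℝ) : Submodule ℝ (WithLp 2 (HSpace O × KSpace d)) where
  carrier := {x | MemV γ x.fst ∧ x.snd = c • Dop γ x.fst}
  zero_mem' := by
    refine ⟨(memV_zero hγ₀ hγ₁).1, ?_⟩
    simp [(memV_zero (O := O) hγ₀ hγ₁).2]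
  add_mem' := by
    rintro x y ⟨hx, hx'⟩ ⟨hy, hy'⟩
    refine ⟨(memV_add hγ₀ hγ₁ hx hy).1, ?_⟩
    simp [(memV_add hγ₀ hγ₁ hx hy).2, hx', hy']
  smul_mem' := by
    rintro a x ⟨hx, hx'⟩
    refine ⟨(memV_smul hγ₀ hγ₁ a hx).1, ?_⟩
    simp [(memV_smul hγ₀ hγ₁ a hx).2, hx', smul_comm a c]

lemma isClosed_graphD {c : ℝ} (hc : c ≠ 0) :
    IsClosed (graphD (O := O) hγ₀ hγ₁ c : Set (WithLp 2 (HSpace O × KSpace d))) := by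
  refine IsSeqClosed.isClosed fun x y hx hxy => ?_
  have h1 : Tendsto (fun n => (x n).fst) atTop (𝓝 y.fst) :=
    ((WithLp.prod_continuous_ofLp 2 _ _).fst.tendsto y).comp hxy
  have h2 : Tendsto (fun n => (x n).snd) atTop (𝓝 y.snd) :=
    ((WithLp.prod_continuous_ofLp 2 _ _).snd.tendsto y).comp hxy
  have h3 : Tendsto (fun n => Dop γ (x n).fst) atTop (𝓝 (c⁻¹ • y.snd)) := by
    refine (h2.const_smul c⁻¹).congr fun n => ?_
    rw [(hx n).2, inv_smul_smul₀ hc]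
  have h4 := memV_of_tendsto hγ₀ hγ₁ (fun n => (hx n).1) h1 h3
  refine ⟨h4.1, ?_⟩
  rw [h4.2, smul_inv_smul₀ hc]

end

end FracSkeleton

namespace FracSkeleton

variable {d : ℕ} {O : Set (Space d)} {γ : ℝ}

lemma isClosed_hSub : IsClosed (hSub O : Set (Lp ℝ 2 (volume : Measure (Space d)))) := by
  refine IsSeqClosed.isClosed fun u v hu huv => ?_
  obtain ⟨ns, -, ha⟩ := (tendstoInMeasure_of_tendsto_Lp huv).exists_seq_tendsto_ae
  have hb := ae_all_iff.2 fun n => (hu (ns n) : ∀ᵐ x, x ∉ O → u (ns n) x = 0)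
  change ∀ᵐ x ∂(volume : Measure (Space d)), x ∉ O → v x = 0
  filter_upwards [ha, hb] with x h1 h2 hx
  refine tendsto_nhds_unique h1 ?_
  simp [h2 _ hx]

instance : CompleteSpace (HSpace O) := isClosed_hSub.completeSpace_coe

instance : SecondCountableTopology (HSpace O) := by
  have : Fact ((2 : ℝ≥0∞) ≠ ∞) := ⟨by simp⟩
  exact inferInstance

instance : SecondCountableTopology (KSpace d) := by
  have : SigmaFinite (volume : Measure (Space d × Space d)) := by
    rw [Measure.volume_eq_prod]
    infer_instance
  have : Fact ((2 : ℝ≥0∞) ≠ ∞) := ⟨by simp⟩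
  have : MeasurableSpace.CountablyGenerated (Space d × Space d) := inferInstance
  exact Lp.SecondCountableTopology

instance : PolishSpace (HSpace O) := inferInstance

lemma stronglyMeasurable_of_isClosed_graph {X Z : Type*} [TopologicalSpace X] [PolishSpace X]
    [MeasurableSpace X] [BorelSpace X] [TopologicalSpace Z] [PolishSpace Z]
    [Zero Z] (f : X → Z) (s : Set X) (hcl : IsClosed {q : X × Z | q.1 ∈ s ∧ q.2 = f q.1})
    (h0 : ∀ x ∉ s, f x = 0) : MeasurableSet s ∧ StronglyMeasurable f := by
  let : MeasurableSpace Z := borel Z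
  have : BorelSpace Z := ⟨rfl⟩
  set Γ : Set (X × Z) := {q : X × Z | q.1 ∈ s ∧ q.2 = f q.1} with hΓ
  have : PolishSpace Γ := hcl.polishSpace
  let i : Γ → X := fun q => q.1.1
  have hi : Continuous i := continuous_fst.comp continuous_subtype_val
  have hinj : Function.Injective i := by
    rintro ⟨⟨x, z⟩, hx, hz⟩ ⟨⟨x', z'⟩, hx', hz'⟩ h
    simp only [i] at h hz hz'
    subst h
    simp [hz, hz']
  have he : MeasurableEmbedding i := hi.measurableEmbedding hinj
  have hr : Set.range i = s := by
    ext x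
    constructor
    · rintro ⟨q, rfl⟩
      exact q.2.1
    · exact fun hx => ⟨⟨(x, f x), hx, rfl⟩, rfl⟩
  have hs : MeasurableSet s := hr ▸ he.measurableSet_range
  refine ⟨hs, Measurable.stronglyMeasurable ?_⟩
  classical
  rcases isEmpty_or_nonempty Γ with hΓe | hΓn
  · have hf : f = fun _ => 0 := by
      ext1 x
      refine h0 x fun hx => hΓe.elim ⟨(x, f x), hx, rfl⟩
    rw [hf]
    exact measurable_const
  · have hm : Measurable (s.piecewise (fun x => (he.invFun x).1.2) fun _ => 0) :=
      Measurable.piecewise hs (measurable_snd.comp (measurable_subtype_coe.comp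
        he.measurable_invFun)) measurable_const
    convert hm using 1
    ext1 x
    by_cases hx : x ∈ s
    · rw [Set.piecewise_eq_of_mem _ _ _ hx]
      have h1 : i (he.invFun x) = x := by
        obtain ⟨q, rfl⟩ := (hr.symm ▸ hx : x ∈ Set.range i)
        rw [he.leftInverse_invFun q]
      have h2 := (he.invFun x).2.2
      rw [h2]
      exact congrArg f h1.symm
    · rw [Set.piecewise_eq_of_notMem _ _ _ hx, h0 x hx]

section
variable (hγ₀ : 0 < γ) (hγ₁ : γ < 1)
include hγ₀ hγ₁

lemma measurable_memV_Dop :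
    MeasurableSet {u : HSpace O | MemV γ u} ∧ StronglyMeasurable (Dop γ : HSpace O → KSpace d) := by
  refine stronglyMeasurable_of_isClosed_graph _ _ ?_ ?_
  · refine IsSeqClosed.isClosed fun x y hx hxy => ?_
    have h := memV_of_tendsto hγ₀ hγ₁ (fun n => (hx n).1)
      ((continuous_fst.tendsto y).comp hxy)
      (((continuous_snd.tendsto y).comp hxy).congr fun n => (hx n).2)
    exact ⟨h.1, h.2.symm⟩
  · intro u hu
    rw [Dop, dif_neg]
    rwa [← memV_iff hγ₀ hγ₁]

lemma measurable_gagliardoSq : Measurable (gagliardoSq γ : HSpace O → ℝ≥0∞) := by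
  classical
  obtain ⟨h1, h2⟩ := measurable_memV_Dop (O := O) hγ₀ hγ₁
  have hC := fracConst_pos (d := d) hγ₀ hγ₁
  have hm : Measurable ({u : HSpace O | MemV γ u}.piecewise
      (fun u => (ENNReal.ofReal (fracConst d γ / 2))⁻¹ * ‖Dop γ u‖ₑ ^ 2) fun _ => ∞) :=
    Measurable.piecewise h1 ((h2.enorm.pow_const 2).const_mul _) measurable_const
  convert hm using 1
  ext1 u
  by_cases hu : MemV γ u
  · rw [Set.piecewise_eq_of_mem {u : HSpace O | MemV γ u} _ _ hu, ← gagliardoSq_eq hγ₀ hγ₁ hu, ← mul_assoc,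
      ENNReal.inv_mul_cancel (by simpa using hC) (by simp), one_mul]
  · rw [Set.piecewise_eq_of_notMem {u : HSpace O | MemV γ u} _ _ hu]
    simpa [MemV] using hu

/-! ### The resolvent -/

lemma exists_resolvent {l : ℝ} (hl : 0 < l) : ∃ J : HSpace O →L[ℝ] HSpace O,
    (∀ f, MemV γ (J f)) ∧
    ∀ f v, MemV γ v → inner ℝ (f - J f) v = l * inner ℝ (Dop γ (J f)) (Dop γ v) := by
  have hc : √l ≠ 0 := (Real.sqrt_pos.2 hl).ne'
  set Γ := graphD (O := O) hγ₀ hγ₁ (√l) with hΓ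
  have : CompleteSpace Γ := (isClosed_graphD hγ₀ hγ₁ hc).completeSpace_coe
  let inc : HSpace O →L[ℝ] WithLp 2 (HSpace O × KSpace d) :=
    (WithLp.prodContinuousLinearEquiv 2 ℝ (HSpace O) (KSpace d)).symm.toContinuousLinearMap.comp
      (ContinuousLinearMap.inl ℝ (HSpace O) (KSpace d))
  refine ⟨(WithLp.fstL 2 ℝ (HSpace O) (KSpace d)).comp (Γ.starProjection.comp inc), ?_, ?_⟩
  · intro f
    exact (Γ.starProjection_apply_mem (inc f)).1
  · intro f v hv
    obtain ⟨h1, h2⟩ := Γ.starProjection_apply_mem (inc f)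
    have hw : WithLp.toLp 2 (v, √l • Dop γ v) ∈ Γ := ⟨hv, rfl⟩
    have h3 := Γ.starProjection_inner_eq_zero (inc f) _ hw
    rw [WithLp.prod_inner_apply] at h3
    change inner ℝ (f - (Γ.starProjection (inc f)).fst) v +
      inner ℝ (0 - (Γ.starProjection (inc f)).snd) (√l • Dop γ v) = 0 at h3
    change inner ℝ (f - (Γ.starProjection (inc f)).fst) v =
      l * inner ℝ (Dop γ (Γ.starProjection (inc f)).fst) (Dop γ v)
    rw [h2, zero_sub, inner_neg_left, real_inner_smul_left, real_inner_smul_right, ← mul_assoc,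
      Real.mul_self_sqrt hl.le] at h3
    linarith

end

end FracSkeleton

namespace FracSkeleton

variable {d : ℕ} {O : Set (Space d)} {γ : ℝ}

/-! ### Superposition operators on `ℍ` -/

lemma norm_le_mul_of_ae {u v : HSpace O} {c : ℝ}
    (h : ∀ᵐ x ∂(volume : Measure (Space d)), |rep u x| ≤ c * |rep v x|) : ‖u‖ ≤ c * ‖v‖ :=
  Lp.norm_le_mul_norm_of_ae_le_mul (f := (u : Lp ℝ 2 (volume : Measure (Space d))))
    (g := (v : Lp ℝ 2 (volume : Measure (Space d)))) h

/-- `|u| ≤ R` almost everywhere. -/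
def BddBy (R : ℝ) (u : HSpace O) : Prop :=
  ∀ᵐ x ∂(volume : Measure (Space d)), |rep u x| ≤ R

open Classical in
/-- The element `1_O φ(u)` of `ℍ`, when it is square integrable. -/
def nem (φ : ℝ → ℝ) (u : HSpace O) : HSpace O :=
  if h : MemLp (O.indicator fun x => φ (rep u x)) 2 (volume : Measure (Space d)) then
    ofFun _ h fun _ hx => Set.indicator_of_notMem hx _ else 0

section
variable (hO : MeasurableSet O) (hOf : volume O < ∞)
include hO hOf

lemma memLp_nem {φ : ℝ → ℝ} {L : ℝ≥0} (hφ : LipschitzWith L φ) (u : HSpace O) :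
    MemLp (O.indicator fun x => φ (rep u x)) 2 (volume : Measure (Space d)) := by
  have h1 : MemLp (O.indicator fun _ => ‖φ 0‖) 2 (volume : Measure (Space d)) :=
    memLp_indicator_const 2 hO _ (Or.inr hOf.ne)
  have h2 : MemLp (fun x => O.indicator (fun _ => ‖φ 0‖) x + L * ‖rep u x‖) 2 volume :=
    h1.add ((memLp_rep u).norm.const_mul _)
  refine h2.mono ?_ (Eventually.of_forall fun x => ?_)
  · exact ((hφ.continuous.measurable.comp (measurable_rep u)).indicator hO).aestronglyMeasurable
  · by_cases hx : x ∈ O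
    · rw [Set.indicator_of_mem hx, Set.indicator_of_mem hx]
      have h3 := hφ.dist_le_mul (rep u x) 0
      rw [dist_eq_norm, dist_zero_right] at h3
      have h4 : ‖φ (rep u x)‖ ≤ ‖φ 0‖ + ‖φ (rep u x) - φ 0‖ := by
        simpa using norm_add_le (φ 0) (φ (rep u x) - φ 0)
      exact (h4.trans (by gcongr)).trans (Real.le_norm_self _)
    · rw [Set.indicator_of_notMem hx]
      simp

lemma rep_nem {φ : ℝ → ℝ} {L : ℝ≥0} (hφ : LipschitzWith L φ) (u : HSpace O) :
    rep (nem φ u) =ᵐ[volume] O.indicator fun x => φ (rep u x) := by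
  rw [nem, dif_pos (memLp_nem hO hOf hφ u)]
  exact rep_ofFun _ _ _

lemma nem_sub_le {φ : ℝ → ℝ} {L : ℝ≥0} (hφ : LipschitzWith L φ) (u v : HSpace O) :
    ‖nem φ u - nem φ v‖ ≤ L * ‖u - v‖ := by
  refine norm_le_mul_of_ae ?_
  filter_upwards [rep_sub (nem φ u) (nem φ v), rep_sub u v, rep_nem hO hOf hφ u,
    rep_nem hO hOf hφ v] with x h1 h2 h3 h4
  rw [h1, h2, h3, h4]
  by_cases hx : x ∈ O
  · rw [Set.indicator_of_mem hx, Set.indicator_of_mem hx]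
    exact hφ.dist_le_mul _ _
  · rw [Set.indicator_of_notMem hx, Set.indicator_of_notMem hx]
    simp only [sub_self, abs_zero]
    positivity

lemma lipschitz_nem {φ : ℝ → ℝ} {L : ℝ≥0} (hφ : LipschitzWith L φ) :
    LipschitzWith L (nem φ : HSpace O → HSpace O) :=
  LipschitzWith.of_dist_le_mul fun u v => by
    rw [dist_eq_norm, dist_eq_norm]
    exact nem_sub_le hO hOf hφ u v

lemma norm_le_of_bddBy {R : ℝ} (hR : 0 ≤ R) {u : HSpace O} (hu : BddBy R u) :
    ‖u‖ ≤ R * √(volume.real O) := by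
  have h1 : ‖u‖ ^ 2 ≤ R ^ 2 * volume.real O := by
    rw [norm_sq_eq_integral]
    have h2 : ∫ x in O, (R ^ 2 : ℝ) = R ^ 2 * volume.real O := by
      rw [setIntegral_const, smul_eq_mul, mul_comm]
    rw [← h2, ← integral_indicator hO]
    refine integral_mono_ae ?_ ?_ ?_
    · simpa [sq] using integrable_rep_mul u u
    · exact (integrableOn_const hOf.ne).integrable_indicator hO
    · filter_upwards [hu, rep_eq_zero u] with x h3 h4
      by_cases hx : x ∈ O
      · rw [Set.indicator_of_mem hx, ← sq_abs]
        gcongr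
      · rw [Set.indicator_of_notMem hx, h4 hx]
        simp
  refine abs_le_of_sq_le_sq' ?_ (by positivity) |>.2
  rw [mul_pow, Real.sq_sqrt measureReal_nonneg]
  exact h1

end

/-- The truncation of a real number to `[-R, R]`. -/
def clampFn (R r : ℝ) : ℝ := max (-R) (min r R)

lemma lipschitz_clampFn (R : ℝ) : LipschitzWith 1 (clampFn R) :=
  (LipschitzWith.id.min_const R).const_max (-R)

lemma abs_clampFn_le {R : ℝ} (hR : 0 ≤ R) (r : ℝ) : |clampFn R r| ≤ R := by
  unfold clampFn
  rw [abs_le]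
  constructor
  · exact le_max_left _ _
  · exact max_le (by linarith) (min_le_right _ _)

lemma clampFn_of_abs_le {R r : ℝ} (h : |r| ≤ R) : clampFn R r = r := by
  rw [abs_le] at h
  unfold clampFn
  rw [min_eq_left h.2, max_eq_right h.1]

lemma clampFn_zero {R : ℝ} (hR : 0 ≤ R) : clampFn R 0 = 0 :=
  clampFn_of_abs_le (by simpa)

lemma abs_clampFn_le_abs {R : ℝ} (hR : 0 ≤ R) (r : ℝ) : |clampFn R r| ≤ |r| := by
  simpa [clampFn_zero hR, Real.dist_eq] using (lipschitz_clampFn R).dist_le_mul r 0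

lemma mul_sub_clampFn_nonneg (R a b : ℝ) :
    0 ≤ (a - b) * ((a - clampFn R a) - (b - clampFn R b)) := by
  have h := (lipschitz_clampFn R).dist_le_mul a b
  rw [Real.dist_eq, Real.dist_eq, NNReal.coe_one, one_mul, abs_le] at h
  rcases le_total a b with hab | hab
  · rw [abs_of_nonpos (by linarith)] at h
    nlinarith
  · rw [abs_of_nonneg (by linarith)] at h
    nlinarith

section
variable (hO : MeasurableSet O) (hOf : volume O < ∞)
include hO hOf

lemma rep_clamp {R : ℝ} (hR : 0 ≤ R) (u : HSpace O) :
    rep (nem (clampFn R) u) =ᵐ[volume] fun x => clampFn R (rep u x) := by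
  filter_upwards [rep_nem hO hOf (lipschitz_clampFn R) u, rep_eq_zero u] with x h1 h2
  rw [h1]
  by_cases hx : x ∈ O
  · rw [Set.indicator_of_mem hx]
  · rw [Set.indicator_of_notMem hx, h2 hx, clampFn_zero hR]

lemma bddBy_clamp {R : ℝ} (hR : 0 ≤ R) (u : HSpace O) : BddBy R (nem (clampFn R) u) := by
  filter_upwards [rep_clamp hO hOf hR u] with x h1
  rw [h1]
  exact abs_clampFn_le hR _

lemma clamp_of_bddBy {R : ℝ} (hR : 0 ≤ R) {u : HSpace O} (hu : BddBy R u) :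
    nem (clampFn R) u = u := by
  refine ext_rep ?_
  filter_upwards [rep_clamp hO hOf hR u, hu] with x h1 h2
  rw [h1, clampFn_of_abs_le h2]

lemma norm_clamp_le {R : ℝ} (hR : 0 ≤ R) (u : HSpace O) : ‖nem (clampFn R) u‖ ≤ ‖u‖ := by
  have h := norm_le_mul_of_ae (u := nem (clampFn R) u) (v := u) (c := 1) (by
    filter_upwards [rep_clamp hO hOf hR u] with x h1
    rw [h1, one_mul]
    exact abs_clampFn_le_abs hR _)
  simpa using h

lemma tendsto_clamp (u : HSpace O) :
    Tendsto (fun n : ℕ => nem (clampFn n) u) atTop (𝓝 u) := by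
  rw [tendsto_iff_norm_sub_tendsto_zero]
  have h1 : Tendsto (fun n : ℕ => ‖nem (clampFn n) u - u‖ ^ 2) atTop (𝓝 0) := by
    have h2 : ∀ n : ℕ, ‖nem (clampFn n) u - u‖ ^ 2 = ∫ x, (clampFn n (rep u x) - rep u x) ^ 2 := by
      intro n
      rw [norm_sq_eq_integral]
      refine integral_congr_ae ?_
      filter_upwards [rep_sub (nem (clampFn n) u) u, rep_clamp hO hOf n.cast_nonneg u] with x h3 h4
      rw [h3, h4]
    simp_rw [h2]
    have h5 : (0 : ℝ) = ∫ x : Space d, (0 : ℝ) := by simp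
    rw [h5]
    refine tendsto_integral_of_dominated_convergence (fun x => 4 * (rep u x * rep u x)) ?_
      ((integrable_rep_mul u u).const_mul _) ?_ ?_
    · intro n
      exact (((((lipschitz_clampFn n).continuous.measurable.comp (measurable_rep u)).sub
        (measurable_rep u)).pow_const 2)).aestronglyMeasurable
    · intro n
      refine Eventually.of_forall fun x => ?_
      have h6 := abs_clampFn_le_abs (n.cast_nonneg (α := ℝ)) (rep u x)
      have h7 : |clampFn n (rep u x) - rep u x| ≤ 2 * |rep u x| :=
        (abs_sub _ _).trans (by linarith)
      rw [Real.norm_eq_abs, abs_pow, ← abs_mul_abs_self (rep u x)]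
      nlinarith [abs_nonneg (clampFn n (rep u x) - rep u x)]
    · refine Eventually.of_forall fun x => ?_
      refine tendsto_const_nhds.congr' ?_
      obtain ⟨N, hN⟩ := exists_nat_ge |rep u x|
      filter_upwards [eventually_ge_atTop N] with n hn
      rw [clampFn_of_abs_le (hN.trans (by exact_mod_cast hn))]
      simp
  have h8 := (Real.continuous_sqrt.tendsto _).comp h1
  simpa [Function.comp_def, Real.sqrt_sq (norm_nonneg _)] using h8

lemma memV_clamp (hγ₀ : 0 < γ) (hγ₁ : γ < 1) {R : ℝ} (hR : 0 ≤ R) {u : HSpace O}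
    (hu : MemV γ u) : MemV γ (nem (clampFn R) u) ∧
      0 ≤ inner ℝ (Dop γ u) (Dop γ (u - nem (clampFn R) u)) := by
  have h1 : MemV γ (nem (clampFn R) u) := by
    rw [memV_iff hγ₀ hγ₁] at hu ⊢
    refine hu.mono (measurable_quot (measurable_rep _)).aestronglyMeasurable ?_
    filter_upwards [quot_congr (γ := γ) (rep_clamp hO hOf hR u)] with z hz
    rw [hz]
    simp only [quot, norm_div, norm_mul]
    gcongr
    simpa [Real.dist_eq] using (lipschitz_clampFn R).dist_le_mul (rep u z.1) (rep u z.2)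
  refine ⟨h1, ?_⟩
  rw [L2.inner_def]
  refine integral_nonneg_of_ae ?_
  filter_upwards [coeFn_Dop hγ₀ hγ₁ hu, coeFn_Dop hγ₀ hγ₁ (memV_sub hγ₀ hγ₁ hu h1).1,
    quot_congr (γ := γ) (rep_sub u (nem (clampFn R) u)),
    ae_prod_of_ae (rep_clamp hO hOf hR u)] with z h2 h3 h4 h5
  rw [h2, h3, h4]
  have h6 := quot_mul hγ₀ hγ₁ (rep u) (fun x => rep u x - rep (nem (clampFn R) u) x) z
  change 0 ≤ inner ℝ _ _
  rw [real_inner_comm]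
  change 0 ≤ quot γ (rep u) z * quot γ (fun x => rep u x - rep (nem (clampFn R) u) x) z
  rw [h6, h5.1, h5.2]
  have h7 := mul_sub_clampFn_nonneg R (rep u z.1) (rep u z.2)
  have h8 := fracConst_pos (d := d) hγ₀ hγ₁
  positivity

/-- The resolvent preserves pointwise bounds. -/
lemma bddBy_resolvent (hγ₀ : 0 < γ) (hγ₁ : γ < 1) {R l : ℝ} (hR : 0 ≤ R) (hl : 0 < l)
    {f y : HSpace O} (hy : MemV γ y)
    (h : ∀ v, MemV γ v → inner ℝ (f - y) v = l * inner ℝ (Dop γ y) (Dop γ v))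
    (hf : BddBy R f) : BddBy R y := by
  obtain ⟨h1, h2⟩ := memV_clamp hO hOf hγ₀ hγ₁ hR hy
  set c := nem (clampFn R) y with hc
  have h3 := h _ (memV_sub hγ₀ hγ₁ hy h1).1
  have h4 : inner ℝ (f - y) (y - c) ≤ -‖y - c‖ ^ 2 := by
    rw [inner_eq_integral, norm_sq_eq_integral, ← integral_neg]
    refine integral_mono_ae (integrable_rep_mul _ _) ?_ ?_
    · simpa [sq] using (integrable_rep_mul (y - c) (y - c)).neg
    · filter_upwards [rep_sub f y, rep_sub y c, rep_clamp hO hOf hR y, hf] with x h5 h6 h7 h8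
      rw [h5, h6, h7]
      rw [abs_le] at h8
      unfold clampFn
      rcases le_total (rep y x) R with ha | ha
      · rw [min_eq_left ha]
        rcases le_total (-R) (rep y x) with hb | hb
        · rw [max_eq_right hb]
          simp
        · rw [max_eq_left hb]
          nlinarith
      · rw [min_eq_right ha, max_eq_right (by linarith)]
        nlinarith
  have h9 : ‖y - c‖ ^ 2 ≤ 0 := by
    have := mul_nonneg hl.le h2
    linarith
  have h10 : y - c = 0 := by
    rw [← norm_eq_zero]
    exact pow_eq_zero_iff (two_ne_zero) |>.1 (le_antisymm h9 (sq_nonneg _))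
  rw [sub_eq_zero.1 h10]
  exact bddBy_clamp hO hOf hR y

end

/-- A continuous function defined by convergence is bounded by `R` if the approximants are. -/
lemma bddBy_of_tendsto {R : ℝ} {u : ℕ → HSpace O} {v : HSpace O} (h : Tendsto u atTop (𝓝 v))
    (hu : ∀ n, BddBy R (u n)) : BddBy R v := by
  obtain ⟨ns, -, ha⟩ := exists_subseq_rep_tendsto h
  filter_upwards [ha, ae_all_iff.2 fun n => hu (ns n)] with x h1 h2
  exact le_of_tendsto h1.abs (Eventually.of_forall h2)

end FracSkeleton

namespace FracSkeleton

variable {d : ℕ} {O : Set (Space d)} {γ : ℝ}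

/-! ### Density of bounded elements of `𝕍` -/

lemma integrable_min_div_rpow (hd : 0 < d) (hγ₀ : 0 < γ) (hγ₁ : γ < 1) {a b : ℝ} (ha : 0 ≤ a)
    (hb : 0 ≤ b) :
    Integrable (fun x : Space d => min (a * ‖x‖ ^ 2) b / ‖x‖ ^ ((d : ℝ) + 2 * γ)) := by
  have : Nonempty (Fin d) := ⟨⟨0, hd⟩⟩
  have hnt : Nontrivial (Space d) := inferInstance
  rw [integrable_fun_norm_addHaar volume
    (f := fun r : ℝ => min (a * r ^ 2) b / r ^ ((d : ℝ) + 2 * γ)), finrank_euclideanSpace_fin]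
  have hm : Measurable fun y : ℝ => y ^ (d - 1) • (min (a * y ^ 2) b / y ^ ((d : ℝ) + 2 * γ)) := by
    refine (measurable_id.pow_const (d - 1)).smul (Measurable.div ?_ ?_)
    · exact ((measurable_id.pow_const 2).const_mul a).min measurable_const
    · exact measurable_id.pow_const _
  have hpow : ∀ y : ℝ, 0 < y → y ^ (d - 1) = y ^ ((d : ℝ) - 1) := by
    intro y hy
    rw [← Real.rpow_natCast, Nat.cast_sub hd, Nat.cast_one]
  have hU : Set.Ioc (0 : ℝ) 1 ∪ Set.Ioi 1 = Set.Ioi 0 := Set.Ioc_union_Ioi_eq_Ioi zero_le_one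
  rw [← hU]
  refine IntegrableOn.union ?_ ?_
  · have h1 : IntegrableOn (fun y : ℝ => a * y ^ (1 - 2 * γ)) (Set.Ioc 0 1) := by
      have := (intervalIntegral.intervalIntegrable_rpow' (a := 0) (b := 1)
        (r := 1 - 2 * γ) (by linarith)).const_mul a
      rwa [intervalIntegrable_iff_integrableOn_Ioc_of_le zero_le_one] at this
    refine h1.mono' hm.aestronglyMeasurable ?_
    filter_upwards [ae_restrict_mem measurableSet_Ioc] with y hy
    have hy0 := hy.1
    rw [Real.norm_of_nonneg (by positivity), smul_eq_mul, hpow y hy0]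
    calc y ^ ((d : ℝ) - 1) * (min (a * y ^ 2) b / y ^ ((d : ℝ) + 2 * γ))
        ≤ y ^ ((d : ℝ) - 1) * ((a * y ^ 2) / y ^ ((d : ℝ) + 2 * γ)) := by
          gcongr
          exact min_le_left _ _
      _ = a * y ^ (1 - 2 * γ) := by
          rw [← Real.rpow_natCast y 2, mul_div_assoc, mul_left_comm, ← Real.rpow_sub hy0,
            ← Real.rpow_add hy0]
          congr 2
          push_cast
          ring
  · have h1 : IntegrableOn (fun y : ℝ => b * y ^ (-1 - 2 * γ)) (Set.Ioi 1) :=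
      (integrableOn_Ioi_rpow_of_lt (by linarith) zero_lt_one).const_mul b
    refine h1.mono' hm.aestronglyMeasurable ?_
    filter_upwards [ae_restrict_mem measurableSet_Ioi] with y hy
    have hy0 : 0 < y := zero_lt_one.trans hy
    rw [Real.norm_of_nonneg (by positivity), smul_eq_mul, hpow y hy0]
    calc y ^ ((d : ℝ) - 1) * (min (a * y ^ 2) b / y ^ ((d : ℝ) + 2 * γ))
        ≤ y ^ ((d : ℝ) - 1) * (b / y ^ ((d : ℝ) + 2 * γ)) := by
          gcongr
          exact min_le_right _ _
      _ = b * y ^ (-1 - 2 * γ) := by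
          rw [div_eq_mul_inv, ← Real.rpow_neg hy0.le, mul_left_comm, ← Real.rpow_add hy0]
          congr 2
          ring

lemma memLp_quot_of_lipschitz (hd : 0 < d) (hγ₀ : 0 < γ) (hγ₁ : γ < 1) {φ : Space d → ℝ}
    {L : ℝ≥0} (hφ : LipschitzWith L φ) (hc : HasCompactSupport φ) {M : ℝ}
    (hM : ∀ x, |φ x| ≤ M) :
    MemLp (quot γ φ) 2 (volume : Measure (Space d × Space d)) := by
  have hmφ : Measurable φ := hφ.continuous.measurable
  have hM0 : 0 ≤ M := (abs_nonneg _).trans (hM 0)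
  rw [memLp_two_iff (measurable_quot hmφ).aestronglyMeasurable]
  set S := tsupport φ with hS
  have hSm : MeasurableSet S := (isClosed_tsupport φ).measurableSet
  have hSf : volume S < ∞ := hc.isCompact.measure_lt_top
  set m : Space d → ℝ≥0∞ := fun x => ENNReal.ofReal
    (min ((L : ℝ) ^ 2 * ‖x‖ ^ 2) (4 * M ^ 2) / ‖x‖ ^ ((d : ℝ) + 2 * γ)) with hm
  have hmm : Measurable m := by
    refine ENNReal.measurable_ofReal.comp (Measurable.div ?_ ?_)
    · exact ((measurable_norm.pow_const 2).const_mul _).min measurable_const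
    · exact measurable_norm.pow_const _
  have hI : ∫⁻ x, m x < ∞ := by
    have h := (integrable_min_div_rpow hd hγ₀ hγ₁ (a := (L : ℝ) ^ 2) (b := 4 * M ^ 2)
      (by positivity) (by positivity)).lintegral_lt_top
    exact h
  have hC := fracConst_pos (d := d) hγ₀ hγ₁
  have hbound : ∀ z : Space d × Space d, ‖quot γ φ z‖ₑ ^ 2 ≤ ENNReal.ofReal (fracConst d γ / 2) *
      (S.indicator 1 z.1 * m (z.1 - z.2) + S.indicator 1 z.2 * m (z.1 - z.2)) := by
    intro z
    have h1 : (φ z.1 - φ z.2) ^ 2 ≤ min ((L : ℝ) ^ 2 * ‖z.1 - z.2‖ ^ 2) (4 * M ^ 2) := by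
      refine le_min ?_ ?_
      · have := hφ.dist_le_mul z.1 z.2
        rw [Real.dist_eq, dist_eq_norm] at this
        rw [← mul_pow, ← sq_abs]
        gcongr
      · have : |φ z.1 - φ z.2| ≤ 2 * M := (abs_sub _ _).trans (by linarith [hM z.1, hM z.2])
        rw [← sq_abs]
        nlinarith [abs_nonneg (φ z.1 - φ z.2)]
    have h2 : ‖quot γ φ z‖ₑ ^ 2 = ENNReal.ofReal (fracConst d γ / 2) *
        ENNReal.ofReal ((φ z.1 - φ z.2) ^ 2 / ‖z.1 - z.2‖ ^ ((d : ℝ) + 2 * γ)) := by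
      rw [← ENNReal.ofReal_mul (by positivity), ← enorm_pow, sq, quot_mul hγ₀ hγ₁,
        Real.enorm_eq_ofReal]
      · congr 3
        ring
      · have : 0 ≤ (φ z.1 - φ z.2) * (φ z.1 - φ z.2) := mul_self_nonneg _
        positivity
    rw [h2, ← add_mul]
    gcongr
    by_cases hz : z.1 ∈ S ∨ z.2 ∈ S
    · have h3 : (1 : ℝ≥0∞) ≤ S.indicator 1 z.1 + S.indicator 1 z.2 := by
        rcases hz with hz | hz
        · rw [Set.indicator_of_mem hz]
          simp
        · rw [Set.indicator_of_mem hz (1 : Space d → ℝ≥0∞)]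
          simp
      refine le_trans ?_ (mul_le_mul_left h3 _)
      rw [one_mul]
      exact ENNReal.ofReal_le_ofReal (by gcongr)
    · push Not at hz
      rw [image_eq_zero_of_notMem_tsupport hz.1, image_eq_zero_of_notMem_tsupport hz.2]
      simp
  have hmS : Measurable (S.indicator (1 : Space d → ℝ≥0∞)) := measurable_one.indicator hSm
  have hm1 : Measurable fun z : Space d × Space d => S.indicator 1 z.1 * m (z.1 - z.2) :=
    (hmS.comp measurable_fst).mul (hmm.comp (measurable_fst.sub measurable_snd))
  have hm2 : Measurable fun z : Space d × Space d => S.indicator 1 z.2 * m (z.1 - z.2) :=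
    (hmS.comp measurable_snd).mul (hmm.comp (measurable_fst.sub measurable_snd))
  have hSint : ∫⁻ x, S.indicator (1 : Space d → ℝ≥0∞) x * ∫⁻ y, m y < ∞ := by
    rw [lintegral_mul_const _ hmS, lintegral_indicator_one hSm]
    exact ENNReal.mul_lt_top hSf hI
  refine lt_of_le_of_lt (lintegral_mono hbound) ?_
  rw [lintegral_const_mul' _ _ ENNReal.ofReal_ne_top]
  refine ENNReal.mul_lt_top ENNReal.ofReal_lt_top ?_
  rw [lintegral_add_left hm1, ENNReal.add_lt_top]
  constructor
  · rw [Measure.volume_eq_prod, lintegral_prod _ hm1.aemeasurable]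
    refine lt_of_le_of_lt (lintegral_mono fun x => ?_) hSint
    change ∫⁻ y, S.indicator 1 x * m (x - y) ≤ S.indicator 1 x * ∫⁻ y, m y
    have hmx : Measurable fun y => m (x - y) := hmm.comp (measurable_const.sub measurable_id)
    rw [lintegral_const_mul _ hmx, lintegral_sub_left_eq_self m x]
  · rw [Measure.volume_eq_prod, lintegral_prod_symm _ hm2.aemeasurable]
    refine lt_of_le_of_lt (lintegral_mono fun y => ?_) hSint
    change ∫⁻ x, S.indicator 1 y * m (x - y) ≤ S.indicator 1 y * ∫⁻ y, m y
    have hmy : Measurable fun x => m (x - y) := hmm.comp (measurable_id.sub measurable_const)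
    rw [lintegral_const_mul _ hmy, lintegral_sub_right_eq_self m y]

lemma bddBy_zero : BddBy 0 (0 : HSpace O) := by
  filter_upwards [rep_zero (O := O)] with x hx
  rw [hx, abs_zero]

/-- Bounded elements of `𝕍`. -/
def boundedV (O : Set (Space d)) (γ : ℝ) : Set (HSpace O) := {v | MemV γ v ∧ ∃ R, BddBy R v}

lemma dense_boundedV (hO : IsOpen O) (hd : 0 < d) (hγ₀ : 0 < γ) (hγ₁ : γ < 1) :
    Dense (boundedV O γ) := by
  let S : Submodule ℝ (HSpace O) :=
    { carrier := boundedV O γ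
      zero_mem' := ⟨(memV_zero hγ₀ hγ₁).1, 0, bddBy_zero⟩
      add_mem' := by
        rintro u v ⟨hu, R, hR⟩ ⟨hv, R', hR'⟩
        refine ⟨(memV_add hγ₀ hγ₁ hu hv).1, R + R', ?_⟩
        filter_upwards [rep_add u v, hR, hR'] with x h1 h2 h3
        rw [h1]
        exact (abs_add_le _ _).trans (by linarith)
      smul_mem' := by
        rintro c u ⟨hu, R, hR⟩
        refine ⟨(memV_smul hγ₀ hγ₁ c hu).1, |c| * R, ?_⟩
        filter_upwards [rep_smul c u, hR] with x h1 h2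
        rw [h1, abs_mul]
        gcongr }
  have hS : Sᗮ = ⊥ := by
    rw [Submodule.eq_bot_iff]
    intro w hw
    refine ext_rep ?_
    have hloc : LocallyIntegrableOn (rep w) O volume :=
      ((memLp_rep w).locallyIntegrable (by norm_num)).locallyIntegrableOn O
    have h0 := hO.ae_eq_zero_of_integral_contDiff_smul_eq_zero hloc (by
      intro φ hφ hc hsupp
      obtain ⟨L, hL⟩ := (hφ.of_le (by simp : (1 : WithTop ℕ∞) ≤ _)).lipschitzWith_of_hasCompactSupport
        hc one_ne_zero
      obtain ⟨M, hM⟩ := hc.exists_bound_of_continuous hφ.continuous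
      have hLp : MemLp φ 2 (volume : Measure (Space d)) := hφ.continuous.memLp_of_hasCompactSupport hc
      set v : HSpace O := ofFun φ hLp fun x hx =>
        image_eq_zero_of_notMem_tsupport fun h => hx (hsupp h) with hv
      have hrep : rep v =ᵐ[volume] φ := rep_ofFun _ _ _
      have hvS : v ∈ S := by
        refine ⟨(memV_iff hγ₀ hγ₁ v).2 ?_, M, ?_⟩
        · exact (memLp_quot_of_lipschitz hd hγ₀ hγ₁ hL hc hM).ae_eq (quot_congr hrep.symm)
        · filter_upwards [hrep] with x hx
          rw [hx]
          exact hM x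
      have h1 : inner ℝ v w = 0 := (Submodule.mem_orthogonal _ _).1 hw v hvS
      rw [inner_eq_integral] at h1
      rw [← h1]
      refine integral_congr_ae ?_
      filter_upwards [hrep] with x hx
      rw [hx, smul_eq_mul])
    filter_upwards [h0, rep_eq_zero w, rep_zero (O := O)] with x h1 h2 h3
    rw [h3]
    by_cases hx : x ∈ O
    · exact h1 hx
    · exact h2 hx
  have h1 := (Submodule.topologicalClosure_eq_top_iff (K := S)).2 hS
  have h2 := (Submodule.dense_iff_topologicalClosure_eq_top (s := S)).2 h1
  exact h2

end FracSkeleton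

namespace FracSkeleton

variable {d : ℕ} {O : Set (Space d)} {γ p : ℝ}

/-! ### The space `L^{p+1}` -/

instance [h : Fact (1 < p)] : Fact (1 ≤ ENNReal.ofReal (p + 1)) :=
  ⟨by
    rw [ENNReal.one_le_ofReal]
    linarith [h.out]⟩

instance : Fact (ENNReal.ofReal (p + 1) ≠ ∞) := ⟨ENNReal.ofReal_ne_top⟩

/-- The integral `∫ |u|^{p+1} dx`. -/
def powInt (p : ℝ) (u : HSpace O) : ℝ≥0∞ := ∫⁻ x, ‖rep u x‖ₑ ^ (p + 1)

lemma lowerSemicontinuous_powInt :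
    LowerSemicontinuous (powInt p : HSpace O → ℝ≥0∞) := by
  rw [lowerSemicontinuous_iff_isClosed_preimage]
  intro c
  refine IsSeqClosed.isClosed fun u v hu huv => ?_
  obtain ⟨ns, -, ha⟩ := exists_subseq_rep_tendsto huv
  change powInt p v ≤ c
  have h1 : powInt p v ≤ ∫⁻ x, liminf (fun n => ‖rep (u (ns n)) x‖ₑ ^ (p + 1)) atTop := by
    refine lintegral_mono_ae ?_
    filter_upwards [ha] with x hx
    have h2 : Tendsto (fun n => ‖rep (u (ns n)) x‖ₑ ^ (p + 1)) atTop
        (𝓝 (‖rep v x‖ₑ ^ (p + 1))) :=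
      (ENNReal.continuous_rpow_const.tendsto _).comp ((continuous_enorm.tendsto _).comp hx)
    rw [h2.liminf_eq]
  refine h1.trans ((lintegral_liminf_le fun n => ?_).trans ?_)
  · exact ((measurable_rep _).enorm).pow_const _
  · refine liminf_le_of_le (by isBoundedDefault) fun b hb => ?_
    obtain ⟨n, hn⟩ := hb.exists
    exact hn.trans (hu (ns n))

lemma measurable_powInt : Measurable (powInt p : HSpace O → ℝ≥0∞) :=
  lowerSemicontinuous_powInt.measurable

lemma powInt_le_liminf {u : ℕ → HSpace O} {v : HSpace O}
    (h : Tendsto u atTop (𝓝 v)) : powInt p v ≤ liminf (fun n => powInt p (u n)) atTop := by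
  have h1 := lowerSemicontinuous_iff_le_liminf.1 (lowerSemicontinuous_powInt (O := O) (p := p)) v
  exact h1.trans (liminf_le_liminf_of_le h)

section
variable [hpf : Fact (1 < p)]

lemma memLp_iff_powInt (u : HSpace O) :
    MemLp (rep u) (ENNReal.ofReal (p + 1)) (volume : Measure (Space d)) ↔ powInt p u < ∞ := by
  have hp := hpf.out
  rw [MemLp, eLpNorm_lt_top_iff_lintegral_rpow_enorm_lt_top
    (by simp only [ne_eq, ENNReal.ofReal_eq_zero, not_le]; linarith) ENNReal.ofReal_ne_top,
    ENNReal.toReal_ofReal (by linarith)]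
  simp only [(measurable_rep u).aestronglyMeasurable, true_and, powInt]

open Classical in
variable (p) in
/-- The class of `u` in `L^{p+1}`; it is `0` if `u` is not in this space. -/
def Eop (u : HSpace O) : Lp ℝ (ENNReal.ofReal (p + 1)) (volume : Measure (Space d)) :=
  if h : MemLp (rep u) (ENNReal.ofReal (p + 1)) (volume : Measure (Space d)) then h.toLp _ else 0

lemma coeFn_Eop {u : HSpace O} (hu : powInt p u < ∞) : Eop p u =ᵐ[volume] rep u := by
  rw [← memLp_iff_powInt] at hu
  rw [Eop, dif_pos hu]
  exact hu.coeFn_toLp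

lemma enorm_Eop {u : HSpace O} (hu : powInt p u < ∞) : ‖Eop p u‖ₑ ^ (p + 1) = powInt p u := by
  have hp := hpf.out
  rw [Lp.enorm_def, eLpNorm_eq_lintegral_rpow_enorm_toReal
    (by simp only [ne_eq, ENNReal.ofReal_eq_zero, not_le]; linarith) ENNReal.ofReal_ne_top,
    ENNReal.toReal_ofReal (by linarith), ← ENNReal.rpow_mul,
    one_div_mul_cancel (by linarith), ENNReal.rpow_one]
  refine lintegral_congr_ae ?_
  filter_upwards [coeFn_Eop hu] with x hx
  rw [hx]

lemma powInt_sub {u v : HSpace O} (hu : powInt p u < ∞) (hv : powInt p v < ∞) :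
    powInt p (u - v) < ∞ ∧ Eop p (u - v) = Eop p u - Eop p v := by
  have h1 : powInt p (u - v) < ∞ := by
    rw [← memLp_iff_powInt] at hu hv ⊢
    exact (hu.sub hv).ae_eq (rep_sub u v).symm
  refine ⟨h1, Lp.ext ?_⟩
  filter_upwards [coeFn_Eop h1, coeFn_Eop hu, coeFn_Eop hv, rep_sub u v,
    Lp.coeFn_sub (Eop p u) (Eop p v)] with x h2 h3 h4 h5 h6
  rw [h2, h6, h5, Pi.sub_apply, h3, h4]

lemma powInt_smul (c : ℝ) (u : HSpace O) : powInt p (c • u) = ‖c‖ₑ ^ (p + 1) * powInt p u := by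
  have hp := hpf.out
  rw [powInt, powInt, ← lintegral_const_mul _ ((measurable_rep u).enorm.pow_const _)]
  refine lintegral_congr_ae ?_
  filter_upwards [rep_smul c u] with x hx
  rw [hx, enorm_mul, ENNReal.mul_rpow_of_nonneg _ _ (by linarith)]

lemma powInt_le_of_bddBy {R : ℝ} {u : HSpace O} (hu : BddBy R u) :
    powInt p u ≤ ENNReal.ofReal R ^ (p + 1) * volume O := by
  have hp := hpf.out
  rw [← setLIntegral_const, powInt, ← setLIntegral_univ]
  refine le_trans ?_ (lintegral_indicator_le _ _)
  rw [setLIntegral_univ]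
  refine lintegral_mono_ae ?_
  filter_upwards [hu, rep_eq_zero u] with x h2 h3
  by_cases hx : x ∈ O
  · rw [Set.indicator_of_mem hx]
    refine ENNReal.rpow_le_rpow ?_ (by linarith)
    rw [← ofReal_norm]
    exact ENNReal.ofReal_le_ofReal h2
  · rw [Set.indicator_of_notMem hx, h3 hx, enorm_zero, ENNReal.zero_rpow_of_pos (by linarith)]

lemma powInt_lt_top_of_bddBy (hOf : volume O < ∞) {R : ℝ} {u : HSpace O} (hu : BddBy R u) :
    powInt p u < ∞ := by
  have hp := hpf.out
  exact (powInt_le_of_bddBy hu).trans_lt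
    (ENNReal.mul_lt_top (ENNReal.rpow_lt_top_of_nonneg (by linarith) ENNReal.ofReal_ne_top) hOf)

lemma stronglyMeasurable_Eop : StronglyMeasurable
    (Eop p : HSpace O → Lp ℝ (ENNReal.ofReal (p + 1)) (volume : Measure (Space d))) := by
  refine (stronglyMeasurable_of_isClosed_graph _ {u : HSpace O | powInt p u < ∞} ?_ ?_).2
  · refine IsSeqClosed.isClosed fun x y hx hxy => ?_
    have h1 : Tendsto (fun n => (x n).1) atTop (𝓝 y.1) := (continuous_fst.tendsto y).comp hxy
    have h2 : Tendsto (fun n => Eop p (x n).1) atTop (𝓝 y.2) :=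
      ((continuous_snd.tendsto y).comp hxy).congr fun n => (hx n).2
    obtain ⟨ns, hns, ha⟩ := exists_subseq_rep_tendsto h1
    obtain ⟨ms, hms, hb⟩ := (tendstoInMeasure_of_tendsto_Lp
      (h2.comp hns.tendsto_atTop)).exists_seq_tendsto_ae
    have hc := ae_all_iff.2 fun n => coeFn_Eop (hx (ns (ms n))).1
    have h3 : y.2 =ᵐ[volume] rep y.1 := by
      filter_upwards [hb, hc, ha] with z h3 h4 h5
      refine tendsto_nhds_unique h3 ?_
      exact (h5.comp hms.tendsto_atTop).congr fun n => (h4 n).symm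
    have h4 : powInt p y.1 < ∞ := (memLp_iff_powInt _).1 ((Lp.memLp y.2).ae_eq h3)
    exact ⟨h4, Lp.ext (h3.trans (coeFn_Eop h4).symm)⟩
  · intro u hu
    rw [Eop, dif_neg]
    rwa [memLp_iff_powInt]

end

/-! ### The nonlinearity -/

lemma condF_add_linear (hp : 1 < p) {F : ℝ → ℝ} (hF : CondF p F) {δ : ℝ} (hδ : 0 ≤ δ) :
    CondF p fun r => F r + δ * r := by
  obtain ⟨h1, ⟨k₁, hk₁, h2⟩, ⟨k₂, hk₂, k₃, hk₃, h3⟩, k₄, hk₄, h4⟩ := hF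
  refine ⟨h1.add (contDiff_const.mul contDiff_id), ⟨k₁ + δ, by linarith, fun r => ?_⟩,
    ⟨k₂, hk₂, k₃, hk₃, fun r => ?_⟩, k₄, hk₄, fun r => ?_⟩
  · have h5 : |r| ≤ 1 + |r| ^ p := by
      rcases le_total |r| 1 with h | h
      · have : 0 ≤ |r| ^ p := by positivity
        linarith
      · have := Real.rpow_le_rpow_of_exponent_le h hp.le
        rw [Real.rpow_one] at this
        linarith
    calc |F r + δ * r| ≤ |F r| + δ * |r| := by
          refine (abs_add_le _ _).trans ?_
          rw [abs_mul, abs_of_nonneg hδ]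
      _ ≤ k₁ * (1 + |r| ^ p) + δ * (1 + |r| ^ p) := by
          gcongr
          exact h2 r
      _ = _ := by ring
  · have : 0 ≤ δ * (r * r) := mul_nonneg hδ (mul_self_nonneg r)
    have := h3 r
    linarith [mul_add r (F r) (δ * r), mul_left_comm r δ r]
  · have hd : HasDerivAt F (deriv F r) r :=
      (h1.differentiable one_ne_zero r).hasDerivAt
    have h6 := (hd.add ((hasDerivAt_id r).const_mul δ)).deriv
    have h7 : deriv (fun r => F r + δ * r) r = deriv F r + δ * 1 := h6
    rw [h7]
    linarith [h4 r]

lemma CondF.continuous {F : ℝ → ℝ} (hF : CondF p F) : Continuous F := hF.1.continuous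

lemma CondF.one_sided {F : ℝ → ℝ} (hF : CondF p F) :
    ∃ κ > 0, ∀ a b, -(κ * (a - b) ^ 2) ≤ (F a - F b) * (a - b) := by
  obtain ⟨h1, -, -, k₄, hk₄, h4⟩ := hF
  have hmono : Monotone fun r => F r + k₄ * r := by
    have hdiff := h1.differentiable one_ne_zero
    refine monotone_of_deriv_nonneg (hdiff.add (differentiable_id.const_mul k₄)) fun r => ?_
    have h6 := ((hdiff r).hasDerivAt.add ((hasDerivAt_id r).const_mul k₄)).deriv
    have h7 : deriv (fun r => F r + k₄ * r) r = deriv F r + k₄ * 1 := h6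
    rw [h7]
    linarith [h4 r]
  refine ⟨k₄, hk₄, fun a b => ?_⟩
  rcases le_total a b with h | h
  · have := hmono h
    simp only at this
    nlinarith
  · have := hmono h
    simp only at this
    nlinarith

lemma CondF.lipschitz_clamp {F : ℝ → ℝ} (hF : CondF p F) {R : ℝ} (hR : 0 ≤ R) :
    ∃ L : ℝ≥0, LipschitzWith L fun r => F (clampFn R r) := by
  have h1 : LocallyLipschitz F := hF.1.locallyLipschitz
  obtain ⟨L, hL⟩ := (h1.locallyLipschitzOn (s := Set.Icc (-R) R)).exists_lipschitzOnWith_of_compact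
    isCompact_Icc
  refine ⟨L, LipschitzWith.of_dist_le_mul fun a b => ?_⟩
  have h2 : ∀ r, clampFn R r ∈ Set.Icc (-R) R := fun r => abs_le.1 (abs_clampFn_le hR r)
  refine (hL.dist_le_mul _ (h2 a) _ (h2 b)).trans ?_
  have := (lipschitz_clampFn R).dist_le_mul a b
  rw [NNReal.coe_one, one_mul] at this
  gcongr

/-- The pairing `∫ F(u) v dx`. -/
def pairF (F : ℝ → ℝ) (u v : HSpace O) : ℝ := ∫ x, F (rep u x) * rep v x

lemma rpow_mul_le (hp : 0 < p) {a b : ℝ} (ha : 0 ≤ a) (hb : 0 ≤ b) :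
    a ^ p * b ≤ a ^ (p + 1) + b ^ (p + 1) := by
  have h0 : ∀ x : ℝ, 0 ≤ x → x ^ (p + 1) = x ^ p * x := by
    intro x hx
    rcases hx.eq_or_lt with rfl | hx
    · rw [Real.zero_rpow (by linarith), mul_zero]
    · rw [Real.rpow_add hx, Real.rpow_one]
  rw [h0 a ha, h0 b hb]
  rcases le_total a b with h | h
  · have := Real.rpow_le_rpow ha h hp.le
    nlinarith [Real.rpow_nonneg ha p, mul_nonneg (Real.rpow_nonneg ha p) ha]
  · have := mul_le_mul_of_nonneg_left h (Real.rpow_nonneg ha p)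
    nlinarith [mul_nonneg (Real.rpow_nonneg hb p) hb]

lemma le_one_add_rpow (hp : 0 < p) {b : ℝ} (hb : 0 ≤ b) : b ≤ 1 + b ^ (p + 1) := by
  rcases le_total b 1 with h | h
  · have := Real.rpow_nonneg hb (p + 1)
    linarith
  · have := Real.rpow_le_rpow_of_exponent_le h (by linarith : (1 : ℝ) ≤ p + 1)
    rw [Real.rpow_one] at this
    linarith

lemma abs_F_mul_le {F : ℝ → ℝ} {k : ℝ} (hk : 0 ≤ k) (h : ∀ r, |F r| ≤ k * (1 + |r| ^ p))
    (hp : 0 < p) (a b : ℝ) :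
    |F a * b| ≤ k * (1 + |a| ^ (p + 1) + 2 * |b| ^ (p + 1)) := by
  rw [abs_mul]
  calc |F a| * |b| ≤ k * (1 + |a| ^ p) * |b| := by
        gcongr
        exact h a
    _ = k * (|b| + |a| ^ p * |b|) := by ring
    _ ≤ k * ((1 + |b| ^ (p + 1)) + (|a| ^ (p + 1) + |b| ^ (p + 1))) := by
        gcongr
        · exact le_one_add_rpow hp (abs_nonneg _)
        · exact rpow_mul_le hp (abs_nonneg _) (abs_nonneg _)
    _ = _ := by ring

section
variable [hpf : Fact (1 < p)] (hO : MeasurableSet O) (hOf : volume O < ∞)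

lemma integrable_pow {u : HSpace O} (hu : powInt p u < ∞) :
    Integrable (fun x => |rep u x| ^ (p + 1)) (volume : Measure (Space d)) ∧
      ∫ x, |rep u x| ^ (p + 1) = (powInt p u).toReal := by
  have hp := hpf.out
  have h1 : ∀ x, ENNReal.ofReal (|rep u x| ^ (p + 1)) = ‖rep u x‖ₑ ^ (p + 1) := by
    intro x
    rw [← ENNReal.ofReal_rpow_of_nonneg (abs_nonneg _) (by linarith), ← Real.norm_eq_abs,
      ofReal_norm]
  have hm : Measurable fun x => |rep u x| ^ (p + 1) := (measurable_rep u).abs.pow_const _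
  constructor
  · refine ⟨hm.aestronglyMeasurable, ?_⟩
    rw [hasFiniteIntegral_iff_ofReal (Eventually.of_forall fun x => by positivity)]
    simp_rw [h1]
    exact hu
  · rw [integral_eq_lintegral_of_nonneg_ae (Eventually.of_forall fun x => by positivity)
      hm.aestronglyMeasurable]
    simp_rw [h1]
    rfl

lemma ae_abs_F_mul_le {F : ℝ → ℝ} {k : ℝ} (hk : 0 ≤ k) (h : ∀ r, |F r| ≤ k * (1 + |r| ^ p))
    (u v : HSpace O) : ∀ᵐ x ∂(volume : Measure (Space d)), |F (rep u x) * rep v x| ≤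
      k * (O.indicator (fun _ => 1) x + |rep u x| ^ (p + 1) + 2 * |rep v x| ^ (p + 1)) := by
  have hp := hpf.out
  filter_upwards [rep_eq_zero v] with x hv
  by_cases hx : x ∈ O
  · rw [Set.indicator_of_mem hx]
    exact abs_F_mul_le hk h (by linarith) _ _
  · rw [Set.indicator_of_notMem hx, hv hx, mul_zero, abs_zero]
    positivity

include hO hOf

lemma pairF_bound {F : ℝ → ℝ} (hFc : Continuous F) {k : ℝ} (hk : 0 ≤ k)
    (h : ∀ r, |F r| ≤ k * (1 + |r| ^ p)) {u v : HSpace O} (hu : powInt p u < ∞)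
    (hv : powInt p v < ∞) :
    Integrable (fun x => F (rep u x) * rep v x) (volume : Measure (Space d)) ∧
      ∫ x, |F (rep u x) * rep v x| ≤
        k * (volume.real O + (powInt p u).toReal + 2 * (powInt p v).toReal) := by
  have h1 : Integrable (fun x => k * (O.indicator (fun _ => 1) x + |rep u x| ^ (p + 1) +
      2 * |rep v x| ^ (p + 1))) (volume : Measure (Space d)) :=
    ((((integrableOn_const hOf.ne).integrable_indicator hO).add (integrable_pow hu).1).add
      ((integrable_pow hv).1.const_mul 2)).const_mul k
  have h2 := ae_abs_F_mul_le hk h u v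
  have h3 : Integrable (fun x => F (rep u x) * rep v x) (volume : Measure (Space d)) :=
    h1.mono' ((hFc.measurable.comp (measurable_rep u)).mul
      (measurable_rep v)).aestronglyMeasurable h2
  refine ⟨h3, (integral_mono_ae h3.abs h1 h2).trans_eq ?_⟩
  rw [integral_const_mul, integral_add, integral_add, integral_const_mul, (integrable_pow hu).2,
    (integrable_pow hv).2, integral_indicator hO]
  · simp
  · exact (integrableOn_const hOf.ne).integrable_indicator hO
  · exact (integrable_pow hu).1
  · exact ((integrableOn_const hOf.ne).integrable_indicator hO).add (integrable_pow hu).1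
  · exact (integrable_pow hv).1.const_mul 2

lemma abs_pairF_le {F : ℝ → ℝ} (hFc : Continuous F) {k : ℝ} (hk : 0 ≤ k)
    (h : ∀ r, |F r| ≤ k * (1 + |r| ^ p)) {u v : HSpace O} (hu : powInt p u < ∞)
    (hv : powInt p v < ∞) :
    |pairF F u v| ≤ k * (volume.real O + (powInt p u).toReal + 2 * (powInt p v).toReal) :=
  (abs_integral_le_integral_abs).trans (pairF_bound hO hOf hFc hk h hu hv).2

end

end FracSkeleton

namespace FracSkeleton

variable {d : ℕ} {O : Set (Space d)} {γ p : ℝ}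

lemma rpow_add_one_eq (hp : 0 < p) {x : ℝ} (hx : 0 ≤ x) : x ^ (p + 1) = x ^ p * x := by
  rcases hx.eq_or_lt with rfl | hx
  · rw [Real.zero_rpow (by linarith), mul_zero]
  · rw [Real.rpow_add hx, Real.rpow_one]

lemma abs_sub_clamp_mul_le {F : ℝ → ℝ} {k : ℝ} (hk : 0 ≤ k) (h : ∀ r, |F r| ≤ k * (1 + |r| ^ p))
    (hp : 0 < p) {M η : ℝ} (hM : 1 ≤ M) (hη : 0 < η) (a b : ℝ) :
    |(F a - F (clampFn M a)) * b| ≤ 4 * k * (η * |a| ^ (p + 1) +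
      (η ^ p)⁻¹ * {y : ℝ | η * M < |y|}.indicator (fun y => |y| ^ (p + 1)) b) := by
  have hind : 0 ≤ {y : ℝ | η * M < |y|}.indicator (fun y => |y| ^ (p + 1)) b :=
    Set.indicator_nonneg (fun y _ => by positivity) b
  rcases le_or_gt |a| M with ha | ha
  · rw [clampFn_of_abs_le ha]
    simp only [sub_self, zero_mul, abs_zero]
    positivity
  · have ha1 : 1 ≤ |a| := hM.trans ha.le
    have hap : 1 ≤ |a| ^ p := Real.one_le_rpow ha1 hp.le
    have hc : |clampFn M a| ^ p ≤ |a| ^ p :=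
      Real.rpow_le_rpow (abs_nonneg _) (abs_clampFn_le_abs (by linarith) a) hp.le
    have h1 : |F a - F (clampFn M a)| ≤ 4 * k * |a| ^ p := by
      refine (abs_sub _ _).trans ?_
      have h2 := h a
      have h3 := h (clampFn M a)
      have h4 : k * (1 + |a| ^ p) ≤ k * (2 * |a| ^ p) := by gcongr; linarith
      have h5 : k * (1 + |clampFn M a| ^ p) ≤ k * (2 * |a| ^ p) := by gcongr; linarith
      linarith
    rw [abs_mul]
    have h6 : |a| ^ p * |b| ≤ η * |a| ^ (p + 1) +
        (η ^ p)⁻¹ * {y : ℝ | η * M < |y|}.indicator (fun y => |y| ^ (p + 1)) b := by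
      rcases le_or_gt |b| (η * |a|) with hb | hb
      · have h7 : |a| ^ p * |b| ≤ |a| ^ p * (η * |a|) := by gcongr
        rw [rpow_add_one_eq hp (abs_nonneg a)]
        have : 0 ≤ (η ^ p)⁻¹ * {y : ℝ | η * M < |y|}.indicator (fun y => |y| ^ (p + 1)) b := by
          positivity
        linarith [mul_left_comm (|a| ^ p) η |a|]
      · have hmem : b ∈ {y : ℝ | η * M < |y|} := by
          change η * M < |b|
          exact lt_of_le_of_lt (by gcongr) hb
        rw [Set.indicator_of_mem hmem, rpow_add_one_eq hp (abs_nonneg b)]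
        have h8 : |a| ≤ |b| / η := by
          rw [le_div_iff₀ hη]
          linarith [mul_comm |a| η]
        have h9 : |a| ^ p ≤ |b| ^ p / η ^ p := by
          rw [← Real.div_rpow (abs_nonneg b) hη.le]
          exact Real.rpow_le_rpow (abs_nonneg _) h8 hp.le
        have h10 : |a| ^ p * |b| ≤ |b| ^ p / η ^ p * |b| := by gcongr
        have h11 : 0 ≤ η * |a| ^ (p + 1) := by positivity
        calc |a| ^ p * |b| ≤ |b| ^ p / η ^ p * |b| := h10
          _ = (η ^ p)⁻¹ * (|b| ^ p * |b|) := by ring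
          _ ≤ _ := by linarith
    calc |F a - F (clampFn M a)| * |b| ≤ 4 * k * |a| ^ p * |b| := by gcongr
      _ = 4 * k * (|a| ^ p * |b|) := by ring
      _ ≤ _ := by gcongr

lemma pairF_smul_right (F : ℝ → ℝ) (u v : HSpace O) (c : ℝ) :
    pairF F u (c • v) = c * pairF F u v := by
  rw [pairF, pairF, ← integral_const_mul]
  refine integral_congr_ae ?_
  filter_upwards [rep_smul c v] with x hx
  rw [hx]
  ring

section
variable [hpf : Fact (1 < p)] (hO : MeasurableSet O) (hOf : volume O < ∞)

lemma exists_tail_le {v : HSpace O} (hv : powInt p v < ∞) {η ε : ℝ} (hη : 0 < η) (hε : 0 < ε) :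
    ∃ M : ℝ, 1 ≤ M ∧
      ∫ x, {y : ℝ | η * M < |y|}.indicator (fun y => |y| ^ (p + 1)) (rep v x) ≤ ε := by
  have hp := hpf.out
  have h1 : Tendsto (fun n : ℕ => ∫ x, {y : ℝ | η * n < |y|}.indicator
      (fun y => |y| ^ (p + 1)) (rep v x)) atTop (𝓝 (∫ x : Space d, (0 : ℝ))) := by
    refine tendsto_integral_of_dominated_convergence (fun x => |rep v x| ^ (p + 1)) ?_
      (integrable_pow hv).1 ?_ ?_
    · intro n
      have : Measurable ({y : ℝ | η * n < |y|}.indicator (fun y : ℝ => |y| ^ (p + 1))) :=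
        (measurable_id.abs.pow_const _).indicator
          (measurableSet_lt measurable_const measurable_id.abs)
      exact (this.comp (measurable_rep v)).aestronglyMeasurable
    · intro n
      refine Eventually.of_forall fun x => ?_
      refine (norm_indicator_le_norm_self _ _).trans ?_
      rw [Real.norm_of_nonneg (by positivity)]
    · refine Eventually.of_forall fun x => ?_
      refine tendsto_const_nhds.congr' ?_
      obtain ⟨N, hN⟩ := exists_nat_ge (|rep v x| / η)
      filter_upwards [eventually_ge_atTop N] with n hn
      rw [Set.indicator_of_notMem]
      simp only [Set.mem_ofPred_eq, not_lt]
      rw [div_le_iff₀ hη] at hN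
      have : (N : ℝ) ≤ n := by exact_mod_cast hn
      nlinarith
  rw [integral_zero] at h1
  obtain ⟨n, hn1, hn2⟩ := ((h1.eventually_le_const hε).and (eventually_ge_atTop 1)).exists
  exact ⟨n, by exact_mod_cast hn2, hn1⟩

include hO hOf

lemma pairF_sub_right {F : ℝ → ℝ} (hF : CondF p F) {u v w : HSpace O} (hu : powInt p u < ∞)
    (hv : powInt p v < ∞) (hw : powInt p w < ∞) :
    pairF F u (v - w) = pairF F u v - pairF F u w := by
  obtain ⟨k, hk, hFk⟩ := hF.2.1
  rw [pairF, pairF, pairF, ← integral_sub (pairF_bound hO hOf hF.continuous hk.le hFk hu hv).1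
    (pairF_bound hO hOf hF.continuous hk.le hFk hu hw).1]
  refine integral_congr_ae ?_
  filter_upwards [rep_sub v w] with x hx
  rw [hx, mul_sub]

lemma abs_pairF_le_scaled {F : ℝ → ℝ} (hF : CondF p F) : ∃ k > 0, ∀ (u v : HSpace O),
    powInt p u < ∞ → powInt p v < ∞ → ∀ ε > 0,
    |pairF F u v| ≤ ε * (k * (volume.real O + (powInt p u).toReal)) +
      ε * (2 * k * (ε⁻¹ ^ (p + 1) * (powInt p v).toReal)) := by
  have hp := hpf.out
  obtain ⟨k, hk, hFk⟩ := hF.2.1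
  refine ⟨k, hk, fun u v hu hv ε hε => ?_⟩
  have h1 : powInt p (ε⁻¹ • v) < ∞ := by
    rw [powInt_smul]
    exact ENNReal.mul_lt_top (ENNReal.rpow_lt_top_of_nonneg (by linarith) enorm_ne_top) hv
  have h2 := abs_pairF_le hO hOf hF.continuous hk.le hFk hu h1
  rw [pairF_smul_right, abs_mul, abs_of_pos (inv_pos.2 hε), powInt_smul, ENNReal.toReal_mul,
    ← ENNReal.toReal_rpow, toReal_enorm, Real.norm_of_nonneg (inv_pos.2 hε).le] at h2
  have h3 := mul_le_mul_of_nonneg_left h2 hε.le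
  rw [← mul_assoc, mul_inv_cancel₀ hε.ne', one_mul] at h3
  linarith

lemma pairF_mono {F : ℝ → ℝ} (hF : CondF p F) : ∃ κ > 0, ∀ (u v : HSpace O),
    powInt p u < ∞ → powInt p v < ∞ →
    -(κ * ‖u - v‖ ^ 2) ≤ pairF F u (u - v) - pairF F v (u - v) := by
  obtain ⟨κ, hκ, h⟩ := hF.one_sided
  obtain ⟨k, hk, hFk⟩ := hF.2.1
  refine ⟨κ, hκ, fun u v hu hv => ?_⟩
  have huv := (powInt_sub hu hv).1
  have h1 := (pairF_bound hO hOf hF.continuous hk.le hFk hu huv).1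
  have h2 := (pairF_bound hO hOf hF.continuous hk.le hFk hv huv).1
  rw [pairF, pairF, ← integral_sub h1 h2, norm_sq_eq_integral, ← integral_const_mul,
    ← integral_neg]
  refine integral_mono_ae ?_ (h1.sub h2) ?_
  · simpa [sq] using ((integrable_rep_mul (u - v) (u - v)).const_mul κ).neg
  · filter_upwards [rep_sub u v] with x hx
    rw [hx]
    linarith [h (rep u x) (rep v x), sub_mul (F (rep u x)) (F (rep v x)) (rep u x - rep v x)]

lemma pairF_coercive {F : ℝ → ℝ} (hF : CondF p F) : ∃ k₂ > 0, ∃ k₃ > 0, ∀ (u : HSpace O),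
    powInt p u < ∞ → k₃ * (powInt p u).toReal ≤ pairF F u u + k₂ := by
  have hp := hpf.out
  obtain ⟨k₂, hk₂, k₃, hk₃, h⟩ := hF.2.2.1
  obtain ⟨k, hk, hFk⟩ := hF.2.1
  refine ⟨k₂ * volume.real O + 1, by positivity, k₃, hk₃, fun u hu => ?_⟩
  have h1 := (pairF_bound hO hOf hF.continuous hk.le hFk hu hu).1
  have hi : Integrable (O.indicator fun _ => k₂) (volume : Measure (Space d)) :=
    (integrableOn_const hOf.ne).integrable_indicator hO
  have h2 : k₃ * (powInt p u).toReal ≤ pairF F u u + k₂ * volume.real O := by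
    rw [← (integrable_pow hu).2, ← integral_const_mul, pairF, mul_comm k₂, ← smul_eq_mul (b := k₂),
      ← setIntegral_const, ← integral_indicator hO, ← integral_add h1 hi]
    refine integral_mono_ae ((integrable_pow hu).1.const_mul _) (h1.add hi) ?_
    filter_upwards [rep_eq_zero u] with x hx
    by_cases hxO : x ∈ O
    · rw [Set.indicator_of_mem hxO]
      linarith [h (rep u x), mul_comm (rep u x) (F (rep u x))]
    · rw [Set.indicator_of_notMem hxO, hx hxO, abs_zero, Real.zero_rpow (by linarith)]
      simp
  linarith

lemma pairF_clamp_eq_inner {F : ℝ → ℝ} (hF : CondF p F) {R : ℝ} (hR : 0 ≤ R) (u v : HSpace O) :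
    inner ℝ (nem (fun r => F (clampFn R r)) u) v = ∫ x, F (clampFn R (rep u x)) * rep v x := by
  obtain ⟨L, hL⟩ := hF.lipschitz_clamp hR
  rw [inner_eq_integral]
  refine integral_congr_ae ?_
  filter_upwards [rep_nem hO hOf hL u, rep_eq_zero v] with x h1 h2
  rw [h1]
  by_cases hx : x ∈ O
  · rw [Set.indicator_of_mem hx]
  · rw [h2 hx, mul_zero, mul_zero]

lemma pairF_eq_inner_of_bddBy {F : ℝ → ℝ} (hF : CondF p F) {R : ℝ} (hR : 0 ≤ R) {u : HSpace O}
    (hu : BddBy R u) (v : HSpace O) :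
    pairF F u v = inner ℝ (nem (fun r => F (clampFn R r)) u) v := by
  rw [pairF_clamp_eq_inner hO hOf hF hR, pairF]
  refine integral_congr_ae ?_
  filter_upwards [hu] with x hx
  rw [clampFn_of_abs_le hx]

lemma tendsto_pairF_clamp {F : ℝ → ℝ} (hF : CondF p F) {u v : HSpace O} (hu : powInt p u < ∞)
    (hv : powInt p v < ∞) :
    Tendsto (fun n : ℕ => inner ℝ (nem (fun r => F (clampFn n r)) u) v) atTop
      (𝓝 (pairF F u v)) := by
  have hp := hpf.out
  obtain ⟨k, hk, hFk⟩ := hF.2.1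
  simp_rw [fun n : ℕ => pairF_clamp_eq_inner hO hOf hF n.cast_nonneg u v]
  refine tendsto_integral_of_dominated_convergence
    (fun x => k * (O.indicator (fun _ => 1) x + |rep u x| ^ (p + 1) + 2 * |rep v x| ^ (p + 1)))
    ?_ ?_ ?_ ?_
  · intro n
    exact ((hF.continuous.measurable.comp ((lipschitz_clampFn n).continuous.measurable.comp
      (measurable_rep u))).mul (measurable_rep v)).aestronglyMeasurable
  · exact ((((integrableOn_const hOf.ne).integrable_indicator hO).add (integrable_pow hu).1).add
      ((integrable_pow hv).1.const_mul 2)).const_mul k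
  · intro n
    filter_upwards [rep_eq_zero v] with x hx
    by_cases hxO : x ∈ O
    · rw [Set.indicator_of_mem hxO]
      refine (abs_F_mul_le hk.le hFk (by linarith) _ _).trans ?_
      have : |clampFn n (rep u x)| ≤ |rep u x| := abs_clampFn_le_abs n.cast_nonneg _
      gcongr
    · rw [Set.indicator_of_notMem hxO, hx hxO, mul_zero, norm_zero]
      positivity
  · refine Eventually.of_forall fun x => ?_
    refine tendsto_const_nhds.congr' ?_
    obtain ⟨N, hN⟩ := exists_nat_ge |rep u x|
    filter_upwards [eventually_ge_atTop N] with n hn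
    rw [clampFn_of_abs_le (hN.trans (by exact_mod_cast hn))]

/-- For fixed `v`, the map `u ↦ ∫ F(u) v dx` is continuous in `ℍ`, up to a small multiple of the
`L^{p+1}` norm. -/
lemma abs_pairF_sub_le {F : ℝ → ℝ} (hF : CondF p F) {v : HSpace O} (hv : powInt p v < ∞)
    {ε : ℝ} (hε : 0 < ε) : ∃ C, 0 ≤ C ∧ ∀ u y : HSpace O, powInt p u < ∞ → powInt p y < ∞ →
      |pairF F y v - pairF F u v| ≤
        C * ‖y - u‖ + ε * (1 + (powInt p y).toReal + (powInt p u).toReal) := by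
  have hp := hpf.out
  have hp0 : 0 < p := by linarith
  obtain ⟨k, hk, hFk⟩ := hF.2.1
  set η := ε / (4 * k) with hη
  have hη0 : 0 < η := by positivity
  set ε' := ε / (8 * k * (η ^ p)⁻¹) with hε'
  have hηp : 0 < η ^ p := Real.rpow_pos_of_pos hη0 p
  have hε'0 : 0 < ε' := by positivity
  obtain ⟨M, hM1, hM⟩ := exists_tail_le hv hη0 hε'0
  have hM0 : 0 ≤ M := by linarith
  obtain ⟨L, hL⟩ := hF.lipschitz_clamp hM0
  refine ⟨L * ‖v‖, by positivity, ?_⟩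
  set ind : Space d → ℝ := fun x =>
    {y : ℝ | η * M < |y|}.indicator (fun y => |y| ^ (p + 1)) (rep v x) with hind
  have hindm : Measurable ind := by
    have : Measurable ({y : ℝ | η * M < |y|}.indicator (fun y : ℝ => |y| ^ (p + 1))) :=
      (measurable_id.abs.pow_const _).indicator
        (measurableSet_lt measurable_const measurable_id.abs)
    exact this.comp (measurable_rep v)
  have hindi : Integrable ind volume := by
    refine (integrable_pow hv).1.mono' hindm.aestronglyMeasurable (Eventually.of_forall fun x => ?_)
    refine (norm_indicator_le_norm_self _ _).trans ?_
    rw [Real.norm_of_nonneg (by positivity)]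
  have key : ∀ u : HSpace O, powInt p u < ∞ →
      |pairF F u v - inner ℝ (nem (fun r => F (clampFn M r)) u) v| ≤
        ε * (1 / 2 + (powInt p u).toReal) := by
    intro u hu
    have hi := integrable_rep_mul (nem (fun r => F (clampFn M r)) u) v
    have hi2 : Integrable (fun x => F (clampFn M (rep u x)) * rep v x) volume := by
      refine hi.congr ?_
      filter_upwards [rep_nem hO hOf hL u, rep_eq_zero v] with x h1 h2
      rw [h1]
      by_cases hx : x ∈ O
      · rw [Set.indicator_of_mem hx]
      · rw [h2 hx, mul_zero, mul_zero]
    have hi1 := (pairF_bound hO hOf hF.continuous hk.le hFk hu hv).1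
    rw [pairF_clamp_eq_inner hO hOf hF hM0, pairF, ← integral_sub hi1 hi2]
    refine (abs_integral_le_integral_abs).trans ?_
    have hb : ∫ x, |F (rep u x) * rep v x - F (clampFn M (rep u x)) * rep v x| ≤
        ∫ x, 4 * k * (η * |rep u x| ^ (p + 1) + (η ^ p)⁻¹ * ind x) := by
      refine integral_mono (hi1.sub hi2).abs
        ((((integrable_pow hu).1.const_mul η).add (hindi.const_mul _)).const_mul _) fun x => ?_
      change |F (rep u x) * rep v x - F (clampFn M (rep u x)) * rep v x| ≤ _
      rw [← sub_mul]
      exact abs_sub_clamp_mul_le hk.le hFk hp0 hM1 hη0 _ _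
    refine hb.trans ?_
    rw [integral_const_mul, integral_add ((integrable_pow hu).1.const_mul η) (hindi.const_mul _),
      integral_const_mul, integral_const_mul, (integrable_pow hu).2]
    have h5 : 4 * k * ((η ^ p)⁻¹ * ∫ x, ind x) ≤ 4 * k * ((η ^ p)⁻¹ * ε') := by gcongr
    have h6 : 4 * k * ((η ^ p)⁻¹ * ε') = ε / 2 := by
      rw [hε']
      field_simp
      norm_num
    have h7 : 4 * k * η = ε := by
      rw [hη]
      field_simp
    rw [mul_add, ← mul_assoc, h7]
    linarith
  intro u y hu hy
  have h1 := key u hu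
  have h2 := key y hy
  have h3 : |inner ℝ (nem (fun r => F (clampFn M r)) y) v -
      inner ℝ (nem (fun r => F (clampFn M r)) u) v| ≤ L * ‖v‖ * ‖y - u‖ := by
    rw [← inner_sub_left]
    refine (abs_real_inner_le_norm _ _).trans ?_
    have := nem_sub_le hO hOf hL y u
    calc ‖nem (fun r => F (clampFn M r)) y - nem (fun r => F (clampFn M r)) u‖ * ‖v‖
        ≤ L * ‖y - u‖ * ‖v‖ := by gcongr
      _ = _ := by ring
  rw [abs_le] at h1 h2 h3 ⊢
  constructor <;> linarith [h1.1, h1.2, h2.1, h2.2, h3.1, h3.2]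

end

end FracSkeleton

namespace FracSkeleton

/-! ### The energy identity -/

lemma tendsto_eLpNorm_translate {Y : Type*} [NormedAddCommGroup Y] {q : ℝ≥0∞} [Fact (1 ≤ q)]
    [Fact (q ≠ ∞)] {y : ℝ → Y} (hy : MemLp y q volume) :
    Tendsto (fun θ : ℝ => eLpNorm (fun s => y s - y (s + θ)) q volume) (𝓝 0) (𝓝 0) := by
  have h1 : Continuous fun θ : ℝ => (DomAddAct.mk θ +ᵥ hy.toLp y : Lp Y q volume) :=
    (DomAddAct.continuous_mk.vadd continuous_const)
  have h2 : Tendsto (fun θ : ℝ => edist (hy.toLp y) (DomAddAct.mk θ +ᵥ hy.toLp y)) (𝓝 0)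
      (𝓝 (edist (hy.toLp y) (DomAddAct.mk (0 : ℝ) +ᵥ hy.toLp y))) :=
    (continuous_const.edist h1).tendsto 0
  have h3 : ∀ θ : ℝ, edist (hy.toLp y) (DomAddAct.mk θ +ᵥ hy.toLp y) =
      eLpNorm (fun s => y s - y (s + θ)) q volume := by
    intro θ
    rw [DomAddAct.mk_vadd_toLp, Lp.edist_toLp_toLp]
    refine eLpNorm_congr_ae (Eventually.of_forall fun s => ?_)
    simp [add_comm]
  simp_rw [h3] at h2
  simpa using h2

lemma lintegral_strip {e : ℝ → ℝ → ℝ≥0∞} (he : Measurable (Function.uncurry e)) (a b : ℝ) :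
    ∫⁻ s, ∫⁻ r in Set.Ioc (s + a) (s + b), e r s = ∫⁻ θ in Set.Ioc a b, ∫⁻ s, e (s + θ) s := by
  have h1 : ∀ s, ∫⁻ r in Set.Ioc (s + a) (s + b), e r s = ∫⁻ θ in Set.Ioc a b, e (s + θ) s := by
    intro s
    rw [← lintegral_indicator measurableSet_Ioc, ← lintegral_indicator measurableSet_Ioc,
      ← lintegral_add_left_eq_self _ s]
    refine lintegral_congr fun θ => ?_
    simp only [Set.indicator, Set.mem_Ioc, add_lt_add_iff_left, add_le_add_iff_left]
  simp_rw [h1]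
  refine lintegral_lintegral_swap ?_
  exact (he.comp ((measurable_fst.add measurable_snd).prodMk measurable_fst)).aemeasurable

theorem norm_sq_eq_of_pairing {H : Type*} [NormedAddCommGroup H] [InnerProductSpace ℝ H]
    {w : ℝ → H} (hw : Continuous w) {T : ℝ} (hT : 0 < T) {P : ℝ → ℝ → ℝ}
    (hdiag : IntervalIntegrable (fun r => P r r) volume 0 T)
    (hP : ∀ᵐ s, s ∈ Set.Ioo 0 T → IntervalIntegrable (fun r => P r s) volume 0 T ∧
      ∀ a ∈ Set.Icc 0 T, ∀ b ∈ Set.Icc 0 T, inner ℝ (w b - w a) (w s) = ∫ r in a..b, P r s)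
    (herr : ∀ ε > 0, ∃ e : ℝ → ℝ → ℝ≥0∞, Measurable (Function.uncurry e) ∧
      (∀ᵐ s, s ∈ Set.Ioo 0 T → ∀ᵐ r, r ∈ Set.Ioo 0 T → ‖P r s - P r r‖ₑ ≤ e r s) ∧
      ∀ᶠ θ in 𝓝 (0 : ℝ), ∫⁻ s, e (s + θ) s ≤ ENNReal.ofReal ε)
    {t : ℝ} (ht : t ∈ Set.Icc 0 T) :
    ‖w t‖ ^ 2 = ‖w 0‖ ^ 2 + 2 * ∫ r in (0 : ℝ)..t, P r r := by
  set D : ℝ → ℝ := (Set.Ioc 0 T).indicator fun r => P r r with hD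
  have hDi : Integrable D := by
    rw [hD, integrable_indicator_iff measurableSet_Ioc]
    rwa [intervalIntegrable_iff_integrableOn_Ioc_of_le hT.le] at hdiag
  have hDint : ∀ a ∈ Set.Icc 0 T, ∀ b ∈ Set.Icc 0 T, ∫ r in a..b, D r = ∫ r in a..b, P r r := by
    intro a ha b hb
    refine intervalIntegral.integral_congr_ae (Eventually.of_forall fun r hr => ?_)
    rw [hD, Set.indicator_of_mem]
    rcases Set.mem_uIoc.1 hr with h | h
    · exact ⟨ha.1.trans_lt h.1, h.2.trans hb.2⟩
    · exact ⟨hb.1.trans_lt h.1, h.2.trans ha.2⟩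
  have h0 : (0 : ℝ) ∈ Set.Icc 0 T := ⟨le_rfl, hT.le⟩
  set φ : ℝ → ℝ := fun x => ‖w x‖ ^ 2 - 2 * ∫ r in (0 : ℝ)..x, D r with hφ
  have hφc : Continuous φ := by
    refine (hw.norm.pow 2).sub (continuous_const.mul ?_)
    exact intervalIntegral.continuous_primitive (fun a b => hDi.intervalIntegrable) 0
  have key : ∀ x ∈ Set.Ico 0 T, φ x = φ 0 := by
    intro x hx
    have hx0 : 0 ≤ x := hx.1
    set Φ : ℝ → ℝ := fun y => ∫ s in (0 : ℝ)..y, φ s with hΦ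
    have hΦd : ∀ y, HasDerivAt Φ (φ y) y := fun y =>
      intervalIntegral.integral_hasDerivAt_right (hφc.intervalIntegrable _ _)
        (hφc.stronglyMeasurableAtFilter _ _) hφc.continuousAt
    have hlim : Tendsto (fun h => h⁻¹ * (∫ s in (0 : ℝ)..x, (φ (s + h) - φ s))) (𝓝[>] 0)
        (𝓝 (φ x - φ 0)) := by
      have h1 := ((hΦd x).tendsto_slope_zero_right).sub ((hΦd 0).tendsto_slope_zero_right)
      refine h1.congr fun h => ?_
      have hc' : Continuous fun s => φ (s + h) := hφc.comp (continuous_add_const h)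
      rw [intervalIntegral.integral_sub (hc'.intervalIntegrable _ _)
        (hφc.intervalIntegrable _ _), intervalIntegral.integral_comp_add_right]
      have h2 : ∫ s in (0 + h)..(x + h), φ s = Φ (x + h) - Φ h := by
        rw [hΦ, intervalIntegral.integral_interval_sub_left (hφc.intervalIntegrable _ _)
          (hφc.intervalIntegrable _ _), zero_add]
      rw [h2]
      have h3 : Φ 0 = 0 := by simp [hΦ]
      simp only [smul_eq_mul, zero_add, h3]
      change _ = h⁻¹ * (Φ (x + h) - Φ h - Φ x)
      ring
    have habs : ∀ ε > 0, |φ x - φ 0| ≤ 2 * ε := by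
      intro ε hε
      obtain ⟨e, hem, he, hes⟩ := herr ε hε
      obtain ⟨η, hη, hball⟩ := Metric.eventually_nhds_iff.1 hes
      refine le_of_tendsto hlim.abs ?_
      have hsmall : ∀ᶠ h in 𝓝[>] (0 : ℝ), h < min η (T - x) :=
        nhdsWithin_le_nhds (gt_mem_nhds (lt_min hη (by linarith [hx.2])))
      filter_upwards [hsmall, self_mem_nhdsWithin] with h hh hh0
      have hh0 : 0 < h := hh0
      have hhη : h < η := hh.trans_le (min_le_left _ _)
      have hhT : x + h < T := by linarith [hh.trans_le (min_le_right _ _)]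
      have hstrip1 : ∫⁻ s, ∫⁻ r in Set.Ioc s (s + h), e r s ≤ ENNReal.ofReal (h * ε) := by
        have := lintegral_strip hem 0 h
        simp only [add_zero] at this
        rw [this, ENNReal.ofReal_mul hh0.le, mul_comm]
        refine (setLIntegral_mono measurable_const (g := fun _ => ENNReal.ofReal ε)
          fun θ hθ => hball ?_).trans ?_
        · rw [Real.dist_eq, sub_zero, abs_of_pos hθ.1]
          exact hθ.2.trans_lt hhη
        · rw [setLIntegral_const, Real.volume_Ioc, sub_zero]
      have hstrip2 : ∫⁻ s, ∫⁻ r in Set.Ioc s (s + h), e r (s + h) ≤ ENNReal.ofReal (h * ε) := by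
        have h1 : ∫⁻ s, ∫⁻ r in Set.Ioc s (s + h), e r (s + h) =
            ∫⁻ s, ∫⁻ r in Set.Ioc (s + (-h)) (s + 0), e r s := by
          rw [← lintegral_add_right_eq_self (fun s => ∫⁻ r in Set.Ioc (s + (-h)) (s + 0), e r s) h]
          simp
        rw [h1, lintegral_strip hem, ENNReal.ofReal_mul hh0.le, mul_comm]
        refine (setLIntegral_mono measurable_const (g := fun _ => ENNReal.ofReal ε)
          fun θ hθ => hball ?_).trans ?_
        · rw [Real.dist_eq, sub_zero, abs_of_nonpos hθ.2]
          linarith [hθ.1]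
        · rw [setLIntegral_const, Real.volume_Ioc, zero_sub, neg_neg]
      have hshift : ∀ {Q : ℝ → Prop}, (∀ᵐ s, Q s) → ∀ᵐ s, Q (s + h) := fun hQ =>
        (measurePreserving_add_right volume h).quasiMeasurePreserving.ae hQ
      have hpt : ∀ᵐ s, s ∈ Set.Ioc 0 x → ‖φ (s + h) - φ s‖ₑ ≤
          ∫⁻ r in Set.Ioc s (s + h), e r s + e r (s + h) := by
        filter_upwards [hP, hshift hP, he, hshift he] with s h1 h2 h3 h4 hs
        have hsI : s ∈ Set.Ioo 0 T := ⟨hs.1, hs.2.trans_lt hx.2⟩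
        have hshI : s + h ∈ Set.Ioo 0 T := ⟨by linarith [hs.1], by linarith [hs.2]⟩
        have hsC := Set.Ioo_subset_Icc_self hsI
        have hshC := Set.Ioo_subset_Icc_self hshI
        obtain ⟨h1i, h1e⟩ := h1 hsI
        obtain ⟨h2i, h2e⟩ := h2 hshI
        have hsub : Set.uIcc s (s + h) ⊆ Set.uIcc 0 T := by
          rw [Set.uIcc_of_le hT.le]
          exact Set.uIcc_subset_Icc hsC hshC
        have h1i' := h1i.mono_set hsub
        have h2i' := h2i.mono_set hsub
        have hdi' := hdiag.mono_set hsub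
        have h5 : φ (s + h) - φ s =
            ∫ r in s..(s + h), ((P r s - P r r) + (P r (s + h) - P r r)) := by
          rw [intervalIntegral.integral_add (h1i'.sub hdi') (h2i'.sub hdi'),
            intervalIntegral.integral_sub h1i' hdi', intervalIntegral.integral_sub h2i' hdi',
            ← h1e s hsC (s + h) hshC, ← h2e s hsC (s + h) hshC, ← hDint s hsC (s + h) hshC]
          have h6 : (∫ r in (0 : ℝ)..(s + h), D r) - ∫ r in (0 : ℝ)..s, D r =
              ∫ r in s..(s + h), D r :=
            intervalIntegral.integral_interval_sub_left hDi.intervalIntegrable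
              hDi.intervalIntegrable
          rw [← h6]
          simp only [hφ, inner_sub_left, real_inner_self_eq_norm_sq]
          rw [real_inner_comm (w (s + h)) (w s)]
          ring
        rw [h5, intervalIntegral.integral_of_le (by linarith)]
        refine (enorm_integral_le_lintegral_enorm _).trans ?_
        refine lintegral_mono_ae ((ae_restrict_iff' measurableSet_Ioc).2 ?_)
        filter_upwards [h3 hsI, h4 hshI] with r h7 h8 hr
        have hrI : r ∈ Set.Ioo 0 T := ⟨hs.1.trans hr.1, by linarith [hr.2, hs.2]⟩
        exact (enorm_add_le _ _).trans (add_le_add (h7 hrI) (h8 hrI))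
      have hfin : ‖∫ s in (0 : ℝ)..x, (φ (s + h) - φ s)‖ₑ ≤ ENNReal.ofReal (h * (2 * ε)) := by
        rw [intervalIntegral.integral_of_le hx0]
        refine (enorm_integral_le_lintegral_enorm _).trans ?_
        refine (lintegral_mono_ae ((ae_restrict_iff' measurableSet_Ioc).2 hpt)).trans ?_
        refine (setLIntegral_le_lintegral _ _).trans ?_
        have h9 : ∀ s, ∫⁻ r in Set.Ioc s (s + h), e r s + e r (s + h) =
            (∫⁻ r in Set.Ioc s (s + h), e r s) + ∫⁻ r in Set.Ioc s (s + h), e r (s + h) := by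
          intro s
          refine lintegral_add_left ?_ _
          exact hem.comp (measurable_id.prodMk measurable_const)
        simp_rw [h9]
        rw [lintegral_add_left' ?_]
        · refine (add_le_add hstrip1 hstrip2).trans_eq ?_
          rw [← ENNReal.ofReal_add (by positivity) (by positivity)]
          congr 1
          ring
        · have h10 : ∀ s, ∫⁻ r in Set.Ioc s (s + h), e r s = ∫⁻ θ in Set.Ioc 0 h, e (s + θ) s := by
            intro s
            rw [← lintegral_indicator measurableSet_Ioc, ← lintegral_indicator measurableSet_Ioc,
              ← lintegral_add_left_eq_self _ s]
            refine lintegral_congr fun θ => ?_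
            simp only [Set.indicator, Set.mem_Ioc, lt_add_iff_pos_right, add_le_add_iff_left]
          simp_rw [h10]
          refine Measurable.aemeasurable (Measurable.lintegral_prod_right' (f := fun z : ℝ × ℝ =>
            e (z.1 + z.2) z.1) ?_)
          exact hem.comp ((measurable_fst.add measurable_snd).prodMk measurable_fst)
      rw [abs_mul, abs_of_pos (inv_pos.2 hh0), inv_mul_le_iff₀ hh0]
      rw [← ofReal_norm, ENNReal.ofReal_le_ofReal_iff (by positivity)] at hfin
      exact hfin
    have hz : |φ x - φ 0| ≤ 0 := by
      refine le_of_forall_pos_le_add fun ε hε => ?_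
      have := habs (ε / 2) (by positivity)
      linarith
    exact sub_eq_zero.1 (abs_nonpos_iff.1 hz)
  have hall : ∀ x ∈ Set.Icc 0 T, φ x = φ 0 := by
    have hcl : IsClosed {x | φ x = φ 0} := isClosed_eq hφc continuous_const
    intro x hx
    have := closure_minimal (s := Set.Ico 0 T) (fun y hy => key y hy) hcl
    rw [closure_Ico hT.ne] at this
    exact this hx
  have h1 := hall t ht
  simp only [hφ, intervalIntegral.integral_same, mul_zero, sub_zero] at h1
  rw [hDint 0 h0 t ht] at h1
  linarith

end FracSkeleton

namespace FracSkeleton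

variable {d : ℕ} {O : Set (Space d)} {γ p : ℝ}

lemma enorm_inner_le_scaled {K : Type*} [NormedAddCommGroup K] [InnerProductSpace ℝ K] (x y : K)
    {η : ℝ} (hη : 0 < η) :
    ‖(inner ℝ x y : ℝ)‖ₑ ≤ ENNReal.ofReal η * ‖x‖ₑ ^ 2 + ENNReal.ofReal η⁻¹ * ‖y‖ₑ ^ 2 := by
  have h1 : ‖(inner ℝ x y : ℝ)‖ ≤ η * ‖x‖ ^ 2 + η⁻¹ * ‖y‖ ^ 2 := by
    refine (abs_real_inner_le_norm x y).trans ?_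
    have h2 : 0 ≤ η * (‖x‖ - η⁻¹ * ‖y‖) ^ 2 := by positivity
    have h3 : η * (‖x‖ - η⁻¹ * ‖y‖) ^ 2 =
        η * ‖x‖ ^ 2 - 2 * (η * η⁻¹) * (‖x‖ * ‖y‖) + (η * η⁻¹) * (η⁻¹ * ‖y‖ ^ 2) := by ring
    rw [mul_inv_cancel₀ hη.ne'] at h3
    have h4 : 0 ≤ ‖x‖ * ‖y‖ := by positivity
    linarith
  rw [← ofReal_norm, ← ofReal_norm, ← ofReal_norm, ← ENNReal.ofReal_pow (norm_nonneg _),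
    ← ENNReal.ofReal_pow (norm_nonneg _), ← ENNReal.ofReal_mul hη.le,
    ← ENNReal.ofReal_mul (inv_pos.2 hη).le, ← ENNReal.ofReal_add (by positivity) (by positivity)]
  exact ENNReal.ofReal_le_ofReal h1

lemma eLpNorm_pow_eq {Y : Type*} [NormedAddCommGroup Y] {q : ℝ} (hq : 0 < q) (y : ℝ → Y) :
    eLpNorm y (ENNReal.ofReal q) volume ^ q = ∫⁻ s, ‖y s‖ₑ ^ q := by
  rw [eLpNorm_eq_lintegral_rpow_enorm_toReal (by simpa using hq) ENNReal.ofReal_ne_top,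
    ENNReal.toReal_ofReal hq.le, ← ENNReal.rpow_mul, one_div_mul_cancel hq.ne', ENNReal.rpow_one]

lemma tendsto_lintegral_translate {Y : Type*} [NormedAddCommGroup Y] {q : ℝ} (hq : 1 ≤ q)
    {y : ℝ → Y} (hy : StronglyMeasurable y) (hi : ∫⁻ s, ‖y s‖ₑ ^ q < ∞) :
    Tendsto (fun θ : ℝ => ∫⁻ s, ‖y s - y (s + θ)‖ₑ ^ q) (𝓝 0) (𝓝 0) := by
  have hq0 : 0 < q := by linarith
  have : Fact (1 ≤ ENNReal.ofReal q) := ⟨by rwa [ENNReal.one_le_ofReal]⟩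
  have : Fact (ENNReal.ofReal q ≠ ∞) := ⟨ENNReal.ofReal_ne_top⟩
  have hm : MemLp y (ENNReal.ofReal q) volume := by
    refine ⟨hy.aestronglyMeasurable, ?_⟩
    rw [← eLpNorm_pow_eq hq0] at hi
    exact (ENNReal.rpow_lt_top_iff_of_pos hq0).1 hi
  have h1 := (ENNReal.continuous_rpow_const (y := q)).tendsto 0 |>.comp
    (tendsto_eLpNorm_translate hm)
  rw [ENNReal.zero_rpow_of_pos hq0] at h1
  refine h1.congr fun θ => ?_
  rw [← eLpNorm_pow_eq hq0]
  rfl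

section
variable [hpf : Fact (1 < p)] (hγ₀ : 0 < γ) (hγ₁ : γ < 1)
include hγ₀ hγ₁

lemma ae_memV {T : ℝ} {w : ℝ → HSpace O} (hw : Continuous w)
    (hwV : ∫⁻ s in Set.Ioc 0 T, gagliardoSq γ (w s) < ∞) :
    ∀ᵐ s ∂(volume.restrict (Set.Ioc 0 T)), MemV γ (w s) :=
  ae_lt_top ((measurable_gagliardoSq hγ₀ hγ₁).comp hw.measurable) hwV.ne

lemma lintegral_Dop_lt_top {T : ℝ} {w : ℝ → HSpace O} (hw : Continuous w)
    (hwV : ∫⁻ s in Set.Ioc 0 T, gagliardoSq γ (w s) < ∞) :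
    ∫⁻ s in Set.Ioc 0 T, ‖Dop γ (w s)‖ₑ ^ 2 < ∞ := by
  have h1 : ∫⁻ s in Set.Ioc 0 T, ‖Dop γ (w s)‖ₑ ^ 2 =
      ENNReal.ofReal (fracConst d γ / 2) * ∫⁻ s in Set.Ioc 0 T, gagliardoSq γ (w s) := by
    have hm : Measurable fun s => gagliardoSq γ (w s) :=
      (measurable_gagliardoSq hγ₀ hγ₁).comp hw.measurable
    rw [← lintegral_const_mul _ hm]
    refine lintegral_congr_ae ?_
    filter_upwards [ae_memV hγ₀ hγ₁ hw hwV] with s hs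
    rw [gagliardoSq_eq hγ₀ hγ₁ hs]
  rw [h1]
  exact ENNReal.mul_lt_top ENNReal.ofReal_lt_top hwV

omit hγ₀ hγ₁ hpf in
lemma ae_powInt {T : ℝ} {w : ℝ → HSpace O} (hw : Continuous w)
    (hwP : ∫⁻ s in Set.Ioc 0 T, powInt p (w s) < ∞) :
    ∀ᵐ s ∂(volume.restrict (Set.Ioc 0 T)), powInt p (w s) < ∞ :=
  ae_lt_top (measurable_powInt.comp hw.measurable) hwP.ne

omit hγ₀ hγ₁ in
lemma integrable_inner_of_sq {K : Type*} [NormedAddCommGroup K] [InnerProductSpace ℝ K] {T : ℝ}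
    {x y : ℝ → K} (hx : StronglyMeasurable x) (hy : StronglyMeasurable y)
    (hx2 : ∫⁻ s in Set.Ioc 0 T, ‖x s‖ₑ ^ 2 < ∞) (hy2 : ∫⁻ s in Set.Ioc 0 T, ‖y s‖ₑ ^ 2 < ∞) :
    IntegrableOn (fun s => (inner ℝ (x s) (y s) : ℝ)) (Set.Ioc 0 T) := by
  refine ⟨(hx.inner hy).aestronglyMeasurable, ?_⟩
  refine lt_of_le_of_lt (lintegral_mono fun s => enorm_inner_le_scaled (x s) (y s) one_pos) ?_
  simp only [ENNReal.ofReal_one, inv_one, one_mul]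
  rw [lintegral_add_left (hx.enorm.pow_const 2), ENNReal.add_lt_top]
  exact ⟨hx2, hy2⟩

set_option maxHeartbeats 400000 in
theorem energy_identity {T : ℝ} (hT : 0 < T) {w : ℝ → HSpace O} {k : ℝ → KSpace d}
    {b : ℝ → HSpace O → ℝ} {f : ℝ → HSpace O} {β : ℝ → ℝ≥0∞} {C : ℝ → ℝ} (hw : Continuous w)
    (hwV : ∫⁻ s in Set.Ioc 0 T, gagliardoSq γ (w s) < ∞)
    (hwP : ∫⁻ s in Set.Ioc 0 T, powInt p (w s) < ∞)
    (hk : StronglyMeasurable k) (hk2 : ∫⁻ s in Set.Ioc 0 T, ‖k s‖ₑ ^ 2 < ∞)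
    (hbm : ∀ v, powInt p v < ∞ →
      AEStronglyMeasurable (fun s => b s v) (volume.restrict (Set.Ioc 0 T)))
    (hbd : AEStronglyMeasurable (fun s => b s (w s)) (volume.restrict (Set.Ioc 0 T)))
    (hβ : Measurable β) (hβi : ∫⁻ s in Set.Ioc 0 T, β s < ∞) (hb0 : ∀ s, b s 0 = 0)
    (hb : ∀ᵐ s ∂(volume.restrict (Set.Ioc 0 T)), ∀ v v', powInt p v < ∞ → powInt p v' < ∞ →
      ∀ ε > 0, ‖b s v - b s v'‖ₑ ≤
        ENNReal.ofReal ε * β s + ENNReal.ofReal (C ε) * powInt p (v - v'))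
    (hf : IntegrableOn f (Set.Ioc 0 T))
    (eqn : ∀ x ∈ Set.Icc 0 T, ∀ y ∈ Set.Icc 0 T, ∀ v, MemV γ v → powInt p v < ∞ →
      inner ℝ (w y - w x) v =
        ∫ r in x..y, (inner ℝ (k r) (Dop γ v) + b r v + inner ℝ (f r) v))
    {t : ℝ} (ht : t ∈ Set.Icc 0 T) :
    IntegrableOn (fun r => b r (w r)) (Set.Ioc 0 T) ∧
    ‖w t‖ ^ 2 = ‖w 0‖ ^ 2 + 2 * ∫ r in (0 : ℝ)..t,
      (inner ℝ (k r) (Dop γ (w r)) + b r (w r) + inner ℝ (f r) (w r)) := by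
  have hp := hpf.out
  have hV := ae_memV hγ₀ hγ₁ hw hwV
  have hPw := ae_powInt hw hwP
  have hDm : StronglyMeasurable fun s => Dop γ (w s) :=
    (measurable_memV_Dop hγ₀ hγ₁).2.comp_measurable hw.measurable
  have hEm : StronglyMeasurable fun s => Eop p (w s) :=
    stronglyMeasurable_Eop.comp_measurable hw.measurable
  have hD2 := lintegral_Dop_lt_top hγ₀ hγ₁ hw hwV
  have hz : powInt p (0 : HSpace O) = 0 := by
    have := powInt_smul (p := p) 0 (0 : HSpace O)
    rwa [zero_smul, enorm_zero, ENNReal.zero_rpow_of_pos (by linarith), zero_mul] at this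
  have hbbound : ∀ᵐ s ∂(volume.restrict (Set.Ioc 0 T)), ∀ v, powInt p v < ∞ →
      ‖b s v‖ₑ ≤ β s + ENNReal.ofReal (C 1) * powInt p v := by
    filter_upwards [hb] with s hs v hv
    have := hs v 0 hv (by rw [hz]; simp) 1 one_pos
    simpa [hb0 s] using this
  have hbi : ∀ v, powInt p v < ∞ → IntegrableOn (fun s => b s v) (Set.Ioc 0 T) := by
    intro v hv
    refine ⟨hbm v hv, ?_⟩
    refine lt_of_le_of_lt (lintegral_mono_ae (g := fun s => β s + ENNReal.ofReal (C 1) *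
      powInt p v) ?_) ?_
    · filter_upwards [hbbound] with s hs using hs v hv
    · rw [lintegral_add_left hβ, ENNReal.add_lt_top]
      refine ⟨hβi, ?_⟩
      rw [setLIntegral_const]
      exact ENNReal.mul_lt_top (ENNReal.mul_lt_top ENNReal.ofReal_lt_top hv) measure_Ioc_lt_top
  have hbdi : IntegrableOn (fun s => b s (w s)) (Set.Ioc 0 T) := by
    refine ⟨hbd, ?_⟩
    refine lt_of_le_of_lt (lintegral_mono_ae (g := fun s => β s + ENNReal.ofReal (C 1) *
      powInt p (w s)) ?_) ?_
    · filter_upwards [hbbound, hPw] with s hs hs' using hs _ hs'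
    · rw [lintegral_add_left hβ, ENNReal.add_lt_top, lintegral_const_mul' _ _ ENNReal.ofReal_ne_top]
      exact ⟨hβi, ENNReal.mul_lt_top ENNReal.ofReal_lt_top hwP⟩
  have hcI : ∀ c : ℝ≥0∞, c < ∞ → ∫⁻ _ in Set.Ioc 0 T, c < ∞ := by
    intro c hc
    rw [setLIntegral_const]
    exact ENNReal.mul_lt_top hc measure_Ioc_lt_top
  have hfw : IntegrableOn (fun r => (inner ℝ (f r) (w r) : ℝ)) (Set.Ioc 0 T) := by
    obtain ⟨M, hM⟩ := isCompact_Icc.exists_bound_of_continuousOn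
      (hw.continuousOn (s := Set.Icc 0 T))
    refine (hf.norm.const_mul M).mono'
      (hf.aestronglyMeasurable.inner hw.aestronglyMeasurable) ?_
    filter_upwards [ae_restrict_mem measurableSet_Ioc] with s hs
    refine (norm_inner_le_norm (𝕜 := ℝ) _ _).trans ?_
    rw [mul_comm]
    gcongr
    exact hM s (Set.Ioc_subset_Icc_self hs)
  refine ⟨hbdi, ?_⟩
  set P : ℝ → ℝ → ℝ := fun r s =>
    inner ℝ (k r) (Dop γ (w s)) + b r (w s) + inner ℝ (f r) (w s) with hP
  refine norm_sq_eq_of_pairing hw hT (P := P) ?_ ?_ ?_ ht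
  · rw [intervalIntegrable_iff_integrableOn_Ioc_of_le hT.le]
    exact ((integrable_inner_of_sq hk hDm hk2 hD2).add hbdi).add hfw
  · have h1 := (ae_restrict_iff' measurableSet_Ioc).1 hV
    have h2 := (ae_restrict_iff' measurableSet_Ioc).1 hPw
    filter_upwards [h1, h2] with s hs1 hs2 hs
    have hs' := Set.Ioo_subset_Ioc_self hs
    refine ⟨?_, fun x hx y hy => eqn x hx y hy (w s) (hs1 hs') (hs2 hs')⟩
    rw [intervalIntegrable_iff_integrableOn_Ioc_of_le hT.le]
    refine ((integrable_inner_of_sq hk (y := fun _ => Dop γ (w s))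
      stronglyMeasurable_const hk2 (hcI _ ?_)).add (hbi _ (hs2 hs'))).add ?_
    · exact ENNReal.pow_lt_top enorm_lt_top
    · exact hf.inner_const (w s)
  · intro ε hε
    set f' := hf.aestronglyMeasurable.mk f with hf'
    have hf'm : StronglyMeasurable f' := hf.aestronglyMeasurable.stronglyMeasurable_mk
    have hff' : ∀ᵐ s ∂(volume.restrict (Set.Ioc 0 T)), f s = f' s :=
      hf.aestronglyMeasurable.ae_eq_mk
    have hf'i : ∫⁻ s in Set.Ioc 0 T, ‖f' s‖ₑ < ∞ := by
      have h1 : ∫⁻ s in Set.Ioc 0 T, ‖f' s‖ₑ = ∫⁻ s in Set.Ioc 0 T, ‖f s‖ₑ := by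
        refine lintegral_congr_ae ?_
        filter_upwards [hff'] with s hs
        rw [hs]
      rw [h1]
      exact hf.2
    set A : ℝ≥0∞ := (∫⁻ s in Set.Ioc 0 T, ‖k s‖ₑ ^ 2) + (∫⁻ s in Set.Ioc 0 T, β s) +
      ∫⁻ s in Set.Ioc 0 T, ‖f' s‖ₑ with hA
    have hAf : A < ∞ := by
      rw [hA, ENNReal.add_lt_top, ENNReal.add_lt_top]
      exact ⟨⟨hk2, hβi⟩, hf'i⟩
    set η : ℝ := ε / (2 * (A.toReal + 1)) with hη
    have hA0 : 0 ≤ A.toReal := ENNReal.toReal_nonneg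
    have hη0 : 0 < η := by positivity
    set yD : ℝ → KSpace d := (Set.Ioc 0 T).indicator fun s => Dop γ (w s) with hyD
    set yE := (Set.Ioc 0 T).indicator fun s => Eop p (w s) with hyE
    have hyDm : StronglyMeasurable yD := hDm.indicator measurableSet_Ioc
    have hyEm : StronglyMeasurable yE := hEm.indicator measurableSet_Ioc
    set I : ℝ → ℝ≥0∞ := (Set.Ioc 0 T).indicator 1 with hI
    have hIm : Measurable I := measurable_one.indicator measurableSet_Ioc
    let e : ℝ → ℝ → ℝ≥0∞ := fun r s =>
      ENNReal.ofReal η * (I r * (‖k r‖ₑ ^ 2 + β r)) + I r * ‖f' r‖ₑ * ‖w s - w r‖ₑ +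
        (ENNReal.ofReal η⁻¹ * ‖yD s - yD r‖ₑ ^ (2 : ℝ) +
          ENNReal.ofReal (C η) * ‖yE s - yE r‖ₑ ^ (p + 1))
    have hIi : ∀ g : ℝ → ℝ≥0∞, ∫⁻ s, I s * g s = ∫⁻ s in Set.Ioc 0 T, g s := by
      intro g
      rw [← lintegral_indicator measurableSet_Ioc]
      refine lintegral_congr fun s => ?_
      by_cases hs : s ∈ Set.Ioc 0 T
      · simp [hI, hs]
      · simp [hI, hs]
    have hem1 : Measurable fun r => I r * (‖k r‖ₑ ^ 2 + β r) :=
      hIm.mul ((hk.enorm.pow_const 2).add hβ)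
    have hem2 : Measurable fun z : ℝ × ℝ => I z.1 * ‖f' z.1‖ₑ * ‖w z.2 - w z.1‖ₑ := by
      refine ((hIm.mul hf'm.enorm).comp measurable_fst).mul ?_
      exact ((hw.comp continuous_snd).sub (hw.comp continuous_fst)).enorm.measurable
    have hem3 : Measurable fun z : ℝ × ℝ => ‖yD z.2 - yD z.1‖ₑ ^ (2 : ℝ) :=
      ((hyDm.comp_measurable measurable_snd).sub
        (hyDm.comp_measurable measurable_fst)).enorm.pow_const _
    have hem4 : Measurable fun z : ℝ × ℝ => ‖yE z.2 - yE z.1‖ₑ ^ (p + 1) :=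
      ((hyEm.comp_measurable measurable_snd).sub
        (hyEm.comp_measurable measurable_fst)).enorm.pow_const _
    refine ⟨e, ?_, ?_, ?_⟩
    · exact (((hem1.comp measurable_fst).const_mul _).add hem2).add
        ((hem3.const_mul _).add (hem4.const_mul _))
    · have h1 := (ae_restrict_iff' measurableSet_Ioc).1 hV
      have h2 := (ae_restrict_iff' measurableSet_Ioc).1 hPw
      have h3 := (ae_restrict_iff' measurableSet_Ioc).1 hb
      have h4 := (ae_restrict_iff' measurableSet_Ioc).1 hff'
      filter_upwards [h1, h2] with s hs1 hs2 hs
      filter_upwards [h1, h2, h3, h4] with r hr1 hr2 hr3 hr4 hr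
      have hs' := Set.Ioo_subset_Ioc_self hs
      have hr' := Set.Ioo_subset_Ioc_self hr
      have hsub := powInt_sub (hs2 hs') (hr2 hr')
      have e1 : ‖(inner ℝ (k r) (Dop γ (w s) - Dop γ (w r)) : ℝ)‖ₑ ≤
          ENNReal.ofReal η * ‖k r‖ₑ ^ 2 + ENNReal.ofReal η⁻¹ * ‖yD s - yD r‖ₑ ^ (2 : ℝ) := by
        rw [hyD, Set.indicator_of_mem hs', Set.indicator_of_mem hr', ENNReal.rpow_two]
        exact enorm_inner_le_scaled _ _ hη0
      have e2 : ‖b r (w s) - b r (w r)‖ₑ ≤ ENNReal.ofReal η * β r +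
          ENNReal.ofReal (C η) * ‖yE s - yE r‖ₑ ^ (p + 1) := by
        rw [hyE, Set.indicator_of_mem hs', Set.indicator_of_mem hr', ← hsub.2, enorm_Eop hsub.1]
        exact hr3 hr' _ _ (hs2 hs') (hr2 hr') η hη0
      have e3 : ‖(inner ℝ (f r) (w s - w r) : ℝ)‖ₑ ≤ ‖f' r‖ₑ * ‖w s - w r‖ₑ := by
        rw [hr4 hr', ← ofReal_norm, ← ofReal_norm, ← ofReal_norm,
          ← ENNReal.ofReal_mul (norm_nonneg _)]
        exact ENNReal.ofReal_le_ofReal (norm_inner_le_norm _ _)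
      have e4 : P r s - P r r = inner ℝ (k r) (Dop γ (w s) - Dop γ (w r)) +
          (b r (w s) - b r (w r)) + inner ℝ (f r) (w s - w r) := by
        simp only [hP, inner_sub_right]
        ring
      have e5 : I r = 1 := by simp [hI, hr']
      rw [e4]
      refine (enorm_add_le _ _).trans ((add_le_add ((enorm_add_le _ _).trans
        (add_le_add e1 e2)) e3).trans_eq ?_)
      simp only [e, e5, one_mul]
      ring
    · have t1 : Tendsto (fun θ : ℝ => ENNReal.ofReal η⁻¹ *
          (∫⁻ s, ‖yD s - yD (s + θ)‖ₑ ^ (2 : ℝ)) + ENNReal.ofReal (C η) *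
          ∫⁻ s, ‖yE s - yE (s + θ)‖ₑ ^ (p + 1)) (𝓝 0) (𝓝 0) := by
        have i1 : ∫⁻ s, ‖yD s‖ₑ ^ (2 : ℝ) < ∞ := by
          have : ∫⁻ s, ‖yD s‖ₑ ^ (2 : ℝ) = ∫⁻ s in Set.Ioc 0 T, ‖Dop γ (w s)‖ₑ ^ 2 := by
            rw [← lintegral_indicator measurableSet_Ioc]
            refine lintegral_congr fun s => ?_
            by_cases hs : s ∈ Set.Ioc 0 T
            · simp [hyD, hs]
            · simp [hyD, hs]
          rw [this]
          exact hD2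
        have i2 : ∫⁻ s, ‖yE s‖ₑ ^ (p + 1) < ∞ := by
          have : ∫⁻ s, ‖yE s‖ₑ ^ (p + 1) = ∫⁻ s in Set.Ioc 0 T, ‖Eop p (w s)‖ₑ ^ (p + 1) := by
            rw [← lintegral_indicator measurableSet_Ioc]
            refine lintegral_congr fun s => ?_
            by_cases hs : s ∈ Set.Ioc 0 T
            · simp [hyE, hs]
            · simp [hyE, hs, ENNReal.zero_rpow_of_pos (by linarith : 0 < p + 1)]
          rw [this]
          refine lt_of_eq_of_lt (lintegral_congr_ae ?_) hwP
          filter_upwards [hPw] with s hs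
          rw [enorm_Eop hs]
        have j1 := ENNReal.Tendsto.const_mul (a := ENNReal.ofReal η⁻¹)
          (tendsto_lintegral_translate one_le_two hyDm i1) (Or.inr ENNReal.ofReal_ne_top)
        have j2 := ENNReal.Tendsto.const_mul (a := ENNReal.ofReal (C η))
          (tendsto_lintegral_translate (by linarith) hyEm i2) (Or.inr ENNReal.ofReal_ne_top)
        simpa using j1.add j2
      have t2 : ∀ᶠ θ in 𝓝 (0 : ℝ), ∀ s, I (s + θ) * ‖w s - w (s + θ)‖ₑ ≤
          I (s + θ) * ENNReal.ofReal η := by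
        have huc := isCompact_Icc.uniformContinuousOn_of_continuous
          (hw.continuousOn (s := Set.Icc (-1) (T + 1)))
        rw [Metric.uniformContinuousOn_iff] at huc
        obtain ⟨θ₀, hθ₀, hu⟩ := huc η hη0
        filter_upwards [Metric.ball_mem_nhds (0 : ℝ) (lt_min hθ₀ one_pos)] with θ hθ s
        rw [Metric.mem_ball, Real.dist_eq, sub_zero] at hθ
        have hθ1 := abs_lt.1 (hθ.trans_le (min_le_right _ _))
        by_cases hs : s + θ ∈ Set.Ioc 0 T
        · gcongr
          rw [← ofReal_norm]
          refine ENNReal.ofReal_le_ofReal ?_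
          rw [← dist_eq_norm]
          refine (hu s ⟨by linarith [hs.1], by linarith [hs.2]⟩ (s + θ)
            ⟨by linarith [hs.1], by linarith [hs.2]⟩ ?_).le
          rw [Real.dist_eq, sub_add_cancel_left, abs_neg]
          exact hθ.trans_le (min_le_left _ _)
        · simp [hI, hs]
      have hε2 : (0 : ℝ≥0∞) < ENNReal.ofReal (ε / 2) := by simpa using hε
      filter_upwards [t1.eventually_le_const hε2, t2] with θ h1 h2
      have hshift : ∀ g : ℝ → ℝ≥0∞, ∫⁻ s, g (s + θ) = ∫⁻ s, g s := fun g =>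
        lintegral_add_right_eq_self g θ
      calc ∫⁻ s, e (s + θ) s
          ≤ ∫⁻ s, ((ENNReal.ofReal η * (I (s + θ) * (‖k (s + θ)‖ₑ ^ 2 + β (s + θ))) +
              ENNReal.ofReal η * (I (s + θ) * ‖f' (s + θ)‖ₑ)) +
              (ENNReal.ofReal η⁻¹ * ‖yD s - yD (s + θ)‖ₑ ^ (2 : ℝ) +
              ENNReal.ofReal (C η) * ‖yE s - yE (s + θ)‖ₑ ^ (p + 1))) := by
            refine lintegral_mono fun s => ?_
            simp only [e]
            refine add_le_add (add_le_add le_rfl ?_) le_rfl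
            calc I (s + θ) * ‖f' (s + θ)‖ₑ * ‖w s - w (s + θ)‖ₑ
                = ‖f' (s + θ)‖ₑ * (I (s + θ) * ‖w s - w (s + θ)‖ₑ) := by ring
              _ ≤ ‖f' (s + θ)‖ₑ * (I (s + θ) * ENNReal.ofReal η) := by
                  gcongr 1
                  exact h2 s
              _ = _ := by ring
        _ = ENNReal.ofReal η * A + (ENNReal.ofReal η⁻¹ *
              (∫⁻ s, ‖yD s - yD (s + θ)‖ₑ ^ (2 : ℝ)) + ENNReal.ofReal (C η) *
              ∫⁻ s, ‖yE s - yE (s + θ)‖ₑ ^ (p + 1)) := by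
            have m1 : Measurable fun s : ℝ => s + θ := measurable_add_const θ
            have m3 : Measurable fun s => ‖yD s - yD (s + θ)‖ₑ ^ (2 : ℝ) :=
              (hyDm.sub (hyDm.comp_measurable m1)).enorm.pow_const _
            have m4 : Measurable fun s => ‖yE s - yE (s + θ)‖ₑ ^ (p + 1) :=
              (hyEm.sub (hyEm.comp_measurable m1)).enorm.pow_const _
            have m5 : Measurable fun s => ENNReal.ofReal η *
                (I (s + θ) * (‖k (s + θ)‖ₑ ^ 2 + β (s + θ))) := (hem1.comp m1).const_mul _
            have m6 : Measurable fun s => ENNReal.ofReal η * (I (s + θ) * ‖f' (s + θ)‖ₑ) :=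
              ((hIm.mul hf'm.enorm).comp m1).const_mul _
            have q5 : ∫⁻ s, ENNReal.ofReal η * (I (s + θ) * (‖k (s + θ)‖ₑ ^ 2 + β (s + θ))) =
                ENNReal.ofReal η * ((∫⁻ s in Set.Ioc 0 T, ‖k s‖ₑ ^ 2) +
                  ∫⁻ s in Set.Ioc 0 T, β s) := by
              rw [lintegral_const_mul' _ _ ENNReal.ofReal_ne_top,
                hshift fun s => I s * (‖k s‖ₑ ^ 2 + β s), hIi,
                lintegral_add_left (hk.enorm.pow_const 2)]
            have q6 : ∫⁻ s, ENNReal.ofReal η * (I (s + θ) * ‖f' (s + θ)‖ₑ) =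
                ENNReal.ofReal η * ∫⁻ s in Set.Ioc 0 T, ‖f' s‖ₑ := by
              rw [lintegral_const_mul' _ _ ENNReal.ofReal_ne_top,
                hshift fun s => I s * ‖f' s‖ₑ, hIi]
            have m7 : Measurable fun s => ENNReal.ofReal η * (I (s + θ) * (‖k (s + θ)‖ₑ ^ 2 +
                β (s + θ))) + ENNReal.ofReal η * (I (s + θ) * ‖f' (s + θ)‖ₑ) := m5.add m6
            rw [lintegral_add_left m7, lintegral_add_left m5,
              lintegral_add_left (m3.const_mul _), lintegral_const_mul _ m3,
              lintegral_const_mul _ m4, q5, q6, ← mul_add]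
        _ ≤ ENNReal.ofReal (ε / 2) + ENNReal.ofReal (ε / 2) := by
            refine add_le_add ?_ h1
            rw [← ENNReal.ofReal_toReal hAf.ne, ← ENNReal.ofReal_mul hη0.le]
            refine ENNReal.ofReal_le_ofReal ?_
            rw [hη, div_mul_eq_mul_div, div_le_div_iff₀ (by positivity) two_pos]
            nlinarith
        _ = ENNReal.ofReal ε := by
            rw [← ENNReal.ofReal_add (by positivity) (by positivity), add_halves]

end

end FracSkeleton

namespace FracSkeleton

/-! ### Weak solutions of the equation with a given right-hand side -/

variable {d : ℕ} {O : Set (Space d)} {γ p T : ℝ} {F : ℝ → ℝ}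

/-- The standing assumptions on the domain, the order and the nonlinearity. -/
structure Ambient (O : Set (Space d)) (γ p : ℝ) (F : ℝ → ℝ) : Prop where
  γ_pos : 0 < γ
  γ_lt : γ < 1
  d_pos : 0 < d
  isOpen : IsOpen O
  finite : volume O < ∞
  condF : CondF p F

/-- `u` solves `u' + (-Δ)^γ u + F(u) = f`, `u(0) = u₀` on `[0, T]`, tested against bounded-energy
elements of `L^{p+1}`. -/
structure IsWeakSol (γ p : ℝ) (F : ℝ → ℝ) (T : ℝ) (u₀ : HSpace O) (f u : ℝ → HSpace O) : Prop where
  cont : Continuous u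
  memV : ∫⁻ s in Set.Ioc 0 T, gagliardoSq γ (u s) < ∞
  memP : ∫⁻ s in Set.Ioc 0 T, powInt p (u s) < ∞
  eqn : ∀ t ∈ Set.Icc 0 T, ∀ v, MemV γ v → powInt p v < ∞ →
    inner ℝ (u t) v = inner ℝ u₀ v + ∫ s in (0 : ℝ)..t,
      (inner ℝ (f s) v - inner ℝ (Dop γ (u s)) (Dop γ v) - pairF F (u s) v)

variable [hpf : Fact (1 < p)]

section
variable (hA : Ambient O γ p F)
include hA

lemma aestronglyMeasurable_pairF {u w : ℝ → HSpace O} (hu : Continuous u) (hw : Continuous w)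
    (hu' : ∫⁻ s in Set.Ioc 0 T, powInt p (u s) < ∞)
    (hw' : ∫⁻ s in Set.Ioc 0 T, powInt p (w s) < ∞) :
    AEStronglyMeasurable (fun s => pairF F (u s) (w s)) (volume.restrict (Set.Ioc 0 T)) := by
  refine aestronglyMeasurable_of_tendsto_ae atTop
    (f := fun (n : ℕ) s => inner ℝ (nem (fun r => F (clampFn n r)) (u s)) (w s)) (fun n => ?_) ?_
  · obtain ⟨L, hL⟩ := hA.condF.lipschitz_clamp (Nat.cast_nonneg (α := ℝ) n)
    have h1 := (lipschitz_nem (O := O) hA.isOpen.measurableSet hA.finite hL).continuous.comp hu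
    exact (h1.inner hw).aestronglyMeasurable
  · filter_upwards [ae_powInt hu hu', ae_powInt hw hw'] with s h1 h2
    exact tendsto_pairF_clamp hA.isOpen.measurableSet hA.finite hA.condF h1 h2

omit hA hpf in
lemma integrableOn_powInt {u : ℝ → HSpace O} (hu : Continuous u)
    (hu' : ∫⁻ s in Set.Ioc 0 T, powInt p (u s) < ∞) :
    IntegrableOn (fun s => (powInt p (u s)).toReal) (Set.Ioc 0 T) :=
  integrable_toReal_of_lintegral_ne_top (measurable_powInt.comp hu.measurable).aemeasurable hu'.ne

omit hA hpf in
lemma lintegral_const_lt_top {c : ℝ≥0∞} (hc : c < ∞) : ∫⁻ _ in Set.Ioc (0 : ℝ) T, c < ∞ := by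
  rw [lintegral_const]
  exact ENNReal.mul_lt_top hc (by simp)

lemma integrableOn_pairF {u : ℝ → HSpace O} (hu : Continuous u)
    (hu' : ∫⁻ s in Set.Ioc 0 T, powInt p (u s) < ∞) {v : HSpace O} (hv : powInt p v < ∞) :
    IntegrableOn (fun s => pairF F (u s) v) (Set.Ioc 0 T) := by
  obtain ⟨k, hk, hFk⟩ := hA.condF.2.1
  have h0 : IntegrableOn (fun s => k * (volume.real O + (powInt p (u s)).toReal +
      2 * (powInt p v).toReal)) (Set.Ioc 0 T) := by
    have h1 : IntegrableOn (fun _ : ℝ => volume.real O) (Set.Ioc 0 T) := by simp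
    have h2 : IntegrableOn (fun _ : ℝ => 2 * (powInt p v).toReal) (Set.Ioc 0 T) :=
      integrableOn_const (by simp)
    exact ((h1.add (integrableOn_powInt hu hu')).add h2).const_mul k
  refine h0.mono' (aestronglyMeasurable_pairF hA hu continuous_const hu'
    (lintegral_const_lt_top hv)) ?_
  filter_upwards [ae_powInt hu hu'] with s hs
  exact abs_pairF_le hA.isOpen.measurableSet hA.finite hA.condF.continuous hk.le hFk hs hv

lemma integrableOn_inner_Dop {u : ℝ → HSpace O} (hu : Continuous u)
    (hu' : ∫⁻ s in Set.Ioc 0 T, gagliardoSq γ (u s) < ∞) (k : KSpace d) :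
    IntegrableOn (fun s => (inner ℝ (Dop γ (u s)) k : ℝ)) (Set.Ioc 0 T) := by
  refine integrable_inner_of_sq ((measurable_memV_Dop hA.γ_pos hA.γ_lt).2.comp_measurable
    hu.measurable) stronglyMeasurable_const (lintegral_Dop_lt_top hA.γ_pos hA.γ_lt hu hu') ?_
  exact lintegral_const_lt_top (by simp)

lemma eq_of_inner_boundedV {x y : HSpace O}
    (h : ∀ v, MemV γ v → powInt p v < ∞ → inner ℝ x v = inner ℝ y v) : x = y := by
  have hd := dense_boundedV (O := O) hA.isOpen hA.d_pos hA.γ_pos hA.γ_lt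
  have h1 : (fun v => inner ℝ x v : HSpace O → ℝ) = fun v => inner ℝ y v := by
    refine Continuous.ext_on hd (by fun_prop) (by fun_prop) fun v hv => ?_
    obtain ⟨h2, R, hR⟩ := hv
    exact h v h2 (powInt_lt_top_of_bddBy hA.finite hR)
  exact ext_inner_right ℝ fun v => congrFun h1 v

end

namespace IsWeakSol

variable {u₀ v₀ : HSpace O} {f g u v : ℝ → HSpace O}

section
variable (hA : Ambient O γ p F) (hT : 0 < T)
include hA hT

lemma apply_zero (hu : IsWeakSol γ p F T u₀ f u) : u 0 = u₀ := by
  refine eq_of_inner_boundedV hA fun v hv hv' => ?_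
  have := hu.eqn 0 ⟨le_rfl, hT.le⟩ v hv hv'
  simpa using this

omit hT in
lemma integrand (hu : IsWeakSol γ p F T u₀ f u) (hf : IntegrableOn f (Set.Ioc 0 T)) {v : HSpace O}
    (hv : powInt p v < ∞) : IntegrableOn (fun s => inner ℝ (f s) v -
      inner ℝ (Dop γ (u s)) (Dop γ v) - pairF F (u s) v) (Set.Ioc 0 T) :=
  ((hf.inner_const v).sub (integrableOn_inner_Dop hA hu.cont hu.memV _)).sub
    (integrableOn_pairF hA hu.cont hu.memP hv)

omit hA hT hpf in
lemma _root_.FracSkeleton.intervalIntegrable_of_integrableOn {X : Type*} [NormedAddCommGroup X]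
    {φ : ℝ → X} (h : IntegrableOn φ (Set.Ioc 0 T)) {x y : ℝ}
    (hx : x ∈ Set.Icc 0 T) (hy : y ∈ Set.Icc 0 T) : IntervalIntegrable φ volume x y := by
  rw [intervalIntegrable_iff]
  refine h.mono_set fun s hs => ?_
  rw [Set.mem_uIoc] at hs
  rcases hs with hs | hs
  · exact ⟨hx.1.trans_lt hs.1, hs.2.trans hy.2⟩
  · exact ⟨hy.1.trans_lt hs.1, hs.2.trans hx.2⟩

omit hT in
lemma increment (hu : IsWeakSol γ p F T u₀ f u) (hf : IntegrableOn f (Set.Ioc 0 T)) {x y : ℝ}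
    (hx : x ∈ Set.Icc 0 T) (hy : y ∈ Set.Icc 0 T) {v : HSpace O} (hv : MemV γ v)
    (hv' : powInt p v < ∞) : inner ℝ (u y) v - inner ℝ (u x) v = ∫ s in x..y,
      (inner ℝ (f s) v - inner ℝ (Dop γ (u s)) (Dop γ v) - pairF F (u s) v) := by
  have h0 : (0 : ℝ) ∈ Set.Icc 0 T := ⟨le_rfl, hx.1.trans hx.2⟩
  rw [hu.eqn y hy v hv hv', hu.eqn x hx v hv hv',
    ← intervalIntegral.integral_interval_sub_left
      (intervalIntegrable_of_integrableOn (hu.integrand hA hf hv') h0 hy)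
      (intervalIntegrable_of_integrableOn (hu.integrand hA hf hv') h0 hx)]
  ring

omit hA hT hpf in
lemma _root_.FracSkeleton.lintegral_sub_lt_top {φ : HSpace O → ℝ≥0∞} {D : ℝ≥0∞} (hD : D < ∞)
    (hφ : ∀ x y, φ (x - y) ≤ D * (φ x + φ y)) (hm : Measurable φ) {u v : ℝ → HSpace O}
    (hu : Continuous u)
    (h1 : ∫⁻ s in Set.Ioc 0 T, φ (u s) < ∞) (h2 : ∫⁻ s in Set.Ioc 0 T, φ (v s) < ∞) :
    ∫⁻ s in Set.Ioc 0 T, φ (u s - v s) < ∞ := by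
  refine (lintegral_mono fun s => hφ (u s) (v s)).trans_lt ?_
  have hm' : Measurable fun s => φ (u s) := hm.comp hu.measurable
  rw [lintegral_const_mul' _ _ hD.ne, lintegral_add_left hm']
  exact ENNReal.mul_lt_top hD (ENNReal.add_lt_top.2 ⟨h1, h2⟩)

omit hT hpf in
lemma _root_.FracSkeleton.gagliardoSq_sub_le (x y : HSpace O) :
    gagliardoSq γ (x - y) ≤ 2 * (gagliardoSq γ x + gagliardoSq γ y) := by
  by_cases hx : MemV γ x
  swap
  · have : gagliardoSq γ x = ∞ := by simpa [MemV] using hx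
    simp [this]
  by_cases hy : MemV γ y
  swap
  · have : gagliardoSq γ y = ∞ := by simpa [MemV] using hy
    simp [this]
  have hC := fracConst_pos (d := d) hA.γ_pos hA.γ_lt
  obtain ⟨h1, h2⟩ := memV_sub hA.γ_pos hA.γ_lt hx hy
  have hc0 : ENNReal.ofReal (fracConst d γ / 2) ≠ 0 := by simpa using hC
  rw [← ENNReal.mul_le_mul_iff_right hc0 ENNReal.ofReal_ne_top, mul_left_comm, mul_add,
    gagliardoSq_eq hA.γ_pos hA.γ_lt hx, gagliardoSq_eq hA.γ_pos hA.γ_lt hy,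
    gagliardoSq_eq hA.γ_pos hA.γ_lt h1, h2]
  rw [← enorm_norm, ← enorm_norm (Dop γ x), ← enorm_norm (Dop γ y)]
  simp only [Real.enorm_of_nonneg (norm_nonneg _)]
  rw [← ENNReal.ofReal_pow (norm_nonneg _), ← ENNReal.ofReal_pow (norm_nonneg _),
    ← ENNReal.ofReal_pow (norm_nonneg _), ← ENNReal.ofReal_add (by positivity) (by positivity)]
  have h5 : ∀ r : ℝ, 2 * ENNReal.ofReal r = ENNReal.ofReal (2 * r) := fun r => by
    rw [ENNReal.ofReal_mul zero_le_two, ENNReal.ofReal_ofNat]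
  rw [h5]
  refine ENNReal.ofReal_le_ofReal ?_
  have h3 := norm_sub_le (Dop γ x) (Dop γ y)
  have h4 := norm_nonneg (Dop γ x - Dop γ y)
  nlinarith [sq_nonneg (‖Dop γ x‖ - ‖Dop γ y‖)]

omit hA hT in
lemma _root_.FracSkeleton.powInt_sub_le (x y : HSpace O) :
    powInt p (x - y) ≤ 2 ^ p * (powInt p x + powInt p y) := by
  have hp := hpf.out
  rw [powInt, powInt, powInt, ← lintegral_add_left ((measurable_rep x).enorm.pow_const _),
    ← lintegral_const_mul' _ _ (ENNReal.rpow_lt_top_of_nonneg (by linarith) (by simp)).ne]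
  refine lintegral_mono_ae ?_
  filter_upwards [rep_sub x y] with z hz
  rw [hz]
  refine (ENNReal.rpow_le_rpow (enorm_sub_le) (by linarith)).trans ?_
  have := ENNReal.rpow_add_le_mul_rpow_add_rpow ‖rep x z‖ₑ ‖rep y z‖ₑ (by linarith : 1 ≤ p + 1)
  simpa using this

theorem difference_energy (hu : IsWeakSol γ p F T u₀ f u) (hv : IsWeakSol γ p F T v₀ g v)
    (hf : IntegrableOn f (Set.Ioc 0 T)) (hg : IntegrableOn g (Set.Ioc 0 T))
    {t : ℝ} (ht : t ∈ Set.Icc 0 T) :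
    IntegrableOn (fun s => pairF F (u s) (u s - v s) - pairF F (v s) (u s - v s)) (Set.Ioc 0 T) ∧
    ‖u t - v t‖ ^ 2 = ‖u₀ - v₀‖ ^ 2 + 2 * ∫ s in (0 : ℝ)..t,
      (-‖Dop γ (u s - v s)‖ ^ 2 - (pairF F (u s) (u s - v s) - pairF F (v s) (u s - v s)) +
        inner ℝ (f s - g s) (u s - v s)) := by
  obtain ⟨k, hk, hkb⟩ := abs_pairF_le_scaled (O := O) hA.isOpen.measurableSet hA.finite hA.condF
  have hp := hpf.out
  have hD := (measurable_memV_Dop (O := O) hA.γ_pos hA.γ_lt).2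
  have hDu : StronglyMeasurable fun s => Dop γ (u s) := hD.comp_measurable hu.cont.measurable
  have hDv : StronglyMeasurable fun s => Dop γ (v s) := hD.comp_measurable hv.cont.measurable
  have hwV : ∫⁻ s in Set.Ioc 0 T, gagliardoSq γ (u s - v s) < ∞ :=
    lintegral_sub_lt_top (by simp) (gagliardoSq_sub_le hA)
      (measurable_gagliardoSq hA.γ_pos hA.γ_lt) hu.cont hu.memV hv.memV
  have hwP : ∫⁻ s in Set.Ioc 0 T, powInt p (u s - v s) < ∞ :=
    lintegral_sub_lt_top (D := 2 ^ p)
      (ENNReal.rpow_lt_top_of_nonneg (by linarith) (by simp)) powInt_sub_le measurable_powInt hu.cont hu.memP hv.memP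
  have hwc : Continuous fun s => u s - v s := hu.cont.sub hv.cont
  have hau := ae_memV hA.γ_pos hA.γ_lt hu.cont hu.memV
  have hav := ae_memV hA.γ_pos hA.γ_lt hv.cont hv.memV
  have hpu := ae_powInt hu.cont hu.memP
  have hpv := ae_powInt hv.cont hv.memP
  have hk2 : ∫⁻ s in Set.Ioc 0 T, ‖-(Dop γ (u s) - Dop γ (v s))‖ₑ ^ 2 < ∞ := by
    refine lt_of_le_of_lt (le_of_eq ?_) (lintegral_Dop_lt_top hA.γ_pos hA.γ_lt hwc hwV)
    refine lintegral_congr_ae ?_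
    filter_upwards [hau, hav] with s h1 h2
    rw [enorm_neg, (memV_sub hA.γ_pos hA.γ_lt h1 h2).2]
  have key := energy_identity (p := p) hA.γ_pos hA.γ_lt hT (w := fun s => u s - v s)
    (k := fun s => -(Dop γ (u s) - Dop γ (v s)))
    (b := fun s x => -(pairF F (u s) x - pairF F (v s) x)) (f := fun s => f s - g s)
    (β := fun s => ENNReal.ofReal k * (volume O + powInt p (u s)) +
      ENNReal.ofReal k * (volume O + powInt p (v s)))
    (C := fun ε => 2 * (ε * (2 * k * (ε⁻¹ ^ (p + 1))))) hwc hwV hwP (hDu.sub hDv).neg hk2 ?_ ?_ ?_ ?_ ?_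
    ?_ (hf.sub hg) ?_ ht
  · obtain ⟨h1, h2⟩ := key
    refine ⟨h1.neg.congr_fun (fun s _ => neg_neg _) measurableSet_Ioc, ?_⟩
    simp only [apply_zero hA hT hu, apply_zero hA hT hv] at h2
    rw [h2]
    congr 2
    refine intervalIntegral.integral_congr_ae ?_
    rw [Set.uIoc_of_le ht.1]
    have hsub : volume.restrict (Set.Ioc 0 t) ≤ volume.restrict (Set.Ioc 0 T) :=
      Measure.restrict_mono (Set.Ioc_subset_Ioc_right ht.2) le_rfl
    refine (ae_restrict_iff' measurableSet_Ioc).1 ?_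
    filter_upwards [ae_mono hsub hau, ae_mono hsub hav] with s h3 h4
    rw [(memV_sub hA.γ_pos hA.γ_lt h3 h4).2, inner_neg_left, real_inner_self_eq_norm_sq]
    ring
  · intro x hx
    exact ((aestronglyMeasurable_pairF hA hu.cont continuous_const hu.memP
      (lintegral_const_lt_top hx)).sub (aestronglyMeasurable_pairF hA hv.cont continuous_const
        hv.memP (lintegral_const_lt_top hx))).neg
  · exact ((aestronglyMeasurable_pairF hA hu.cont hwc hu.memP hwP).sub
      (aestronglyMeasurable_pairF hA hv.cont hwc hv.memP hwP)).neg
  · have h1 : Measurable fun s => powInt p (u s) := measurable_powInt.comp hu.cont.measurable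
    have h2 : Measurable fun s => powInt p (v s) := measurable_powInt.comp hv.cont.measurable
    exact ((measurable_const.add h1).const_mul _).add ((measurable_const.add h2).const_mul _)
  · have h1 : ∀ {y : ℝ → HSpace O}, ∫⁻ s in Set.Ioc 0 T, powInt p (y s) < ∞ →
        ∫⁻ s in Set.Ioc 0 T, ENNReal.ofReal k * (volume O + powInt p (y s)) < ∞ := by
      intro y hy
      rw [lintegral_const_mul' _ _ ENNReal.ofReal_ne_top, lintegral_add_left measurable_const]
      exact ENNReal.mul_lt_top ENNReal.ofReal_lt_top
        (ENNReal.add_lt_top.2 ⟨lintegral_const_lt_top hA.finite, hy⟩)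
    have h2 : Measurable fun s => powInt p (u s) := measurable_powInt.comp hu.cont.measurable
    have h3 : Measurable fun s => ENNReal.ofReal k * (volume O + powInt p (u s)) :=
      (measurable_const.add h2).const_mul _
    rw [lintegral_add_left h3]
    exact ENNReal.add_lt_top.2 ⟨h1 hu.memP, h1 hv.memP⟩
  · intro s
    simp only [pairF]
    have h0 : ∀ G : Space d → ℝ, ∫ x, G x * rep (0 : HSpace O) x = 0 := by
      intro G
      refine integral_eq_zero_of_ae ?_
      filter_upwards [rep_zero (O := O)] with x hx
      simp [hx]
    simp [h0]
  · filter_upwards [hpu, hpv] with s h1 h2 x x' hx hx' ε hε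
    have hxx := (powInt_sub hx hx').1
    have e1 := pairF_sub_right hA.isOpen.measurableSet hA.finite hA.condF h1 hx hx'
    have e2 := pairF_sub_right hA.isOpen.measurableSet hA.finite hA.condF h2 hx hx'
    have b1 := hkb (u s) (x - x') h1 hxx ε hε
    have b2 := hkb (v s) (x - x') h2 hxx ε hε
    have h3 : |-(pairF F (u s) x - pairF F (v s) x) - -(pairF F (u s) x' - pairF F (v s) x')| ≤
        ε * (k * (volume.real O + (powInt p (u s)).toReal) +
          k * (volume.real O + (powInt p (v s)).toReal)) +
        2 * (ε * (2 * k * ε⁻¹ ^ (p + 1))) * (powInt p (x - x')).toReal := by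
      have : -(pairF F (u s) x - pairF F (v s) x) - -(pairF F (u s) x' - pairF F (v s) x') =
          pairF F (v s) (x - x') - pairF F (u s) (x - x') := by
        rw [e1, e2]; ring
      rw [this]
      refine (abs_sub _ _).trans ?_
      linarith
    rw [Real.enorm_eq_ofReal_abs]
    refine (ENNReal.ofReal_le_ofReal h3).trans (le_of_eq ?_)
    have hr : ∀ y : HSpace O, powInt p y < ∞ →
        ENNReal.ofReal (k * (volume.real O + (powInt p y).toReal)) =
          ENNReal.ofReal k * (volume O + powInt p y) := by
      intro y hy
      rw [ENNReal.ofReal_mul hk.le, ENNReal.ofReal_add measureReal_nonneg ENNReal.toReal_nonneg,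
        ENNReal.ofReal_toReal hy.ne, measureReal_def, ENNReal.ofReal_toReal hA.finite.ne]
    have hv0 : 0 ≤ volume.real O := measureReal_nonneg
    rw [ENNReal.ofReal_add (by positivity) (by positivity), ENNReal.ofReal_mul hε.le,
      ENNReal.ofReal_add (by positivity) (by positivity), hr _ h1, hr _ h2,
      ENNReal.ofReal_mul (by positivity), ENNReal.ofReal_toReal hxx.ne]
  · intro x hx y hy z hz hz'
    have e1 := hu.increment hA hf hx hy hz hz'
    have e2 := hv.increment hA hg hx hy hz hz'
    have i1 := intervalIntegrable_of_integrableOn (hu.integrand hA hf hz') hx hy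
    have i2 := intervalIntegrable_of_integrableOn (hv.integrand hA hg hz') hx hy
    have : inner ℝ (u y - v y - (u x - v x)) z =
        (inner ℝ (u y) z - inner ℝ (u x) z) - (inner ℝ (v y) z - inner ℝ (v x) z) := by
      simp only [inner_sub_left]; ring
    rw [this, e1, e2, ← intervalIntegral.integral_sub i1 i2]
    refine intervalIntegral.integral_congr fun s _ => ?_
    simp only [inner_sub_left, inner_neg_left]
    ring

end

end IsWeakSol

end FracSkeleton

namespace FracSkeleton

/-! ### Gronwall's inequality with an integrable kernel, and fixed points of Volterra type -/

lemma integrableOn_mul_continuous {T : ℝ} {ℓ ψ : ℝ → ℝ} (hℓ : IntegrableOn ℓ (Set.Ioc 0 T))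
    (hψ : Continuous ψ) : IntegrableOn (fun s => ℓ s * ψ s) (Set.Ioc 0 T) := by
  obtain ⟨C, hC⟩ := (isCompact_Icc (a := (0 : ℝ)) (b := T)).exists_bound_of_continuousOn
    hψ.continuousOn
  refine Integrable.mul_bdd (c := C) hℓ hψ.aestronglyMeasurable ?_
  refine (ae_restrict_iff' measurableSet_Ioc).2 (Eventually.of_forall fun s hs => ?_)
  exact hC s ⟨hs.1.le, hs.2⟩

/-- A form of Gronwall's inequality: the bound `ψ ≤ A + ∫ ℓ ψ` gives `ψ ≤ 2ⁿ A`
as soon as `∫ ℓ ≤ n / 2`. -/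
theorem gronwall_integrable {T A : ℝ} {ℓ ψ : ℝ → ℝ} (hA : 0 ≤ A)
    (hℓ : IntegrableOn ℓ (Set.Ioc 0 T)) (hℓ0 : ∀ s, 0 ≤ ℓ s) (hψ : Continuous ψ)
    (hψ0 : ∀ s, 0 ≤ ψ s)
    (h : ∀ t ∈ Set.Icc 0 T, ψ t ≤ A + ∫ s in (0 : ℝ)..t, ℓ s * ψ s) (n : ℕ) :
    ∀ t ∈ Set.Icc 0 T, ∫ s in (0 : ℝ)..t, ℓ s ≤ n / 2 →
      A + ∫ s in (0 : ℝ)..t, ℓ s * ψ s ≤ 2 ^ n * A := by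
  have hi := integrableOn_mul_continuous hℓ hψ
  have bound : ∀ x ∈ Set.Icc 0 T, ∀ y ∈ Set.Icc 0 T, x ≤ y → ∀ M, (∀ s ∈ Set.Icc x y, ψ s ≤ M) →
      ∫ s in x..y, ℓ s * ψ s ≤ (∫ s in x..y, ℓ s) * M := by
    intro x hx y hy hxy M hM
    rw [← intervalIntegral.integral_mul_const]
    refine intervalIntegral.integral_mono_on hxy (intervalIntegrable_of_integrableOn hi hx hy)
      ((intervalIntegrable_of_integrableOn hℓ hx hy).mul_const M) fun s hs => ?_
    exact mul_le_mul_of_nonneg_left (hM s hs) (hℓ0 s)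
  induction n with
  | zero =>
    intro t ht hLt
    have h0 : (0 : ℝ) ∈ Set.Icc 0 T := ⟨le_rfl, ht.1.trans ht.2⟩
    obtain ⟨C, hC⟩ := (isCompact_Icc (a := (0 : ℝ)) (b := t)).exists_bound_of_continuousOn
      hψ.continuousOn
    have h1 := bound 0 h0 t ht ht.1 C fun s hs => (le_abs_self _).trans (hC s hs)
    have h2 : 0 ≤ C := (norm_nonneg _).trans (hC 0 ⟨le_rfl, ht.1⟩)
    have h3 : (∫ s in (0 : ℝ)..t, ℓ s) * C ≤ 0 := by
      refine mul_nonpos_of_nonpos_of_nonneg ?_ h2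
      simpa using hLt
    simp only [pow_zero, one_mul]
    linarith
  | succ n ih =>
    intro t ht hLt
    have h0 : (0 : ℝ) ∈ Set.Icc 0 T := ⟨le_rfl, ht.1.trans ht.2⟩
    have hp : (0 : ℝ) ≤ 2 ^ n * A := by positivity
    rcases le_total (∫ s in (0 : ℝ)..t, ℓ s) (n / 2) with hc | hc
    · have := ih t ht hc
      rw [pow_succ]
      linarith
    have hLc : ContinuousOn (fun x => ∫ s in (0 : ℝ)..x, ℓ s) (Set.Icc 0 t) := by
      have := intervalIntegral.continuousOn_primitive_interval'
        (intervalIntegrable_of_integrableOn hℓ h0 ht) Set.left_mem_uIcc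
      rwa [Set.uIcc_of_le ht.1] at this
    obtain ⟨x, hx, hLx⟩ := intermediate_value_Icc ht.1 hLc
      (show (n / 2 : ℝ) ∈ _ from ⟨by simp; positivity, hc⟩)
    simp only at hLx
    have hxT : x ∈ Set.Icc 0 T := ⟨hx.1, hx.2.trans ht.2⟩
    have hZ := ih x hxT hLx.le
    obtain ⟨z, hz, hmax⟩ := isCompact_Icc.exists_isMaxOn (Set.nonempty_Icc.2 hx.2)
      hψ.continuousOn
    have key : ∀ y ∈ Set.Icc x t, A + ∫ s in (0 : ℝ)..y, ℓ s * ψ s ≤ 2 ^ n * A + ψ z / 2 := by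
      intro y hy
      have hyT : y ∈ Set.Icc 0 T := ⟨hx.1.trans hy.1, hy.2.trans ht.2⟩
      rw [← intervalIntegral.integral_add_adjacent_intervals
        (intervalIntegrable_of_integrableOn hi h0 hxT)
        (intervalIntegrable_of_integrableOn hi hxT hyT)]
      have h1 := bound x hxT y hyT hy.1 (ψ z) fun s hs => hmax ⟨hs.1, hs.2.trans hy.2⟩
      have h2 : ∫ s in x..y, ℓ s ≤ 1 / 2 := by
        have h3 := intervalIntegral.integral_add_adjacent_intervals
          (intervalIntegrable_of_integrableOn hℓ h0 hxT)
          (intervalIntegrable_of_integrableOn hℓ hxT hyT)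
        have h4 := intervalIntegral.integral_add_adjacent_intervals
          (intervalIntegrable_of_integrableOn hℓ h0 hyT)
          (intervalIntegrable_of_integrableOn hℓ hyT ht)
        have h5 : 0 ≤ ∫ s in y..t, ℓ s :=
          intervalIntegral.integral_nonneg hy.2 fun s _ => hℓ0 s
        push_cast at hLt
        linarith
      have h3 := mul_le_mul_of_nonneg_right h2 (hψ0 z)
      linarith
    have h1 := (h z ⟨hx.1.trans hz.1, hz.2.trans ht.2⟩).trans (key z hz)
    have h2 := key t ⟨hx.2, le_rfl⟩
    rw [pow_succ]
    linarith

theorem le_of_gronwall {T A : ℝ} {ℓ ψ : ℝ → ℝ} (hA : 0 ≤ A)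
    (hℓ : IntegrableOn ℓ (Set.Ioc 0 T)) (hℓ0 : ∀ s, 0 ≤ ℓ s) (hψ : Continuous ψ)
    (hψ0 : ∀ s, 0 ≤ ψ s)
    (h : ∀ t ∈ Set.Icc 0 T, ψ t ≤ A + ∫ s in (0 : ℝ)..t, ℓ s * ψ s) {n : ℕ}
    (hn : ∫ s in (0 : ℝ)..T, ℓ s ≤ n / 2) {t : ℝ} (ht : t ∈ Set.Icc 0 T) : ψ t ≤ 2 ^ n * A := by
  refine (h t ht).trans (gronwall_integrable hA hℓ hℓ0 hψ hψ0 h n t ht (le_trans ?_ hn))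
  have h0 : (0 : ℝ) ∈ Set.Icc 0 T := ⟨le_rfl, ht.1.trans ht.2⟩
  have hT : T ∈ Set.Icc 0 T := ⟨ht.1.trans ht.2, le_rfl⟩
  rw [← intervalIntegral.integral_add_adjacent_intervals
    (intervalIntegrable_of_integrableOn hℓ h0 ht) (intervalIntegrable_of_integrableOn hℓ ht hT)]
  have : 0 ≤ ∫ s in t..T, ℓ s := intervalIntegral.integral_nonneg ht.2 fun s _ => hℓ0 s
  linarith

theorem exists_fixedPoint_of_volterra {X : Type*} [NormedAddCommGroup X] [CompleteSpace X]
    {T : ℝ} (hT : 0 ≤ T) {ℓ : ℝ → ℝ} (hℓ : IntegrableOn ℓ (Set.Ioc 0 T)) (hℓ0 : ∀ s, 0 ≤ ℓ s)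
    (S : C(Set.Icc 0 T, X) → C(Set.Icc 0 T, X))
    (hS : ∀ u v, ∀ t : Set.Icc 0 T, ‖S u t - S v t‖ ≤
      ∫ s in (0 : ℝ)..t, ℓ s * ‖Set.IccExtend hT u s - Set.IccExtend hT v s‖) :
    ∃ u, S u = u := by
  have h0T : (0 : ℝ) ∈ Set.Icc 0 T := ⟨le_rfl, hT⟩
  have hTT : T ∈ Set.Icc 0 T := ⟨hT, le_rfl⟩
  set U : ℕ → C(Set.Icc 0 T, X) := fun k => S^[k] 0 with hU
  have hUs : ∀ k, U (k + 1) = S (U k) := fun k => Function.iterate_succ_apply' S k 0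
  set δ : ℕ → ℝ → ℝ := fun k s => ‖Set.IccExtend hT (U (k + 1)) s - Set.IccExtend hT (U k) s‖
    with hδ
  have hδc : ∀ k, Continuous (δ k) := fun k =>
    ((U (k + 1)).continuous.Icc_extend'.sub (U k).continuous.Icc_extend').norm
  have hδ0 : ∀ k s, 0 ≤ δ k s := fun k s => norm_nonneg _
  have hδs : ∀ k, ∀ t ∈ Set.Icc 0 T, δ (k + 1) t ≤ ∫ s in (0 : ℝ)..t, ℓ s * δ k s := by
    intro k t ht
    have := hS (U (k + 1)) (U k) ⟨t, ht⟩
    rw [← hUs, ← hUs] at this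
    simpa only [hδ, Set.IccExtend_of_mem hT _ ht] using this
  have hℓ2 : IntegrableOn (fun s => 2 * ℓ s) (Set.Ioc 0 T) := hℓ.const_mul 2
  obtain ⟨N, hN⟩ := exists_nat_ge (2 * ∫ s in (0 : ℝ)..T, 2 * ℓ s)
  set M := dist (U 1) (U 0) with hM
  have hbound : ∀ n, ∀ t ∈ Set.Icc 0 T, ∑ k ∈ Finset.range n, 2 ^ k * δ k t ≤ 2 ^ N * M := by
    intro n t ht
    refine le_of_gronwall (A := M) (ℓ := fun s => 2 * ℓ s)
      (ψ := fun t => ∑ k ∈ Finset.range n, 2 ^ k * δ k t) dist_nonneg hℓ2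
      (fun s => by have := hℓ0 s; positivity)
      (continuous_finsetSum _ fun k _ => continuous_const.mul (hδc k))
      (fun s => Finset.sum_nonneg fun k _ => mul_nonneg (by positivity) (hδ0 k s)) ?_
      (by linarith) ht
    intro t ht
    have hint : ∀ k, IntervalIntegrable (fun s => ℓ s * δ k s) volume 0 t := fun k =>
      intervalIntegrable_of_integrableOn (integrableOn_mul_continuous hℓ (hδc k)) h0T ht
    have hδ00 : δ 0 t ≤ M := by
      have := (U 1).dist_apply_le_dist (g := U 0) ⟨t, ht⟩
      rw [dist_eq_norm] at this
      simp only [hδ, Set.IccExtend_of_mem hT _ ht]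
      exact this
    have e1 : ∫ s in (0 : ℝ)..t, 2 * ℓ s * ∑ k ∈ Finset.range n, 2 ^ k * δ k s =
        ∑ k ∈ Finset.range n, 2 ^ (k + 1) * ∫ s in (0 : ℝ)..t, ℓ s * δ k s := by
      simp_rw [← intervalIntegral.integral_const_mul]
      rw [← intervalIntegral.integral_finsetSum fun k _ => (hint k).const_mul _]
      refine intervalIntegral.integral_congr fun s _ => ?_
      simp only [Finset.mul_sum]
      exact Finset.sum_congr rfl fun k _ => by ring
    rw [e1]
    have hnn : ∀ k, 0 ≤ ∫ s in (0 : ℝ)..t, ℓ s * δ k s := fun k =>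
      intervalIntegral.integral_nonneg ht.1 fun s _ => mul_nonneg (hℓ0 s) (hδ0 k s)
    rcases n with - | n
    · simp [hM]
    rw [Finset.sum_range_succ', Finset.sum_range_succ]
    have h1 : ∑ k ∈ Finset.range n, 2 ^ (k + 1) * δ (k + 1) t ≤
        ∑ k ∈ Finset.range n, 2 ^ (k + 1) * ∫ s in (0 : ℝ)..t, ℓ s * δ k s :=
      Finset.sum_le_sum fun k _ => mul_le_mul_of_nonneg_left (hδs k t ht) (by positivity)
    have h2 : 0 ≤ 2 ^ (n + 1) * ∫ s in (0 : ℝ)..t, ℓ s * δ n s :=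
      mul_nonneg (by positivity) (hnn n)
    simp only [pow_zero, one_mul]
    linarith
  have hgeo : ∀ k, dist (U k) (U (k + 1)) ≤ 2 ^ N * M * (1 / 2) ^ k := by
    intro k
    refine (ContinuousMap.dist_le (by positivity)).2 fun t => ?_
    have h1 := hbound (k + 1) t t.2
    rw [Finset.sum_range_succ] at h1
    have h2 : 0 ≤ ∑ j ∈ Finset.range k, 2 ^ j * δ j t :=
      Finset.sum_nonneg fun j _ => mul_nonneg (by positivity) (hδ0 j t)
    have h3 : dist (U k t) (U (k + 1) t) = δ k t := by
      rw [dist_comm, dist_eq_norm]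
      simp only [hδ, Set.IccExtend_of_mem hT _ t.2]
    rw [h3, one_div, inv_pow, ← div_eq_mul_inv, le_div_iff₀ (by positivity)]
    linarith
  obtain ⟨u, hu⟩ := cauchySeq_tendsto_of_complete
    (cauchySeq_of_le_geometric (1 / 2) _ (by norm_num) hgeo)
  refine ⟨u, ?_⟩
  have hSc : Continuous S := by
    refine (LipschitzWith.of_dist_le_mul (K := (∫ s in (0 : ℝ)..T, ℓ s).toNNReal)
      fun v w => ?_).continuous
    have hI : 0 ≤ ∫ s in (0 : ℝ)..T, ℓ s := intervalIntegral.integral_nonneg hT fun s _ => hℓ0 s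
    rw [Real.coe_toNNReal _ hI]
    refine (ContinuousMap.dist_le (mul_nonneg hI dist_nonneg)).2 fun t => ?_
    rw [dist_eq_norm]
    refine (hS v w t).trans ?_
    have hc : Continuous fun s => ‖Set.IccExtend hT v s - Set.IccExtend hT w s‖ :=
      (v.continuous.Icc_extend'.sub w.continuous.Icc_extend').norm
    rw [← intervalIntegral.integral_mul_const]
    have hi := integrableOn_mul_continuous hℓ hc
    refine le_trans (intervalIntegral.integral_mono_interval le_rfl t.2.1 t.2.2
      (Eventually.of_forall fun s => mul_nonneg (hℓ0 s) (norm_nonneg _))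
      (intervalIntegrable_of_integrableOn hi h0T hTT)) ?_
    refine intervalIntegral.integral_mono_on hT (intervalIntegrable_of_integrableOn hi h0T hTT)
      ((intervalIntegrable_of_integrableOn hℓ h0T hTT).mul_const _) fun s hs => ?_
    refine mul_le_mul_of_nonneg_left ?_ (hℓ0 s)
    rw [← dist_eq_norm, Set.IccExtend_of_mem hT _ hs, Set.IccExtend_of_mem hT _ hs]
    exact v.dist_apply_le_dist _
  exact isFixedPt_of_tendsto_iterate hu hSc.continuousAt

end FracSkeleton

namespace FracSkeleton

/-! ### Stability and a priori estimates -/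

variable {d : ℕ} {O : Set (Space d)} {γ p T : ℝ} {F : ℝ → ℝ} [hpf : Fact (1 < p)]

lemma integrableOn_inner_continuous {X : Type*} [NormedAddCommGroup X] [InnerProductSpace ℝ X]
    {f w : ℝ → X} (hf : IntegrableOn f (Set.Ioc 0 T)) (hw : Continuous w) :
    IntegrableOn (fun s => (inner ℝ (f s) (w s) : ℝ)) (Set.Ioc 0 T) := by
  have hn := hw.norm
  refine (integrableOn_mul_continuous hf.norm hn).mono'
    (hf.aestronglyMeasurable.inner hw.aestronglyMeasurable) ?_
  exact Eventually.of_forall fun s => abs_real_inner_le_norm _ _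

section
variable (hA : Ambient O γ p F)
include hA

omit hpf in
lemma integrableOn_norm_Dop_sq {w : ℝ → HSpace O} (hw : Continuous w)
    (hw' : ∫⁻ s in Set.Ioc 0 T, gagliardoSq γ (w s) < ∞) :
    IntegrableOn (fun s => ‖Dop γ (w s)‖ ^ 2) (Set.Ioc 0 T) := by
  have hm : StronglyMeasurable fun s => Dop γ (w s) :=
    (measurable_memV_Dop hA.γ_pos hA.γ_lt).2.comp_measurable hw.measurable
  refine ⟨(hm.norm.pow 2).aestronglyMeasurable, ?_⟩
  refine lt_of_le_of_lt (le_of_eq ?_) (lintegral_Dop_lt_top hA.γ_pos hA.γ_lt hw hw')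
  simp

lemma IsWeakSol.sub_memV {u₀ v₀ : HSpace O} {f g u v : ℝ → HSpace O}
    (hu : IsWeakSol γ p F T u₀ f u) (hv : IsWeakSol γ p F T v₀ g v) :
    ∫⁻ s in Set.Ioc 0 T, gagliardoSq γ (u s - v s) < ∞ :=
  lintegral_sub_lt_top (by simp) (gagliardoSq_sub_le hA)
    (measurable_gagliardoSq hA.γ_pos hA.γ_lt) hu.cont hu.memV hv.memV

omit hA hpf in
lemma ae_Ioc_of_ae {t : ℝ} (ht : t ∈ Set.Icc 0 T) {q : ℝ → Prop}
    (h : ∀ᵐ s ∂(volume.restrict (Set.Ioc 0 T)), q s) :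
    ∀ᵐ s ∂(volume.restrict (Set.Ioc 0 t)), q s :=
  ae_mono (Measure.restrict_mono (Set.Ioc_subset_Ioc_right ht.2) le_rfl) h

omit hA hpf in
lemma intervalIntegral_mono_ae_Ioc {φ ψ : ℝ → ℝ} (hφ : IntegrableOn φ (Set.Ioc 0 T))
    (hψ : IntegrableOn ψ (Set.Ioc 0 T)) (h : ∀ᵐ s ∂(volume.restrict (Set.Ioc 0 T)), φ s ≤ ψ s)
    {t : ℝ} (ht : t ∈ Set.Icc 0 T) :
    ∫ s in (0 : ℝ)..t, φ s ≤ ∫ s in (0 : ℝ)..t, ψ s := by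
  have h0 : (0 : ℝ) ∈ Set.Icc 0 T := ⟨le_rfl, ht.1.trans ht.2⟩
  rw [intervalIntegral.integral_of_le ht.1, intervalIntegral.integral_of_le ht.1]
  exact setIntegral_mono_ae_restrict (hφ.mono_set (Set.Ioc_subset_Ioc_right ht.2))
    (hψ.mono_set (Set.Ioc_subset_Ioc_right ht.2)) (ae_Ioc_of_ae ht h)

theorem stability : ∃ κ > 0, ∀ {T : ℝ}, 0 < T → ∀ {u₀ v₀ : HSpace O} {f g u v : ℝ → HSpace O},
    IsWeakSol γ p F T u₀ f u → IsWeakSol γ p F T v₀ g v → IntegrableOn f (Set.Ioc 0 T) →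
    IntegrableOn g (Set.Ioc 0 T) → ∀ t ∈ Set.Icc 0 T,
    ‖u t - v t‖ ^ 2 + 2 * ∫ s in (0 : ℝ)..t, ‖Dop γ (u s - v s)‖ ^ 2 ≤ ‖u₀ - v₀‖ ^ 2 +
      2 * ∫ s in (0 : ℝ)..t, (κ * ‖u s - v s‖ ^ 2 + inner ℝ (f s - g s) (u s - v s)) := by
  obtain ⟨κ, hκ, hm⟩ := pairF_mono (O := O) hA.isOpen.measurableSet hA.finite hA.condF
  refine ⟨κ, hκ, fun {T} hT {u₀ v₀ f g u v} hu hv hf hg t ht => ?_⟩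
  obtain ⟨h1, h2⟩ := hu.difference_energy hA hT hv hf hg ht
  have hwc : Continuous fun s => u s - v s := hu.cont.sub hv.cont
  have h0 : (0 : ℝ) ∈ Set.Icc 0 T := ⟨le_rfl, hT.le⟩
  have i1 := integrableOn_norm_Dop_sq hA hwc (hu.sub_memV hA hv)
  have i2 : IntegrableOn (fun s => (inner ℝ (f s - g s) (u s - v s) : ℝ)) (Set.Ioc 0 T) :=
    integrableOn_inner_continuous (hf.sub hg) hwc
  have i3 : IntegrableOn (fun s => κ * ‖u s - v s‖ ^ 2) (Set.Ioc 0 T) :=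
    (continuous_const.mul (hwc.norm.pow 2)).integrableOn_Ioc
  have h3 := intervalIntegral_mono_ae_Ioc
    (φ := fun s => -‖Dop γ (u s - v s)‖ ^ 2 -
      (pairF F (u s) (u s - v s) - pairF F (v s) (u s - v s)) + inner ℝ (f s - g s) (u s - v s))
    (ψ := fun s => (κ * ‖u s - v s‖ ^ 2 + inner ℝ (f s - g s) (u s - v s)) -
      ‖Dop γ (u s - v s)‖ ^ 2) ((i1.neg.sub h1).add i2) ((i3.add i2).sub i1) ?_ ht
  · have i4 : IntegrableOn (fun s => κ * ‖u s - v s‖ ^ 2 + inner ℝ (f s - g s) (u s - v s))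
        (Set.Ioc 0 T) := i3.add i2
    rw [intervalIntegral.integral_sub (intervalIntegrable_of_integrableOn i4 h0 ht)
      (intervalIntegrable_of_integrableOn i1 h0 ht)] at h3
    rw [h2]
    linarith
  · filter_upwards [ae_powInt hu.cont hu.memP, ae_powInt hv.cont hv.memP] with s h4 h5
    have := hm _ _ h4 h5
    linarith

/-- The zero function solves the equation with right-hand side `F(0) 1_O`. -/
lemma isWeakSol_zero : IsWeakSol γ p F T 0 (fun _ => nem (fun r => F (clampFn 0 r)) 0)
    (fun _ => (0 : HSpace O)) := by
  refine ⟨continuous_const, ?_, ?_, ?_⟩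
  · exact lintegral_const_lt_top (memV_zero hA.γ_pos hA.γ_lt).1
  · exact lintegral_const_lt_top (powInt_lt_top_of_bddBy hA.finite bddBy_zero)
  · intro t ht v hv hv'
    rw [(memV_zero hA.γ_pos hA.γ_lt).2, pairF_eq_inner_of_bddBy hA.isOpen.measurableSet hA.finite
      hA.condF le_rfl bddBy_zero]
    simp

theorem a_priori : ∃ k₂ > 0, ∃ k₃ > 0, ∀ {T : ℝ}, 0 < T → ∀ {u₀ : HSpace O} {f u : ℝ → HSpace O},
    IsWeakSol γ p F T u₀ f u → IntegrableOn f (Set.Ioc 0 T) → ∀ t ∈ Set.Icc 0 T,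
    ‖u t‖ ^ 2 + 2 * (∫ s in (0 : ℝ)..t, ‖Dop γ (u s)‖ ^ 2) +
        2 * k₃ * (∫ s in (0 : ℝ)..t, (powInt p (u s)).toReal) ≤
      ‖u₀‖ ^ 2 + 2 * k₂ * t + 2 * ∫ s in (0 : ℝ)..t, inner ℝ (f s) (u s) := by
  obtain ⟨k₂, hk₂, k₃, hk₃, hm⟩ :=
    pairF_coercive (O := O) hA.isOpen.measurableSet hA.finite hA.condF
  refine ⟨k₂, hk₂, k₃, hk₃, fun {T} hT {u₀ f u} hu hf t ht => ?_⟩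
  set g₀ : HSpace O := nem (fun r => F (clampFn 0 r)) 0 with hg₀
  have hg : IntegrableOn (fun _ : ℝ => g₀) (Set.Ioc 0 T) := integrableOn_const (by simp)
  obtain ⟨h1, h2⟩ := hu.difference_energy hA hT (isWeakSol_zero hA) hf hg ht
  have hp0 : ∀ s, pairF F 0 (u s) = inner ℝ g₀ (u s) := fun s =>
    pairF_eq_inner_of_bddBy hA.isOpen.measurableSet hA.finite hA.condF le_rfl bddBy_zero _
  simp only [sub_zero, inner_sub_left, hp0] at h1 h2
  have h0 : (0 : ℝ) ∈ Set.Icc 0 T := ⟨le_rfl, hT.le⟩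
  have i1 := integrableOn_norm_Dop_sq hA hu.cont hu.memV
  have i2 := integrableOn_inner_continuous hf hu.cont
  have i2' := integrableOn_inner_continuous hg hu.cont
  have i3 : IntegrableOn (fun _ : ℝ => k₂) (Set.Ioc 0 T) := integrableOn_const (by simp)
  have i4 : IntegrableOn (fun s => k₃ * (powInt p (u s)).toReal) (Set.Ioc 0 T) :=
    (integrableOn_powInt hu.cont hu.memP).const_mul k₃
  have h3 := intervalIntegral_mono_ae_Ioc
    (φ := fun s => -‖Dop γ (u s)‖ ^ 2 - (pairF F (u s) (u s) - inner ℝ g₀ (u s)) +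
      (inner ℝ (f s) (u s) - inner ℝ g₀ (u s)))
    (ψ := fun s => inner ℝ (f s) (u s) + k₂ - k₃ * (powInt p (u s)).toReal -
      ‖Dop γ (u s)‖ ^ 2) ((i1.neg.sub h1).add (i2.sub i2')) (((i2.add i3).sub i4).sub i1) ?_ ht
  · have i5 : IntegrableOn (fun s => inner ℝ (f s) (u s) + k₂) (Set.Ioc 0 T) := i2.add i3
    have i6 : IntegrableOn (fun s => inner ℝ (f s) (u s) + k₂ - k₃ * (powInt p (u s)).toReal)
        (Set.Ioc 0 T) := i5.sub i4
    rw [intervalIntegral.integral_sub (intervalIntegrable_of_integrableOn i6 h0 ht)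
        (intervalIntegrable_of_integrableOn i1 h0 ht),
      intervalIntegral.integral_sub (intervalIntegrable_of_integrableOn i5 h0 ht)
        (intervalIntegrable_of_integrableOn i4 h0 ht),
      intervalIntegral.integral_add (intervalIntegrable_of_integrableOn i2 h0 ht)
        (intervalIntegrable_of_integrableOn i3 h0 ht), intervalIntegral.integral_const,
        intervalIntegral.integral_const_mul, smul_eq_mul, sub_zero] at h3
    rw [h2]
    linarith
  · filter_upwards [ae_powInt hu.cont hu.memP] with s h4
    have := hm _ h4
    linarith

omit hA hpf in
lemma le_of_sq_le {M a I B : ℝ} (ha : 0 ≤ a) (hI : 0 ≤ I) (hB : 1 ≤ B)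
    (h : M ^ 2 ≤ B * (a ^ 2 + 2 * (M * I))) : M ≤ 2 * B * (a + I) := by
  by_contra hn
  push Not at hn
  have h1 : 2 * a ≤ 2 * B * (a + I) := by nlinarith
  have hM : 0 ≤ M := le_trans (by positivity) hn.le
  rcases ha.eq_or_lt with rfl | ha
  · rcases hM.eq_or_lt with rfl | hM
    · have : 0 ≤ 2 * B * (0 + I) := by positivity
      linarith
    · nlinarith
  · have h2 : 2 * B * (a + I) * M ≤ M * M := mul_le_mul_of_nonneg_right hn.le hM
    have h3 : 0 < B * a * (2 * M - a) := by
      have : 0 < 2 * M - a := by linarith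
      positivity
    nlinarith

theorem norm_sub_le_of_isWeakSol (T : ℝ) : ∃ B > 0, ∀ {u₀ v₀ : HSpace O} {f g u v : ℝ → HSpace O},
    IsWeakSol γ p F T u₀ f u → IsWeakSol γ p F T v₀ g v → IntegrableOn f (Set.Ioc 0 T) →
    IntegrableOn g (Set.Ioc 0 T) → ∀ t ∈ Set.Icc 0 T,
    ‖u t - v t‖ ≤ B * (‖u₀ - v₀‖ + ∫ s in (0 : ℝ)..t, ‖f s - g s‖) := by
  obtain ⟨κ, hκ, hst⟩ := stability hA
  obtain ⟨N, hN⟩ := exists_nat_ge (2 * (2 * κ * T))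
  refine ⟨2 * 2 ^ N, by positivity, fun {u₀ v₀ f g u v} hu hv hf hg t ht => ?_⟩
  have hwc : Continuous fun s => u s - v s := hu.cont.sub hv.cont
  obtain ⟨z, hz, hmax⟩ := isCompact_Icc.exists_isMaxOn (Set.nonempty_Icc.2 ht.1)
    hwc.norm.continuousOn
  have hT : 0 ≤ T := ht.1.trans ht.2
  have hfg : IntegrableOn (fun s => ‖f s - g s‖) (Set.Ioc 0 T) := (hf.sub hg).norm
  have h0 : (0 : ℝ) ∈ Set.Icc 0 T := ⟨le_rfl, hT⟩
  have hInn : 0 ≤ ∫ s in (0 : ℝ)..t, ‖f s - g s‖ :=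
    intervalIntegral.integral_nonneg ht.1 fun s _ => norm_nonneg _
  set I := ∫ s in (0 : ℝ)..t, ‖f s - g s‖ with hI
  rcases ht.1.eq_or_lt with h00 | htpos
  · rcases hT.eq_or_lt with hT0 | hT0
    · subst h00
      have e : ∀ {w₀ : HSpace O} {k w : ℝ → HSpace O}, IsWeakSol γ p F T w₀ k w → w 0 = w₀ := by
        intro w₀ k w hw
        refine eq_of_inner_boundedV hA fun v hv hv' => ?_
        simpa using hw.eqn 0 h0 v hv hv'
      rw [e hu, e hv]
      have : (1 : ℝ) ≤ 2 * 2 ^ N := by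
        have := one_le_pow₀ (M₀ := ℝ) one_le_two (n := N)
        linarith
      nlinarith [norm_nonneg (u₀ - v₀)]
    · subst h00
      rw [hu.apply_zero hA hT0, hv.apply_zero hA hT0]
      have : (1 : ℝ) ≤ 2 * 2 ^ N := by
        have := one_le_pow₀ (M₀ := ℝ) one_le_two (n := N)
        linarith
      nlinarith [norm_nonneg (u₀ - v₀)]
  refine (hmax (⟨ht.1, le_rfl⟩ : t ∈ Set.Icc 0 t)).trans
    (le_of_sq_le (norm_nonneg _) hInn (one_le_pow₀ one_le_two) ?_)
  have hkt : IntegrableOn (fun _ : ℝ => 2 * κ) (Set.Ioc 0 t) := integrableOn_const (by simp)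
  refine le_of_gronwall (ψ := fun s => ‖u s - v s‖ ^ 2) (ℓ := fun _ => 2 * κ) (T := t)
    (by positivity) hkt (fun _ => by positivity) (hwc.norm.pow 2)
    (fun _ => by positivity) ?_ ?_ hz
  · intro s hs
    have hsT : s ∈ Set.Icc 0 T := ⟨hs.1, hs.2.trans ht.2⟩
    have h1 := hst (htpos.trans_le ht.2) hu hv hf hg s hsT
    have i2 : IntegrableOn (fun s => (inner ℝ (f s - g s) (u s - v s) : ℝ)) (Set.Ioc 0 T) :=
      integrableOn_inner_continuous (hf.sub hg) hwc
    have i3 : IntegrableOn (fun s => κ * ‖u s - v s‖ ^ 2) (Set.Ioc 0 T) :=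
      (continuous_const.mul (hwc.norm.pow 2)).integrableOn_Ioc
    have h2 : 0 ≤ ∫ r in (0 : ℝ)..s, ‖Dop γ (u r - v r)‖ ^ 2 :=
      intervalIntegral.integral_nonneg hs.1 fun r _ => by positivity
    rw [intervalIntegral.integral_add (intervalIntegrable_of_integrableOn i3 h0 hsT)
      (intervalIntegrable_of_integrableOn i2 h0 hsT)] at h1
    have h3 : ∫ r in (0 : ℝ)..s, inner ℝ (f r - g r) (u r - v r) ≤ ‖u z - v z‖ * I := by
      calc ∫ r in (0 : ℝ)..s, inner ℝ (f r - g r) (u r - v r)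
          ≤ ∫ r in (0 : ℝ)..s, ‖u z - v z‖ * ‖f r - g r‖ := by
            refine intervalIntegral.integral_mono_on hs.1
              (intervalIntegrable_of_integrableOn i2 h0 hsT)
              ((intervalIntegrable_of_integrableOn hfg h0 hsT).const_mul _) fun r hr => ?_
            refine (real_inner_le_norm _ _).trans ?_
            rw [mul_comm]
            exact mul_le_mul_of_nonneg_right (hmax ⟨hr.1, hr.2.trans hs.2⟩) (norm_nonneg _)
        _ = ‖u z - v z‖ * ∫ r in (0 : ℝ)..s, ‖f r - g r‖ :=
            intervalIntegral.integral_const_mul _ _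
        _ ≤ ‖u z - v z‖ * I := by
            refine mul_le_mul_of_nonneg_left ?_ (norm_nonneg _)
            exact intervalIntegral.integral_mono_interval le_rfl hs.1 hs.2
              (Eventually.of_forall fun r => norm_nonneg _)
              (intervalIntegrable_of_integrableOn hfg h0 ht)
    have h4 : ∫ r in (0 : ℝ)..s, 2 * κ * ‖u r - v r‖ ^ 2 =
        2 * ∫ r in (0 : ℝ)..s, κ * ‖u r - v r‖ ^ 2 := by
      rw [← intervalIntegral.integral_const_mul]
      exact intervalIntegral.integral_congr fun r _ => by ring
    rw [h4]
    linarith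
  · rw [intervalIntegral.integral_const, smul_eq_mul, sub_zero]
    have : t * (2 * κ) ≤ T * (2 * κ) := mul_le_mul_of_nonneg_right ht.2 (by positivity)
    linarith

end

end FracSkeleton

namespace FracSkeleton

/-! ### Passing to the limit in the energy -/

variable {d : ℕ} {O : Set (Space d)} {γ p T : ℝ} {F : ℝ → ℝ}

section
variable (hγ₀ : 0 < γ) (hγ₁ : γ < 1)
include hγ₀ hγ₁

lemma lowerSemicontinuous_gagliardoSq :
    LowerSemicontinuous (gagliardoSq γ : HSpace O → ℝ≥0∞) := by
  have hC := fracConst_pos (d := d) hγ₀ hγ₁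
  rw [lowerSemicontinuous_iff_isClosed_preimage]
  intro c
  refine IsSeqClosed.isClosed fun u v hu huv => ?_
  obtain ⟨ns, -, ha⟩ := exists_subseq_rep_tendsto huv
  change gagliardoSq γ v ≤ c
  have hc0 : ENNReal.ofReal (fracConst d γ / 2) ≠ 0 := by simpa using hC
  rw [← ENNReal.mul_le_mul_iff_right hc0 ENNReal.ofReal_ne_top, ← lintegral_quot_sq hγ₀ hγ₁]
  have h1 : ∫⁻ z, ‖quot γ (rep v) z‖ₑ ^ 2 ≤
      ∫⁻ z, liminf (fun n => ‖quot γ (rep (u (ns n))) z‖ₑ ^ 2) atTop := by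
    refine lintegral_mono_ae ?_
    filter_upwards [ae_prod_of_ae ha] with z hz
    have h6 : Tendsto (fun n => quot γ (rep (u (ns n))) z) atTop (𝓝 (quot γ (rep v) z)) := by
      unfold quot
      exact ((hz.1.sub hz.2).const_mul _).div_const _
    have h2 : Tendsto (fun n => ‖quot γ (rep (u (ns n))) z‖ₑ ^ 2) atTop
        (𝓝 (‖quot γ (rep v) z‖ₑ ^ 2)) :=
      ((ENNReal.continuous_pow 2).tendsto _).comp ((continuous_enorm.tendsto _).comp h6)
    rw [h2.liminf_eq]
  refine h1.trans ((lintegral_liminf_le fun n => ?_).trans ?_)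
  · exact ((measurable_quot (measurable_rep _)).enorm).pow_const _
  · refine liminf_le_of_le (by isBoundedDefault) fun b hb => ?_
    obtain ⟨n, hn⟩ := hb.exists
    rw [lintegral_quot_sq hγ₀ hγ₁] at hn
    exact hn.trans (mul_le_mul_right (hu (ns n)) _)

lemma lintegral_gagliardoSq_sub_le {y : ℕ → ℝ → HSpace O} {u : ℝ → HSpace O}
    (hy : ∀ n, Continuous (y n))
    (h : ∀ s ∈ Set.Ioc 0 T, Tendsto (fun n => y n s) atTop (𝓝 (u s))) {n : ℕ} {ε : ℝ≥0∞}
    (hε : ∀ m ≥ n, ∫⁻ s in Set.Ioc 0 T, gagliardoSq γ (y m s - y n s) ≤ ε) :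
    ∫⁻ s in Set.Ioc 0 T, gagliardoSq γ (u s - y n s) ≤ ε := by
  have h1 : ∫⁻ s in Set.Ioc 0 T, gagliardoSq γ (u s - y n s) ≤
      ∫⁻ s in Set.Ioc 0 T, liminf (fun m => gagliardoSq γ (y m s - y n s)) atTop := by
    refine setLIntegral_mono' measurableSet_Ioc fun s hs => ?_
    have h2 := lowerSemicontinuous_iff_le_liminf.1
      (lowerSemicontinuous_gagliardoSq (O := O) hγ₀ hγ₁) (u s - y n s)
    exact h2.trans (liminf_le_liminf_of_le ((h s hs).sub_const (y n s)))
  refine h1.trans ((lintegral_liminf_le fun m => ?_).trans ?_)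
  · exact (measurable_gagliardoSq hγ₀ hγ₁).comp ((hy m).sub (hy n)).measurable
  · refine liminf_le_of_le (by isBoundedDefault) fun b hb => ?_
    obtain ⟨m, hm, hm'⟩ := (hb.and (eventually_ge_atTop n)).exists
    exact hm.trans (hε m hm')

end

lemma tendsto_integral_Dop [Fact (1 < p)] (hA : Ambient O γ p F) {y : ℕ → ℝ → HSpace O} {u : ℝ → HSpace O}
    (hy : ∀ n, Continuous (y n)) (hu : Continuous u)
    (h : ∀ s ∈ Set.Ioc 0 T, Tendsto (fun n => y n s) atTop (𝓝 (u s)))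
    (hyV : ∀ n, ∫⁻ s in Set.Ioc 0 T, gagliardoSq γ (y n s) < ∞) {ε : ℕ → ℝ≥0∞}
    (hε : Tendsto ε atTop (𝓝 0)) (hεt : ∀ n, ε n < ∞)
    (hyε : ∀ n, ∀ m ≥ n, ∫⁻ s in Set.Ioc 0 T, gagliardoSq γ (y m s - y n s) ≤ ε n) :
    ∫⁻ s in Set.Ioc 0 T, gagliardoSq γ (u s) < ∞ ∧
    ∀ t ∈ Set.Icc 0 T, ∀ k : KSpace d,
      Tendsto (fun n => ∫ s in (0 : ℝ)..t, inner ℝ (Dop γ (y n s)) k) atTop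
        (𝓝 (∫ s in (0 : ℝ)..t, inner ℝ (Dop γ (u s)) k)) := by
  have hγ₀ := hA.γ_pos
  have hγ₁ := hA.γ_lt
  have hle := fun n => lintegral_gagliardoSq_sub_le hγ₀ hγ₁ hy h (hyε n)
  have huV : ∫⁻ s in Set.Ioc 0 T, gagliardoSq γ (u s) < ∞ := by
    have h1 := lintegral_sub_lt_top (D := 2) (by simp) (gagliardoSq_sub_le hA)
      (measurable_gagliardoSq hγ₀ hγ₁) (T := T) (u := fun s => u s - y 0 s)
      (v := fun s => 0 - y 0 s) (hu.sub (hy 0)) ((hle 0).trans_lt (hεt 0))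
      (lintegral_sub_lt_top (D := 2) (by simp) (gagliardoSq_sub_le hA)
        (measurable_gagliardoSq hγ₀ hγ₁) continuous_const
        (lintegral_const_lt_top (memV_zero hγ₀ hγ₁).1) (hyV 0))
    simpa using h1
  refine ⟨huV, fun t ht k => ?_⟩
  have h0 : (0 : ℝ) ∈ Set.Icc 0 T := ⟨le_rfl, ht.1.trans ht.2⟩
  rw [tendsto_iff_enorm_sub_tendsto_zero]
  set c := ENNReal.ofReal (fracConst d γ / 2) with hc
  have bound : ∀ n, ∀ η > 0, ‖(∫ s in (0 : ℝ)..t, inner ℝ (Dop γ (y n s)) k) -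
      ∫ s in (0 : ℝ)..t, inner ℝ (Dop γ (u s)) k‖ₑ ≤
      ENNReal.ofReal η * (‖k‖ₑ ^ 2 * ENNReal.ofReal T) + ENNReal.ofReal η⁻¹ * (c * ε n) := by
    intro n η hη
    rw [← intervalIntegral.integral_sub
      (intervalIntegrable_of_integrableOn (integrableOn_inner_Dop hA (hy n) (hyV n) k) h0 ht)
      (intervalIntegrable_of_integrableOn (integrableOn_inner_Dop hA hu huV k) h0 ht),
      intervalIntegral.integral_of_le ht.1]
    refine (enorm_integral_le_lintegral_enorm _).trans
      ((lintegral_mono_set (Set.Ioc_subset_Ioc_right ht.2)).trans ?_)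
    have h3 : ∫⁻ s in Set.Ioc 0 T, ‖(inner ℝ (Dop γ (y n s)) k - inner ℝ (Dop γ (u s)) k : ℝ)‖ₑ ≤
        ∫⁻ s in Set.Ioc 0 T, (ENNReal.ofReal η * ‖k‖ₑ ^ 2 +
          ENNReal.ofReal η⁻¹ * (c * gagliardoSq γ (u s - y n s))) := by
      refine lintegral_mono_ae ?_
      filter_upwards [ae_memV hγ₀ hγ₁ hu huV, ae_memV hγ₀ hγ₁ (hy n) (hyV n)] with s h4 h5
      obtain ⟨h6, h7⟩ := memV_sub hγ₀ hγ₁ h4 h5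
      rw [gagliardoSq_eq hγ₀ hγ₁ h6, ← inner_sub_left, ← neg_sub, ← h7, inner_neg_left, enorm_neg,
        real_inner_comm]
      exact enorm_inner_le_scaled _ _ hη
    refine h3.trans ?_
    rw [lintegral_add_left measurable_const, lintegral_const_mul' _ _ ENNReal.ofReal_ne_top,
      lintegral_const_mul' _ _ ENNReal.ofReal_ne_top, lintegral_const,
      Measure.restrict_apply_univ, Real.volume_Ioc, sub_zero,
      lintegral_const_mul' _ _ (by simp [hc])]
    gcongr
    exact hle n
  rw [ENNReal.tendsto_nhds_zero]
  intro r hr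
  rcases eq_or_ne r ∞ with rfl | hrt
  · exact Eventually.of_forall fun n => le_top
  have hfin : ‖k‖ₑ ^ 2 * ENNReal.ofReal T < ∞ := ENNReal.mul_lt_top (by simp) (by simp)
  obtain ⟨η, hη, hηr⟩ : ∃ η : ℝ, 0 < η ∧
      ENNReal.ofReal η * (‖k‖ₑ ^ 2 * ENNReal.ofReal T) ≤ r / 2 := by
    have h4 : Tendsto (fun η : ℝ => ENNReal.ofReal η * (‖k‖ₑ ^ 2 * ENNReal.ofReal T)) (𝓝[>] 0)
        (𝓝 (ENNReal.ofReal 0 * (‖k‖ₑ ^ 2 * ENNReal.ofReal T))) :=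
      ENNReal.Tendsto.mul_const
        ((ENNReal.continuous_ofReal.tendsto 0).mono_left nhdsWithin_le_nhds) (Or.inr hfin.ne)
    rw [ENNReal.ofReal_zero, zero_mul] at h4
    have h5 := (ENNReal.tendsto_nhds_zero.1 h4 (r / 2) (ENNReal.half_pos hr.ne')).and
      self_mem_nhdsWithin
    obtain ⟨η, h6, h7⟩ := h5.exists
    exact ⟨η, h7, h6⟩
  have h8 : Tendsto (fun n => ENNReal.ofReal η⁻¹ * (c * ε n)) atTop (𝓝 0) := by
    have h9 := ENNReal.Tendsto.const_mul (a := ENNReal.ofReal η⁻¹ * c) hε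
      (Or.inr (ENNReal.mul_ne_top ENNReal.ofReal_ne_top ENNReal.ofReal_ne_top))
    simpa [mul_assoc] using h9
  filter_upwards [ENNReal.tendsto_nhds_zero.1 h8 (r / 2) (ENNReal.half_pos hr.ne')] with n hn
  refine (bound n η hη).trans ((add_le_add hηr hn).trans_eq (ENNReal.add_halves r))

end FracSkeleton

namespace FracSkeleton

/-! ### The regularised equation -/

variable {d : ℕ} {O : Set (Space d)} {γ p T : ℝ} {F : ℝ → ℝ}

/-- Cauchy-Lipschitz on `[0, T]` for a globally Lipschitz right-hand side. -/
lemma exists_ode_solution {X : Type*} [NormedAddCommGroup X] [NormedSpace ℝ X] [CompleteSpace X]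
    (hT : 0 ≤ T) {B : ℝ → X → X} {K : ℝ} (hK : 0 ≤ K) (hB : Continuous fun z : ℝ × X => B z.1 z.2)
    (hL : ∀ s x y, ‖B s x - B s y‖ ≤ K * ‖x - y‖) (x₀ : X) :
    ∃ w : ℝ → X, Continuous w ∧ w 0 = x₀ ∧ ∀ t ∈ Set.Icc 0 T, HasDerivAt w (B t (w t)) t := by
  have hc : ∀ u : C(Set.Icc 0 T, X), Continuous fun s => B s (Set.IccExtend hT u s) := fun u =>
    hB.comp (continuous_id.prodMk u.continuous.Icc_extend')
  let S : C(Set.Icc 0 T, X) → C(Set.Icc 0 T, X) := fun u =>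
    ⟨fun t => x₀ + ∫ s in (0 : ℝ)..t, B s (Set.IccExtend hT u s),
      continuous_const.add ((intervalIntegral.continuous_primitive
        (fun a b => (hc u).intervalIntegrable a b) 0).comp continuous_subtype_val)⟩
  obtain ⟨u, hu⟩ := exists_fixedPoint_of_volterra hT (ℓ := fun _ => K)
    (integrableOn_const (by simp)) (fun _ => hK) S (fun u v t => by
      change ‖(x₀ + ∫ s in (0 : ℝ)..t, B s (Set.IccExtend hT u s)) -
        (x₀ + ∫ s in (0 : ℝ)..t, B s (Set.IccExtend hT v s))‖ ≤ _
      rw [add_sub_add_left_eq_sub, ← intervalIntegral.integral_sub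
        ((hc u).intervalIntegrable _ _) ((hc v).intervalIntegrable _ _)]
      refine (intervalIntegral.norm_integral_le_integral_norm t.2.1).trans ?_
      refine intervalIntegral.integral_mono_on t.2.1
        (((hc u).sub (hc v)).norm.intervalIntegrable _ _) ?_ fun s _ => hL _ _ _
      exact (continuous_const.mul
        ((u.continuous.Icc_extend'.sub v.continuous.Icc_extend').norm)).intervalIntegrable _ _)
  have hder : ∀ t, HasDerivAt (fun t => x₀ + ∫ s in (0 : ℝ)..t, B s (Set.IccExtend hT u s))
      (B t (Set.IccExtend hT u t)) t := fun t =>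
    ((hc u).integral_hasStrictDerivAt 0 t).hasDerivAt.const_add x₀
  refine ⟨_, continuous_iff_continuousAt.2 fun t => (hder t).continuousAt, by simp, fun t ht => ?_⟩
  have h1 : x₀ + ∫ s in (0 : ℝ)..t, B s (Set.IccExtend hT u s) = Set.IccExtend hT u t := by
    rw [Set.IccExtend_of_mem hT _ ht]
    exact DFunLike.congr_fun hu ⟨t, ht⟩
  have h2 := hder t
  rw [← h1] at h2
  exact h2

lemma nonpos_of_deriv_le {t c : ℝ} (ht : 0 ≤ t) {y y' : ℝ → ℝ} (h0 : y 0 ≤ 0)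
    (hy : ∀ s ∈ Set.Icc 0 t, HasDerivAt y (y' s) s) (hle : ∀ s ∈ Set.Icc 0 t, y' s ≤ -(c * y s)) :
    y t ≤ 0 := by
  have hd : ∀ s ∈ Set.Icc 0 t, HasDerivAt (fun s => Real.exp (c * s) * y s)
      (Real.exp (c * s) * (c * y s + y' s)) s := by
    intro s hs
    have h1 : HasDerivAt (fun s => Real.exp (c * s)) (Real.exp (c * s) * (c * 1)) s :=
      ((hasDerivAt_id s).const_mul c).exp
    exact (h1.mul (hy s hs)).congr_deriv (by ring)
  have hanti : AntitoneOn (fun s => Real.exp (c * s) * y s) (Set.Icc 0 t) := by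
    refine antitoneOn_of_deriv_nonpos (convex_Icc 0 t)
      (fun s hs => (hd s hs).continuousAt.continuousWithinAt) ?_ ?_
    · intro s hs
      rw [interior_Icc] at hs
      exact (hd s (Set.Ioo_subset_Icc_self hs)).differentiableAt.differentiableWithinAt
    · intro s hs
      rw [interior_Icc] at hs
      rw [(hd s (Set.Ioo_subset_Icc_self hs)).deriv]
      refine mul_nonpos_of_nonneg_of_nonpos (Real.exp_pos _).le ?_
      have := hle s (Set.Ioo_subset_Icc_self hs)
      linarith
  have h1 := hanti ⟨le_rfl, ht⟩ ⟨ht, le_rfl⟩ ht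
  simp only [mul_zero, Real.exp_zero, one_mul] at h1
  have h2 := Real.exp_pos (c * t)
  by_contra hn
  push Not at hn
  have := mul_pos h2 hn
  linarith

/-- Half-spaces are invariant for `w' = c (Φ(s) - w)` if `Φ` takes its values in them. -/
lemma inner_le_of_relaxation {X : Type*} [NormedAddCommGroup X] [InnerProductSpace ℝ X]
    {c t m : ℝ} (ht : 0 ≤ t) (hc : 0 ≤ c) {w Φ : ℝ → X} {e : X} (h0 : inner ℝ (w 0) e ≤ m)
    (hΦ : ∀ s ∈ Set.Icc 0 t, inner ℝ (Φ s) e ≤ m)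
    (hw : ∀ s ∈ Set.Icc 0 t, HasDerivAt w (c • (Φ s - w s)) s) : inner ℝ (w t) e ≤ m := by
  have h1 : inner ℝ (w t) e - m ≤ 0 := by
    refine nonpos_of_deriv_le (c := c) ht (y := fun s => inner ℝ (w s) e - m)
      (y' := fun s => inner ℝ (c • (Φ s - w s)) e) (sub_nonpos.2 h0) (fun s hs => ?_)
      fun s hs => ?_
    · have := (hw s hs).inner ℝ (hasDerivAt_const s e)
      simp only [inner_zero_right, zero_add] at this
      exact this.sub_const m
    · have h2 := hΦ s hs
      rw [real_inner_smul_left, inner_sub_left]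
      nlinarith
  linarith

section
variable (hO : MeasurableSet O) (hOf : volume O < ∞)
include hO hOf

lemma inner_le_inner_clamp {R : ℝ} (hR : 0 ≤ R) (x : HSpace O) {v : HSpace O} (hv : BddBy R v) :
    inner ℝ v (x - nem (clampFn R) x) ≤ inner ℝ (nem (clampFn R) x) (x - nem (clampFn R) x) := by
  rw [inner_eq_integral, inner_eq_integral]
  refine integral_mono_ae (integrable_rep_mul _ _) (integrable_rep_mul _ _) ?_
  filter_upwards [rep_sub x (nem (clampFn R) x), rep_clamp hO hOf hR x, hv] with z h1 h2 h3
  rw [h1, h2]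
  rw [abs_le] at h3
  unfold clampFn
  rcases le_total (rep x z) R with h | h
  · rw [min_eq_left h]
    rcases le_total (-R) (rep x z) with h' | h'
    · rw [max_eq_right h', sub_self, mul_zero, mul_zero]
    · rw [max_eq_left h']
      nlinarith
  · rw [min_eq_right h, max_eq_right (by linarith)]
    nlinarith

/-- The set `{|u| ≤ R}` is invariant for `w' = c (Φ(s, w) - w)` if `Φ` takes its values in it. -/
lemma bddBy_of_relaxation {R c : ℝ} (hR : 0 ≤ R) (hc : 0 ≤ c) {w : ℝ → HSpace O}
    {Φ : ℝ → HSpace O}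
    (h0 : BddBy R (w 0)) (hΦ : ∀ s ∈ Set.Icc 0 T, BddBy R (Φ s))
    (hw : ∀ t ∈ Set.Icc 0 T, HasDerivAt w (c • (Φ t - w t)) t) {t : ℝ} (ht : t ∈ Set.Icc 0 T) :
    BddBy R (w t) := by
  have hle := fun {v : HSpace O} (hv : BddBy R v) => inner_le_inner_clamp hO hOf hR (w t) hv
  have h1 := inner_le_of_relaxation ht.1 hc (hle h0)
    (fun s hs => hle (hΦ s ⟨hs.1, hs.2.trans ht.2⟩)) fun s hs => hw s ⟨hs.1, hs.2.trans ht.2⟩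
  rw [← sub_nonpos, ← inner_sub_left, real_inner_self_eq_norm_sq] at h1
  have h2 : w t - nem (clampFn R) (w t) = 0 := by
    have : ‖w t - nem (clampFn R) (w t)‖ = 0 := by
      nlinarith [norm_nonneg (w t - nem (clampFn R) (w t))]
    exact norm_eq_zero.1 this
  rw [sub_eq_zero] at h2
  rw [h2]
  exact bddBy_clamp hO hOf hR _

end

lemma CondF.exists_barrier (hp : 1 < p) (hF : CondF p F) (R M : ℝ) :
    ∃ R', R ≤ R' ∧ 0 ≤ R' ∧ M ≤ F R' ∧ F (-R') ≤ -M := by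
  obtain ⟨k₂, hk₂, k₃, hk₃, h⟩ := hF.2.2.1
  set R' := max R (max 1 ((|M| + k₂) / k₃)) with hR'
  have h1 : R ≤ R' := le_max_left _ _
  have h2 : 1 ≤ R' := (le_max_left _ _).trans (le_max_right _ _)
  have h3 : (|M| + k₂) / k₃ ≤ R' := (le_max_right _ _).trans (le_max_right _ _)
  have h0 : 0 < R' := by linarith
  rw [div_le_iff₀ hk₃] at h3
  have h4 : R' * R' ≤ R' ^ (p + 1) := by
    have : R' ^ (2 : ℝ) ≤ R' ^ (p + 1) := Real.rpow_le_rpow_of_exponent_le h2 (by linarith)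
    rwa [Real.rpow_two, sq] at this
  have h5 := h R'
  have h6 := h (-R')
  rw [abs_neg] at h6
  rw [abs_of_pos h0] at h5 h6
  have h7 : R' * |M| ≤ -k₂ + k₃ * R' ^ (p + 1) := by nlinarith [mul_le_mul_of_nonneg_left h4 hk₃.le]
  refine ⟨R', h1, h0.le, ?_, ?_⟩
  · have : |M| ≤ F R' := le_of_mul_le_mul_left (h7.trans h5) h0
    exact (le_abs_self M).trans this
  · have : |M| ≤ -F (-R') := le_of_mul_le_mul_left ((h7.trans h6).trans_eq (by ring)) h0
    linarith [le_abs_self M]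

lemma abs_linear_sub_le {R M c : ℝ} (hR : 0 ≤ R) {L : ℝ≥0}
    (hL : LipschitzWith L fun r => F (clampFn R r)) (hc : (L : ℝ) ≤ c)
    (h1 : M ≤ F R) (h2 : F (-R) ≤ -M) {r f : ℝ} (hr : |r| ≤ R) (hf : |f| ≤ M) :
    |c * r - F r + f| ≤ c * R := by
  rw [abs_le] at hr hf
  have key : ∀ a b : ℝ, |a| ≤ R → |b| ≤ R → a ≤ b → F b - F a ≤ c * (b - a) := by
    intro a b ha hb hab
    have h3 := hL.dist_le_mul b a
    rw [clampFn_of_abs_le ha, clampFn_of_abs_le hb, Real.dist_eq, Real.dist_eq,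
      abs_of_nonneg (sub_nonneg.2 hab)] at h3
    exact (le_abs_self _).trans (h3.trans (mul_le_mul_of_nonneg_right hc (sub_nonneg.2 hab)))
  have h3 := key r R (abs_le.2 hr) (abs_of_nonneg hR).le hr.2
  have h4 := key (-R) r (by rw [abs_neg, abs_of_nonneg hR]) (abs_le.2 hr) hr.1
  rw [abs_le]
  constructor <;> nlinarith

/-- The Yosida approximation of the equation has a solution, bounded by `R` if `R` is a barrier. -/
theorem exists_yosida_solution (hA : Ambient O γ p F) (hT : 0 ≤ T) {R M l : ℝ} (hR : 0 ≤ R)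
    (hl : 0 < l) {u₀ : HSpace O} (hu₀ : BddBy R u₀) {f : ℝ → HSpace O} (hf : Continuous f)
    (hfM : ∀ s, BddBy M (f s)) (h1 : M ≤ F R) (h2 : F (-R) ≤ -M) {J : HSpace O →L[ℝ] HSpace O}
    (hJ : ∀ f, MemV γ (J f))
    (hJ' : ∀ f v, MemV γ v → inner ℝ (f - J f) v = l * inner ℝ (Dop γ (J f)) (Dop γ v)) :
    ∃ w : ℝ → HSpace O, Continuous w ∧ w 0 = u₀ ∧ ∀ t ∈ Set.Icc 0 T, BddBy R (w t) ∧
      HasDerivAt w (f t - l⁻¹ • (w t - J (w t)) - nem (fun r => F (clampFn R r)) (w t)) t := by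
  have hO := hA.isOpen.measurableSet
  have hOf := hA.finite
  obtain ⟨L, hL⟩ := hA.condF.lipschitz_clamp hR
  set P : HSpace O → HSpace O := nem (clampFn R) with hP
  set N : HSpace O → HSpace O := nem (fun r => F (clampFn R r)) with hN
  have hPl : LipschitzWith 1 P := lipschitz_nem hO hOf (lipschitz_clampFn R)
  have hNl : LipschitzWith L N := lipschitz_nem hO hOf hL
  set c : ℝ := l⁻¹ + L with hc
  have hc0 : 0 < c := by positivity
  have hJn : 0 ≤ ‖J‖ := norm_nonneg J
  obtain ⟨w, hwc, hw0, hw⟩ := exists_ode_solution (X := HSpace O) hT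
    (B := fun s x => f s + l⁻¹ • J (P x) + (L : ℝ) • P x - N x - c • x)
    (K := l⁻¹ * ‖J‖ + L + L + c) (by positivity)
    (by
      have e1 : Continuous fun z : ℝ × HSpace O => P z.2 := hPl.continuous.comp continuous_snd
      have e2 : Continuous fun z : ℝ × HSpace O => N z.2 := hNl.continuous.comp continuous_snd
      have e3 : Continuous fun z : ℝ × HSpace O => J (P z.2) := J.continuous.comp e1
      have e4 : Continuous fun z : ℝ × HSpace O => f z.1 := hf.comp continuous_fst
      exact (((e4.add (e3.const_smul l⁻¹)).add (e1.const_smul (L : ℝ))).sub e2).sub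
        (continuous_snd.const_smul c))
    (fun s x y => by
      have e1 : ‖P x - P y‖ ≤ ‖x - y‖ := by simpa [dist_eq_norm] using hPl.dist_le_mul x y
      have e2 : ‖N x - N y‖ ≤ L * ‖x - y‖ := by simpa [dist_eq_norm] using hNl.dist_le_mul x y
      have e3 : ‖J (P x - P y)‖ ≤ ‖J‖ * ‖x - y‖ :=
        (J.le_opNorm _).trans (mul_le_mul_of_nonneg_left e1 hJn)
      have e4 : f s + l⁻¹ • J (P x) + (L : ℝ) • P x - N x - c • x -
          (f s + l⁻¹ • J (P y) + (L : ℝ) • P y - N y - c • y) =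
          l⁻¹ • J (P x - P y) + (L : ℝ) • (P x - P y) - (N x - N y) - c • (x - y) := by
        rw [map_sub]
        module
      rw [e4]
      refine (norm_sub_le _ _).trans ((add_le_add_left ((norm_sub_le _ _).trans
        (add_le_add_left (norm_add_le _ _) _)) _).trans ?_)
      rw [norm_smul, norm_smul, norm_smul, Real.norm_of_nonneg (by positivity : 0 ≤ l⁻¹),
        Real.norm_of_nonneg L.coe_nonneg, Real.norm_of_nonneg hc0.le]
      have e5 := mul_le_mul_of_nonneg_left e3 (by positivity : 0 ≤ l⁻¹)
      have e6 := mul_le_mul_of_nonneg_left e1 L.coe_nonneg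
      nlinarith) u₀
  have hbdd : ∀ t ∈ Set.Icc 0 T, BddBy R (w t) := by
    intro t ht
    refine bddBy_of_relaxation (T := T) hO hOf hR hc0.le
      (Φ := fun s => c⁻¹ • (f s + l⁻¹ • J (P (w s)) + (L : ℝ) • P (w s) - N (w s)))
      (by rwa [hw0]) (fun s hs => ?_) (fun s hs => ?_) ht
    · have hPb : BddBy R (P (w s)) := bddBy_clamp hO hOf hR _
      have hJb : BddBy R (J (P (w s))) :=
        bddBy_resolvent hO hOf hA.γ_pos hA.γ_lt hR hl (hJ _) (hJ' _) hPb
      have r1 := rep_smul c⁻¹ (f s + l⁻¹ • J (P (w s)) + (L : ℝ) • P (w s) - N (w s))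
      have r2 := rep_sub (f s + l⁻¹ • J (P (w s)) + (L : ℝ) • P (w s)) (N (w s))
      have r3 := rep_add (f s + l⁻¹ • J (P (w s))) ((L : ℝ) • P (w s))
      have r4 := rep_add (f s) (l⁻¹ • J (P (w s)))
      have r5 := rep_smul l⁻¹ (J (P (w s)))
      have r6 := rep_smul (L : ℝ) (P (w s))
      filter_upwards [r1, r2, r3, r4, r5, r6, rep_nem hO hOf hL (w s), rep_clamp hO hOf hR (w s),
        hPb, hJb, hfM s, rep_eq_zero (f s), rep_eq_zero (J (P (w s))),
        rep_eq_zero (P (w s))] with x r1 r2 r3 r4 r5 r6 r7 r8 b1 b2 b3 z1 z2 z3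
      rw [r1, r2, r3, r4, r5, r6, r7]
      by_cases hx : x ∈ O
      · rw [Set.indicator_of_mem hx, ← r8, abs_mul, abs_of_pos (by positivity : 0 < c⁻¹),
          inv_mul_le_iff₀ hc0]
        have q1 := abs_linear_sub_le hR hL le_rfl h1 h2 b1 b3
        have q2 : |l⁻¹ * rep (J (P (w s))) x| ≤ l⁻¹ * R := by
          rw [abs_mul, abs_of_pos (by positivity : 0 < l⁻¹)]
          exact mul_le_mul_of_nonneg_left b2 (by positivity)
        have q3 : rep (f s) x + l⁻¹ * rep (J (P (w s))) x + L * rep (P (w s)) x -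
            F (rep (P (w s)) x) = l⁻¹ * rep (J (P (w s))) x +
              (L * rep (P (w s)) x - F (rep (P (w s)) x) + rep (f s) x) := by ring
        rw [q3]
        refine (abs_add_le _ _).trans ?_
        rw [hc, add_mul]
        linarith
      · rw [Set.indicator_of_notMem hx, z1 hx, z2 hx, z3 hx]
        simpa using hR
    · refine (hw s hs).congr_deriv ?_
      rw [smul_sub, smul_smul, mul_inv_cancel₀ hc0.ne', one_smul]
  refine ⟨w, hwc, hw0, fun t ht => ⟨hbdd t ht, ?_⟩⟩
  refine (hw t ht).congr_deriv ?_
  rw [hP, clamp_of_bddBy hO hOf hR (hbdd t ht), hc]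
  module

end FracSkeleton

namespace FracSkeleton

/-! ### Energy estimates for the regularised equation -/

variable {d : ℕ} {O : Set (Space d)} {γ p T : ℝ} {F : ℝ → ℝ}

section Abstract
variable {X : Type*} [NormedAddCommGroup X] [InnerProductSpace ℝ X]

lemma sub_le_of_hasDerivAt {t : ℝ} (ht : 0 ≤ t) {φ φ' ψ : ℝ → ℝ}
    (hφ : ∀ s ∈ Set.Icc 0 t, HasDerivAt φ (φ' s) s) (hφ' : Continuous φ') (hψ : Continuous ψ)
    (h : ∀ s ∈ Set.Icc 0 t, φ' s ≤ ψ s) : φ t - φ 0 ≤ ∫ s in (0 : ℝ)..t, ψ s := by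
  rw [← intervalIntegral.integral_eq_sub_of_hasDerivAt (f := φ) (f' := φ')
    (fun s hs => hφ s (by rwa [Set.uIcc_of_le ht] at hs)) (hφ'.intervalIntegrable _ _)]
  exact intervalIntegral.integral_mono_on ht (hφ'.intervalIntegrable _ _)
    (hψ.intervalIntegrable _ _) h

lemma yosida_energy {A : X →L[ℝ] X} (hA : ∀ x y, inner ℝ (A x) y = inner ℝ x (A y)) {w q : ℝ → X}
    (hw : Continuous w) (hq : Continuous q)
    (hd : ∀ t ∈ Set.Icc 0 T, HasDerivAt w (q t - A (w t)) t) {C : ℝ}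
    (hC : ∀ t ∈ Set.Icc 0 T, ‖q t‖ ≤ C) {t : ℝ} (ht : t ∈ Set.Icc 0 T) :
    inner ℝ (A (w t)) (w t) + ∫ s in (0 : ℝ)..t, ‖A (w s)‖ ^ 2 ≤
      inner ℝ (A (w 0)) (w 0) + C ^ 2 * t := by
  have hAw : Continuous fun s => A (w s) := A.continuous.comp hw
  have h1 := sub_le_of_hasDerivAt ht.1 (φ := fun s => inner ℝ (A (w s)) (w s))
    (φ' := fun s => inner ℝ (A (w s)) (q s - A (w s)) + inner ℝ (A (q s - A (w s))) (w s))
    (ψ := fun s => C ^ 2 - ‖A (w s)‖ ^ 2)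
    (fun s hs => by
      have h2 := hd s ⟨hs.1, hs.2.trans ht.2⟩
      exact (A.hasFDerivAt.comp_hasDerivAt s h2).inner ℝ h2)
    (by fun_prop) (by fun_prop)
    (fun s hs => by
      have h2 := hC s ⟨hs.1, hs.2.trans ht.2⟩
      have h3 := real_inner_le_norm (A (w s)) (q s)
      have h6 : inner ℝ (A (q s - A (w s))) (w s) = inner ℝ (A (w s)) (q s - A (w s)) := by
        rw [hA, real_inner_comm]
      rw [h6, inner_sub_right, real_inner_self_eq_norm_sq]
      have h5 := norm_nonneg (q s)
      have h4 : ‖q s‖ ^ 2 ≤ C ^ 2 := pow_le_pow_left₀ h5 h2 2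
      nlinarith [sq_nonneg (‖A (w s)‖ - ‖q s‖)])
  have hAc : Continuous fun s => ‖A (w s)‖ ^ 2 := hAw.norm.pow 2
  rw [intervalIntegral.integral_sub (by simp) (hAc.intervalIntegrable _ _), intervalIntegral.integral_const, smul_eq_mul,
    sub_zero] at h1
  linarith

lemma yosida_difference {A₁ A₂ : X →L[ℝ] X} {l₁ l₂ : ℝ} (hl₁ : 0 ≤ l₁) (hl₂ : 0 ≤ l₂)
    {w₁ w₂ q₁ q₂ : ℝ → X} (hw₁ : Continuous w₁) (hw₂ : Continuous w₂) (hq₁ : Continuous q₁)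
    (hq₂ : Continuous q₂) (h0 : w₁ 0 = w₂ 0) (hT : 0 ≤ T)
    (hd₁ : ∀ t ∈ Set.Icc 0 T, HasDerivAt w₁ (q₁ t - A₁ (w₁ t)) t)
    (hd₂ : ∀ t ∈ Set.Icc 0 T, HasDerivAt w₂ (q₂ t - A₂ (w₂ t)) t) {L : ℝ} (hL0 : 0 ≤ L)
    (hL : ∀ t ∈ Set.Icc 0 T, ‖q₁ t - q₂ t‖ ≤ L * ‖w₁ t - w₂ t‖)
    (hpos : ∀ s, 0 ≤ inner ℝ (A₁ (w₁ s) - A₂ (w₂ s))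
      ((w₁ s - l₁ • A₁ (w₁ s)) - (w₂ s - l₂ • A₂ (w₂ s)))) {Q : ℝ}
    (hQ₁ : ∫ s in (0 : ℝ)..T, ‖A₁ (w₁ s)‖ ^ 2 ≤ Q) (hQ₂ : ∫ s in (0 : ℝ)..T, ‖A₂ (w₂ s)‖ ^ 2 ≤ Q)
    {N : ℕ} (hN : T * (2 * L) ≤ N / 2) {t : ℝ} (ht : t ∈ Set.Icc 0 T) :
    ‖w₁ t - w₂ t‖ ^ 2 ≤ 2 ^ N * (2 * (l₁ + l₂) * Q) ∧
      2 * ∫ s in (0 : ℝ)..t, inner ℝ (A₁ (w₁ s) - A₂ (w₂ s))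
        ((w₁ s - l₁ • A₁ (w₁ s)) - (w₂ s - l₂ • A₂ (w₂ s))) ≤ 2 ^ N * (2 * (l₁ + l₂) * Q) := by
  set G : ℝ → ℝ := fun s => inner ℝ (A₁ (w₁ s) - A₂ (w₂ s))
      ((w₁ s - l₁ • A₁ (w₁ s)) - (w₂ s - l₂ • A₂ (w₂ s))) with hG
  set a : ℝ → X := fun s => A₁ (w₁ s) with ha
  set b : ℝ → X := fun s => A₂ (w₂ s) with hb
  have hac : Continuous a := A₁.continuous.comp hw₁
  have hbc : Continuous b := A₂.continuous.comp hw₂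
  have hGc : Continuous G := by fun_prop
  have hwc : Continuous fun s => w₁ s - w₂ s := hw₁.sub hw₂
  have hQ : 0 ≤ Q := le_trans (intervalIntegral.integral_nonneg hT fun s _ => by positivity) hQ₁
  have hA0 : 0 ≤ 2 * (l₁ + l₂) * Q := by positivity
  have key : ∀ t ∈ Set.Icc 0 T, ‖w₁ t - w₂ t‖ ^ 2 + 2 * ∫ s in (0 : ℝ)..t, G s ≤
      2 * (l₁ + l₂) * Q + ∫ s in (0 : ℝ)..t, 2 * L * ‖w₁ s - w₂ s‖ ^ 2 := by
    intro t ht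
    have c1 : Continuous fun s => 2 * L * ‖w₁ s - w₂ s‖ ^ 2 := by fun_prop
    have c2 : Continuous fun s => (l₁ + l₂) * ‖a s‖ ^ 2 := by fun_prop
    have c3 : Continuous fun s => (l₁ + l₂) * ‖b s‖ ^ 2 := by fun_prop
    have c4 : Continuous fun s => 2 * G s := by fun_prop
    have c5 : Continuous fun s => 2 * L * ‖w₁ s - w₂ s‖ ^ 2 + (l₁ + l₂) * ‖a s‖ ^ 2 := c1.add c2
    have c6 : Continuous fun s => 2 * L * ‖w₁ s - w₂ s‖ ^ 2 + (l₁ + l₂) * ‖a s‖ ^ 2 +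
      (l₁ + l₂) * ‖b s‖ ^ 2 := c5.add c3
    have h1 := sub_le_of_hasDerivAt ht.1 (φ := fun s => inner ℝ (w₁ s - w₂ s) (w₁ s - w₂ s))
      (φ' := fun s => inner ℝ (w₁ s - w₂ s) ((q₁ s - a s) - (q₂ s - b s)) +
        inner ℝ ((q₁ s - a s) - (q₂ s - b s)) (w₁ s - w₂ s))
      (ψ := fun s => 2 * L * ‖w₁ s - w₂ s‖ ^ 2 + (l₁ + l₂) * ‖a s‖ ^ 2 + (l₁ + l₂) * ‖b s‖ ^ 2 -
        2 * G s)
      (fun s hs => by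
        have h2 := (hd₁ s ⟨hs.1, hs.2.trans ht.2⟩).sub (hd₂ s ⟨hs.1, hs.2.trans ht.2⟩)
        exact h2.inner ℝ h2)
      (by fun_prop) (c6.sub c4)
      (fun s hs => by
        have h2 := hL s ⟨hs.1, hs.2.trans ht.2⟩
        have h3 := real_inner_le_norm (q₁ s - q₂ s) (w₁ s - w₂ s)
        have h4 : inner ℝ (q₁ s - q₂ s) (w₁ s - w₂ s) ≤ L * ‖w₁ s - w₂ s‖ ^ 2 := by
          nlinarith [norm_nonneg (w₁ s - w₂ s)]
        have h5 : inner ℝ (a s - b s) (w₁ s - w₂ s) =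
            G s + inner ℝ (a s - b s) (l₁ • a s - l₂ • b s) := by
          rw [hG, ← inner_add_right]
          congr 1
          abel
        have h6 : inner ℝ (a s - b s) (l₁ • a s - l₂ • b s) =
            l₁ * ‖a s‖ ^ 2 + l₂ * ‖b s‖ ^ 2 - (l₁ + l₂) * inner ℝ (a s) (b s) := by
          simp only [inner_sub_left, inner_sub_right, real_inner_smul_right,
            real_inner_self_eq_norm_sq, real_inner_comm (a s) (b s)]
          ring
        have h7 : inner ℝ (a s) (b s) ≤ (‖a s‖ ^ 2 + ‖b s‖ ^ 2) / 2 := by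
          have := real_inner_le_norm (a s) (b s)
          nlinarith [sq_nonneg (‖a s‖ - ‖b s‖)]
        have h8 := mul_le_mul_of_nonneg_left h7 (add_nonneg hl₁ hl₂)
        have h9 : (q₁ s - a s) - (q₂ s - b s) = (q₁ s - q₂ s) - (a s - b s) := by abel
        rw [h9, real_inner_comm, ← two_mul, inner_sub_left]
        have h10 : 0 ≤ l₁ * ‖a s‖ ^ 2 := by positivity
        have h11 : 0 ≤ l₂ * ‖b s‖ ^ 2 := by positivity
        nlinarith)
    rw [intervalIntegral.integral_sub (c6.intervalIntegrable _ _)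
        (c4.intervalIntegrable _ _),
      intervalIntegral.integral_add (c5.intervalIntegrable _ _)
        (c3.intervalIntegrable _ _),
      intervalIntegral.integral_add (c1.intervalIntegrable _ _) (c2.intervalIntegrable _ _),
      intervalIntegral.integral_const_mul (l₁ + l₂), intervalIntegral.integral_const_mul (l₁ + l₂),
      intervalIntegral.integral_const_mul 2 G, real_inner_self_eq_norm_sq,
      real_inner_self_eq_norm_sq, h0, sub_self, norm_zero] at h1
    have mono : ∀ φ : ℝ → X, Continuous φ → ∫ s in (0 : ℝ)..t, ‖φ s‖ ^ 2 ≤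
        ∫ s in (0 : ℝ)..T, ‖φ s‖ ^ 2 := fun φ hφ =>
      intervalIntegral.integral_mono_interval le_rfl ht.1 ht.2
        (Eventually.of_forall fun s => by positivity) ((hφ.norm.pow 2).intervalIntegrable _ _)
    have h2 := mul_le_mul_of_nonneg_left ((mono a hac).trans hQ₁) (add_nonneg hl₁ hl₂)
    have h3 := mul_le_mul_of_nonneg_left ((mono b hbc).trans hQ₂) (add_nonneg hl₁ hl₂)
    linarith
  have hGi : ∀ t ∈ Set.Icc 0 T, 0 ≤ ∫ s in (0 : ℝ)..t, G s := fun t ht =>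
    intervalIntegral.integral_nonneg ht.1 fun s _ => hpos s
  have hk : IntegrableOn (fun _ : ℝ => 2 * L) (Set.Ioc 0 T) := integrableOn_const (by simp)
  have hψ : ∀ t ∈ Set.Icc 0 T, ‖w₁ t - w₂ t‖ ^ 2 ≤
      2 * (l₁ + l₂) * Q + ∫ s in (0 : ℝ)..t, 2 * L * ‖w₁ s - w₂ s‖ ^ 2 := fun t ht => by
    have h1 := key t ht
    have h2 := hGi t ht
    linarith
  have h1 := gronwall_integrable (ψ := fun s => ‖w₁ s - w₂ s‖ ^ 2) (ℓ := fun _ => 2 * L) hA0 hk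
    (fun _ => by positivity) (hwc.norm.pow 2) (fun _ => by positivity) hψ N t ht (by
      rw [intervalIntegral.integral_const, smul_eq_mul, sub_zero]
      exact (mul_le_mul_of_nonneg_right ht.2 (by positivity)).trans hN)
  refine ⟨(hψ t ht).trans h1, ?_⟩
  have h2 := key t ht
  have h3 : 0 ≤ ‖w₁ t - w₂ t‖ ^ 2 := by positivity
  linarith

/-- The solutions of the regularised equations `w' + Aₙ w + N(w) = f` converge uniformly, and so
does their dissipation. -/
theorem yosida_limit [CompleteSpace X] (hT : 0 < T) {l : ℕ → ℝ} (hl0 : ∀ n, 0 < l n)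
    (hlanti : ∀ n, ∀ m ≥ n, l m ≤ l n) (hlt : Tendsto l atTop (𝓝 0)) {A : ℕ → X →L[ℝ] X}
    (hsymm : ∀ n x y, inner ℝ (A n x) y = inner ℝ x (A n y))
    (hself : ∀ n x, l n * ‖A n x‖ ^ 2 ≤ inner ℝ (A n x) x)
    (hdis : ∀ m n x y, 0 ≤ inner ℝ (A m x - A n y) ((x - l m • A m x) - (y - l n • A n y)))
    {N : X → X} {L : ℝ≥0} (hN : LipschitzWith L N) {f : ℝ → X} (hf : Continuous f)
    {w : ℕ → ℝ → X} (hwc : ∀ n, Continuous (w n)) {u₀ : X} (hw0 : ∀ n, w n 0 = u₀)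
    (hwd : ∀ n, ∀ t ∈ Set.Icc 0 T, HasDerivAt (w n) (f t - N (w n t) - A n (w n t)) t) {C E : ℝ}
    (hC : ∀ n, ∀ t ∈ Set.Icc 0 T, ‖f t - N (w n t)‖ ≤ C) (hE : ∀ n, inner ℝ (A n u₀) u₀ ≤ E) :
    ∃ (u : ℝ → X) (Q D : ℝ), Continuous u ∧ 0 ≤ D ∧
      (∀ n, ∀ t ∈ Set.Icc 0 T, inner ℝ (A n (w n t)) (w n t) ≤ Q) ∧
      (∀ t ∈ Set.Icc 0 T, Tendsto (fun n => w n t) atTop (𝓝 (u t))) ∧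
      (∀ t ∈ Set.Icc 0 T, Tendsto (fun n => w n t - l n • A n (w n t)) atTop (𝓝 (u t))) ∧
      (∀ m n, Continuous fun s => (inner ℝ (A m (w m s) - A n (w n s))
        ((w m s - l m • A m (w m s)) - (w n s - l n • A n (w n s))) : ℝ)) ∧
      ∀ n, ∀ m ≥ n, ∫ s in (0 : ℝ)..T, inner ℝ (A m (w m s) - A n (w n s))
        ((w m s - l m • A m (w m s)) - (w n s - l n • A n (w n s))) ≤ D * l n := by
  have hNle : ∀ x y, ‖N x - N y‖ ≤ L * ‖x - y‖ := fun x y => by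
    simpa [dist_eq_norm] using hN.dist_le_mul x y
  have hqc : ∀ n, Continuous fun s => f s - N (w n s) := fun n =>
    hf.sub (hN.continuous.comp (hwc n))
  set Q : ℝ := |E| + C ^ 2 * T with hQ
  have hQ0 : 0 ≤ Q := by positivity
  have hAi : ∀ n, ∀ t ∈ Set.Icc 0 T, 0 ≤ ∫ s in (0 : ℝ)..t, ‖A n (w n s)‖ ^ 2 := fun n t ht =>
    intervalIntegral.integral_nonneg ht.1 fun s _ => by positivity
  have hen : ∀ n, ∀ t ∈ Set.Icc 0 T, inner ℝ (A n (w n t)) (w n t) +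
      ∫ s in (0 : ℝ)..t, ‖A n (w n s)‖ ^ 2 ≤ Q := by
    intro n t ht
    have h1 := yosida_energy (hsymm n) (hwc n) (hqc n) (hwd n) (hC n) ht
    have h2 := (hE n).trans (le_abs_self E)
    rw [hw0 n] at h1
    have h4 : C ^ 2 * t ≤ C ^ 2 * T := mul_le_mul_of_nonneg_left ht.2 (by positivity)
    linarith
  have hTm : T ∈ Set.Icc 0 T := ⟨hT.le, le_rfl⟩
  have hnn : ∀ n x, 0 ≤ inner ℝ (A n x) x := fun n x =>
    (mul_nonneg (hl0 n).le (sq_nonneg _)).trans (hself n x)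
  have hQi : ∀ n, ∫ s in (0 : ℝ)..T, ‖A n (w n s)‖ ^ 2 ≤ Q := fun n => by
    have h1 := hen n T hTm
    have h2 := hnn n (w n T)
    linarith
  have hQu : ∀ n, ∀ t ∈ Set.Icc 0 T, inner ℝ (A n (w n t)) (w n t) ≤ Q := fun n t ht => by
    have h1 := hen n t ht
    have h2 := hAi n t ht
    linarith
  obtain ⟨K, hK⟩ := exists_nat_ge (2 * (T * (2 * (L : ℝ))))
  set D : ℝ := 2 ^ K * (4 * Q) with hD
  have hD0 : 0 ≤ D := by positivity
  have hdn : ∀ n, ∀ m ≥ n, 2 ^ K * (2 * (l m + l n) * Q) ≤ D * l n := by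
    intro n m hnm
    have h1 := hlanti n m hnm
    have h2 : 2 * (l m + l n) * Q ≤ 4 * Q * l n := by nlinarith
    calc _ ≤ 2 ^ K * (4 * Q * l n) := mul_le_mul_of_nonneg_left h2 (by positivity)
      _ = _ := by ring
  have hdiff : ∀ n, ∀ m ≥ n, ∀ t ∈ Set.Icc 0 T, ‖w m t - w n t‖ ^ 2 ≤ D * l n ∧
      2 * ∫ s in (0 : ℝ)..t, inner ℝ (A m (w m s) - A n (w n s))
        ((w m s - l m • A m (w m s)) - (w n s - l n • A n (w n s))) ≤ D * l n := by
    intro n m hnm t ht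
    have h1 := yosida_difference (hl0 m).le (hl0 n).le (hwc m) (hwc n) (hqc m) (hqc n)
      ((hw0 m).trans (hw0 n).symm) hT.le (hwd m) (hwd n) L.coe_nonneg (fun s _ => by
        rw [sub_sub_sub_cancel_left, norm_sub_rev]
        exact hNle _ _) (fun s => hdis _ _ _ _) (hQi m) (hQi n) (N := K)
        (by linarith) ht
    exact ⟨h1.1.trans (hdn n m hnm), h1.2.trans (hdn n m hnm)⟩
  have hDl : Tendsto (fun n => D * l n) atTop (𝓝 0) := by simpa using hlt.const_mul D
  let W : ℕ → C(Set.Icc 0 T, X) := fun n => ⟨fun t => w n t, (hwc n).comp continuous_subtype_val⟩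
  have hWc : CauchySeq W := by
    refine cauchySeq_of_le_tendsto_0' (fun n => √(D * l n)) (fun n m hnm => ?_) ?_
    · rw [dist_comm]
      refine (ContinuousMap.dist_le (Real.sqrt_nonneg _)).2 fun t => ?_
      rw [dist_eq_norm]
      exact Real.le_sqrt_of_sq_le (hdiff n m hnm t t.2).1
    · simpa using hDl.sqrt
  obtain ⟨Wl, hWl⟩ := cauchySeq_tendsto_of_complete hWc
  have hwu : ∀ s ∈ Set.Icc 0 T, Tendsto (fun n => w n s) atTop (𝓝 (Set.IccExtend hT.le Wl s)) := by
    intro s hs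
    rw [Set.IccExtend_of_mem hT.le _ hs]
    exact ((continuous_eval_const (⟨s, hs⟩ : Set.Icc 0 T)).tendsto Wl).comp hWl
  refine ⟨Set.IccExtend hT.le Wl, Q, D, Wl.continuous.Icc_extend', hD0, hQu, hwu, fun s hs => ?_,
    fun m n => ?_, fun n m hnm => ?_⟩
  · have h1 : Tendsto (fun n => l n • A n (w n s)) atTop (𝓝 0) := by
      rw [tendsto_zero_iff_norm_tendsto_zero]
      refine squeeze_zero (g := fun n => √(Q * l n)) (fun n => norm_nonneg _) (fun n => ?_) ?_
      · refine Real.le_sqrt_of_sq_le ?_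
        rw [norm_smul, Real.norm_of_nonneg (hl0 n).le, mul_pow, sq (l n), mul_assoc, mul_comm]
        exact mul_le_mul_of_nonneg_right ((hself n _).trans (hQu n s hs)) (hl0 n).le
      · have : Tendsto (fun n => Q * l n) atTop (𝓝 0) := by simpa using hlt.const_mul Q
        simpa using this.sqrt
    simpa using (hwu s hs).sub h1
  · have h1 := hwc m
    have h2 := hwc n
    fun_prop
  · have h2 := (hdiff n m hnm T hTm).2
    have h3 : 0 ≤ ∫ s in (0 : ℝ)..T, inner ℝ (A m (w m s) - A n (w n s))
        ((w m s - l m • A m (w m s)) - (w n s - l n • A n (w n s))) :=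
      intervalIntegral.integral_nonneg hT.le fun s _ => hdis _ _ _ _
    linarith

end Abstract

end FracSkeleton

namespace FracSkeleton

/-! ### Existence for regular data -/

variable {d : ℕ} {O : Set (Space d)} {γ p T : ℝ} {F : ℝ → ℝ}

/-! Scalar multiplication on `ℍ` reaches `inner` through two instance paths, which `rw` does not
identify; these restatements fix one of them. -/

lemma inner_smul_left_hSpace (c : ℝ) (x y : HSpace O) : inner ℝ (c • x) y = c * inner ℝ x y :=
  real_inner_smul_left x y c

lemma inner_smul_right_hSpace (c : ℝ) (x y : HSpace O) : inner ℝ x (c • y) = c * inner ℝ x y :=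
  real_inner_smul_right x y c

section Resolvent

variable {l : ℝ} (hl : 0 < l) {J : HSpace O →L[ℝ] HSpace O}
  (hJ : ∀ f, MemV γ (J f))
  (hJ' : ∀ f v, MemV γ v → inner ℝ (f - J f) v = l * inner ℝ (Dop γ (J f)) (Dop γ v))
include hl hJ hJ'

lemma inner_yosida_right (x : HSpace O) {v : HSpace O} (hv : MemV γ v) :
    inner ℝ ((l⁻¹ • (ContinuousLinearMap.id ℝ (HSpace O) - J)) x) v =
      inner ℝ (Dop γ (J x)) (Dop γ v) := by
  have h1 : (l⁻¹ • (ContinuousLinearMap.id ℝ (HSpace O) - J)) x = l⁻¹ • (x - J x) := rfl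
  rw [h1, inner_smul_left_hSpace, hJ' x v hv, ← mul_assoc, inv_mul_cancel₀ hl.ne', one_mul]

omit hJ hJ' in
lemma sub_smul_yosida (x : HSpace O) :
    x - l • (l⁻¹ • (ContinuousLinearMap.id ℝ (HSpace O) - J)) x = J x := by
  have h1 : (l⁻¹ • (ContinuousLinearMap.id ℝ (HSpace O) - J)) x = l⁻¹ • (x - J x) := rfl
  rw [h1, smul_smul, mul_inv_cancel₀ hl.ne', one_smul, sub_sub_cancel]

lemma inner_yosida_self (x : HSpace O) :
    inner ℝ ((l⁻¹ • (ContinuousLinearMap.id ℝ (HSpace O) - J)) x) x = ‖Dop γ (J x)‖ ^ 2 +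
      l * ‖(l⁻¹ • (ContinuousLinearMap.id ℝ (HSpace O) - J)) x‖ ^ 2 := by
  have h2 := inner_yosida_right hl hJ hJ' x (hJ x)
  have h3 := sub_smul_yosida hl (J := J) x
  set a := (l⁻¹ • (ContinuousLinearMap.id ℝ (HSpace O) - J)) x with ha
  have h1 : x = J x + l • a := by rw [← h3]; abel
  conv_lhs => rw [h1]
  rw [inner_add_right, h2, inner_smul_right_hSpace, real_inner_self_eq_norm_sq,
    real_inner_self_eq_norm_sq]

lemma yosida_symm (x y : HSpace O) :
    inner ℝ ((l⁻¹ • (ContinuousLinearMap.id ℝ (HSpace O) - J)) x) y =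
      inner ℝ x ((l⁻¹ • (ContinuousLinearMap.id ℝ (HSpace O) - J)) y) := by
  have h1 := inner_yosida_right hl hJ hJ' x (hJ y)
  have h2 := inner_yosida_right hl hJ hJ' y (hJ x)
  have hx := sub_smul_yosida hl (J := J) x
  have hy := sub_smul_yosida hl (J := J) y
  set a := (l⁻¹ • (ContinuousLinearMap.id ℝ (HSpace O) - J)) x
  set b := (l⁻¹ • (ContinuousLinearMap.id ℝ (HSpace O) - J)) y
  have h3 : inner ℝ a (J y) = inner ℝ b (J x) := by rw [h1, h2, real_inner_comm]
  rw [← hx, ← hy, inner_sub_right, inner_sub_right, inner_smul_right_hSpace, inner_smul_right_hSpace,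
    real_inner_comm a b] at h3
  rw [real_inner_comm b x]
  linarith

lemma inner_yosida_self_le {x : HSpace O} (hx : MemV γ x) :
    inner ℝ ((l⁻¹ • (ContinuousLinearMap.id ℝ (HSpace O) - J)) x) x ≤ ‖Dop γ x‖ ^ 2 := by
  have h1 := inner_yosida_right hl hJ hJ' x hx
  have h2 := inner_yosida_self hl hJ hJ' x
  have h3 := real_inner_le_norm (Dop γ (J x)) (Dop γ x)
  have h4 : 0 ≤ l * ‖(l⁻¹ • (ContinuousLinearMap.id ℝ (HSpace O) - J)) x‖ ^ 2 := by positivity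
  nlinarith [sq_nonneg (‖Dop γ (J x)‖ - ‖Dop γ x‖)]

lemma le_inner_yosida_self (x : HSpace O) :
    l * ‖(l⁻¹ • (ContinuousLinearMap.id ℝ (HSpace O) - J)) x‖ ^ 2 ≤
      inner ℝ ((l⁻¹ • (ContinuousLinearMap.id ℝ (HSpace O) - J)) x) x := by
  rw [inner_yosida_self hl hJ hJ']
  have : 0 ≤ ‖Dop γ (J x)‖ ^ 2 := by positivity
  linarith

end Resolvent

set_option maxHeartbeats 1000000 in
theorem exists_isWeakSol_of_regular [Fact (1 < p)] (hA : Ambient O γ p F) (hT : 0 < T) {R₀ M : ℝ}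
    (hM : 0 ≤ M) {u₀ : HSpace O} (hu₀V : MemV γ u₀) (hu₀ : BddBy R₀ u₀) {f : ℝ → HSpace O}
    (hf : Continuous f) (hfM : ∀ s, BddBy M (f s)) :
    ∃ u, IsWeakSol γ p F T u₀ f u := by
  have hO := hA.isOpen.measurableSet
  have hOf := hA.finite
  have hγ₀ := hA.γ_pos
  have hγ₁ := hA.γ_lt
  obtain ⟨R, hR₀, hR, hb1, hb2⟩ := hA.condF.exists_barrier (Fact.out : 1 < p) R₀ M
  have hu₀R : BddBy R u₀ := by
    filter_upwards [hu₀] with x hx using hx.trans hR₀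
  obtain ⟨L, hL⟩ := hA.condF.lipschitz_clamp hR
  set N : HSpace O → HSpace O := nem (fun r => F (clampFn R r)) with hN
  have hNl : LipschitzWith L N := lipschitz_nem hO hOf hL
  have hNle : ∀ x y, ‖N x - N y‖ ≤ L * ‖x - y‖ := fun x y => by
    simpa [dist_eq_norm] using hNl.dist_le_mul x y
  set l : ℕ → ℝ := fun n => 1 / ((n : ℝ) + 1) with hl
  have hl0 : ∀ n, 0 < l n := fun n => by positivity
  have hlanti : ∀ n, ∀ m ≥ n, l m ≤ l n := fun n m hnm =>
    one_div_le_one_div_of_le (by positivity) (by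
      have : (n : ℝ) ≤ m := by exact_mod_cast hnm
      linarith)
  have hlt : Tendsto l atTop (𝓝 0) := tendsto_one_div_add_atTop_nhds_zero_nat
  choose J hJ hJ' using fun n => exists_resolvent (O := O) hγ₀ hγ₁ (hl0 n)
  choose w hwc hw0 hw using fun n => exists_yosida_solution hA hT.le hR (hl0 n) hu₀R hf hfM hb1 hb2
    (hJ n) (hJ' n)
  obtain ⟨A, hAdef⟩ : ∃ A : ℕ → HSpace O →L[ℝ] HSpace O, ∀ n,
      A n = (l n)⁻¹ • (ContinuousLinearMap.id ℝ (HSpace O) - J n) := ⟨_, fun n => rfl⟩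
  have hAx : ∀ n x, A n x = (l n)⁻¹ • (x - J n x) := fun n x => by rw [hAdef]; rfl
  have hAv : ∀ n x v, MemV γ v → inner ℝ (A n x) v = inner ℝ (Dop γ (J n x)) (Dop γ v) :=
    fun n x v hv => by rw [hAdef]; exact inner_yosida_right (hl0 n) (hJ n) (hJ' n) x hv
  have hsub : ∀ n x, x - l n • A n x = J n x := fun n x => by
    rw [hAdef]; exact sub_smul_yosida (hl0 n) x
  have hself : ∀ n x, inner ℝ (A n x) x = ‖Dop γ (J n x)‖ ^ 2 + l n * ‖A n x‖ ^ 2 := fun n x => by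
    rw [hAdef]; exact inner_yosida_self (hl0 n) (hJ n) (hJ' n) x
  have hwd : ∀ n, ∀ t ∈ Set.Icc 0 T, HasDerivAt (w n) (f t - N (w n t) - A n (w n t)) t :=
    fun n t ht => by
      refine (hw n t ht).2.congr_deriv ?_
      rw [hAx, sub_right_comm]
  set C : ℝ := M * √(volume.real O) + (‖N 0‖ + L * (R * √(volume.real O))) with hC
  have hNR : ∀ x, BddBy R x → ‖N x‖ ≤ ‖N 0‖ + L * (R * √(volume.real O)) := by
    intro x hx
    have h1 := hNle x 0
    have h2 := norm_le_of_bddBy hO hOf hR hx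
    rw [sub_zero] at h1
    have h3 := norm_sub_norm_le (N x) (N 0)
    have h4 := mul_le_mul_of_nonneg_left h2 L.coe_nonneg
    linarith
  have hqC : ∀ n, ∀ t ∈ Set.Icc 0 T, ‖f t - N (w n t)‖ ≤ C := fun n t ht =>
    (norm_sub_le _ _).trans (add_le_add (norm_le_of_bddBy hO hOf hM (hfM t))
      (hNR _ (hw n t ht).1))
  have hdis : ∀ m n x y, inner ℝ (A m x - A n y) ((x - l m • A m x) - (y - l n • A n y)) =
      ‖Dop γ (J m x - J n y)‖ ^ 2 := by
    intro m n x y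
    obtain ⟨h1, h2⟩ := memV_sub hγ₀ hγ₁ (hJ m x) (hJ n y)
    rw [hsub, hsub, inner_sub_left, hAv m x _ h1, hAv n y _ h1, ← inner_sub_left, h2,
      real_inner_self_eq_norm_sq]
  obtain ⟨u, Q, D, huc, hD0, hQ, hwu, hyu, hmc, hdiss⟩ := yosida_limit (X := HSpace O) hT hl0 hlanti hlt
    (A := A) (fun n => by rw [hAdef]; exact yosida_symm (hl0 n) (hJ n) (hJ' n))
    (fun n => by rw [hAdef]; exact le_inner_yosida_self (hl0 n) (hJ n) (hJ' n))
    (fun m n x y => by rw [hdis]; positivity) hNl hf hwc hw0 hwd hqC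
    (fun n => by rw [hAdef]; exact inner_yosida_self_le (hl0 n) (hJ n) (hJ' n) hu₀V)
  simp_rw [hdis] at hdiss hmc
  simp_rw [hsub] at hyu
  have hAwc : ∀ n, Continuous fun s => A n (w n s) := fun n => (A n).continuous.comp (hwc n)
  set y : ℕ → ℝ → HSpace O := fun n s => J n (w n s) with hy
  have hyc : ∀ n, Continuous (y n) := fun n => (J n).continuous.comp (hwc n)
  have hyV : ∀ n s, MemV γ (y n s) := fun n s => hJ n _
  have hDl : Tendsto (fun n => D * l n) atTop (𝓝 0) := by simpa using hlt.const_mul D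
  have huR : ∀ s ∈ Set.Icc 0 T, BddBy R (u s) := fun s hs =>
    bddBy_of_tendsto (hwu s hs) fun n => (hw n s hs).1
  set c : ℝ≥0∞ := ENNReal.ofReal (fracConst d γ / 2) with hc
  have hCpos := fracConst_pos (d := d) hγ₀ hγ₁
  have hc0 : c ≠ 0 := by simpa [hc] using hCpos
  have hct : c ≠ ∞ := ENNReal.ofReal_ne_top
  have hgag : ∀ n, ∀ m ≥ n, ∫⁻ s in Set.Ioc 0 T, gagliardoSq γ (y m s - y n s) ≤
      c⁻¹ * ENNReal.ofReal (D * l n) := by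
    intro n m hnm
    rw [← ENNReal.mul_le_mul_iff_right hc0 hct, ← mul_assoc, ENNReal.mul_inv_cancel hc0 hct, one_mul,
      ← lintegral_const_mul' _ _ hct]
    have h1 : ∀ s, c * gagliardoSq γ (y m s - y n s) =
        ENNReal.ofReal (‖Dop γ (y m s - y n s)‖ ^ 2) := by
      intro s
      rw [gagliardoSq_eq hγ₀ hγ₁ (memV_sub hγ₀ hγ₁ (hyV m s) (hyV n s)).1, ← ofReal_norm,
        ENNReal.ofReal_pow (norm_nonneg _)]
    simp_rw [h1]
    rw [← ofReal_integral_eq_lintegral_ofReal (hmc m n).integrableOn_Ioc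
      (Eventually.of_forall fun s => by positivity), ← intervalIntegral.integral_of_le hT.le]
    refine ENNReal.ofReal_le_ofReal ?_
    exact hdiss n m hnm
  have hyVi : ∀ n, ∫⁻ s in Set.Ioc 0 T, gagliardoSq γ (y n s) < ∞ := by
    intro n
    have h1 : ∫⁻ s in Set.Ioc 0 T, gagliardoSq γ (y n s) ≤
        ∫⁻ s in Set.Ioc 0 T, c⁻¹ * ENNReal.ofReal Q := by
      refine setLIntegral_mono' measurableSet_Ioc fun s hs => ?_
      rw [← ENNReal.mul_le_mul_iff_right hc0 hct, ← mul_assoc, ENNReal.mul_inv_cancel hc0 hct,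
        one_mul, gagliardoSq_eq hγ₀ hγ₁ (hyV n s), ← ofReal_norm,
        ← ENNReal.ofReal_pow (norm_nonneg _)]
      refine ENNReal.ofReal_le_ofReal ?_
      have hs' : s ∈ Set.Icc 0 T := ⟨hs.1.le, hs.2⟩
      have h2 := hQ n s hs'
      rw [hself] at h2
      have h4 : 0 ≤ l n * ‖A n (w n s)‖ ^ 2 := mul_nonneg (hl0 n).le (by positivity)
      linarith
    exact h1.trans_lt (lintegral_const_lt_top
      (ENNReal.mul_lt_top (ENNReal.inv_lt_top.2 hc0.bot_lt) ENNReal.ofReal_lt_top))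
  have hεt : Tendsto (fun n => c⁻¹ * ENNReal.ofReal (D * l n)) atTop (𝓝 0) := by
    have h1 := ENNReal.Tendsto.const_mul (a := c⁻¹) (ENNReal.tendsto_ofReal hDl)
      (Or.inr (ENNReal.inv_ne_top.2 hc0))
    simpa using h1
  obtain ⟨huV, hlim⟩ := tendsto_integral_Dop hA hyc huc
    (fun s hs => hyu s ⟨hs.1.le, hs.2⟩) hyVi hεt
    (fun n => ENNReal.mul_lt_top (ENNReal.inv_lt_top.2 hc0.bot_lt) ENNReal.ofReal_lt_top) hgag
  have hp := (Fact.out : 1 < p)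
  refine ⟨u, huc, huV, ?_, fun t ht v hv hv' => ?_⟩
  · refine lt_of_le_of_lt (setLIntegral_mono' measurableSet_Ioc fun s hs =>
      powInt_le_of_bddBy (huR s ⟨hs.1.le, hs.2⟩)) (lintegral_const_lt_top ?_)
    exact ENNReal.mul_lt_top (ENNReal.rpow_lt_top_of_nonneg (by linarith) ENNReal.ofReal_ne_top) hOf
  · have h0 : (0 : ℝ) ∈ Set.Icc 0 T := ⟨le_rfl, hT.le⟩
    have hpair : ∀ s ∈ Set.Icc 0 T, pairF F (u s) v = inner ℝ (N (u s)) v := fun s hs =>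
      pairF_eq_inner_of_bddBy hO hOf hA.condF hR (huR s hs) v
    have hfv : Continuous fun s => (inner ℝ (f s) v : ℝ) := hf.inner continuous_const
    have hNv : ∀ n, Continuous fun s => (inner ℝ (N (w n s)) v : ℝ) := fun n =>
      (hNl.continuous.comp (hwc n)).inner continuous_const
    have hNu : Continuous fun s => (inner ℝ (N (u s)) v : ℝ) :=
      (hNl.continuous.comp huc).inner continuous_const
    have hAvc : ∀ n, Continuous fun s => (inner ℝ (A n (w n s)) v : ℝ) := fun n =>
      (hAwc n).inner continuous_const
    have hAD : ∀ n s, inner ℝ (A n (w n s)) v = inner ℝ (Dop γ (y n s)) (Dop γ v) := fun n s =>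
      hAv n _ v hv
    have e1 : ∀ n, inner ℝ (w n t) v = inner ℝ u₀ v + ((∫ s in (0 : ℝ)..t, inner ℝ (f s) v) -
        (∫ s in (0 : ℝ)..t, inner ℝ (Dop γ (y n s)) (Dop γ v)) -
        ∫ s in (0 : ℝ)..t, inner ℝ (N (w n s)) v) := by
      intro n
      have h1 := intervalIntegral.integral_eq_sub_of_hasDerivAt (a := 0) (b := t)
        (f := fun s => inner ℝ (w n s) v) (f' := fun s => inner ℝ (f s - N (w n s) - A n (w n s)) v)
        (fun s hs => by
          rw [Set.uIcc_of_le ht.1] at hs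
          have := (hwd n s ⟨hs.1, hs.2.trans ht.2⟩).inner ℝ (hasDerivAt_const s v)
          simp only [inner_zero_right, zero_add] at this
          exact this)
        ((((hf.sub (hNl.continuous.comp (hwc n))).sub (hAwc n)).inner
          continuous_const).intervalIntegrable _ _)
      have h2 : ∀ s, inner ℝ (f s - N (w n s) - A n (w n s)) v = inner ℝ (f s) v -
          inner ℝ (A n (w n s)) v - inner ℝ (N (w n s)) v := fun s => by
        rw [inner_sub_left, inner_sub_left]
        ring
      have h3 : Continuous fun s => (inner ℝ (f s) v - inner ℝ (A n (w n s)) v : ℝ) :=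
        hfv.sub (hAvc n)
      simp_rw [h2] at h1
      rw [intervalIntegral.integral_sub (h3.intervalIntegrable _ _)
        ((hNv n).intervalIntegrable _ _), intervalIntegral.integral_sub
        (hfv.intervalIntegrable _ _) ((hAvc n).intervalIntegrable _ _), hw0 n] at h1
      simp_rw [hAD] at h1
      rw [h1]
      ring
    have e2 : Tendsto (fun n => ∫ s in (0 : ℝ)..t, inner ℝ (N (w n s)) v) atTop
        (𝓝 (∫ s in (0 : ℝ)..t, inner ℝ (N (u s)) v)) := by
      refine intervalIntegral.tendsto_integral_filter_of_dominated_convergence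
        (fun _ => (‖N 0‖ + L * (R * √(volume.real O))) * ‖v‖) (Eventually.of_forall fun n =>
          (hNv n).aestronglyMeasurable) (Eventually.of_forall fun n => Eventually.of_forall
          fun s hs => ?_) (by simp) (Eventually.of_forall fun s hs => ?_)
      · rw [Set.uIoc_of_le ht.1] at hs
        have hs' : s ∈ Set.Icc 0 T := ⟨hs.1.le, hs.2.trans ht.2⟩
        refine (norm_inner_le_norm _ _).trans (mul_le_mul_of_nonneg_right ?_ (norm_nonneg _))
        exact hNR _ (hw n s hs').1
      · rw [Set.uIoc_of_le ht.1] at hs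
        have hs' : s ∈ Set.Icc 0 T := ⟨hs.1.le, hs.2.trans ht.2⟩
        exact ((hNl.continuous.tendsto _).comp (hwu s hs')).inner tendsto_const_nhds
    have e3 := tendsto_nhds_unique ((hwu t ht).inner (tendsto_const_nhds (x := v)))
      ((tendsto_const_nhds.add ((tendsto_const_nhds.sub (hlim t ht (Dop γ v))).sub e2)).congr
        fun n => (e1 n).symm)
    rw [e3]
    have i1 := intervalIntegrable_of_integrableOn
      (integrableOn_inner_Dop hA huc huV (Dop γ v)) h0 ht
    have i2 : IntervalIntegrable (fun s => inner ℝ (f s) v - inner ℝ (Dop γ (u s)) (Dop γ v))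
      volume 0 t := (hfv.intervalIntegrable _ _).sub i1
    rw [← intervalIntegral.integral_sub (hfv.intervalIntegrable _ _) i1,
      ← intervalIntegral.integral_sub i2 (hNu.intervalIntegrable _ _)]
    congr 1
    refine intervalIntegral.integral_congr fun s hs => ?_
    rw [Set.uIcc_of_le ht.1] at hs
    rw [hpair s ⟨hs.1, hs.2.trans ht.2⟩]

end FracSkeleton

namespace FracSkeleton

/-! ### Existence for general data -/

variable {d : ℕ} {O : Set (Space d)} {γ p T : ℝ} {F : ℝ → ℝ}

lemma exists_regular_approx (hO : MeasurableSet O) (hOf : volume O < ∞) {f : ℝ → HSpace O}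
    (hf : IntegrableOn f (Set.Ioc 0 T)) {ε : ℝ} (hε : 0 < ε) :
    ∃ (g : ℝ → HSpace O) (M : ℝ), 0 ≤ M ∧ Continuous g ∧ (∀ s, BddBy M (g s)) ∧
      ∫ s in Set.Ioc 0 T, ‖f s - g s‖ ≤ ε := by
  obtain ⟨g, -, hg1, hgc, hgi⟩ := (hf.integrable_indicator
    measurableSet_Ioc).exists_hasCompactSupport_integral_sub_le (half_pos hε)
  have hgI : IntegrableOn g (Set.Ioc 0 T) := hgi.integrableOn
  have hPl : ∀ n : ℕ, LipschitzWith 1 (nem (clampFn n) : HSpace O → HSpace O) := fun n =>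
    lipschitz_nem hO hOf (lipschitz_clampFn n)
  have hPc : ∀ n : ℕ, Continuous fun s => nem (clampFn n) (g s) := fun n =>
    (hPl n).continuous.comp hgc
  have hPI : ∀ n : ℕ, IntegrableOn (fun s => nem (clampFn n) (g s)) (Set.Ioc 0 T) := fun n =>
    (hPc n).integrableOn_Ioc
  have h1 : Tendsto (fun n : ℕ => ∫ s in Set.Ioc 0 T, ‖g s - nem (clampFn n) (g s)‖) atTop
      (𝓝 (∫ s in Set.Ioc 0 T, (0 : ℝ))) := by
    refine tendsto_integral_of_dominated_convergence (fun s => 2 * ‖g s‖) (fun n =>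
      (hgc.sub (hPc n)).norm.aestronglyMeasurable) (hgI.norm.const_mul 2) (fun n =>
        Eventually.of_forall fun s => ?_) (Eventually.of_forall fun s => ?_)
    · rw [norm_norm]
      refine (norm_sub_le _ _).trans ?_
      have := norm_clamp_le hO hOf (Nat.cast_nonneg (α := ℝ) n) (g s)
      linarith
    · have h2 := (tendsto_const_nhds (x := g s)).sub (tendsto_clamp hO hOf (g s))
      rw [sub_self] at h2
      simpa using h2.norm
  rw [integral_zero] at h1
  obtain ⟨n, hn⟩ := (h1.eventually (gt_mem_nhds (half_pos hε))).exists
  refine ⟨fun s => nem (clampFn n) (g s), n, n.cast_nonneg, hPc n,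
    fun s => bddBy_clamp hO hOf n.cast_nonneg _, ?_⟩
  have h3 : ∫ s in Set.Ioc 0 T, ‖f s - g s‖ ≤ ε / 2 := by
    refine le_trans ?_ hg1
    have h4 : ∫ s in Set.Ioc 0 T, ‖f s - g s‖ =
        ∫ s in Set.Ioc 0 T, ‖(Set.Ioc 0 T).indicator f s - g s‖ :=
      setIntegral_congr_fun measurableSet_Ioc fun s hs => by
        simp only [Set.indicator_of_mem hs]
    rw [h4]
    exact setIntegral_le_integral ((hf.integrable_indicator measurableSet_Ioc).sub hgi).norm
      (Eventually.of_forall fun s => norm_nonneg _)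
  have i1 : IntegrableOn (fun s => ‖f s - g s‖) (Set.Ioc 0 T) := (hf.sub hgI).norm
  have i2 : IntegrableOn (fun s => ‖g s - nem (clampFn n) (g s)‖) (Set.Ioc 0 T) :=
    (hgI.sub (hPI n)).norm
  have i3 : IntegrableOn (fun s => ‖f s - nem (clampFn n) (g s)‖) (Set.Ioc 0 T) :=
    (hf.sub (hPI n)).norm
  calc ∫ s in Set.Ioc 0 T, ‖f s - nem (clampFn n) (g s)‖
      ≤ ∫ s in Set.Ioc 0 T, (‖f s - g s‖ + ‖g s - nem (clampFn n) (g s)‖) :=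
        setIntegral_mono i3 (i1.add i2) fun s => norm_sub_le_norm_sub_add_norm_sub _ _ _
    _ = (∫ s in Set.Ioc 0 T, ‖f s - g s‖) +
        ∫ s in Set.Ioc 0 T, ‖g s - nem (clampFn n) (g s)‖ := integral_add i1 i2
    _ ≤ ε := by linarith

lemma tendsto_integral_pairF [Fact (1 < p)] (hA : Ambient O γ p F) {w : ℕ → ℝ → HSpace O}
    {u : ℝ → HSpace O} (hw : ∀ n, Continuous (w n)) (hu : Continuous u) {e : ℕ → ℝ}
    (he : Tendsto e atTop (𝓝 0)) (h : ∀ n, ∀ s ∈ Set.Icc 0 T, ‖w n s - u s‖ ≤ e n)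
    (hwP : ∀ n, ∫⁻ s in Set.Ioc 0 T, powInt p (w n s) < ∞) {C : ℝ}
    (hC : ∀ n, ∫ s in (0 : ℝ)..T, (powInt p (w n s)).toReal ≤ C) :
    ∫⁻ s in Set.Ioc 0 T, powInt p (u s) < ∞ ∧
    ∀ t ∈ Set.Icc 0 T, ∀ v : HSpace O, powInt p v < ∞ →
      Tendsto (fun n => ∫ s in (0 : ℝ)..t, pairF F (w n s) v) atTop
        (𝓝 (∫ s in (0 : ℝ)..t, pairF F (u s) v)) := by
  rcases lt_or_ge T 0 with hT | hT
  · refine ⟨by simp [Set.Ioc_eq_empty (by linarith : ¬ (0 < T))], fun t ht => ?_⟩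
    exact absurd (ht.1.trans ht.2) (by linarith)
  have hconv : ∀ s ∈ Set.Icc 0 T, Tendsto (fun n => w n s) atTop (𝓝 (u s)) := fun s hs =>
    tendsto_iff_norm_sub_tendsto_zero.2
      (squeeze_zero (fun n => norm_nonneg _) (fun n => h n s hs) he)
  have hlin : ∀ n, ∫⁻ s in Set.Ioc 0 T, powInt p (w n s) ≤ ENNReal.ofReal C := fun n => by
    have h1 := hC n
    have hm : Measurable fun s => powInt p (w n s) := measurable_powInt.comp (hw n).measurable
    rw [intervalIntegral.integral_of_le hT, integral_toReal hm.aemeasurable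
      (ae_lt_top hm (hwP n).ne)] at h1
    rw [← ENNReal.ofReal_toReal (hwP n).ne]
    exact ENNReal.ofReal_le_ofReal h1
  have huP' : ∫⁻ s in Set.Ioc 0 T, powInt p (u s) ≤ ENNReal.ofReal C := by
    have h1 : ∫⁻ s in Set.Ioc 0 T, powInt p (u s) ≤
        ∫⁻ s in Set.Ioc 0 T, liminf (fun n => powInt p (w n s)) atTop :=
      setLIntegral_mono' measurableSet_Ioc fun s hs =>
        powInt_le_liminf (hconv s ⟨hs.1.le, hs.2⟩)
    refine h1.trans ((lintegral_liminf_le fun n =>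
      measurable_powInt.comp (hw n).measurable).trans ?_)
    refine liminf_le_of_le (by isBoundedDefault) fun b hb => ?_
    obtain ⟨n, hn⟩ := hb.exists
    exact hn.trans (hlin n)
  have huP := huP'.trans_lt ENNReal.ofReal_lt_top
  refine ⟨huP, fun t ht v hv => ?_⟩
  have h0 : (0 : ℝ) ∈ Set.Icc 0 T := ⟨le_rfl, hT⟩
  have hTm : T ∈ Set.Icc 0 T := ⟨hT, le_rfl⟩
  have iu := integrableOn_powInt hu huP
  have iw := fun n => integrableOn_powInt (hw n) (hwP n)
  set C' : ℝ := ∫ s in (0 : ℝ)..T, (powInt p (u s)).toReal with hC'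
  have hC'0 : 0 ≤ C' := intervalIntegral.integral_nonneg hT fun s _ => ENNReal.toReal_nonneg
  have hC0 : 0 ≤ C := le_trans (intervalIntegral.integral_nonneg hT fun s _ =>
    ENNReal.toReal_nonneg) (hC 0)
  rw [Metric.tendsto_atTop]
  intro η hη
  set ε : ℝ := η / (2 * (T + C + C' + 1)) with hε
  have hε0 : 0 < ε := by positivity
  obtain ⟨B, hB, hBle⟩ := abs_pairF_sub_le (O := O) hA.isOpen.measurableSet hA.finite hA.condF hv hε0
  have h2 : Tendsto (fun n => B * e n * T) atTop (𝓝 0) := by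
    simpa using (he.const_mul B).mul_const T
  obtain ⟨n₀, hn₀⟩ := eventually_atTop.1 (h2.eventually (gt_mem_nhds (half_pos hη)))
  refine ⟨n₀, fun n hn => ?_⟩
  have i1 := integrableOn_pairF hA (hw n) (hwP n) hv
  have i2 := integrableOn_pairF hA hu huP hv
  have i3 : IntegrableOn (fun s => |pairF F (w n s) v - pairF F (u s) v|) (Set.Ioc 0 T) :=
    (i1.sub i2).abs
  have j1 : IntegrableOn (fun _ : ℝ => B * e n + ε) (Set.Ioc 0 T) := integrableOn_const (by simp)
  have j2 : IntegrableOn (fun s => ε * (powInt p (w n s)).toReal) (Set.Ioc 0 T) :=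
    (iw n).const_mul ε
  have j3 : IntegrableOn (fun s => ε * (powInt p (u s)).toReal) (Set.Ioc 0 T) := iu.const_mul ε
  have j4 : IntegrableOn (fun s => B * e n + ε + ε * (powInt p (w n s)).toReal) (Set.Ioc 0 T) :=
    j1.add j2
  have j5 : IntegrableOn (fun s => B * e n + ε + ε * (powInt p (w n s)).toReal +
    ε * (powInt p (u s)).toReal) (Set.Ioc 0 T) := j4.add j3
  rw [Real.dist_eq, ← intervalIntegral.integral_sub (intervalIntegrable_of_integrableOn i1 h0 ht)
    (intervalIntegrable_of_integrableOn i2 h0 ht)]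
  have key : |∫ s in (0 : ℝ)..t, (pairF F (w n s) v - pairF F (u s) v)| ≤
      (B * e n + ε) * T + ε * C + ε * C' := by
    calc |∫ s in (0 : ℝ)..t, (pairF F (w n s) v - pairF F (u s) v)|
        ≤ ∫ s in (0 : ℝ)..t, |pairF F (w n s) v - pairF F (u s) v| :=
          intervalIntegral.abs_integral_le_integral_abs ht.1
      _ ≤ ∫ s in (0 : ℝ)..T, |pairF F (w n s) v - pairF F (u s) v| :=
          intervalIntegral.integral_mono_interval le_rfl ht.1 ht.2
            (Eventually.of_forall fun s => abs_nonneg _)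
            (intervalIntegrable_of_integrableOn i3 h0 hTm)
      _ ≤ ∫ s in (0 : ℝ)..T, (B * e n + ε + ε * (powInt p (w n s)).toReal +
            ε * (powInt p (u s)).toReal) := by
          refine intervalIntegral_mono_ae_Ioc i3 j5 ?_ hTm
          filter_upwards [ae_powInt hu huP, ae_powInt (hw n) (hwP n),
            ae_restrict_mem measurableSet_Ioc] with s h3 h4 h5
          refine (hBle _ _ h3 h4).trans ?_
          have h6 := mul_le_mul_of_nonneg_left (h n s ⟨h5.1.le, h5.2⟩) hB
          linarith
      _ = (B * e n + ε) * T + ε * (∫ s in (0 : ℝ)..T, (powInt p (w n s)).toReal) + ε * C' := by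
          rw [intervalIntegral.integral_add (intervalIntegrable_of_integrableOn j4 h0 hTm)
            (intervalIntegrable_of_integrableOn j3 h0 hTm),
            intervalIntegral.integral_add (intervalIntegrable_of_integrableOn j1 h0 hTm)
            (intervalIntegrable_of_integrableOn j2 h0 hTm), intervalIntegral.integral_const,
            intervalIntegral.integral_const_mul, intervalIntegral.integral_const_mul, smul_eq_mul,
            sub_zero]
          ring
      _ ≤ _ := by
          have := mul_le_mul_of_nonneg_left (hC n) hε0.le
          linarith
  refine key.trans_lt ?_
  have h7 := hn₀ n hn
  have h8 : ε * (T + C + C' + 1) = η / 2 := by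
    rw [hε]
    field_simp
  nlinarith

theorem exists_isWeakSol [Fact (1 < p)] (hA : Ambient O γ p F) (hT : 0 < T) (u₀ : HSpace O)
    {f : ℝ → HSpace O} (hf : IntegrableOn f (Set.Ioc 0 T)) :
    ∃ u, IsWeakSol γ p F T u₀ f u := by
  have hO := hA.isOpen.measurableSet
  have hOf := hA.finite
  have hγ₀ := hA.γ_pos
  have hγ₁ := hA.γ_lt
  have h0 : (0 : ℝ) ∈ Set.Icc 0 T := ⟨le_rfl, hT.le⟩
  have hTm : T ∈ Set.Icc 0 T := ⟨hT.le, le_rfl⟩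
  set e : ℕ → ℝ := fun n => 1 / ((n : ℝ) + 1) with he
  have he0 : ∀ n, 0 < e n := fun n => by positivity
  have he1 : ∀ n, e n ≤ 1 := fun n => by
    rw [he]
    simp only
    rw [div_le_one (by positivity)]
    have : (0 : ℝ) ≤ n := n.cast_nonneg
    linarith
  have heanti : ∀ n, ∀ m ≥ n, e m ≤ e n := fun n m hnm =>
    one_div_le_one_div_of_le (by positivity) (by
      have : (n : ℝ) ≤ m := by exact_mod_cast hnm
      linarith)
  have het : Tendsto e atTop (𝓝 0) := tendsto_one_div_add_atTop_nhds_zero_nat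
  have hex : ∀ n, ∃ v ∈ boundedV O γ, ‖v - u₀‖ ≤ e n := fun n => by
    obtain ⟨v, hv, hv'⟩ := (dense_boundedV (O := O) hA.isOpen hA.d_pos hγ₀ hγ₁).exists_dist_lt u₀
      (he0 n)
    refine ⟨v, hv, ?_⟩
    rw [dist_comm, dist_eq_norm] at hv'
    exact hv'.le
  choose v hv hvu using hex
  choose g M hM hgc hgM hgf using fun n => exists_regular_approx hO hOf hf (he0 n)
  have hsol : ∀ n, ∃ u, IsWeakSol γ p F T (v n) (g n) u := fun n => by
    obtain ⟨h1, R, h2⟩ := hv n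
    exact exists_isWeakSol_of_regular hA hT (hM n) h1 h2 (hgc n) (hgM n)
  choose w hw using hsol
  have hgI : ∀ n, IntegrableOn (g n) (Set.Ioc 0 T) := fun n => (hgc n).integrableOn_Ioc
  obtain ⟨B, hB, hBle⟩ := norm_sub_le_of_isWeakSol hA T
  obtain ⟨κ, hκ, hst⟩ := stability hA
  have hvd : ∀ n, ∀ m ≥ n, ‖v m - v n‖ ≤ 2 * e n := fun n m hnm => by
    have h1 := norm_sub_le_norm_sub_add_norm_sub (v m) u₀ (v n)
    rw [norm_sub_rev u₀] at h1
    have := hvu m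
    have := hvu n
    have := heanti n m hnm
    linarith
  have hgd : ∀ n, ∀ m ≥ n, ∫ s in (0 : ℝ)..T, ‖g m s - g n s‖ ≤ 2 * e n := fun n m hnm => by
    have i1 : ∀ n, IntegrableOn (fun s => ‖f s - g n s‖) (Set.Ioc 0 T) := fun n =>
      (hf.sub (hgI n)).norm
    have i2 : IntegrableOn (fun s => ‖g m s - g n s‖) (Set.Ioc 0 T) := ((hgI m).sub (hgI n)).norm
    rw [intervalIntegral.integral_of_le hT.le]
    calc ∫ s in Set.Ioc 0 T, ‖g m s - g n s‖
        ≤ ∫ s in Set.Ioc 0 T, (‖f s - g m s‖ + ‖f s - g n s‖) :=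
          setIntegral_mono i2 ((i1 m).add (i1 n)) fun s => by
            have h1 := norm_sub_le_norm_sub_add_norm_sub (g m s) (f s) (g n s)
            rwa [norm_sub_rev (g m s) (f s)] at h1
      _ = _ := integral_add (i1 m) (i1 n)
      _ ≤ 2 * e n := by
          have := hgf m
          have := hgf n
          have := heanti n m hnm
          linarith
  have hwd : ∀ n, ∀ m ≥ n, ∀ t ∈ Set.Icc 0 T, ‖w m t - w n t‖ ≤ 4 * B * e n := by
    intro n m hnm t ht
    refine (hBle (hw m) (hw n) (hgI m) (hgI n) t ht).trans ?_
    have h1 : ∫ s in (0 : ℝ)..t, ‖g m s - g n s‖ ≤ ∫ s in (0 : ℝ)..T, ‖g m s - g n s‖ :=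
      intervalIntegral.integral_mono_interval le_rfl ht.1 ht.2
        (Eventually.of_forall fun s => norm_nonneg _)
        (((hgc m).sub (hgc n)).norm.intervalIntegrable _ _)
    have h2 := hgd n m hnm
    have h3 := hvd n m hnm
    nlinarith
  -- the limit
  let W : ℕ → C(Set.Icc 0 T, HSpace O) := fun n =>
    ⟨fun t => w n t, (hw n).cont.comp continuous_subtype_val⟩
  have hWd : ∀ n, ∀ m ≥ n, dist (W m) (W n) ≤ 4 * B * e n := fun n m hnm => by
    have := he0 n
    refine (ContinuousMap.dist_le (by positivity)).2 fun t => ?_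
    rw [dist_eq_norm]
    exact hwd n m hnm t t.2
  have h4e : Tendsto (fun n => 4 * B * e n) atTop (𝓝 0) := by simpa using het.const_mul (4 * B)
  have hWc : CauchySeq W := by
    refine cauchySeq_of_le_tendsto_0' (fun n => 4 * B * e n) (fun n m hnm => ?_) h4e
    rw [dist_comm]
    exact hWd n m hnm
  obtain ⟨Wl, hWl⟩ := cauchySeq_tendsto_of_complete hWc
  set u : ℝ → HSpace O := Set.IccExtend hT.le Wl with hu
  have huc : Continuous u := Wl.continuous.Icc_extend'
  have hwu : ∀ n, ∀ s ∈ Set.Icc 0 T, ‖w n s - u s‖ ≤ dist (W n) Wl := by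
    intro n s hs
    rw [hu, Set.IccExtend_of_mem hT.le _ hs, ← dist_eq_norm]
    exact ContinuousMap.dist_apply_le_dist (f := W n) (g := Wl) ⟨s, hs⟩
  have hdt : Tendsto (fun n => dist (W n) Wl) atTop (𝓝 0) := tendsto_iff_dist_tendsto_zero.1 hWl
  have hconv : ∀ s ∈ Set.Icc 0 T, Tendsto (fun n => w n s) atTop (𝓝 (u s)) := fun s hs =>
    tendsto_iff_norm_sub_tendsto_zero.2
      (squeeze_zero (fun n => norm_nonneg _) (fun n => hwu n s hs) hdt)
  obtain ⟨S, hS⟩ : ∃ S, ∀ n, ∀ s ∈ Set.Icc 0 T, ‖w n s‖ ≤ S := by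
    obtain ⟨S, hS⟩ := hWc.norm_bddAbove
    refine ⟨S, fun n s hs => ?_⟩
    exact ((W n).norm_coe_le_norm ⟨s, hs⟩).trans (hS ⟨n, rfl⟩)
  have hS0 : 0 ≤ S := (norm_nonneg _).trans (hS 0 0 h0)
  -- the dissipation
  set c : ℝ≥0∞ := ENNReal.ofReal (fracConst d γ / 2) with hc
  have hCpos := fracConst_pos (d := d) hγ₀ hγ₁
  have hc0 : c ≠ 0 := by simpa [hc] using hCpos
  have hct : c ≠ ∞ := ENNReal.ofReal_ne_top
  set D : ℝ := 4 + 2 * κ * T * (4 * B) ^ 2 + 16 * B with hD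
  have hD0 : 0 ≤ D := by positivity
  have hgag : ∀ n, ∀ m ≥ n, ∫⁻ s in Set.Ioc 0 T, gagliardoSq γ (w m s - w n s) ≤
      c⁻¹ * ENNReal.ofReal (D * e n) := by
    intro n m hnm
    have hVi := (hw m).sub_memV hA (hw n)
    have hwc : Continuous fun s => w m s - w n s := (hw m).cont.sub (hw n).cont
    rw [← ENNReal.mul_le_mul_iff_right hc0 hct, ← mul_assoc, ENNReal.mul_inv_cancel hc0 hct, one_mul,
      ← lintegral_const_mul' _ _ hct]
    have h1 : ∫⁻ s in Set.Ioc 0 T, c * gagliardoSq γ (w m s - w n s) =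
        ∫⁻ s in Set.Ioc 0 T, ENNReal.ofReal (‖Dop γ (w m s - w n s)‖ ^ 2) := by
      refine lintegral_congr_ae ?_
      filter_upwards [ae_memV hγ₀ hγ₁ hwc hVi] with s hs
      rw [gagliardoSq_eq hγ₀ hγ₁ hs, ← ofReal_norm, ENNReal.ofReal_pow (norm_nonneg _)]
    rw [h1, ← ofReal_integral_eq_lintegral_ofReal (integrableOn_norm_Dop_sq hA hwc hVi)
      (Eventually.of_forall fun s => by positivity), ← intervalIntegral.integral_of_le hT.le]
    refine ENNReal.ofReal_le_ofReal ?_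
    have h2 := hst hT (hw m) (hw n) (hgI m) (hgI n) T hTm
    have hgc' : Continuous fun s => ‖g m s - g n s‖ := ((hgc m).sub (hgc n)).norm
    have h3 : ∫ s in (0 : ℝ)..T, (κ * ‖w m s - w n s‖ ^ 2 +
        inner ℝ (g m s - g n s) (w m s - w n s)) ≤
        κ * (4 * B * e n) ^ 2 * T + 4 * B * e n * (2 * e n) := by
      calc ∫ s in (0 : ℝ)..T, (κ * ‖w m s - w n s‖ ^ 2 +
            inner ℝ (g m s - g n s) (w m s - w n s))
          ≤ ∫ s in (0 : ℝ)..T, (κ * (4 * B * e n) ^ 2 + 4 * B * e n * ‖g m s - g n s‖) := by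
            refine intervalIntegral.integral_mono_on hT.le
              (((continuous_const.mul (hwc.norm.pow 2)).add
                (((hgc m).sub (hgc n)).inner hwc)).intervalIntegrable _ _)
              ((continuous_const.add (continuous_const.mul hgc')).intervalIntegrable _ _)
              fun s hs => ?_
            have h4 := hwd n m hnm s hs
            have h5 := real_inner_le_norm (g m s - g n s) (w m s - w n s)
            have h6 : ‖w m s - w n s‖ ^ 2 ≤ (4 * B * e n) ^ 2 := pow_le_pow_left₀ (norm_nonneg _) h4 2
            have h7 := mul_le_mul_of_nonneg_left h6 hκ.le
            have h8 := mul_le_mul_of_nonneg_left h4 (norm_nonneg (g m s - g n s))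
            linarith
        _ = κ * (4 * B * e n) ^ 2 * T + 4 * B * e n * ∫ s in (0 : ℝ)..T, ‖g m s - g n s‖ := by
            have hgc2 : Continuous fun s => 4 * B * e n * ‖g m s - g n s‖ :=
              continuous_const.mul hgc'
            rw [intervalIntegral.integral_add (by simp) (hgc2.intervalIntegrable _ _),
              intervalIntegral.integral_const, intervalIntegral.integral_const_mul, smul_eq_mul,
              sub_zero]
            ring
        _ ≤ _ := by
            have := he0 n
            have h9 := mul_le_mul_of_nonneg_left (hgd n m hnm) (by positivity : 0 ≤ 4 * B * e n)
            linarith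
    have h10 : ‖v m - v n‖ ^ 2 ≤ (2 * e n) ^ 2 := pow_le_pow_left₀ (norm_nonneg _) (hvd n m hnm) 2
    have h11 : e n ^ 2 ≤ e n := by nlinarith [he0 n, he1 n]
    have h12 : 0 ≤ ∫ s in (0 : ℝ)..T, ‖Dop γ (w m s - w n s)‖ ^ 2 :=
      intervalIntegral.integral_nonneg hT.le fun s _ => by positivity
    have h13 : 0 ≤ ‖w m T - w n T‖ ^ 2 := by positivity
    have h14 : (2 * e n) ^ 2 + 2 * (κ * (4 * B * e n) ^ 2 * T + 4 * B * e n * (2 * e n)) =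
        D * e n ^ 2 := by rw [hD]; ring
    have h15 := mul_le_mul_of_nonneg_left h11 hD0
    linarith
  have hεt : Tendsto (fun n => c⁻¹ * ENNReal.ofReal (D * e n)) atTop (𝓝 0) := by
    have h2 : Tendsto (fun n => D * e n) atTop (𝓝 0) := by simpa using het.const_mul D
    have h1 := ENNReal.Tendsto.const_mul (a := c⁻¹) (ENNReal.tendsto_ofReal h2)
      (Or.inr (ENNReal.inv_ne_top.2 hc0))
    simpa using h1
  obtain ⟨huV, hlim⟩ := tendsto_integral_Dop hA (fun n => (hw n).cont) huc
    (fun s hs => hconv s ⟨hs.1.le, hs.2⟩) (fun n => (hw n).memV) hεt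
    (fun n => ENNReal.mul_lt_top (ENNReal.inv_lt_top.2 hc0.bot_lt) ENNReal.ofReal_lt_top) hgag
  -- the nonlinearity
  obtain ⟨k₂, hk₂, k₃, hk₃, hap⟩ := a_priori hA
  have hgn : ∀ n, ∫ s in (0 : ℝ)..T, ‖g n s‖ ≤ (∫ s in (0 : ℝ)..T, ‖f s‖) + 1 := by
    intro n
    have i1 : IntegrableOn (fun s => ‖f s - g n s‖) (Set.Ioc 0 T) := (hf.sub (hgI n)).norm
    have i2 : IntegrableOn (fun s => ‖f s‖) (Set.Ioc 0 T) := hf.norm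
    rw [intervalIntegral.integral_of_le hT.le, intervalIntegral.integral_of_le hT.le]
    calc ∫ s in Set.Ioc 0 T, ‖g n s‖ ≤ ∫ s in Set.Ioc 0 T, (‖f s‖ + ‖f s - g n s‖) :=
          setIntegral_mono (hgI n).norm (i2.add i1) fun s => by
            have := norm_le_norm_add_norm_sub (f s) (g n s)
            simpa using this
      _ = _ := integral_add i2 i1
      _ ≤ _ := by
          have := hgf n
          have := he1 n
          linarith
  set If : ℝ := ∫ s in (0 : ℝ)..T, ‖f s‖ with hIf
  have hWb : ∀ n, ∫ s in (0 : ℝ)..T, (powInt p (w n s)).toReal ≤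
      ((‖u₀‖ + 1) ^ 2 + 2 * k₂ * T + 2 * (S * (If + 1))) / (2 * k₃) := by
    intro n
    rw [le_div_iff₀ (by positivity)]
    have h1 := hap hT (hw n) (hgI n) T hTm
    have h2 : ∫ s in (0 : ℝ)..T, inner ℝ (g n s) (w n s) ≤ S * (If + 1) := by
      calc ∫ s in (0 : ℝ)..T, inner ℝ (g n s) (w n s) ≤ ∫ s in (0 : ℝ)..T, S * ‖g n s‖ := by
            refine intervalIntegral.integral_mono_on hT.le
              (((hgc n).inner (hw n).cont).intervalIntegrable _ _)
              ((continuous_const.mul (hgc n).norm).intervalIntegrable _ _) fun s hs => ?_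
            refine (real_inner_le_norm _ _).trans ?_
            rw [mul_comm]
            exact mul_le_mul_of_nonneg_right (hS n s hs) (norm_nonneg _)
        _ = S * ∫ s in (0 : ℝ)..T, ‖g n s‖ := intervalIntegral.integral_const_mul _ _
        _ ≤ _ := mul_le_mul_of_nonneg_left (hgn n) hS0
    have h3 : 0 ≤ ∫ s in (0 : ℝ)..T, ‖Dop γ (w n s)‖ ^ 2 :=
      intervalIntegral.integral_nonneg hT.le fun s _ => by positivity
    have h4 : ‖v n‖ ≤ ‖u₀‖ + 1 := by
      have := norm_sub_norm_le (v n) u₀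
      have := hvu n
      have := he1 n
      linarith
    have h5 : ‖v n‖ ^ 2 ≤ (‖u₀‖ + 1) ^ 2 := pow_le_pow_left₀ (norm_nonneg _) h4 2
    have h6 : 0 ≤ ‖w n T‖ ^ 2 := by positivity
    linarith
  obtain ⟨huP, hpair⟩ := tendsto_integral_pairF hA (fun n => (hw n).cont) huc hdt hwu
    (fun n => (hw n).memP) hWb
  refine ⟨u, huc, huV, huP, fun t ht x hx hx' => ?_⟩
  have hfx : Tendsto (fun n => ∫ s in (0 : ℝ)..t, inner ℝ (g n s) x) atTop
      (𝓝 (∫ s in (0 : ℝ)..t, inner ℝ (f s) x)) := by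
    rw [tendsto_iff_norm_sub_tendsto_zero]
    refine squeeze_zero (g := fun n => e n * ‖x‖) (fun n => norm_nonneg _) (fun n => ?_)
      (by simpa using het.mul_const ‖x‖)
    have i0 : IntegrableOn (fun s => ‖f s - g n s‖) (Set.Ioc 0 T) := (hf.sub (hgI n)).norm
    have j1 : IntegrableOn (fun s => (inner ℝ (g n s) x : ℝ)) (Set.Ioc 0 T) :=
      (hgI n).inner_const x
    have j2 : IntegrableOn (fun s => (inner ℝ (f s) x : ℝ)) (Set.Ioc 0 T) := hf.inner_const x
    rw [← intervalIntegral.integral_sub (intervalIntegrable_of_integrableOn j1 h0 ht)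
      (intervalIntegrable_of_integrableOn j2 h0 ht)]
    refine (intervalIntegral.norm_integral_le_integral_norm ht.1).trans ?_
    have i1 : IntegrableOn (fun s => ‖(inner ℝ (g n s) x - inner ℝ (f s) x : ℝ)‖) (Set.Ioc 0 T) :=
      (j1.sub j2).norm
    refine (intervalIntegral_mono_ae_Ioc i1 (i0.mul_const ‖x‖)
      (Eventually.of_forall fun s => ?_) ht).trans ?_
    · rw [← inner_sub_left, norm_sub_rev]
      exact norm_inner_le_norm _ _
    · rw [intervalIntegral.integral_mul_const]
      refine mul_le_mul_of_nonneg_right (le_trans ?_ (hgf n)) (norm_nonneg _)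
      rw [← intervalIntegral.integral_of_le hT.le]
      exact intervalIntegral.integral_mono_interval le_rfl ht.1 ht.2
        (Eventually.of_forall fun s => norm_nonneg _)
        (intervalIntegrable_of_integrableOn i0 h0 hTm)
  have hvx : Tendsto (fun n => (inner ℝ (v n) x : ℝ)) atTop (𝓝 (inner ℝ u₀ x)) := by
    have h1 : Tendsto v atTop (𝓝 u₀) := tendsto_iff_norm_sub_tendsto_zero.2
      (squeeze_zero (fun n => norm_nonneg _) hvu het)
    exact h1.inner tendsto_const_nhds
  have hsplit : ∀ {f' u' : ℝ → HSpace O}, IntegrableOn f' (Set.Ioc 0 T) → Continuous u' →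
      ∫⁻ s in Set.Ioc 0 T, gagliardoSq γ (u' s) < ∞ →
      ∫⁻ s in Set.Ioc 0 T, powInt p (u' s) < ∞ → ∫ s in (0 : ℝ)..t,
        (inner ℝ (f' s) x - inner ℝ (Dop γ (u' s)) (Dop γ x) - pairF F (u' s) x) =
      (∫ s in (0 : ℝ)..t, inner ℝ (f' s) x) -
        (∫ s in (0 : ℝ)..t, inner ℝ (Dop γ (u' s)) (Dop γ x)) -
        ∫ s in (0 : ℝ)..t, pairF F (u' s) x := by
    intro f' u' h1 h2 h3 h4
    have i1 : IntegrableOn (fun s => (inner ℝ (f' s) x : ℝ)) (Set.Ioc 0 T) := h1.inner_const x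
    have i2 := integrableOn_inner_Dop hA h2 h3 (Dop γ x)
    have i3 := integrableOn_pairF hA h2 h4 hx'
    have i4 : IntegrableOn (fun s => inner ℝ (f' s) x - inner ℝ (Dop γ (u' s)) (Dop γ x))
      (Set.Ioc 0 T) := i1.sub i2
    rw [intervalIntegral.integral_sub (intervalIntegrable_of_integrableOn i4 h0 ht)
      (intervalIntegrable_of_integrableOn i3 h0 ht), intervalIntegral.integral_sub
      (intervalIntegrable_of_integrableOn i1 h0 ht) (intervalIntegrable_of_integrableOn i2 h0 ht)]
  rw [hsplit hf huc huV huP]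
  refine tendsto_nhds_unique ((hconv t ht).inner (tendsto_const_nhds (x := x)))
    ((hvx.add ((hfx.sub (hlim t ht (Dop γ x))).sub (hpair t ht x hx'))).congr fun n => ?_)
  rw [← hsplit (hgI n) (hw n).cont (hw n).memV (hw n).memP]
  exact ((hw n).eqn t ht x hx hx').symm

end FracSkeleton

namespace FracSkeleton

/-! ### State-dependent right-hand sides -/

variable {d : ℕ} {O : Set (Space d)} {γ p T : ℝ} {F : ℝ → ℝ}

/-- Radial retraction onto the ball of radius `R`. -/
def radial {X : Type*} [NormedAddCommGroup X] [NormedSpace ℝ X] (R : ℝ) (x : X) : X :=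
  (R / max R ‖x‖) • x

section radial
variable {X : Type*} [NormedAddCommGroup X] [NormedSpace ℝ X] {R : ℝ}

lemma radial_of_norm_le (hR : 0 < R) {x : X} (hx : ‖x‖ ≤ R) : radial R x = x := by
  rw [radial, max_eq_left hx, div_self hR.ne', one_smul]

lemma norm_radial_le (hR : 0 < R) (x : X) : ‖radial R x‖ ≤ R := by
  have h : 0 < max R ‖x‖ := lt_max_of_lt_left hR
  rw [radial, norm_smul, Real.norm_of_nonneg (by positivity), div_mul_eq_mul_div, div_le_iff₀ h]
  exact mul_le_mul_of_nonneg_left (le_max_right _ _) hR.le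

lemma norm_radial_le_norm (hR : 0 < R) (x : X) : ‖radial R x‖ ≤ ‖x‖ := by
  have h : 0 < max R ‖x‖ := lt_max_of_lt_left hR
  rw [radial, norm_smul, Real.norm_of_nonneg (by positivity)]
  exact mul_le_of_le_one_left (norm_nonneg _) ((div_le_one h).2 (le_max_left _ _))

lemma norm_radial_sub_le (hR : 0 < R) (x y : X) : ‖radial R x - radial R y‖ ≤ 2 * ‖x - y‖ := by
  set a := max R ‖x‖ with ha
  set b := max R ‖y‖ with hb
  have ha0 : 0 < a := lt_max_of_lt_left hR
  have hb0 : 0 < b := lt_max_of_lt_left hR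
  have h1 : radial R x - radial R y = (R / a) • (x - y) + (R / a - R / b) • y := by
    rw [radial, radial]
    module
  have h2 : |b - a| ≤ ‖x - y‖ := by
    rw [abs_sub_comm]
    refine (abs_max_sub_max_le_max R ‖x‖ R ‖y‖).trans ?_
    rw [sub_self, abs_zero]
    exact max_le (norm_nonneg _) (abs_norm_sub_norm_le x y)
  have h3 : ‖(R / a) • (x - y)‖ ≤ ‖x - y‖ := by
    rw [norm_smul, Real.norm_of_nonneg (by positivity)]
    exact mul_le_of_le_one_left (norm_nonneg _) ((div_le_one ha0).2 (le_max_left _ _))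
  have h4 : ‖(R / a - R / b) • y‖ ≤ ‖x - y‖ := by
    have h5 : R / a - R / b = R / a * ((b - a) / b) := by field_simp
    rw [norm_smul, h5, norm_mul, Real.norm_of_nonneg (by positivity : 0 ≤ R / a), norm_div,
      Real.norm_of_nonneg hb0.le, Real.norm_eq_abs, mul_assoc]
    refine (mul_le_of_le_one_left (by positivity) ((div_le_one ha0).2 (le_max_left _ _))).trans ?_
    rw [div_mul_eq_mul_div, div_le_iff₀ hb0]
    exact mul_le_mul h2 (le_max_right _ _) (norm_nonneg _) (norm_nonneg _)
  rw [h1]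
  refine (norm_add_le _ _).trans ?_
  linarith

end radial

/-- A right-hand side `G(s, u)` of linear growth and locally Lipschitz in `u`, with integrable
constants. -/
structure IsSource {X : Type*} [NormedAddCommGroup X] (T : ℝ) (G : ℝ → X → X) (m : ℝ → ℝ)
    (ℓ : ℝ → ℝ → ℝ) : Prop where
  meas : ∀ u : ℝ → X, Continuous u →
    AEStronglyMeasurable (fun s => G s (u s)) (volume.restrict (Set.Ioc 0 T))
  m_nonneg : ∀ s, 0 ≤ m s
  m_int : IntegrableOn m (Set.Ioc 0 T)
  ℓ_nonneg : ∀ r s, 0 ≤ ℓ r s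
  ℓ_int : ∀ r, IntegrableOn (ℓ r) (Set.Ioc 0 T)
  growth : ∀ᵐ s ∂(volume.restrict (Set.Ioc 0 T)), ∀ x, ‖G s x‖ ≤ m s * (1 + ‖x‖)
  lip : ∀ r, ∀ᵐ s ∂(volume.restrict (Set.Ioc 0 T)), ∀ x y, ‖x‖ ≤ r → ‖y‖ ≤ r →
    ‖G s x - G s y‖ ≤ ℓ r s * ‖x - y‖

namespace IsSource

variable {X : Type*} [NormedAddCommGroup X] {G : ℝ → X → X} {m : ℝ → ℝ} {ℓ : ℝ → ℝ → ℝ}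

lemma integrableOn (hG : IsSource T G m ℓ) {u : ℝ → X} (hu : Continuous u) :
    IntegrableOn (fun s => G s (u s)) (Set.Ioc 0 T) := by
  have hc : Continuous fun s => 1 + ‖u s‖ := continuous_const.add hu.norm
  refine (integrableOn_mul_continuous hG.m_int hc).mono' (hG.meas u hu) ?_
  filter_upwards [hG.growth] with s hs using hs _

lemma truncate [NormedSpace ℝ X] (hG : IsSource T G m ℓ) {R : ℝ} (hR : 0 < R) :
    IsSource T (fun s x => G s (radial R x)) m fun _ s => 2 * ℓ R s where
  meas u hu := by
    have hc : Continuous (radial R : X → X) :=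
      (LipschitzWith.of_dist_le_mul (K := 2) fun x y => by
        rw [dist_eq_norm, dist_eq_norm]
        exact norm_radial_sub_le hR x y).continuous
    exact hG.meas _ (hc.comp hu)
  m_nonneg := hG.m_nonneg
  m_int := hG.m_int
  ℓ_nonneg r s := mul_nonneg zero_le_two (hG.ℓ_nonneg R s)
  ℓ_int r := (hG.ℓ_int R).const_mul 2
  growth := by
    filter_upwards [hG.growth] with s hs x
    refine (hs _).trans (mul_le_mul_of_nonneg_left ?_ (hG.m_nonneg s))
    linarith [norm_radial_le_norm hR x]
  lip r := by
    filter_upwards [hG.lip R] with s hs x y _ _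
    refine (hs _ _ (norm_radial_le hR x) (norm_radial_le hR y)).trans ?_
    rw [mul_comm (2 : ℝ), mul_assoc]
    exact mul_le_mul_of_nonneg_left (norm_radial_sub_le hR x y) (hG.ℓ_nonneg R s)

end IsSource

section
variable [hpf : Fact (1 < p)] (hA : Ambient O γ p F) (hT : 0 < T)
include hA hT

/-- A priori bounds that depend on the source only through the integral of its growth bound. -/
theorem source_a_priori (u₀ : HSpace O) (Mb : ℝ) : ∃ R > 0, ∀ {G : ℝ → HSpace O → HSpace O}
    {m : ℝ → ℝ} {ℓ : ℝ → ℝ → ℝ}, IsSource T G m ℓ → ∫ s in (0 : ℝ)..T, m s ≤ Mb →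
    ∀ {u : ℝ → HSpace O}, IsWeakSol γ p F T u₀ (fun s => G s (u s)) u →
      (∀ t ∈ Set.Icc 0 T, ‖u t‖ ≤ R) ∧ ∫ s in (0 : ℝ)..T, ‖Dop γ (u s)‖ ^ 2 ≤ R ∧
        ∫ s in (0 : ℝ)..T, (powInt p (u s)).toReal ≤ R := by
  obtain ⟨k₂, hk₂, k₃, hk₃, hap⟩ := a_priori hA
  obtain ⟨N, hN⟩ := exists_nat_ge (2 * (4 * |Mb|))
  set A : ℝ := ‖u₀‖ ^ 2 + 2 * k₂ * T + 2 * |Mb| with hAdef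
  have hA0 : 0 ≤ A := by positivity
  set Z : ℝ := 2 ^ N * A with hZ
  have hZ0 : 0 ≤ Z := by positivity
  refine ⟨√Z + Z + Z / k₃ + 1, by positivity, fun {G m ℓ} hG hm {u} hu => ?_⟩
  have hm' := hm.trans (le_abs_self Mb)
  have h0 : (0 : ℝ) ∈ Set.Icc 0 T := ⟨le_rfl, hT.le⟩
  have hTm : T ∈ Set.Icc 0 T := ⟨hT.le, le_rfl⟩
  have hf := hG.integrableOn hu.cont
  have hfu := integrableOn_inner_continuous hf hu.cont
  have h4m : IntegrableOn (fun s => 4 * m s) (Set.Ioc 0 T) := hG.m_int.const_mul 4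
  have hc : Continuous fun s => ‖u s‖ ^ 2 := hu.cont.norm.pow 2
  have i1 : IntegrableOn (fun s => 4 * m s * ‖u s‖ ^ 2) (Set.Ioc 0 T) :=
    integrableOn_mul_continuous h4m hc
  have i2 : IntegrableOn (fun s => 2 * m s) (Set.Ioc 0 T) := hG.m_int.const_mul 2
  have i3 : IntegrableOn (fun s => 2 * m s + 4 * m s * ‖u s‖ ^ 2) (Set.Ioc 0 T) := i2.add i1
  have key : ∀ t ∈ Set.Icc 0 T, ‖u t‖ ^ 2 + 2 * (∫ s in (0 : ℝ)..t, ‖Dop γ (u s)‖ ^ 2) +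
      2 * k₃ * (∫ s in (0 : ℝ)..t, (powInt p (u s)).toReal) ≤
      A + ∫ s in (0 : ℝ)..t, 4 * m s * ‖u s‖ ^ 2 := by
    intro t ht
    refine (hap hT hu hf t ht).trans ?_
    have h1 : 2 * ∫ s in (0 : ℝ)..t, inner ℝ (G s (u s)) (u s) ≤
        ∫ s in (0 : ℝ)..t, (2 * m s + 4 * m s * ‖u s‖ ^ 2) := by
      rw [← intervalIntegral.integral_const_mul]
      refine intervalIntegral_mono_ae_Ioc (hfu.const_mul 2) i3 ?_ ht
      filter_upwards [hG.growth] with s hs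
      have h2 := real_inner_le_norm (G s (u s)) (u s)
      have h3 := mul_le_mul_of_nonneg_right (hs (u s)) (norm_nonneg (u s))
      have h5 := mul_nonneg (hG.m_nonneg s) (sq_nonneg (‖u s‖ - 1))
      nlinarith [hG.m_nonneg s, mul_nonneg (hG.m_nonneg s) (sq_nonneg ‖u s‖)]
    rw [intervalIntegral.integral_add (intervalIntegrable_of_integrableOn i2 h0 ht)
      (intervalIntegrable_of_integrableOn i1 h0 ht), intervalIntegral.integral_const_mul] at h1
    have h2 : ∫ s in (0 : ℝ)..t, m s ≤ ∫ s in (0 : ℝ)..T, m s :=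
      intervalIntegral.integral_mono_interval le_rfl ht.1 ht.2
        (Eventually.of_forall hG.m_nonneg) (intervalIntegrable_of_integrableOn hG.m_int h0 hTm)
    have h3 : 2 * k₂ * t ≤ 2 * k₂ * T := mul_le_mul_of_nonneg_left ht.2 (by positivity)
    rw [hAdef]
    linarith
  have hD0 : ∀ t ∈ Set.Icc 0 T, 0 ≤ ∫ s in (0 : ℝ)..t, ‖Dop γ (u s)‖ ^ 2 := fun t ht =>
    intervalIntegral.integral_nonneg ht.1 fun s _ => by positivity
  have hP0 : ∀ t ∈ Set.Icc 0 T, 0 ≤ k₃ * ∫ s in (0 : ℝ)..t, (powInt p (u s)).toReal := fun t ht =>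
    mul_nonneg hk₃.le (intervalIntegral.integral_nonneg ht.1 fun s _ => ENNReal.toReal_nonneg)
  have hψ : ∀ t ∈ Set.Icc 0 T, ‖u t‖ ^ 2 ≤ A + ∫ s in (0 : ℝ)..t, 4 * m s * ‖u s‖ ^ 2 :=
    fun t ht => by
      have h1 := key t ht
      have h2 := hD0 t ht
      have h3 := hP0 t ht
      linarith
  have h4m0 : ∀ s, 0 ≤ 4 * m s := fun s => mul_nonneg (by norm_num) (hG.m_nonneg s)
  have hIm : ∫ s in (0 : ℝ)..T, 4 * m s ≤ N / 2 := by
    rw [intervalIntegral.integral_const_mul]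
    linarith
  have hfin := gronwall_integrable hA0 h4m h4m0 hc (fun _ => by positivity) hψ N T hTm hIm
  have hkT := key T hTm
  have hs0 := Real.sqrt_nonneg Z
  have hZk : 0 ≤ Z / k₃ := by positivity
  refine ⟨fun t ht => ?_, ?_, ?_⟩
  · have h1 := le_of_gronwall hA0 h4m h4m0 hc (fun _ => by positivity) hψ hIm ht
    have h2 : ‖u t‖ ≤ √Z := Real.le_sqrt_of_sq_le h1
    linarith
  · have h1 := hP0 T hTm
    have h2 := hD0 T hTm
    have h3 : 0 ≤ ‖u T‖ ^ 2 := by positivity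
    linarith
  · have h2 := hD0 T hTm
    have h3 : 0 ≤ ‖u T‖ ^ 2 := by positivity
    have h4 : ∫ s in (0 : ℝ)..T, (powInt p (u s)).toReal ≤ Z / k₃ := by
      rw [le_div_iff₀ hk₃]
      have h1 := hP0 T hTm
      linarith
    linarith

/-- Stability with respect to the source. -/
theorem source_stability : ∃ κ > 0, ∀ {G G' : ℝ → HSpace O → HSpace O} {m m' : ℝ → ℝ}
    {ℓ ℓ' : ℝ → ℝ → ℝ} {u₀ : HSpace O} {u v : ℝ → HSpace O} {R ε : ℝ} {N : ℕ},
    IsSource T G m ℓ → IsSource T G' m' ℓ' →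
    IsWeakSol γ p F T u₀ (fun s => G s (u s)) u → IsWeakSol γ p F T u₀ (fun s => G' s (v s)) v →
    (∀ t ∈ Set.Icc 0 T, ‖u t‖ ≤ R) → (∀ t ∈ Set.Icc 0 T, ‖v t‖ ≤ R) → 0 ≤ ε →
    (∀ t ∈ Set.Icc 0 T, ∫ s in (0 : ℝ)..t, inner ℝ (G s (v s) - G' s (v s)) (u s - v s) ≤ ε) →
    2 * κ * T + 2 * ∫ s in (0 : ℝ)..T, ℓ R s ≤ N / 2 →
    ∀ t ∈ Set.Icc 0 T, ‖u t - v t‖ ^ 2 ≤ 2 ^ N * (2 * ε) := by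
  obtain ⟨κ, hκ, hst⟩ := stability hA
  refine ⟨κ, hκ, fun {G G' m m' ℓ ℓ' u₀ u v R ε N} hG hG' hu hv huR hvR hε hr hN t ht => ?_⟩
  have h0 : (0 : ℝ) ∈ Set.Icc 0 T := ⟨le_rfl, hT.le⟩
  have hTm : T ∈ Set.Icc 0 T := ⟨hT.le, le_rfl⟩
  have hwc : Continuous fun s => u s - v s := hu.cont.sub hv.cont
  have hc : Continuous fun s => ‖u s - v s‖ ^ 2 := hwc.norm.pow 2
  have k1 : IntegrableOn (fun _ : ℝ => 2 * κ) (Set.Ioc 0 T) := integrableOn_const (by simp)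
  have k2 : IntegrableOn (fun s => 2 * ℓ R s) (Set.Ioc 0 T) := (hG.ℓ_int R).const_mul 2
  have k3 : IntegrableOn (fun s => 2 * κ + 2 * ℓ R s) (Set.Ioc 0 T) := k1.add k2
  have i1 : IntegrableOn (fun s => (2 * κ + 2 * ℓ R s) * ‖u s - v s‖ ^ 2) (Set.Ioc 0 T) :=
    integrableOn_mul_continuous k3 hc
  have i2 : IntegrableOn (fun s => (inner ℝ (G s (v s) - G' s (v s)) (u s - v s) : ℝ))
      (Set.Ioc 0 T) :=
    integrableOn_inner_continuous ((hG.integrableOn hv.cont).sub (hG'.integrableOn hv.cont)) hwc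
  have i3 : IntegrableOn (fun s => (inner ℝ (G s (u s) - G' s (v s)) (u s - v s) : ℝ))
      (Set.Ioc 0 T) :=
    integrableOn_inner_continuous ((hG.integrableOn hu.cont).sub (hG'.integrableOn hv.cont)) hwc
  have i4 : IntegrableOn (fun s => κ * ‖u s - v s‖ ^ 2) (Set.Ioc 0 T) :=
    (continuous_const.mul hc).integrableOn_Ioc
  have i5 : IntegrableOn (fun s => κ * ‖u s - v s‖ ^ 2 +
      inner ℝ (G s (u s) - G' s (v s)) (u s - v s)) (Set.Ioc 0 T) := i4.add i3
  have i6 : IntegrableOn (fun s => 2 * inner ℝ (G s (v s) - G' s (v s)) (u s - v s))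
      (Set.Ioc 0 T) := i2.const_mul 2
  have i7 : IntegrableOn (fun s => (2 * κ + 2 * ℓ R s) * ‖u s - v s‖ ^ 2 +
      2 * inner ℝ (G s (v s) - G' s (v s)) (u s - v s)) (Set.Ioc 0 T) := i1.add i6
  have hψ : ∀ t ∈ Set.Icc 0 T, ‖u t - v t‖ ^ 2 ≤
      2 * ε + ∫ s in (0 : ℝ)..t, (2 * κ + 2 * ℓ R s) * ‖u s - v s‖ ^ 2 := by
    intro t ht
    have h1 := hst hT hu hv (hG.integrableOn hu.cont) (hG'.integrableOn hv.cont) t ht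
    have h2 : 0 ≤ ∫ s in (0 : ℝ)..t, ‖Dop γ (u s - v s)‖ ^ 2 :=
      intervalIntegral.integral_nonneg ht.1 fun s _ => by positivity
    have h3 : 2 * ∫ s in (0 : ℝ)..t, (κ * ‖u s - v s‖ ^ 2 +
        inner ℝ (G s (u s) - G' s (v s)) (u s - v s)) ≤ ∫ s in (0 : ℝ)..t,
        ((2 * κ + 2 * ℓ R s) * ‖u s - v s‖ ^ 2 +
          2 * inner ℝ (G s (v s) - G' s (v s)) (u s - v s)) := by
      rw [← intervalIntegral.integral_const_mul]
      refine intervalIntegral_mono_ae_Ioc (i5.const_mul 2) i7 ?_ ht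
      filter_upwards [hG.lip R, ae_restrict_mem measurableSet_Ioc] with s hs hsT
      have hs' : s ∈ Set.Icc 0 T := ⟨hsT.1.le, hsT.2⟩
      have h4 := hs (u s) (v s) (huR s hs') (hvR s hs')
      have h5 : G s (u s) - G' s (v s) = (G s (u s) - G s (v s)) + (G s (v s) - G' s (v s)) := by
        abel
      rw [h5, inner_add_left]
      have h6 := real_inner_le_norm (G s (u s) - G s (v s)) (u s - v s)
      have h7 := mul_le_mul_of_nonneg_right h4 (norm_nonneg (u s - v s))
      have h8 : ‖u s - v s‖ ^ 2 = ‖u s - v s‖ * ‖u s - v s‖ := sq _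
      rw [h8]
      linarith
    rw [intervalIntegral.integral_add (intervalIntegrable_of_integrableOn i1 h0 ht)
      (intervalIntegrable_of_integrableOn i6 h0 ht), intervalIntegral.integral_const_mul] at h3
    have h8 := hr t ht
    rw [sub_self, norm_zero] at h1
    linarith
  refine le_of_gronwall (ℓ := fun s => 2 * κ + 2 * ℓ R s) (by positivity) k3
    (fun s => add_nonneg (by positivity) (mul_nonneg zero_le_two (hG.ℓ_nonneg R s))) hc
    (fun _ => by positivity) hψ ?_ ht
  rw [intervalIntegral.integral_add (intervalIntegrable_of_integrableOn k1 h0 hTm)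
    (intervalIntegrable_of_integrableOn k2 h0 hTm), intervalIntegral.integral_const,
    intervalIntegral.integral_const_mul, smul_eq_mul, sub_zero]
  linarith

theorem source_unique {G : ℝ → HSpace O → HSpace O} {m : ℝ → ℝ} {ℓ : ℝ → ℝ → ℝ}
    (hG : IsSource T G m ℓ) {u₀ : HSpace O} {u v : ℝ → HSpace O}
    (hu : IsWeakSol γ p F T u₀ (fun s => G s (u s)) u)
    (hv : IsWeakSol γ p F T u₀ (fun s => G s (v s)) v) : Set.EqOn u v (Set.Icc 0 T) := by
  obtain ⟨R, hR, hap⟩ := source_a_priori hA hT u₀ (∫ s in (0 : ℝ)..T, m s)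
  obtain ⟨κ, hκ, hst⟩ := source_stability (p := p) hA hT
  obtain ⟨N, hN⟩ := exists_nat_ge (2 * (2 * κ * T + 2 * ∫ s in (0 : ℝ)..T, ℓ R s))
  intro t ht
  have h1 := hst hG hG hu hv (hap hG le_rfl hu).1 (hap hG le_rfl hv).1 le_rfl
    (fun t _ => by simp) (N := N) (by linarith) t ht
  have h2 : ‖u t - v t‖ = 0 := by
    have h3 := norm_nonneg (u t - v t)
    nlinarith
  exact sub_eq_zero.1 (norm_eq_zero.1 h2)

theorem source_exists {G : ℝ → HSpace O → HSpace O} {m : ℝ → ℝ} {ℓ : ℝ → ℝ → ℝ}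
    (hG : IsSource T G m ℓ) (u₀ : HSpace O) :
    ∃ u : C(Set.Icc 0 T, HSpace O), IsWeakSol γ p F T u₀
      (fun s => G s (Set.IccExtend hT.le u s)) (Set.IccExtend hT.le u) := by
  obtain ⟨R, hR, hap⟩ := source_a_priori hA hT u₀ (∫ s in (0 : ℝ)..T, m s)
  obtain ⟨B, hB, hBle⟩ := norm_sub_le_of_isWeakSol hA T
  have hGR := hG.truncate hR
  have hex : ∀ x : C(Set.Icc 0 T, HSpace O), ∃ u : ℝ → HSpace O, IsWeakSol γ p F T u₀
      (fun s => G s (radial R (Set.IccExtend hT.le x s))) u := fun x =>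
    exists_isWeakSol hA hT u₀ (hGR.integrableOn x.continuous.Icc_extend')
  choose S hS using hex
  let S' : C(Set.Icc 0 T, HSpace O) → C(Set.Icc 0 T, HSpace O) := fun x =>
    ⟨fun t => S x t, (hS x).cont.comp continuous_subtype_val⟩
  have h0 : (0 : ℝ) ∈ Set.Icc 0 T := ⟨le_rfl, hT.le⟩
  obtain ⟨x, hx⟩ := exists_fixedPoint_of_volterra hT.le (ℓ := fun s => B * (2 * ℓ R s))
    (((hG.ℓ_int R).const_mul 2).const_mul B)
    (fun s => mul_nonneg hB.le (mul_nonneg zero_le_two (hG.ℓ_nonneg R s))) S' (fun x y t => by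
      have ix := hGR.integrableOn (u := Set.IccExtend hT.le x) x.continuous.Icc_extend'
      have iy := hGR.integrableOn (u := Set.IccExtend hT.le y) y.continuous.Icc_extend'
      have h1 := hBle (hS x) (hS y) ix iy t t.2
      rw [sub_self, norm_zero, zero_add] at h1
      refine h1.trans ?_
      have hc : Continuous fun s => ‖Set.IccExtend hT.le x s - Set.IccExtend hT.le y s‖ :=
        (x.continuous.Icc_extend'.sub y.continuous.Icc_extend').norm
      have i1 := integrableOn_mul_continuous (((hG.ℓ_int R).const_mul 2).const_mul B) hc
      rw [← intervalIntegral.integral_const_mul]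
      refine intervalIntegral_mono_ae_Ioc ((ix.sub iy).norm.const_mul B) i1 ?_ t.2
      filter_upwards [hGR.lip (max ‖x‖ ‖y‖)] with s hs
      rw [mul_assoc]
      refine mul_le_mul_of_nonneg_left (hs _ _ ?_ ?_) hB.le
      · exact (x.norm_coe_le_norm _).trans (le_max_left _ _)
      · exact (y.norm_coe_le_norm _).trans (le_max_right _ _))
  have hxS : ∀ t ∈ Set.Icc 0 T, Set.IccExtend hT.le x t = S x t := fun t ht => by
    rw [Set.IccExtend_of_mem hT.le _ ht]
    conv_lhs => rw [← hx]
    rfl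
  have hxI : ∀ t ∈ Set.Ioc 0 T, Set.IccExtend hT.le x t = S x t := fun t ht =>
    hxS t ⟨ht.1.le, ht.2⟩
  have hsol : IsWeakSol γ p F T u₀ (fun s => G s (radial R (Set.IccExtend hT.le x s)))
      (Set.IccExtend hT.le x) := by
    refine ⟨x.continuous.Icc_extend', ?_, ?_, fun t ht v hv hv' => ?_⟩
    · rw [setLIntegral_congr_fun measurableSet_Ioc fun s hs => by rw [hxI s hs]]
      exact (hS x).memV
    · rw [setLIntegral_congr_fun measurableSet_Ioc fun s hs => by rw [hxI s hs]]
      exact (hS x).memP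
    · rw [hxS t ht, (hS x).eqn t ht v hv hv']
      congr 1
      refine intervalIntegral.integral_congr fun s hs => ?_
      rw [Set.uIcc_of_le ht.1] at hs
      rw [hxS s ⟨hs.1, hs.2.trans ht.2⟩]
  have hbd := (hap hGR le_rfl hsol).1
  refine ⟨x, hsol.cont, hsol.memV, hsol.memP, fun t ht v hv hv' => ?_⟩
  rw [hsol.eqn t ht v hv hv']
  congr 1
  refine intervalIntegral.integral_congr fun s hs => ?_
  rw [Set.uIcc_of_le ht.1] at hs
  rw [radial_of_norm_le hR (hbd s ⟨hs.1, hs.2.trans ht.2⟩)]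

end

end FracSkeleton

namespace FracSkeleton

/-! ### Integrals over the time interval -/

section Time
variable {T : ℝ} (hT : 0 < T)

lemma lintegral_timeVol (φ : Set.Icc (0 : ℝ) T → ℝ≥0∞) :
    ∫⁻ t, φ t ∂(timeVol T) = ∫⁻ s in Set.Ioc 0 T, φ (Set.projIcc 0 T hT.le s) := by
  have h := lintegral_subtype_comap (μ := (volume : Measure ℝ)) (s := Set.Icc 0 T)
    measurableSet_Icc (fun s => φ (Set.projIcc 0 T hT.le s))
  simp only [Set.projIcc_val] at h
  rw [timeVol, h, ← restrict_Ioc_eq_restrict_Icc]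

lemma measurePreserving_projIcc :
    MeasurePreserving (Set.projIcc 0 T hT.le) (volume.restrict (Set.Ioc 0 T)) (timeVol T) := by
  have hm : Measurable (Set.projIcc 0 T hT.le) := continuous_projIcc.measurable
  refine ⟨hm, ?_⟩
  ext B hB
  rw [Measure.map_apply hm hB, ← lintegral_indicator_one hB, lintegral_timeVol hT,
    ← lintegral_indicator_one (hm hB)]
  rfl

lemma setIntegral_timeVol {X : Type*} [NormedAddCommGroup X] [NormedSpace ℝ X]
    (φ : Set.Icc (0 : ℝ) T → X) (t : Set.Icc (0 : ℝ) T) :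
    ∫ s in Set.Iic t, φ s ∂(timeVol T) = ∫ s in (0 : ℝ)..t, φ (Set.projIcc 0 T hT.le s) := by
  have h := integral_subtype_comap (μ := (volume : Measure ℝ)) (s := Set.Icc 0 T)
    measurableSet_Icc
    (fun s => (Set.Iic t).indicator φ (Set.projIcc 0 T hT.le s))
  simp only [Set.projIcc_val] at h
  rw [← integral_indicator measurableSet_Iic, timeVol, h,
    intervalIntegral.integral_of_le t.2.1, ← integral_indicator measurableSet_Ioc,
    integral_Icc_eq_integral_Ioc, ← integral_indicator measurableSet_Ioc]
  congr 1
  ext s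
  by_cases hs : s ∈ Set.Ioc 0 T
  · have hs' : s ∈ Set.Icc 0 T := ⟨hs.1.le, hs.2⟩
    by_cases hst : s ≤ t
    · rw [Set.indicator_of_mem hs, Set.indicator_of_mem (show s ∈ Set.Ioc 0 (t : ℝ) from ⟨hs.1, hst⟩),
        Set.indicator_of_mem]
      rw [Set.projIcc_of_mem hT.le hs']
      exact hst
    · rw [Set.indicator_of_mem hs, Set.indicator_of_notMem
        (show s ∉ Set.Ioc 0 (t : ℝ) from fun h => hst h.2), Set.indicator_of_notMem]
      rw [Set.projIcc_of_mem hT.le hs']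
      exact hst
  · rw [Set.indicator_of_notMem hs, Set.indicator_of_notMem
      (fun h => hs ⟨h.1, h.2.trans t.2.2⟩)]

lemma integral_timeVol {X : Type*} [NormedAddCommGroup X] [NormedSpace ℝ X]
    (φ : Set.Icc (0 : ℝ) T → X) :
    ∫ s, φ s ∂(timeVol T) = ∫ s in (0 : ℝ)..T, φ (Set.projIcc 0 T hT.le s) := by
  have h := setIntegral_timeVol hT φ ⟨T, hT.le, le_rfl⟩
  rwa [show Set.Iic (⟨T, hT.le, le_rfl⟩ : Set.Icc (0 : ℝ) T) = Set.univ from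
    Set.eq_univ_of_forall fun s => s.2.2, Measure.restrict_univ] at h

end Time

/-! ### The entropy and its convex conjugate -/

/-- The Young function `x ↦ eˣ - 1 - x` conjugate to the entropy `r ↦ r log r - r + 1`. -/
def expGap (x : ℝ) : ℝ := Real.exp x - 1 - x

lemma expGap_nonneg (x : ℝ) : 0 ≤ expGap x := by
  have := Real.add_one_le_exp x
  rw [expGap]; linarith

lemma mul_sub_one_le_expGap_add_klFun (y : ℝ) {b : ℝ} (hb : 0 ≤ b) :
    y * (b - 1) ≤ expGap y + InformationTheory.klFun b := by
  rw [expGap, InformationTheory.klFun]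
  rcases hb.eq_or_lt with rfl | hb
  · have := Real.exp_pos y
    simp; linarith
  · have h1 := mul_le_mul_of_nonneg_left (Real.add_one_le_exp (y - Real.log b)) hb.le
    rw [Real.exp_sub, Real.exp_log hb, mul_div_cancel₀ _ hb.ne'] at h1
    linarith

lemma mul_abs_sub_one_le_expGap_add_klFun {x b : ℝ} (hx : 0 ≤ x) (hb : 0 ≤ b) :
    x * |b - 1| ≤ expGap x + InformationTheory.klFun b := by
  rcases le_total 0 (b - 1) with h | h
  · rw [abs_of_nonneg h]
    exact mul_sub_one_le_expGap_add_klFun x hb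
  · rw [abs_of_nonpos h]
    have h1 := mul_sub_one_le_expGap_add_klFun (-x) hb
    have h2 : expGap (-x) ≤ expGap x := by
      have h3 := Real.self_le_sinh_iff.2 hx
      rw [Real.sinh_eq] at h3
      rw [expGap, expGap]; linarith
    linarith

lemma expGap_le {x : ℝ} (hx : 0 ≤ x) : expGap x ≤ x ^ 2 * Real.exp x := by
  have h1 : Real.exp x - 1 ≤ x * Real.exp x := by
    have h2 := mul_le_mul_of_nonneg_right (Real.add_one_le_exp (-x)) (Real.exp_pos x).le
    rw [← Real.exp_add, neg_add_cancel, Real.exp_zero] at h2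
    linarith
  have h3 := mul_le_mul_of_nonneg_left h1 hx
  have h4 : expGap x ≤ x * (Real.exp x - 1) := by
    have h5 : 0 ≤ x * Real.exp x - (Real.exp x - 1) := by linarith
    rw [expGap]; nlinarith
  nlinarith

/-- A finite-valued Young function, up to a multiplicative constant. -/
structure IsYoung (Ψ : ℝ → ℝ) : Prop where
  zero : Ψ 0 = 0
  cont : Continuous Ψ
  mono : MonotoneOn Ψ (Set.Ici 0)
  scale : ∀ κ a : ℝ, 0 ≤ κ → 0 ≤ a → a ≤ 1 → Ψ (κ * a) ≤ a * Ψ κ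

lemma IsYoung.nonneg {Ψ : ℝ → ℝ} (h : IsYoung Ψ) {x : ℝ} (hx : 0 ≤ x) : 0 ≤ Ψ x := by
  rw [← h.zero]
  exact h.mono Set.self_mem_Ici hx hx

lemma isYoung_sq : IsYoung fun x => x ^ 2 where
  zero := by simp
  cont := by fun_prop
  mono x hx y hy hxy := pow_le_pow_left₀ hx hxy 2
  scale κ a hκ ha ha1 := by
    have h1 : 0 ≤ κ ^ 2 * (a * (1 - a)) :=
      mul_nonneg (sq_nonneg _) (mul_nonneg ha (sub_nonneg.2 ha1))
    nlinarith

lemma isYoung_two_mul_expGap : IsYoung fun x => 2 * expGap x where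
  zero := by simp [expGap]
  cont := by unfold expGap; fun_prop
  mono x hx y hy hxy := by
    have hx' : (0 : ℝ) ≤ x := hx
    have h1 := Real.add_one_le_exp (y - x)
    have h2 : Real.exp y = Real.exp x * Real.exp (y - x) := by
      rw [← Real.exp_add]; congr 1; ring
    have h3 : 1 ≤ Real.exp x := Real.one_le_exp hx'
    have h4 : (y - x) * 1 ≤ (y - x) * Real.exp x :=
      mul_le_mul_of_nonneg_left h3 (sub_nonneg.2 hxy)
    have h5 := mul_le_mul_of_nonneg_left h1 (Real.exp_pos x).le
    simp only [expGap]
    nlinarith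
  scale κ a hκ ha ha1 := by
    have h := convexOn_exp.2 (Set.mem_univ κ) (Set.mem_univ 0) ha (sub_nonneg.2 ha1)
      (by ring : a + (1 - a) = 1)
    simp only [smul_eq_mul, mul_zero, add_zero, Real.exp_zero, mul_one] at h
    simp only [expGap]
    rw [mul_comm κ a]
    nlinarith

/-- The weight `exp(δ N²)` of the exponential integrability condition. -/
def expWeight (δ : ℝ) (N : ℝ≥0∞) : ℝ≥0∞ :=
  EReal.exp ((ENNReal.ofReal δ * N ^ 2 : ℝ≥0∞) : EReal)

lemma measurable_expWeight (δ : ℝ) : Measurable (expWeight δ) := by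
  have h1 : Measurable fun N : ℝ≥0∞ => ENNReal.ofReal δ * N ^ 2 :=
    (measurable_id.pow_const 2).const_mul _
  exact EReal.measurable_exp.comp (measurable_coe_ennreal_ereal.comp h1)

lemma ofReal_exp_le_expWeight {δ a : ℝ} {N : ℝ≥0∞} (hδ : 0 ≤ δ) (ha : 0 ≤ a)
    (h : ENNReal.ofReal a ≤ N) : ENNReal.ofReal (Real.exp (δ * a ^ 2)) ≤ expWeight δ N := by
  rw [expWeight, ← EReal.exp_coe]
  refine EReal.exp_monotone ?_
  have h1 : ENNReal.ofReal (δ * a ^ 2) ≤ ENNReal.ofReal δ * N ^ 2 := by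
    rw [ENNReal.ofReal_mul hδ, ENNReal.ofReal_pow ha]
    gcongr
  refine le_trans (le_of_eq ?_) (EReal.coe_ennreal_le_coe_ennreal_iff.2 h1)
  rw [EReal.coe_ennreal_ofReal, max_eq_left (by positivity)]

lemma expGap_le_add_expWeight {δ a c K : ℝ} {N : ℝ≥0∞} (hδ : 0 < δ) (ha : 0 ≤ a) (hc : 0 ≤ c)
    (hK : 0 ≤ K) (h : ENNReal.ofReal a ≤ N) :
    ENNReal.ofReal (expGap (c * a)) ≤
      ENNReal.ofReal (c ^ 2 * Real.exp (c * K)) * ENNReal.ofReal a ^ 2 +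
        ENNReal.ofReal (Real.exp (c ^ 2 / (4 * δ))) *
          (Set.Ioi (ENNReal.ofReal K)).indicator (expWeight δ) N := by
  by_cases hN : N ∈ Set.Ioi (ENNReal.ofReal K)
  · refine le_add_left ?_
    rw [Set.indicator_of_mem hN]
    refine le_trans ?_ (mul_le_mul_right (ofReal_exp_le_expWeight hδ.le ha h) _)
    rw [← ENNReal.ofReal_mul (Real.exp_pos _).le, ← Real.exp_add]
    refine ENNReal.ofReal_le_ofReal ?_
    have h1 : c * a ≤ c ^ 2 / (4 * δ) + δ * a ^ 2 := by
      have h2 : 0 ≤ (c - 2 * δ * a) ^ 2 / (4 * δ) := by positivity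
      have h3 : (c - 2 * δ * a) ^ 2 / (4 * δ) = c ^ 2 / (4 * δ) + δ * a ^ 2 - c * a := by
        field_simp; ring
      linarith
    have h4 := Real.exp_le_exp.2 h1
    have h5 : 0 ≤ c * a := by positivity
    rw [expGap]; linarith
  · refine le_add_right ?_
    have h1 : a ≤ K := by
      have h2 : ENNReal.ofReal a ≤ ENNReal.ofReal K := h.trans (not_lt.1 hN)
      exact (ENNReal.ofReal_le_ofReal_iff hK).1 h2
    rw [← ENNReal.ofReal_pow ha, ← ENNReal.ofReal_mul (by positivity)]
    refine ENNReal.ofReal_le_ofReal ((expGap_le (by positivity)).trans ?_)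
    have h3 : Real.exp (c * a) ≤ Real.exp (c * K) :=
      Real.exp_le_exp.2 (mul_le_mul_of_nonneg_left h1 hc)
    nlinarith [mul_le_mul_of_nonneg_left h3 (by positivity : 0 ≤ (c * a) ^ 2)]

/-! ### Exponential integrability forces a bound off a set of finite measure -/

section Threshold
variable {E : Type*} [MeasurableSpace E] {T : ℝ}

/-- Since time is non-atomic, a set of infinite measure has subsets of every measure. -/
lemma exists_subset_lamT_eq (hT : 0 < T) (lam : Measure E) [SigmaFinite lam]
    {C : Set (Set.Icc (0 : ℝ) T × E)} (hC : MeasurableSet C) (hCt : lamT T lam C = ∞) {c : ℝ}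
    (hc : 0 ≤ c) : ∃ B ⊆ C, MeasurableSet B ∧ lamT T lam B = ENNReal.ofReal c := by
  obtain ⟨k, hk⟩ : ∃ k, ENNReal.ofReal c < lamT T lam (C ∩ Set.univ ×ˢ spanningSets lam k) := by
    have h1 : Tendsto (fun k => lamT T lam (C ∩ Set.univ ×ˢ spanningSets lam k)) atTop
        (𝓝 (lamT T lam (⋃ k, C ∩ Set.univ ×ˢ spanningSets lam k))) := by
      refine tendsto_measure_iUnion_atTop fun i j hij => ?_
      exact Set.inter_subset_inter_right _
        (Set.prod_mono_right (monotone_spanningSets lam hij))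
    rw [← Set.inter_iUnion, ← Set.prod_iUnion, iUnion_spanningSets, Set.univ_prod_univ,
      Set.inter_univ, hCt] at h1
    exact (h1.eventually (lt_mem_nhds ENNReal.ofReal_lt_top)).exists
  set S := spanningSets lam k with hS
  have hSm : MeasurableSet S := measurableSet_spanningSets lam k
  have hSf : lam S < ∞ := measure_spanningSets_lt_top lam k
  let f : ℝ → ℝ := fun s => (lamT T lam).real (C ∩ {t : Set.Icc (0 : ℝ) T | (t : ℝ) ≤ s} ×ˢ S)
  have hIm : ∀ s : ℝ, MeasurableSet {t : Set.Icc (0 : ℝ) T | (t : ℝ) ≤ s} := fun s =>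
    measurableSet_le measurable_subtype_coe measurable_const
  have hfin : ∀ D : Set (Set.Icc (0 : ℝ) T), lamT T lam (D ×ˢ S) ≠ ∞ := fun D => by
    rw [lamT, Measure.prod_prod]
    exact ENNReal.mul_ne_top (measure_ne_top _ _) hSf.ne
  have hlip : ∀ s t, s ≤ t → f t ≤ f s + lam.real S * (t - s) := by
    intro s t hst
    have h1 : C ∩ {τ : Set.Icc (0 : ℝ) T | (τ : ℝ) ≤ t} ×ˢ S ⊆
        (C ∩ {τ : Set.Icc (0 : ℝ) T | (τ : ℝ) ≤ s} ×ˢ S) ∪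
          {τ : Set.Icc (0 : ℝ) T | (τ : ℝ) ∈ Set.Ioc s t} ×ˢ S := by
      rintro ⟨τ, ξ⟩ ⟨h2, h3, h4⟩
      by_cases h5 : (τ : ℝ) ≤ s
      · exact Or.inl ⟨h2, h5, h4⟩
      · exact Or.inr ⟨⟨not_le.1 h5, h3⟩, h4⟩
    have h2 : (timeVol T).real {τ : Set.Icc (0 : ℝ) T | (τ : ℝ) ∈ Set.Ioc s t} ≤ t - s := by
      rw [Measure.real, timeVol, comap_subtype_coe_apply measurableSet_Icc]
      refine ENNReal.toReal_le_of_le_ofReal (sub_nonneg.2 hst) ?_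
      rw [← Real.volume_Ioc]
      refine measure_mono ?_
      rintro _ ⟨τ, h, rfl⟩
      exact h
    refine (measureReal_mono h1 ?_).trans ((measureReal_union_le _ _).trans ?_)
    · exact (measure_union_lt_top ((measure_mono Set.inter_subset_right).trans_lt
        (hfin _).lt_top) (hfin _).lt_top).ne
    · refine add_le_add le_rfl ?_
      rw [lamT, measureReal_prod_prod, mul_comm]
      exact mul_le_mul_of_nonneg_left h2 measureReal_nonneg
  have hmono : Monotone f := fun s t hst => measureReal_mono
    (Set.inter_subset_inter_right _ (Set.prod_mono_left fun τ h => le_trans h hst))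
    ((measure_mono Set.inter_subset_right).trans_lt (hfin _).lt_top).ne
  have hcont : Continuous f := by
    refine (LipschitzWith.of_le_add_mul (Real.toNNReal (lam.real S)) fun x y => ?_).continuous
    rw [Real.coe_toNNReal _ measureReal_nonneg, Real.dist_eq]
    rcases le_total x y with h | h
    · exact (hmono h).trans (le_add_of_nonneg_right (mul_nonneg measureReal_nonneg (abs_nonneg _)))
    · rw [abs_of_nonneg (sub_nonneg.2 h)]
      exact hlip y x h
  have hf0 : f (-1) ≤ c := by
    have h1 : {t : Set.Icc (0 : ℝ) T | (t : ℝ) ≤ -1} = ∅ := by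
      ext t
      have := t.2.1
      simp only [Set.mem_ofPred_eq, Set.mem_empty_iff_false, iff_false, not_le]
      linarith
    simp only [f, h1, Set.empty_prod, Set.inter_empty, measureReal_empty]
    exact hc
  have hfT : c ≤ f T := by
    have h1 : {t : Set.Icc (0 : ℝ) T | (t : ℝ) ≤ T} = Set.univ :=
      Set.eq_univ_of_forall fun t => t.2.2
    simp only [f, h1]
    rw [Measure.real, ← ENNReal.ofReal_le_iff_le_toReal]
    · exact hk.le
    · exact ((measure_mono Set.inter_subset_right).trans_lt (hfin _).lt_top).ne
  obtain ⟨s, -, hs⟩ := intermediate_value_Icc (by linarith : (-1 : ℝ) ≤ T) hcont.continuousOn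
    ⟨hf0, hfT⟩
  refine ⟨_, Set.inter_subset_left, hC.inter ((hIm s).prod hSm), ?_⟩
  rw [← hs, ofReal_measureReal ((measure_mono Set.inter_subset_right).trans_lt (hfin _).lt_top).ne]

lemma exists_lamT_lt_top (hT : 0 < T) (lam : Measure E) [SigmaFinite lam] {δ : ℝ} (hδ : 0 < δ)
    {N : Set.Icc (0 : ℝ) T × E → ℝ≥0∞} (hN : Measurable N)
    (h : ∀ B, MeasurableSet B → lamT T lam B < ∞ →
      ∫⁻ z in B, expWeight δ (N z) ∂(lamT T lam) < ∞) :
    ∃ K : ℝ, 0 ≤ K ∧ lamT T lam {z | ENNReal.ofReal K < N z} < ∞ := by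
  by_contra! hcon
  have hm : ∀ j : ℕ, MeasurableSet {z | ENNReal.ofReal j < N z} := fun j =>
    measurableSet_lt measurable_const hN
  choose B hBs hBm hB using fun j : ℕ => exists_subset_lamT_eq hT lam (hm j)
    (top_le_iff.1 (hcon j (Nat.cast_nonneg j))) (c := j * Real.exp (-(δ * (j : ℝ) ^ 2)))
    (by positivity)
  have hsum : Summable fun j : ℕ => (j : ℝ) * Real.exp (-(δ * (j : ℝ) ^ 2)) := by
    have h1 := Real.summable_pow_mul_exp_neg_nat_mul 1 hδ
    refine Summable.of_nonneg_of_le (fun j => by positivity) (fun j => ?_) h1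
    rw [pow_one]
    refine mul_le_mul_of_nonneg_left (Real.exp_le_exp.2 ?_) (Nat.cast_nonneg j)
    have h2 : (j : ℝ) ≤ (j : ℝ) ^ 2 := by
      exact_mod_cast Nat.le_self_pow two_ne_zero j
    nlinarith
  have hfin : lamT T lam (⋃ j, B j) < ∞ := by
    refine (measure_iUnion_le B).trans_lt ?_
    simp_rw [hB]
    rw [← ENNReal.ofReal_tsum_of_nonneg (fun j => by positivity) hsum]
    exact ENNReal.ofReal_lt_top
  have h1 := h _ (MeasurableSet.iUnion hBm) hfin
  refine absurd (top_le_iff.1 (ENNReal.le_of_forall_nnreal_lt (x := ∞) fun r _ => ?_)) h1.ne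
  obtain ⟨j, hj⟩ := exists_nat_ge r
  refine (ENNReal.coe_le_coe.2 hj).trans ?_
  calc ((j : ℝ≥0) : ℝ≥0∞) = ENNReal.ofReal (Real.exp (δ * (j : ℝ) ^ 2)) * lamT T lam (B j) := by
        rw [hB, ← ENNReal.ofReal_mul (Real.exp_pos _).le, mul_left_comm, ← Real.exp_add,
          add_neg_cancel, Real.exp_zero, mul_one, ENNReal.ofReal_natCast]
        simp
    _ = ∫⁻ _ in B j, ENNReal.ofReal (Real.exp (δ * (j : ℝ) ^ 2)) ∂(lamT T lam) := by
        rw [setLIntegral_const]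
    _ ≤ ∫⁻ z in B j, expWeight δ (N z) ∂(lamT T lam) :=
        setLIntegral_mono' (hBm j) fun z hz =>
          ofReal_exp_le_expWeight hδ.le (Nat.cast_nonneg j) (le_of_lt (hBs j hz))
    _ ≤ ∫⁻ z in ⋃ j, B j, expWeight δ (N z) ∂(lamT T lam) :=
        lintegral_mono_set (Set.subset_iUnion B j)

end Threshold

end FracSkeleton

namespace FracSkeleton

/-! ### Hilbert-Schmidt bounds -/

section HilbertSchmidt
variable {ι U K : Type*} [NormedAddCommGroup U] [InnerProductSpace ℝ U]
  [NormedAddCommGroup K] [InnerProductSpace ℝ K] (a : HilbertBasis ι ℝ U) (G : U →L[ℝ] K)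

lemma hasSum_inner_smul_apply (y : U) : HasSum (fun i => (inner ℝ (a i) y : ℝ) • G (a i)) (G y) := by
  have h := G.hasSum (a.hasSum_repr y)
  simpa only [map_smul, HilbertBasis.repr_apply_apply] using h

variable {G}

lemma sum_norm_sq_le_of_hsNormSq_le {M : ℝ} (hM : 0 ≤ M) (h : hsNormSq a G ≤ ENNReal.ofReal M)
    (S : Finset ι) : ∑ i ∈ S, ‖G (a i)‖ ^ 2 ≤ M := by
  have h1 : ∑ i ∈ S, ‖G (a i)‖ₑ ^ 2 ≤ ENNReal.ofReal M := (ENNReal.sum_le_tsum S).trans h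
  rw [← ENNReal.ofReal_le_ofReal_iff hM, ENNReal.ofReal_sum_of_nonneg fun i _ => by positivity]
  simpa only [ENNReal.ofReal_pow (norm_nonneg _), ofReal_norm] using h1

lemma sum_abs_mul_norm_le {M : ℝ} (hM : 0 ≤ M) (h : hsNormSq a G ≤ ENNReal.ofReal M) (y : U)
    (S : Finset ι) : ∑ i ∈ S, ‖(inner ℝ (a i) y : ℝ) • G (a i)‖ ≤ Real.sqrt M * ‖y‖ := by
  simp only [norm_smul]
  refine (Real.sum_mul_le_sqrt_mul_sqrt S _ _).trans ?_
  rw [mul_comm]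
  refine mul_le_mul (Real.sqrt_le_sqrt (sum_norm_sq_le_of_hsNormSq_le a hM h S)) ?_
    (Real.sqrt_nonneg _) (Real.sqrt_nonneg _)
  exact Real.sqrt_le_iff.2 ⟨norm_nonneg _, a.orthonormal.sum_inner_products_le y⟩

lemma norm_apply_le_of_hsNormSq_le {M : ℝ} (hM : 0 ≤ M) (h : hsNormSq a G ≤ ENNReal.ofReal M)
    (y : U) : ‖G y‖ ≤ Real.sqrt M * ‖y‖ :=
  le_of_tendsto (hasSum_inner_smul_apply a G y).norm
    (Eventually.of_forall fun S => (norm_sum_le _ _).trans (sum_abs_mul_norm_le a hM h y S))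

end HilbertSchmidt

section Diffusion
variable {ι U : Type*} [NormedAddCommGroup U] [InnerProductSpace ℝ U]
  {d : ℕ} {O : Set (Space d)} {T : ℝ} {a : HilbertBasis ι ℝ U}
  {g : Set.Icc (0 : ℝ) T → HSpace O → U →L[ℝ] HSpace O}

lemma CondG.continuous (hg : CondG T a g) (s : Set.Icc (0 : ℝ) T) (y : U) :
    Continuous fun x => g s x y := by
  refine continuous_iff_continuousAt.2 fun x => ?_
  obtain ⟨L, hL, hlip⟩ := hg.1 (‖x‖ + 1) (by positivity)
  rw [ContinuousAt, tendsto_iff_norm_sub_tendsto_zero]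
  have h1 : Tendsto (fun x' : HSpace O => Real.sqrt (L * ‖x' - x‖ ^ 2) * ‖y‖) (𝓝 x) (𝓝 0) := by
    have hc : Continuous fun x' : HSpace O => Real.sqrt (L * ‖x' - x‖ ^ 2) * ‖y‖ := by fun_prop
    have := hc.tendsto x
    simpa using this
  refine squeeze_zero' (Eventually.of_forall fun _ => norm_nonneg _) ?_ h1
  filter_upwards [Metric.ball_mem_nhds x one_pos] with x' hx'
  rw [mem_ball_iff_norm] at hx'
  have h2 : ‖x'‖ ≤ ‖x‖ + 1 := by
    have := norm_sub_norm_le x' x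
    linarith
  exact norm_apply_le_of_hsNormSq_le a (by positivity) (hlip s x' x h2 (by linarith)) y

lemma CondG.measurable (hg : CondG T a g) (y : U) :
    Measurable fun z : Set.Icc (0 : ℝ) T × HSpace O => g z.1 z.2 y := by
  have h := measurable_uncurry_of_continuous_of_measurable
    (u := fun (x : HSpace O) (s : Set.Icc (0 : ℝ) T) => g s x y) (fun s => hg.continuous s y)
    (fun x => hg.2.2 x y)
  exact h.comp measurable_swap

lemma CondG.aestronglyMeasurable [Countable ι] (hg : CondG T a g) {u : Set.Icc (0 : ℝ) T → HSpace O}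
    (hu : Continuous u) (σ : L2Time T U) :
    AEStronglyMeasurable (fun s => g s (u s) (σ s)) (timeVol T) := by
  refine aestronglyMeasurable_of_tendsto_ae (u := (atTop : Filter (Finset ι)))
    (f := fun S s => ∑ i ∈ S, (inner ℝ (a i) (σ s) : ℝ) • g s (u s) (a i)) (fun S => ?_) ?_
  · refine Finset.aestronglyMeasurable_fun_sum S fun i _ => ?_
    have h1 : AEStronglyMeasurable (fun s => (inner ℝ (a i) (σ s) : ℝ)) (timeVol T) :=
      aestronglyMeasurable_const.inner (Lp.stronglyMeasurable σ).aestronglyMeasurable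
    have h2 : Measurable fun s => g s (u s) (a i) :=
      (hg.measurable (a i)).comp (measurable_id.prodMk hu.measurable)
    exact h1.smul h2.aestronglyMeasurable
  · exact Eventually.of_forall fun s => hasSum_inner_smul_apply a (g s (u s)) (σ s)

end Diffusion

/-! ### Bounds for the jump term -/

section Jump
variable {E : Type*} [MeasurableSpace E] {T : ℝ}

/-- The part of the weight `exp(δ N²)` above a threshold is integrable. -/
lemma ExpIntegrable.exists_weight (hT : 0 < T) {lam : Measure E} [SigmaFinite lam]
    {N : Set.Icc (0 : ℝ) T × E → ℝ≥0∞} (h : ExpIntegrable (lamT T lam) N) :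
    ∃ δ > 0, ∃ K ≥ 0, ∃ N' : Set.Icc (0 : ℝ) T × E → ℝ≥0∞, Measurable N' ∧
      N =ᵐ[lamT T lam] N' ∧
      ∫⁻ z, (Set.Ioi (ENNReal.ofReal K)).indicator (expWeight δ) (N' z) ∂(lamT T lam) < ∞ := by
  obtain ⟨hN, δ, hδ, hB⟩ := h
  have hB' : ∀ B, MeasurableSet B → lamT T lam B < ∞ →
      ∫⁻ z in B, expWeight δ (hN.mk N z) ∂(lamT T lam) < ∞ := by
    intro B hBm hBf
    refine lt_of_eq_of_lt (lintegral_congr_ae ?_) (hB B hBm hBf)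
    filter_upwards [ae_restrict_of_ae hN.ae_eq_mk] with z hz
    rw [hz, expWeight]
  obtain ⟨K, hK, hKf⟩ := exists_lamT_lt_top hT lam hδ hN.measurable_mk hB'
  refine ⟨δ, hδ, K, hK, hN.mk N, hN.measurable_mk, hN.ae_eq_mk, ?_⟩
  have hm : MeasurableSet {z | ENNReal.ofReal K < hN.mk N z} :=
    measurableSet_lt measurable_const hN.measurable_mk
  refine lt_of_eq_of_lt ?_ (hB' _ hm hKf)
  rw [← lintegral_indicator hm]
  rfl

lemma lintegral_enorm_smul_le {Y : Type*} [NormedAddCommGroup Y] [NormedSpace ℝ Y]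
    {lam : Measure E} {N : E → ℝ≥0∞} {b : E → ℝ≥0} (hb : Measurable b) {k : E → Y}
    (hk : AEStronglyMeasurable k lam) {c C K δ : ℝ} (hc : 0 < c) (hK : 0 ≤ K) (hδ : 0 < δ)
    (hkN : ∀ᵐ ξ ∂lam, ‖k ξ‖ₑ ≤ ENNReal.ofReal c * N ξ)
    (hkC : ∫⁻ ξ, ‖k ξ‖ₑ ^ 2 ∂lam ≤ ENNReal.ofReal (C * c ^ 2)) :
    ∫⁻ ξ, ‖((b ξ : ℝ) - 1) • k ξ‖ₑ ∂lam ≤ ENNReal.ofReal c *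
      (ENNReal.ofReal (Real.exp K) * ENNReal.ofReal C +
        ENNReal.ofReal (Real.exp (1 / (4 * δ))) *
          ∫⁻ ξ, (Set.Ioi (ENNReal.ofReal K)).indicator (expWeight δ) (N ξ) ∂lam +
        ∫⁻ ξ, ENNReal.ofReal (InformationTheory.klFun (b ξ)) ∂lam) := by
  have hpt : ∀ᵐ ξ ∂lam, ‖((b ξ : ℝ) - 1) • k ξ‖ₑ ≤ ENNReal.ofReal c *
      (ENNReal.ofReal (Real.exp K) * (ENNReal.ofReal (c⁻¹ ^ 2) * ‖k ξ‖ₑ ^ 2) +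
        ENNReal.ofReal (InformationTheory.klFun (b ξ)) +
        ENNReal.ofReal (Real.exp (1 / (4 * δ))) *
          (Set.Ioi (ENNReal.ofReal K)).indicator (expWeight δ) (N ξ)) := by
    filter_upwards [hkN] with ξ hξ
    have ha : 0 ≤ c⁻¹ * ‖k ξ‖ := by positivity
    have h1 : ENNReal.ofReal (c⁻¹ * ‖k ξ‖) ≤ N ξ := by
      rw [ENNReal.ofReal_mul (by positivity), ofReal_norm, ENNReal.ofReal_inv_of_pos hc]
      rw [mul_comm, ← div_eq_mul_inv]
      exact ENNReal.div_le_of_le_mul' hξ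
    have h2 := expGap_le_add_expWeight hδ ha zero_le_one hK h1
    have h3 := mul_abs_sub_one_le_expGap_add_klFun ha (b ξ).2
    have h4 : ‖((b ξ : ℝ) - 1) • k ξ‖ₑ =
        ENNReal.ofReal c * ENNReal.ofReal (c⁻¹ * ‖k ξ‖ * |(b ξ : ℝ) - 1|) := by
      rw [← ENNReal.ofReal_mul hc.le, ← ofReal_norm, norm_smul, Real.norm_eq_abs]
      congr 1
      field_simp
    have h5 : ENNReal.ofReal (c⁻¹ * ‖k ξ‖) ^ 2 = ENNReal.ofReal (c⁻¹ ^ 2) * ‖k ξ‖ₑ ^ 2 := by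
      rw [ENNReal.ofReal_mul (by positivity), mul_pow, ofReal_norm,
        ENNReal.ofReal_pow (by positivity)]
    rw [one_mul, one_mul, one_pow, one_mul, h5] at h2
    rw [h4]
    refine mul_le_mul_right ((ENNReal.ofReal_le_ofReal h3).trans ?_) _
    rw [ENNReal.ofReal_add (expGap_nonneg _) (InformationTheory.klFun_nonneg (b ξ).2),
      add_right_comm]
    exact add_le_add h2 le_rfl
  have hbm : Measurable fun ξ => ENNReal.ofReal (InformationTheory.klFun (b ξ)) :=
    (InformationTheory.measurable_klFun.comp hb.coe_nnreal_real).ennreal_ofReal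
  have hk2 : AEMeasurable (fun ξ => ENNReal.ofReal (Real.exp K) *
      (ENNReal.ofReal (c⁻¹ ^ 2) * ‖k ξ‖ₑ ^ 2)) lam :=
    ((hk.enorm.pow_const 2).const_mul _).const_mul _
  have hk3 : AEMeasurable (fun ξ => ENNReal.ofReal (Real.exp K) *
      (ENNReal.ofReal (c⁻¹ ^ 2) * ‖k ξ‖ₑ ^ 2) +
        ENNReal.ofReal (InformationTheory.klFun (b ξ))) lam := hk2.add hbm.aemeasurable
  refine (lintegral_mono_ae hpt).trans ?_
  rw [lintegral_const_mul' _ _ ENNReal.ofReal_ne_top,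
    lintegral_add_left' hk3, lintegral_add_left' hk2,
    lintegral_const_mul' _ _ ENNReal.ofReal_ne_top, lintegral_const_mul' _ _ ENNReal.ofReal_ne_top,
    lintegral_const_mul' _ _ ENNReal.ofReal_ne_top, add_right_comm]
  gcongr
  refine (mul_le_mul_right hkC _).trans ?_
  rw [← ENNReal.ofReal_mul (by positivity)]
  refine le_of_eq (congrArg _ ?_)
  field_simp

lemma ExpIntegrable.exists_bound {Y : Type*} [NormedAddCommGroup Y] [NormedSpace ℝ Y] (hT : 0 < T)
    {lam : Measure E} [SigmaFinite lam]
    {N : Set.Icc (0 : ℝ) T × E → ℝ≥0∞} (h : ExpIntegrable (lamT T lam) N) (C : ℝ) :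
    ∃ θ : Set.Icc (0 : ℝ) T → ℝ≥0∞, Measurable θ ∧ ∫⁻ s, θ s ∂(timeVol T) < ∞ ∧
      ∀ᵐ s ∂(timeVol T), ∀ b : E → ℝ≥0, Measurable b → ∀ k : E → Y,
        AEStronglyMeasurable k lam → ∀ c : ℝ, 0 < c →
        (∀ ξ, ‖k ξ‖ₑ ≤ ENNReal.ofReal c * N (s, ξ)) →
        ∫⁻ ξ, ‖k ξ‖ₑ ^ 2 ∂lam ≤ ENNReal.ofReal (C * c ^ 2) →
        ∫⁻ ξ, ‖((b ξ : ℝ) - 1) • k ξ‖ₑ ∂lam ≤ ENNReal.ofReal c *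
          (θ s + ∫⁻ ξ, ENNReal.ofReal (InformationTheory.klFun (b ξ)) ∂lam) := by
  obtain ⟨δ, hδ, K, hK, N', hN', hNN, hfin⟩ := h.exists_weight hT
  have hwm : Measurable fun z => (Set.Ioi (ENNReal.ofReal K)).indicator (expWeight δ) (N' z) :=
    ((measurable_expWeight δ).indicator measurableSet_Ioi).comp hN'
  refine ⟨fun s => ENNReal.ofReal (Real.exp K) * ENNReal.ofReal C +
    ENNReal.ofReal (Real.exp (1 / (4 * δ))) *
      ∫⁻ ξ, (Set.Ioi (ENNReal.ofReal K)).indicator (expWeight δ) (N' (s, ξ)) ∂lam, ?_, ?_, ?_⟩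
  · exact (hwm.lintegral_prod_right'.const_mul _).const_add _
  · rw [lintegral_add_left measurable_const, lintegral_const,
      lintegral_const_mul' _ _ ENNReal.ofReal_ne_top]
    refine ENNReal.add_lt_top.2 ⟨?_, ?_⟩
    · exact ENNReal.mul_lt_top (ENNReal.mul_lt_top ENNReal.ofReal_lt_top ENNReal.ofReal_lt_top)
        (measure_lt_top _ _)
    · refine ENNReal.mul_lt_top ENNReal.ofReal_lt_top ?_
      rw [lamT, lintegral_prod _ hwm.aemeasurable] at hfin
      exact hfin
  · filter_upwards [Measure.ae_ae_of_ae_prod hNN] with s hs b hb k hk c hc hkN hkC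
    refine lintegral_enorm_smul_le hb hk hc hK hδ ?_ hkC
    filter_upwards [hs] with ξ hξ
    rw [← hξ]
    exact hkN ξ

variable {d : ℕ} {O : Set (Space d)} {h : Set.Icc (0 : ℝ) T → HSpace O → E → HSpace O}

lemma enorm_le_mul_hNorm0 (s : Set.Icc (0 : ℝ) T) (x : HSpace O) (ξ : E) :
    ‖h s x ξ‖ₑ ≤ ENNReal.ofReal (1 + ‖x‖) * hNorm0 h (s, ξ) := by
  have h1 : ‖h s x ξ‖ₑ / (1 + ‖x‖ₑ) ≤ hNorm0 h (s, ξ) :=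
    le_iSup (fun u : HSpace O => ‖h s u ξ‖ₑ / (1 + ‖u‖ₑ)) x
  rw [ENNReal.ofReal_add zero_le_one (norm_nonneg _), ofReal_norm, ENNReal.ofReal_one]
  exact (ENNReal.div_le_iff' (by simp) (by simp)).1 h1

lemma enorm_sub_le_mul_hNorm1 (s : Set.Icc (0 : ℝ) T) {x y : HSpace O} (hxy : x ≠ y) (ξ : E) :
    ‖h s x ξ - h s y ξ‖ₑ ≤ ENNReal.ofReal ‖x - y‖ * hNorm1 h (s, ξ) := by
  have h1 : ‖h s x ξ - h s y ξ‖ₑ / ‖x - y‖ₑ ≤ hNorm1 h (s, ξ) :=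
    le_iSup_of_le x (le_iSup_of_le y (le_iSup_of_le hxy le_rfl))
  rw [ofReal_norm]
  refine (ENNReal.div_le_iff' ?_ (by simp)).1 h1
  exact enorm_ne_zero.2 (sub_ne_zero.2 hxy)

lemma CondH.measurable_section {lam : Measure E} (hh : CondH T lam h) (s : Set.Icc (0 : ℝ) T)
    (x : HSpace O) : Measurable fun ξ => h s x ξ := by
  have h1 : Measurable fun ξ : E => (s, x, ξ) :=
    measurable_const.prodMk (measurable_const.prodMk measurable_id)
  exact hh.1.comp h1

end Jump

/-! ### The right-hand side of the skeleton equation -/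

section Source
variable {ι U : Type*} [NormedAddCommGroup U] [InnerProductSpace ℝ U]
  {E : Type*} [MeasurableSpace E] {d : ℕ} {O : Set (Space d)} {T : ℝ}

/-- The jump contribution `∫ h(s, x, ξ) (ρ(s, ξ) - 1) lam(dξ)`. -/
def jumpSource (lam : Measure E) (h : Set.Icc (0 : ℝ) T → HSpace O → E → HSpace O)
    (ρ : Set.Icc (0 : ℝ) T × E → ℝ≥0) (s : Set.Icc (0 : ℝ) T) (x : HSpace O) : HSpace O :=
  ∫ ξ, ((ρ (s, ξ) : ℝ) - 1) • h s x ξ ∂lam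

/-- The right-hand side `g(s, x) σ(s) + ∫ h(s, x, ξ) (ρ(s, ξ) - 1) lam(dξ)`. -/
def skelSource (g : Set.Icc (0 : ℝ) T → HSpace O → U →L[ℝ] HSpace O) (lam : Measure E)
    (h : Set.Icc (0 : ℝ) T → HSpace O → E → HSpace O) (σ : L2Time T U)
    (ρ : Set.Icc (0 : ℝ) T × E → ℝ≥0) (s : Set.Icc (0 : ℝ) T) (x : HSpace O) : HSpace O :=
  g s x (σ s) + jumpSource lam h ρ s x

lemma isSource_comp_projIcc (hT : 0 < T) {X : Type*} [NormedAddCommGroup X]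
    {G : Set.Icc (0 : ℝ) T → X → X} {m : Set.Icc (0 : ℝ) T → ℝ} {ℓ : ℝ → Set.Icc (0 : ℝ) T → ℝ}
    (meas : ∀ u : Set.Icc (0 : ℝ) T → X, Continuous u →
      AEStronglyMeasurable (fun s => G s (u s)) (timeVol T))
    (m_nonneg : ∀ s, 0 ≤ m s) (m_int : Integrable m (timeVol T)) (ℓ_nonneg : ∀ r s, 0 ≤ ℓ r s)
    (ℓ_int : ∀ r, Integrable (ℓ r) (timeVol T))
    (growth : ∀ᵐ s ∂(timeVol T), ∀ x, ‖G s x‖ ≤ m s * (1 + ‖x‖))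
    (lip : ∀ r, ∀ᵐ s ∂(timeVol T), ∀ x y, ‖x‖ ≤ r → ‖y‖ ≤ r →
      ‖G s x - G s y‖ ≤ ℓ r s * ‖x - y‖) :
    IsSource T (fun s => G (Set.projIcc 0 T hT.le s)) (fun s => m (Set.projIcc 0 T hT.le s))
      (fun r s => ℓ r (Set.projIcc 0 T hT.le s)) where
  meas u hu := by
    have h1 := (meas (fun s => u s) (hu.comp continuous_subtype_val)).comp_measurePreserving
      (measurePreserving_projIcc hT)
    refine h1.congr ?_
    filter_upwards [ae_restrict_mem measurableSet_Ioc] with s hs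
    rw [Function.comp_apply, Set.projIcc_of_mem hT.le ⟨hs.1.le, hs.2⟩]
  m_nonneg s := m_nonneg _
  m_int := (measurePreserving_projIcc hT).integrable_comp_of_integrable m_int
  ℓ_nonneg r s := ℓ_nonneg r _
  ℓ_int r := (measurePreserving_projIcc hT).integrable_comp_of_integrable (ℓ_int r)
  growth := (measurePreserving_projIcc hT).quasiMeasurePreserving.ae growth
  lip r := (measurePreserving_projIcc hT).quasiMeasurePreserving.ae (lip r)

variable [Countable ι] {a : HilbertBasis ι ℝ U}
  {g : Set.Icc (0 : ℝ) T → HSpace O → U →L[ℝ] HSpace O}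
  {lam : Measure E} [SigmaFinite lam] {h : Set.Icc (0 : ℝ) T → HSpace O → E → HSpace O}

lemma MemS.integral_norm_le {Υ : ℕ} {σ : L2Time T U} {ρ : Set.Icc (0 : ℝ) T × E → ℝ≥0}
    (hS : MemS lam Υ σ ρ) : ∫ s, ‖σ s‖ ∂(timeVol T) ≤ (timeVol T).real Set.univ + 2 * Υ := by
  have h1 : Integrable (fun s => ‖σ s‖ ^ 2) (timeVol T) := (Lp.memLp σ).integrable_norm_pow two_ne_zero
  have h2 : Integrable (fun s => ‖σ s‖) (timeVol T) := ((Lp.memLp σ).integrable one_le_two).norm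
  have h3 : ∫ s, ‖σ s‖ ∂(timeVol T) ≤ ∫ s, (1 + ‖σ s‖ ^ 2) ∂(timeVol T) :=
    integral_mono h2 ((integrable_const _).add h1) fun s => by
      have := sq_nonneg (‖σ s‖ - 1)
      have := norm_nonneg (σ s)
      simp only
      nlinarith
  rw [integral_add (integrable_const _) h1, integral_const, smul_eq_mul, mul_one] at h3
  have h4 := hS.1
  linarith

omit [Countable ι] in
lemma measurable_klFun_coe {Z : Type*} [MeasurableSpace Z] {b : Z → ℝ≥0} (hb : Measurable b) :
    Measurable fun z => ENNReal.ofReal (InformationTheory.klFun (b z)) :=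
  (InformationTheory.measurable_klFun.comp hb.coe_nnreal_real).ennreal_ofReal

omit [Countable ι] in
lemma MemS.lintegral_klFun_le {Υ : ℕ} {σ : L2Time T U} {ρ : Set.Icc (0 : ℝ) T × E → ℝ≥0}
    (hS : MemS lam Υ σ ρ) : ∫⁻ s, ∫⁻ ξ, ENNReal.ofReal (InformationTheory.klFun (ρ (s, ξ))) ∂lam
      ∂(timeVol T) ≤ Υ := by
  have h1 := hS.2.2
  rwa [lamT, lintegral_prod _ (measurable_klFun_coe hS.2.1).aemeasurable] at h1

variable (hh : CondH T lam h)
include hh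

omit [Countable ι] in
/-- The jump term has linear growth and is Lipschitz, with constants whose integrals are controlled
by the entropy. -/
lemma exists_jumpSource_bound (hT : 0 < T) (hexp₀ : ExpIntegrable (lamT T lam) (hNorm0 h))
    (hexp₁ : ExpIntegrable (lamT T lam) (hNorm1 h)) :
    ∃ Θ : ℝ≥0, ∀ (Υ : ℕ) (σ : L2Time T U) (ρ : Set.Icc (0 : ℝ) T × E → ℝ≥0), MemS lam Υ σ ρ →
      ∃ m : Set.Icc (0 : ℝ) T → ℝ, (∀ s, 0 ≤ m s) ∧ Integrable m (timeVol T) ∧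
        ∫ s, m s ∂(timeVol T) ≤ Θ + Υ ∧
        (∀ᵐ s ∂(timeVol T), ∀ x, Integrable (fun ξ => ((ρ (s, ξ) : ℝ) - 1) • h s x ξ) lam) ∧
        (∀ᵐ s ∂(timeVol T), ∀ x, ‖jumpSource lam h ρ s x‖ ≤ m s * (1 + ‖x‖)) ∧
        ∀ᵐ s ∂(timeVol T), ∀ x y,
          ‖jumpSource lam h ρ s x - jumpSource lam h ρ s y‖ ≤ m s * ‖x - y‖ := by
  obtain ⟨L, hL, hLip⟩ := hh.2.1
  obtain ⟨C, hC, hgr⟩ := hh.2.2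
  obtain ⟨θ₀, hm₀, hf₀, hb₀⟩ := hexp₀.exists_bound (Y := HSpace O) hT C
  obtain ⟨θ₁, hm₁, hf₁, hb₁⟩ := hexp₁.exists_bound (Y := HSpace O) hT L
  have hΘ : ∫⁻ s, θ₀ s ∂(timeVol T) + ∫⁻ s, θ₁ s ∂(timeVol T) ≠ ∞ :=
    (ENNReal.add_lt_top.2 ⟨hf₀, hf₁⟩).ne
  refine ⟨(∫⁻ s, θ₀ s ∂(timeVol T) + ∫⁻ s, θ₁ s ∂(timeVol T)).toNNReal, fun Υ σ ρ hS => ?_⟩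
  set k : Set.Icc (0 : ℝ) T → ℝ≥0∞ := fun s =>
    ∫⁻ ξ, ENNReal.ofReal (InformationTheory.klFun (ρ (s, ξ))) ∂lam with hk
  have hkm : Measurable k := (measurable_klFun_coe hS.2.1).lintegral_prod_right'
  set M : Set.Icc (0 : ℝ) T → ℝ≥0∞ := fun s => θ₀ s + θ₁ s + k s with hM
  have hMm : Measurable M := (hm₀.add hm₁).add hkm
  have hMle : ∫⁻ s, M s ∂(timeVol T) ≤
      (∫⁻ s, θ₀ s ∂(timeVol T) + ∫⁻ s, θ₁ s ∂(timeVol T)) + Υ := by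
    rw [hM, lintegral_add_right _ hkm, lintegral_add_right _ hm₁]
    exact add_le_add le_rfl hS.lintegral_klFun_le
  have hMtop : (∫⁻ s, θ₀ s ∂(timeVol T) + ∫⁻ s, θ₁ s ∂(timeVol T)) + (Υ : ℝ≥0∞) ≠ ∞ :=
    ENNReal.add_ne_top.2 ⟨hΘ, ENNReal.natCast_ne_top Υ⟩
  have hMfin : ∫⁻ s, M s ∂(timeVol T) ≠ ∞ := ne_top_of_le_ne_top hMtop hMle
  have hae : ∀ᵐ s ∂(timeVol T), M s < ∞ := ae_lt_top hMm hMfin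
  have hρs : ∀ s, Measurable fun ξ => ρ (s, ξ) := fun s => hS.2.1.comp measurable_prodMk_left
  have hkey₀ : ∀ᵐ s ∂(timeVol T), ∀ x, ∫⁻ ξ, ‖((ρ (s, ξ) : ℝ) - 1) • h s x ξ‖ₑ ∂lam ≤
      ENNReal.ofReal (1 + ‖x‖) * M s := by
    filter_upwards [hb₀] with s hs x
    refine (hs _ (hρs s) (fun ξ => h s x ξ) (hh.measurable_section s x).aestronglyMeasurable
      (1 + ‖x‖) (by positivity) (enorm_le_mul_hNorm0 s x) ?_).trans ?_
    · refine (hgr s x).trans (ENNReal.ofReal_le_ofReal (mul_le_mul_of_nonneg_left ?_ hC.le))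
      nlinarith [norm_nonneg x]
    · refine mul_le_mul_right ?_ _
      exact add_le_add le_self_add le_rfl
  have hkey₁ : ∀ᵐ s ∂(timeVol T), ∀ x y, x ≠ y →
      ∫⁻ ξ, ‖((ρ (s, ξ) : ℝ) - 1) • (h s x ξ - h s y ξ)‖ₑ ∂lam ≤
      ENNReal.ofReal ‖x - y‖ * M s := by
    filter_upwards [hb₁] with s hs x y hxy
    refine (hs _ (hρs s) (fun ξ => h s x ξ - h s y ξ)
      ((hh.measurable_section s x).sub (hh.measurable_section s y)).aestronglyMeasurable
      ‖x - y‖ (norm_pos_iff.2 (sub_ne_zero.2 hxy)) (enorm_sub_le_mul_hNorm1 s hxy)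
      (hLip s x y)).trans ?_
    refine mul_le_mul_right ?_ _
    exact add_le_add le_add_self le_rfl
  have hint : ∀ᵐ s ∂(timeVol T), ∀ x,
      Integrable (fun ξ => ((ρ (s, ξ) : ℝ) - 1) • h s x ξ) lam := by
    filter_upwards [hkey₀, hae] with s h1 h2 x
    have hm : Measurable fun ξ => ((ρ (s, ξ) : ℝ) - 1) • h s x ξ :=
      ((hρs s).coe_nnreal_real.sub_const 1).smul (hh.measurable_section s x)
    exact ⟨hm.aestronglyMeasurable, (h1 x).trans_lt (ENNReal.mul_lt_top ENNReal.ofReal_lt_top h2)⟩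
  have hreal : ∀ {y : HSpace O} {c : ℝ} {s}, 0 ≤ c → M s < ∞ →
      ‖y‖ₑ ≤ ENNReal.ofReal c * M s → ‖y‖ ≤ (M s).toReal * c := by
    intro y c s hc hs hy
    have h1 := ENNReal.toReal_mono (ENNReal.mul_lt_top ENNReal.ofReal_lt_top hs).ne hy
    rwa [toReal_enorm, ENNReal.toReal_mul, ENNReal.toReal_ofReal hc, mul_comm] at h1
  refine ⟨fun s => (M s).toReal, fun s => ENNReal.toReal_nonneg,
    integrable_toReal_of_lintegral_ne_top hMm.aemeasurable hMfin, ?_, hint, ?_, ?_⟩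
  · rw [integral_toReal hMm.aemeasurable hae]
    have h1 := ENNReal.toReal_mono hMtop hMle
    rwa [ENNReal.toReal_add hΘ (ENNReal.natCast_ne_top Υ), ENNReal.toReal_natCast] at h1
  · filter_upwards [hkey₀, hae] with s h1 h2 x
    exact hreal (by positivity) h2 ((enorm_integral_le_lintegral_enorm _).trans (h1 x))
  · filter_upwards [hkey₁, hae, hint] with s h1 h2 h3 x y
    by_cases hxy : x = y
    · simp [hxy]
    · refine hreal (norm_nonneg _) h2 ?_
      rw [jumpSource, jumpSource, ← integral_sub (h3 x) (h3 y)]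
      simp only [← smul_sub]
      exact (enorm_integral_le_lintegral_enorm _).trans (h1 x y hxy)

omit [Countable ι] in
lemma aestronglyMeasurable_jumpSource {u : Set.Icc (0 : ℝ) T → HSpace O} (hu : Continuous u)
    {ρ : Set.Icc (0 : ℝ) T × E → ℝ≥0} (hρ : Measurable ρ) :
    AEStronglyMeasurable (fun s => jumpSource lam h ρ s (u s)) (timeVol T) := by
  have h1 : Measurable fun z : Set.Icc (0 : ℝ) T × E => h z.1 (u z.1) z.2 :=
    hh.1.comp (measurable_fst.prodMk ((hu.measurable.comp measurable_fst).prodMk measurable_snd))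
  have h2 : Measurable fun z : Set.Icc (0 : ℝ) T × E => ((ρ z : ℝ) - 1) • h z.1 (u z.1) z.2 :=
    (hρ.coe_nnreal_real.sub_const 1).smul h1
  exact (h2.stronglyMeasurable.integral_prod_right' (ν := lam)).aestronglyMeasurable

/-- The right-hand side of the skeleton equation is a source, with constants that are controlled
uniformly over `S^Υ`. -/
theorem exists_isSource (hT : 0 < T) (hg : CondG T a g)
    (hexp₀ : ExpIntegrable (lamT T lam) (hNorm0 h))
    (hexp₁ : ExpIntegrable (lamT T lam) (hNorm1 h)) (Υ : ℕ) :
    ∃ (Mb : ℝ) (Lb : ℝ → ℝ), ∀ (σ : L2Time T U) (ρ : Set.Icc (0 : ℝ) T × E → ℝ≥0),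
      MemS lam Υ σ ρ → ∃ (m : ℝ → ℝ) (ℓ : ℝ → ℝ → ℝ),
        IsSource T (fun s => skelSource g lam h σ ρ (Set.projIcc 0 T hT.le s)) m ℓ ∧
        ∫ s in (0 : ℝ)..T, m s ≤ Mb ∧ ∀ r, ∫ s in (0 : ℝ)..T, ℓ r s ≤ Lb r := by
  obtain ⟨Θ, hΘ⟩ := exists_jumpSource_bound (U := U) hh hT hexp₀ hexp₁
  obtain ⟨C, hC, hgr⟩ := hg.2.1
  have hlip : ∀ r : ℝ, ∃ L : ℝ, 0 < L ∧ ∀ t u₁ u₂, ‖u₁‖ ≤ r → ‖u₂‖ ≤ r →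
      hsNormSq a (g t u₁ - g t u₂) ≤ ENNReal.ofReal (L * ‖u₁ - u₂‖ ^ 2) := fun r => by
    obtain ⟨L, hL, hLe⟩ := hg.1 (max r 1) (by positivity)
    exact ⟨L, hL, fun t u₁ u₂ h₁ h₂ => hLe t u₁ u₂ (h₁.trans (le_max_left _ _))
      (h₂.trans (le_max_left _ _))⟩
  choose L hL hLe using hlip
  set S := (timeVol T).real Set.univ + 2 * Υ with hSdef
  refine ⟨Real.sqrt C * S + (Θ + Υ), fun r => Real.sqrt (L r) * S + (Θ + Υ), fun σ ρ hS => ?_⟩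
  obtain ⟨M, hM0, hMi, hMle, hMint, hMg, hMl⟩ := hΘ Υ σ ρ hS
  have hσi : Integrable (fun s => ‖σ s‖) (timeVol T) := ((Lp.memLp σ).integrable one_le_two).norm
  have hint : ∀ c : ℝ, Integrable (fun s => c * ‖σ s‖ + M s) (timeVol T) := fun c =>
    (hσi.const_mul c).add hMi
  have hle : ∀ c : ℝ, 0 ≤ c → ∫ s in (0 : ℝ)..T, (c * ‖σ (Set.projIcc 0 T hT.le s)‖ +
      M (Set.projIcc 0 T hT.le s)) ≤ c * S + (Θ + Υ) := fun c hc => by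
    rw [← integral_timeVol hT fun s => c * ‖σ s‖ + M s, integral_add (hσi.const_mul c) hMi,
      integral_const_mul]
    exact add_le_add (mul_le_mul_of_nonneg_left hS.integral_norm_le hc) hMle
  refine ⟨_, _, isSource_comp_projIcc hT (m := fun s => Real.sqrt C * ‖σ s‖ + M s)
    (ℓ := fun r s => Real.sqrt (L r) * ‖σ s‖ + M s) (fun u hu => ?_) (fun s => ?_) (hint _)
    (fun r s => ?_) (fun r => hint _) ?_ (fun r => ?_), hle _ (Real.sqrt_nonneg _),
    fun r => hle _ (Real.sqrt_nonneg _)⟩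
  · exact (hg.aestronglyMeasurable hu σ).add (aestronglyMeasurable_jumpSource hh hu hS.2.1)
  · have := hM0 s
    positivity
  · have := hM0 s
    positivity
  · filter_upwards [hMg] with s hs x
    have h1 := norm_apply_le_of_hsNormSq_le a (by positivity) (hgr s x) (σ s)
    have h2 : Real.sqrt (C * (1 + ‖x‖ ^ 2)) ≤ Real.sqrt C * (1 + ‖x‖) := by
      rw [Real.sqrt_mul hC.le]
      refine mul_le_mul_of_nonneg_left ?_ (Real.sqrt_nonneg _)
      refine Real.sqrt_le_iff.2 ⟨by positivity, ?_⟩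
      nlinarith [norm_nonneg x]
    have h3 := mul_le_mul_of_nonneg_right h2 (norm_nonneg (σ s))
    refine (norm_add_le _ _).trans ?_
    linarith [hs x]
  · filter_upwards [hMl] with s hs x y hx hy
    have h1 := norm_apply_le_of_hsNormSq_le a (mul_nonneg (hL r).le (sq_nonneg _))
      (hLe r s x y hx hy) (σ s)
    rw [Real.sqrt_mul (hL r).le, Real.sqrt_sq (norm_nonneg _)] at h1
    have h2 : skelSource g lam h σ ρ s x - skelSource g lam h σ ρ s y =
        (g s x - g s y) (σ s) + (jumpSource lam h ρ s x - jumpSource lam h ρ s y) := by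
      rw [skelSource, skelSource, sub_apply]
      abel
    rw [h2]
    refine (norm_add_le _ _).trans ?_
    linarith [hs x y]

end Source

end FracSkeleton

namespace FracSkeleton

/-! ### Densities with a uniform Young bound -/

/-- The functions `qₙ` are bounded, uniformly in `n`, in the sense of the Young inequality for `Ψ`. -/
structure IsYoungBounded {Z : Type*} [MeasurableSpace Z] (m : Measure Z) (Ψ : ℝ → ℝ) (M : ℝ≥0)
    (q : ℕ → Z → ℝ) : Prop where
  young : IsYoung Ψ
  meas : ∀ n, Measurable (q n)
  bound : ∀ n, ∃ y : Z → ℝ, Measurable y ∧ (∀ z, 0 ≤ y z) ∧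
    (∀ z x, 0 ≤ x → x * |q n z| ≤ Ψ x + y z) ∧ ∫⁻ z, ENNReal.ofReal (y z) ∂m ≤ M

namespace IsYoungBounded

variable {Z : Type*} [MeasurableSpace Z] {m : Measure Z} {Ψ : ℝ → ℝ} {M : ℝ≥0} {q : ℕ → Z → ℝ}
  (hq : IsYoungBounded m Ψ M q)
include hq

lemma lintegral_enorm_mul_le {Y : Type*} [NormedAddCommGroup Y] (a : Z → Y) {κ : ℝ} (hκ : 0 < κ)
    (n : ℕ) : ∫⁻ z, ‖q n z‖ₑ * ‖a z‖ₑ ∂m ≤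
      ENNReal.ofReal κ⁻¹ * (∫⁻ z, ENNReal.ofReal (Ψ (κ * ‖a z‖)) ∂m + M) := by
  obtain ⟨y, hym, hy0, hy, hyM⟩ := hq.bound n
  have hpt : ∀ z, ‖q n z‖ₑ * ‖a z‖ₑ ≤
      ENNReal.ofReal κ⁻¹ * (ENNReal.ofReal (Ψ (κ * ‖a z‖)) + ENNReal.ofReal (y z)) := fun z => by
    rw [← ENNReal.ofReal_add (hq.young.nonneg (by positivity)) (hy0 z),
      ← ENNReal.ofReal_mul (by positivity), ← ofReal_norm, ← ofReal_norm,
      ← ENNReal.ofReal_mul (norm_nonneg _)]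
    refine ENNReal.ofReal_le_ofReal ?_
    have h1 := mul_le_mul_of_nonneg_left (hy z (κ * ‖a z‖) (by positivity))
      (inv_nonneg.2 hκ.le)
    refine le_trans (le_of_eq ?_) h1
    rw [Real.norm_eq_abs]
    field_simp
  refine (lintegral_mono hpt).trans ?_
  rw [lintegral_const_mul' _ _ ENNReal.ofReal_ne_top, lintegral_add_right _ hym.ennreal_ofReal]
  gcongr

/-- Uniform integrability. -/
lemma exists_small {ε : ℝ} (hε : 0 < ε) : ∃ η > 0, ∀ a : Z → ℝ, (∀ z, ‖a z‖ ≤ 1) →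
    ∫⁻ z, ‖a z‖ₑ ∂m ≤ ENNReal.ofReal η → ∀ n, ∫⁻ z, ‖q n z‖ₑ * ‖a z‖ₑ ∂m ≤ ENNReal.ofReal ε := by
  set κ : ℝ := (M + 1) / ε with hκdef
  have hκ : 0 < κ := by positivity
  have hΨ : 0 ≤ Ψ κ := hq.young.nonneg hκ.le
  refine ⟨(Ψ κ + 1)⁻¹, by positivity, fun a ha1 ha n => ?_⟩
  refine (hq.lintegral_enorm_mul_le a hκ n).trans ?_
  have h1 : ∫⁻ z, ENNReal.ofReal (Ψ (κ * ‖a z‖)) ∂m ≤ 1 := by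
    calc ∫⁻ z, ENNReal.ofReal (Ψ (κ * ‖a z‖)) ∂m
        ≤ ∫⁻ z, ENNReal.ofReal (Ψ κ) * ‖a z‖ₑ ∂m := lintegral_mono fun z => by
          rw [← ofReal_norm, ← ENNReal.ofReal_mul hΨ, mul_comm (Ψ κ)]
          exact ENNReal.ofReal_le_ofReal (hq.young.scale κ _ hκ.le (norm_nonneg _) (ha1 z))
      _ ≤ ENNReal.ofReal (Ψ κ) * ENNReal.ofReal (Ψ κ + 1)⁻¹ := by
          rw [lintegral_const_mul' _ _ ENNReal.ofReal_ne_top]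
          gcongr
      _ ≤ 1 := by
          rw [← ENNReal.ofReal_mul hΨ, ← ENNReal.ofReal_one]
          refine ENNReal.ofReal_le_ofReal ?_
          rw [← div_eq_mul_inv, div_le_one (by positivity)]
          linarith
  calc ENNReal.ofReal κ⁻¹ * (∫⁻ z, ENNReal.ofReal (Ψ (κ * ‖a z‖)) ∂m + M)
      ≤ ENNReal.ofReal κ⁻¹ * ENNReal.ofReal (1 + M) := by
        rw [ENNReal.ofReal_add zero_le_one M.coe_nonneg, ENNReal.ofReal_one, ENNReal.ofReal_coe_nnreal]
        gcongr
    _ = ENNReal.ofReal ε := by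
        rw [← ENNReal.ofReal_mul (by positivity)]
        congr 1
        rw [hκdef]
        field_simp
        ring

lemma integrableOn {B : Set Z} (hB : MeasurableSet B) (hBf : m B < ∞) (n : ℕ) :
    IntegrableOn (q n) B m := by
  refine ⟨(hq.meas n).aestronglyMeasurable, ?_⟩
  have h1 := hq.lintegral_enorm_mul_le (B.indicator fun _ => (1 : ℝ)) one_pos n
  have h2 : ∀ z, ‖q n z‖ₑ * ‖B.indicator (fun _ => (1 : ℝ)) z‖ₑ =
      B.indicator (fun z => ‖q n z‖ₑ) z := fun z => by
    by_cases hz : z ∈ B <;> simp [hz]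
  have h3 : ∀ z, ENNReal.ofReal (Ψ (1 * ‖B.indicator (fun _ => (1 : ℝ)) z‖)) =
      B.indicator (fun _ => ENNReal.ofReal (Ψ 1)) z := fun z => by
    by_cases hz : z ∈ B <;> simp [hz, hq.young.zero]
  simp only [h2, h3, lintegral_indicator hB, setLIntegral_const] at h1
  refine lt_of_le_of_lt h1 ?_
  exact ENNReal.mul_lt_top ENNReal.ofReal_lt_top
    (ENNReal.add_lt_top.2 ⟨ENNReal.mul_lt_top ENNReal.ofReal_lt_top hBf, ENNReal.coe_lt_top⟩)

lemma integrable_mul {Y : Type*} [NormedAddCommGroup Y] [NormedSpace ℝ Y] {a : Z → Y}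
    (ha : AEStronglyMeasurable a m) (hfin : ∫⁻ z, ENNReal.ofReal (Ψ (1 * ‖a z‖)) ∂m < ∞) (n : ℕ) :
    Integrable (fun z => q n z • a z) m := by
  refine ⟨(hq.meas n).aestronglyMeasurable.smul ha, ?_⟩
  simp only [hasFiniteIntegral_iff_enorm, enorm_smul]
  refine (hq.lintegral_enorm_mul_le a one_pos n).trans_lt ?_
  exact ENNReal.mul_lt_top ENNReal.ofReal_lt_top
    (ENNReal.add_lt_top.2 ⟨hfin, ENNReal.coe_lt_top⟩)

end IsYoungBounded

/-! ### Convergence to zero, uniformly in the final time -/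

section Uniform
variable {E : Type*} [MeasurableSpace E] {T : ℝ} {lam : Measure E} [SigmaFinite lam]

instance : SigmaFinite (lamT T lam) := by
  rw [lamT]; infer_instance

variable {Ψ : ℝ → ℝ} {M : ℝ≥0} {q : ℕ → Set.Icc (0 : ℝ) T × E → ℝ}
  (hq : IsYoungBounded (lamT T lam) Ψ M q)

lemma lamT_fst_singleton (t : Set.Icc (0 : ℝ) T) :
    lamT T lam (Prod.fst ⁻¹' {t}) = 0 := by
  rw [← Set.prod_univ, lamT, Measure.prod_prod, measure_singleton, zero_mul]

/-- Strips around a time have small measure within a set of finite measure. -/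
lemma exists_nhds_strip {B : Set (Set.Icc (0 : ℝ) T × E)} (hBf : lamT T lam B < ∞)
    (t : Set.Icc (0 : ℝ) T) {η : ℝ} (hη : 0 < η) :
    ∃ r > 0, lamT T lam (B ∩ Prod.fst ⁻¹' Metric.ball t r) ≤ ENNReal.ofReal η := by
  have : IsFiniteMeasure ((lamT T lam).restrict B) := ⟨by simpa using hBf⟩
  set ν := ((lamT T lam).restrict B).map Prod.fst with hν
  have h0 : ν {t} < ENNReal.ofReal η := by
    rw [hν, Measure.map_apply measurable_fst (measurableSet_singleton t)]
    refine lt_of_le_of_lt (Measure.restrict_apply_le _ _) ?_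
    rw [lamT_fst_singleton]
    exact ENNReal.ofReal_pos.2 hη
  obtain ⟨V, hV, hVo, hVν⟩ := Set.exists_isOpen_lt_of_lt _ _ h0
  obtain ⟨r, hr, hrV⟩ := Metric.isOpen_iff.1 hVo t (hV rfl)
  refine ⟨r, hr, ?_⟩
  have h1 : ν (Metric.ball t r) ≤ ENNReal.ofReal η := (measure_mono hrV).trans hVν.le
  rwa [hν, Measure.map_apply measurable_fst measurableSet_ball,
    Measure.restrict_apply (measurable_fst measurableSet_ball), Set.inter_comm] at h1

include hq in
/-- For a set of finite measure, convergence of the masses of all subsets is uniform over time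
strips. -/
lemma IsYoungBounded.eventually_strip
    (hconv : ∀ B, MeasurableSet B → lamT T lam B < ∞ →
      Tendsto (fun n => ∫ z in B, q n z ∂(lamT T lam)) atTop (𝓝 0))
    {B : Set (Set.Icc (0 : ℝ) T × E)} (hB : MeasurableSet B) (hBf : lamT T lam B < ∞) {ε : ℝ}
    (hε : 0 < ε) : ∀ᶠ n in atTop, ∀ r t : Set.Icc (0 : ℝ) T,
      |∫ z in B ∩ Prod.fst ⁻¹' Set.Ioc r t, q n z ∂(lamT T lam)| ≤ ε := by
  let Q : ℕ → Set.Icc (0 : ℝ) T → ℝ := fun n t =>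
    ∫ z in B ∩ Prod.fst ⁻¹' Set.Iic t, q n z ∂(lamT T lam)
  have hint : ∀ n (S : Set (Set.Icc (0 : ℝ) T)),
      IntegrableOn (q n) (B ∩ Prod.fst ⁻¹' S) (lamT T lam) := fun n S =>
    (hq.integrableOn hB hBf n).mono_set Set.inter_subset_left
  have hdiff : ∀ n (r t : Set.Icc (0 : ℝ) T), r ≤ t →
      Q n t - Q n r = ∫ z in B ∩ Prod.fst ⁻¹' Set.Ioc r t, q n z ∂(lamT T lam) := by
    intro n r t hrt
    have h1 : B ∩ (Prod.fst ⁻¹' Set.Iic t : Set (Set.Icc (0 : ℝ) T × E)) =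
        (B ∩ Prod.fst ⁻¹' Set.Iic r) ∪ (B ∩ Prod.fst ⁻¹' Set.Ioc r t) := by
      rw [← Set.inter_union_distrib_left, ← Set.preimage_union, Set.Iic_union_Ioc_eq_Iic hrt]
    have h2 : Disjoint (B ∩ (Prod.fst ⁻¹' Set.Iic r : Set (Set.Icc (0 : ℝ) T × E)))
        (B ∩ Prod.fst ⁻¹' Set.Ioc r t) := by
      refine Set.disjoint_left.2 fun z hz hz' => ?_
      exact absurd hz'.2.1 (not_lt.2 hz.2)
    simp only [Q]
    rw [h1, setIntegral_union h2 (hB.inter (measurable_fst measurableSet_Ioc)) (hint n _)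
      (hint n _)]
    ring
  have hsmall : ∀ n (r t : Set.Icc (0 : ℝ) T), r ≤ t → ∀ c : ℝ, 0 ≤ c →
      ∫⁻ z, ‖q n z‖ₑ * ‖(B ∩ Prod.fst ⁻¹' Set.Ioc r t).indicator (fun _ => (1 : ℝ)) z‖ₑ
        ∂(lamT T lam) ≤ ENNReal.ofReal c → |Q n t - Q n r| ≤ c := by
    intro n r t hrt c hc h
    rw [hdiff n r t hrt]
    have h1 := enorm_integral_le_lintegral_enorm
      (μ := (lamT T lam).restrict (B ∩ Prod.fst ⁻¹' Set.Ioc r t)) (q n)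
    have h2 : ∫⁻ z in B ∩ Prod.fst ⁻¹' Set.Ioc r t, ‖q n z‖ₑ ∂(lamT T lam) ≤ ENNReal.ofReal c := by
      refine le_trans (le_of_eq ?_) h
      rw [← lintegral_indicator (hB.inter (measurable_fst measurableSet_Ioc))]
      refine lintegral_congr fun z => ?_
      by_cases hz : z ∈ B ∩ Prod.fst ⁻¹' Set.Ioc r t
      · rw [Set.indicator_of_mem hz, Set.indicator_of_mem hz, enorm_one, mul_one]
      · rw [Set.indicator_of_notMem hz, Set.indicator_of_notMem hz, enorm_zero, mul_zero]
    have h3 := h1.trans h2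
    rw [← ofReal_norm, ENNReal.ofReal_le_ofReal_iff hc] at h3
    exact h3
  have heq : Equicontinuous Q := by
    intro t
    rw [Metric.equicontinuousAt_iff]
    intro ε hε
    obtain ⟨η, hη, hηs⟩ := hq.exists_small (half_pos hε)
    obtain ⟨r, hr, hrB⟩ := exists_nhds_strip (lam := lam) hBf t hη
    refine ⟨r, hr, fun s hs n => ?_⟩
    have hab : ∀ a b : Set.Icc (0 : ℝ) T, a ≤ b → Set.Ioc a b ⊆ Metric.ball t r →
        |Q n b - Q n a| ≤ ε / 2 := by
      intro a b hab hsub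
      refine hsmall n a b hab _ (half_pos hε).le (hηs _ (fun z => ?_) ?_ n)
      · by_cases hz : z ∈ B ∩ Prod.fst ⁻¹' Set.Ioc a b
        · rw [Set.indicator_of_mem hz, norm_one]
        · rw [Set.indicator_of_notMem hz, norm_zero]
          exact zero_le_one
      · have h1 : ∀ z, ‖(B ∩ Prod.fst ⁻¹' Set.Ioc a b).indicator (fun _ => (1 : ℝ)) z‖ₑ =
            (B ∩ Prod.fst ⁻¹' Set.Ioc a b).indicator 1 z := fun z => by
          by_cases hz : z ∈ B ∩ Prod.fst ⁻¹' Set.Ioc a b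
          · rw [Set.indicator_of_mem hz, Set.indicator_of_mem hz, enorm_one, Pi.one_apply]
          · rw [Set.indicator_of_notMem hz, Set.indicator_of_notMem hz, enorm_zero]
        simp only [h1]
        rw [lintegral_indicator_one (hB.inter (measurable_fst measurableSet_Ioc))]
        exact (measure_mono (Set.inter_subset_inter_right _ (Set.preimage_mono hsub))).trans hrB
    have hball : ∀ c : Set.Icc (0 : ℝ) T, dist (c : ℝ) t < r → c ∈ Metric.ball t r := fun c hc => hc
    have hs' : |(s : ℝ) - t| < r := hs
    rw [abs_lt] at hs'
    rcases le_total s t with hst | hst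
    · have h1 := hab s t hst fun c hc => hball c (by
        have hc1 : (s : ℝ) < c := hc.1
        have hc2 : (c : ℝ) ≤ t := hc.2
        rw [Real.dist_eq, abs_lt]
        constructor <;> linarith)
      rw [Real.dist_eq]
      linarith
    · have h1 := hab t s hst fun c hc => hball c (by
        have hc1 : (t : ℝ) < c := hc.1
        have hc2 : (c : ℝ) ≤ s := hc.2
        rw [Real.dist_eq, abs_lt]
        constructor <;> linarith)
      rw [Real.dist_eq, abs_sub_comm]
      linarith
  have hpt : Tendsto Q atTop (𝓝 fun _ => 0) := by
    refine tendsto_pi_nhds.2 fun t => hconv _ (hB.inter (measurable_fst measurableSet_Iic)) ?_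
    exact (measure_mono Set.inter_subset_left).trans_lt hBf
  have hunif : TendstoUniformly Q (fun _ => 0) atTop :=
    UniformFun.tendsto_iff_tendstoUniformly.1 ((heq.tendsto_uniformFun_iff_pi atTop _).2 hpt)
  filter_upwards [Metric.tendstoUniformly_iff.1 hunif (ε / 2) (half_pos hε)] with n hn r t
  by_cases hrt : r ≤ t
  · rw [← hdiff n r t hrt]
    have h1 := hn r
    have h2 := hn t
    rw [dist_zero_left, Real.norm_eq_abs] at h1 h2
    have := abs_sub (Q n t) (Q n r)
    linarith
  · rw [Set.Ioc_eq_empty (fun h => hrt h.le), Set.preimage_empty, Set.inter_empty,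
      setIntegral_empty, abs_zero]
    exact hε.le

end Uniform

end FracSkeleton

namespace FracSkeleton

/-! ### Oscillating kernels tested against paths of bounded variation -/

section Paths
variable {X : Type*} [NormedAddCommGroup X] [InnerProductSpace ℝ X]

/-- Bounded continuous paths whose components along `D` are primitives of functions bounded in
`L¹`. -/
structure IsTestPath (T : ℝ) (D : Set X) (w : ℕ → Set.Icc (0 : ℝ) T → X) : Prop where
  cont : ∀ n, Continuous (w n)
  bound : ∃ R : ℝ, 0 < R ∧ ∀ n t, ‖w n t‖ ≤ R
  prim : ∀ x ∈ D, ∃ C : ℝ, 0 ≤ C ∧ ∀ n, ∃ φ : Set.Icc (0 : ℝ) T → ℝ, Integrable φ (timeVol T) ∧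
    ∫ s, |φ s| ∂(timeVol T) ≤ C ∧ ∀ t, inner ℝ x (w n t) = ∫ s in Set.Iio t, φ s ∂(timeVol T)

variable {E : Type*} [MeasurableSpace E] {T : ℝ} {lam : Measure E} [SigmaFinite lam]
  {Ψ : ℝ → ℝ} {M : ℝ≥0} {q : ℕ → Set.Icc (0 : ℝ) T × E → ℝ}
  {D : Set X} {w : ℕ → Set.Icc (0 : ℝ) T → X}

/-- Integration by parts: a primitive tested against a density is controlled by the masses of the
density on time strips. -/
lemma abs_setIntegral_mul_primitive_le {B : Set (Set.Icc (0 : ℝ) T × E)} (hB : MeasurableSet B)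
    {f : Set.Icc (0 : ℝ) T × E → ℝ} (hf : IntegrableOn f B (lamT T lam))
    {φ y : Set.Icc (0 : ℝ) T → ℝ} (hφ : Integrable φ (timeVol T))
    (hy : ∀ t, y t = ∫ s in Set.Iio t, φ s ∂(timeVol T)) {ε : ℝ} {t : Set.Icc (0 : ℝ) T}
    (hε : ∀ r : Set.Icc (0 : ℝ) T,
      |∫ z in B ∩ Prod.fst ⁻¹' Set.Ioc r t, f z ∂(lamT T lam)| ≤ ε) :
    |∫ z in B ∩ Prod.fst ⁻¹' Set.Iic t, f z * y z.1 ∂(lamT T lam)| ≤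
      ε * ∫ s, |φ s| ∂(timeVol T) := by
  have hBt : MeasurableSet (B ∩ (Prod.fst ⁻¹' Set.Iic t : Set (Set.Icc (0 : ℝ) T × E))) :=
    hB.inter (measurable_fst measurableSet_Iic)
  set ν := (lamT T lam).restrict (B ∩ Prod.fst ⁻¹' Set.Iic t) with hν
  have hfν : Integrable f ν := hf.mono_set Set.inter_subset_left
  let S : Set ((Set.Icc (0 : ℝ) T × E) × Set.Icc (0 : ℝ) T) := {p | p.2 < p.1.1}
  have hS : MeasurableSet S := measurableSet_lt measurable_snd (measurable_fst.comp measurable_fst)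
  have hint : Integrable (S.indicator fun p => f p.1 * φ p.2) (ν.prod (timeVol T)) :=
    (hfν.mul_prod hφ).indicator hS
  have h1 : ∀ z, f z * y z.1 = ∫ s, S.indicator (fun p => f p.1 * φ p.2) (z, s) ∂(timeVol T) := by
    intro z
    rw [hy, ← integral_indicator measurableSet_Iio, ← integral_const_mul]
    refine integral_congr_ae (Eventually.of_forall fun s => ?_)
    by_cases hs : s < z.1
    · have h2 : (z, s) ∈ S := hs
      simp only [Set.indicator_of_mem h2, Set.indicator_of_mem (Set.mem_Iio.2 hs)]
    · have h2 : (z, s) ∉ S := hs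
      have h3 : s ∉ Set.Iio z.1 := hs
      simp only [Set.indicator_of_notMem h2, Set.indicator_of_notMem h3, mul_zero]
  have h2 : ∀ s, ∫ z, S.indicator (fun p => f p.1 * φ p.2) (z, s) ∂ν =
      (∫ z in B ∩ Prod.fst ⁻¹' Set.Ioc s t, f z ∂(lamT T lam)) * φ s := by
    intro s
    rw [← integral_mul_const]
    have hm : MeasurableSet (Prod.fst ⁻¹' Set.Ioi s : Set (Set.Icc (0 : ℝ) T × E)) :=
      measurable_fst measurableSet_Ioi
    have h3 : ∀ z, S.indicator (fun p => f p.1 * φ p.2) (z, s) =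
        (Prod.fst ⁻¹' Set.Ioi s : Set (Set.Icc (0 : ℝ) T × E)).indicator
          (fun z => f z * φ s) z := fun z => rfl
    simp only [h3]
    rw [integral_indicator hm, hν, Measure.restrict_restrict hm]
    congr 2
    ext z
    simp only [Set.mem_inter_iff, Set.mem_preimage, Set.mem_Ioi, Set.mem_Iic, Set.mem_Ioc]
    tauto
  simp only [h1]
  rw [integral_integral_swap (f := fun z s => S.indicator (fun p => f p.1 * φ p.2) (z, s)) hint]
  simp only [h2]
  rw [← integral_const_mul, ← Real.norm_eq_abs]
  refine norm_integral_le_of_norm_le (hφ.abs.const_mul ε) (Eventually.of_forall fun s => ?_)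
  rw [norm_mul, Real.norm_eq_abs, Real.norm_eq_abs]
  exact mul_le_mul_of_nonneg_right (hε s) (abs_nonneg _)

variable (hq : IsYoungBounded (lamT T lam) Ψ M q) (hw : IsTestPath T D w)
include hq hw

lemma integrableOn_mul_inner {B : Set (Set.Icc (0 : ℝ) T × E)} (hB : MeasurableSet B)
    (hBf : lamT T lam B < ∞) (x : X) (n : ℕ) :
    IntegrableOn (fun z => q n z * inner ℝ x (w n z.1)) B (lamT T lam) := by
  obtain ⟨R, hR, hwR⟩ := hw.bound
  refine Integrable.mul_bdd (c := ‖x‖ * R) (hq.integrableOn hB hBf n) ?_ ?_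
  · have h1 : Continuous fun t => inner ℝ x (w n t) := continuous_const.inner (hw.cont n)
    exact (h1.measurable.comp measurable_fst).aestronglyMeasurable
  · refine Eventually.of_forall fun z => (norm_inner_le_norm _ _).trans ?_
    exact mul_le_mul_of_nonneg_left (hwR n z.1) (norm_nonneg _)

lemma eventually_simple_kernel
    (hconv : ∀ B, MeasurableSet B → lamT T lam B < ∞ →
      Tendsto (fun n => ∫ z in B, q n z ∂(lamT T lam)) atTop (𝓝 0))
    (χ : SimpleFunc (Set.Icc (0 : ℝ) T × E) X) (hχ : ∀ z, χ z ∈ D)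
    (hχf : ∀ x, x ≠ 0 → lamT T lam (χ ⁻¹' {x}) < ∞) {ε : ℝ} (hε : 0 < ε) :
    ∀ᶠ n in atTop, ∀ t : Set.Icc (0 : ℝ) T,
      |∫ z in Prod.fst ⁻¹' Set.Iic t, q n z * inner ℝ (χ z) (w n z.1) ∂(lamT T lam)| ≤ ε := by
  classical
  set S := χ.range.filter fun x => x ≠ 0 with hS
  have hpt : ∀ n z, q n z * inner ℝ (χ z) (w n z.1) =
      ∑ x ∈ S, (χ ⁻¹' {x}).indicator (fun z => q n z * inner ℝ x (w n z.1)) z := by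
    intro n z
    by_cases h0 : χ z = 0
    · rw [h0, inner_zero_left, mul_zero, Finset.sum_eq_zero]
      intro x hx
      refine Set.indicator_of_notMem (fun h => ?_) _
      exact (Finset.mem_filter.1 hx).2 (h.symm.trans h0)
    · have hmem : χ z ∈ S := Finset.mem_filter.2 ⟨χ.mem_range_self z, h0⟩
      rw [Finset.sum_eq_single_of_mem _ hmem fun x _ hx =>
        Set.indicator_of_notMem (fun h => hx h.symm) _]
      rw [Set.indicator_of_mem (show z ∈ χ ⁻¹' {χ z} from rfl)]
  have hterm : ∀ x ∈ S, ∀ᶠ n in atTop, ∀ t : Set.Icc (0 : ℝ) T,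
      |∫ z in (χ ⁻¹' {x}) ∩ Prod.fst ⁻¹' Set.Iic t, q n z * inner ℝ x (w n z.1) ∂(lamT T lam)| ≤
        ε / (S.card + 1) := by
    intro x hx
    obtain ⟨hxr, hx0⟩ := Finset.mem_filter.1 hx
    obtain ⟨z₀, rfl⟩ := SimpleFunc.mem_range.1 hxr
    obtain ⟨C, hC, hprim⟩ := hw.prim _ (hχ z₀)
    have hε' : 0 < ε / (S.card + 1) / (C + 1) := by positivity
    filter_upwards [hq.eventually_strip hconv (χ.measurableSet_fiber _) (hχf _ hx0) hε'] with n hn t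
    obtain ⟨φ, hφ, hφC, hφw⟩ := hprim n
    refine (abs_setIntegral_mul_primitive_le (χ.measurableSet_fiber _)
      (hq.integrableOn (χ.measurableSet_fiber _) (hχf _ hx0) n) hφ hφw fun r => hn r t).trans ?_
    refine (mul_le_mul_of_nonneg_left (hφC.trans (by linarith : C ≤ C + 1)) hε'.le).trans ?_
    rw [div_mul_cancel₀ _ (by positivity)]
  filter_upwards [(Finset.eventually_all S).2 hterm] with n hn t
  simp only [hpt]
  rw [integral_finsetSum]
  · have hm : MeasurableSet (Prod.fst ⁻¹' Set.Iic t : Set (Set.Icc (0 : ℝ) T × E)) :=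
      measurable_fst measurableSet_Iic
    refine (Finset.abs_sum_le_sum_abs _ _).trans ?_
    have h1 : ∀ x ∈ S, |∫ z in Prod.fst ⁻¹' Set.Iic t,
        (χ ⁻¹' {x}).indicator (fun z => q n z * inner ℝ x (w n z.1)) z ∂(lamT T lam)| ≤
        ε / (S.card + 1) := fun x hx => by
      rw [setIntegral_indicator (χ.measurableSet_fiber x), Set.inter_comm]
      exact hn x hx t
    refine (Finset.sum_le_sum h1).trans ?_
    rw [Finset.sum_const, nsmul_eq_mul, mul_div_assoc', div_le_iff₀ (by positivity)]
    nlinarith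
  · intro x hx
    refine Integrable.integrableOn ?_
    rw [integrable_indicator_iff (χ.measurableSet_fiber x)]
    exact integrableOn_mul_inner hq hw (χ.measurableSet_fiber x)
      (hχf x (Finset.mem_filter.1 hx).2) x n

variable [MeasurableSpace X] [BorelSpace X] [SecondCountableTopology X]

lemma eventually_kernel (hD : Dense D) (h0 : (0 : X) ∈ D)
    (hconv : ∀ B, MeasurableSet B → lamT T lam B < ∞ →
      Tendsto (fun n => ∫ z in B, q n z ∂(lamT T lam)) atTop (𝓝 0))
    {H : Set.Icc (0 : ℝ) T × E → X} (hH : Measurable H) (hH2 : MemLp H 2 (lamT T lam))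
    (hHΨ : ∀ κ > 0, ∫⁻ z, ENNReal.ofReal (Ψ (κ * ‖H z‖)) ∂(lamT T lam) < ∞) {ε : ℝ} (hε : 0 < ε) :
    ∀ᶠ n in atTop, ∀ t : Set.Icc (0 : ℝ) T,
      |∫ z in Prod.fst ⁻¹' Set.Iic t, q n z * inner ℝ (H z) (w n z.1) ∂(lamT T lam)| ≤ ε := by
  obtain ⟨R, hR, hwR⟩ := hw.bound
  set χ := SimpleFunc.approxOn H hH D 0 h0 with hχdef
  have hχH : ∀ j z, ‖H z - χ j z‖ ≤ ‖H z‖ := fun j z => by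
    have h1 := SimpleFunc.edist_approxOn_le hH h0 z j
    rwa [edist_comm, edist_eq_enorm_sub, edist_eq_enorm_sub, zero_sub, enorm_neg,
      enorm_le_iff_norm_le] at h1
  set κ : ℝ := (M + 1) / (ε / (2 * R)) with hκdef
  have hκ : 0 < κ := by positivity
  have hlim : Tendsto (fun j => ∫⁻ z, ENNReal.ofReal (Ψ (κ * ‖H z - χ j z‖)) ∂(lamT T lam)) atTop
      (𝓝 0) := by
    have h1 : ∫⁻ _ : Set.Icc (0 : ℝ) T × E, 0 ∂(lamT T lam) = 0 := lintegral_zero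
    rw [← h1]
    refine tendsto_lintegral_of_dominated_convergence
      (fun z => ENNReal.ofReal (Ψ (κ * ‖H z‖))) (fun j => ?_) (fun j => ?_) (hHΨ κ hκ).ne ?_
    · exact (hq.young.cont.measurable.comp ((hH.sub (χ j).measurable).norm.const_mul κ)).ennreal_ofReal
    · refine Eventually.of_forall fun z => ENNReal.ofReal_le_ofReal (hq.young.mono ?_ ?_ ?_)
      · exact mul_nonneg hκ.le (norm_nonneg _)
      · exact mul_nonneg hκ.le (norm_nonneg _)
      · exact mul_le_mul_of_nonneg_left (hχH j z) hκ.le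
    · refine Eventually.of_forall fun z => ?_
      have h2 : Tendsto (fun j => χ j z) atTop (𝓝 (H z)) :=
        SimpleFunc.tendsto_approxOn hH h0 (hD.closure_eq ▸ Set.mem_univ _)
      have h3 : Tendsto (fun j => κ * ‖H z - χ j z‖) atTop (𝓝 0) := by
        have h4 := ((tendsto_const_nhds (x := H z)).sub h2).norm.const_mul κ
        simpa using h4
      have h5 := (hq.young.cont.tendsto 0).comp h3
      rw [hq.young.zero] at h5
      have h6 := ENNReal.tendsto_ofReal h5
      rwa [ENNReal.ofReal_zero] at h6
  obtain ⟨j, hj⟩ := (hlim.eventually (ge_mem_nhds zero_lt_one)).exists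
  have hχ2 : MemLp (χ j) 2 (lamT T lam) :=
    SimpleFunc.memLp_approxOn hH hH2 h0 MemLp.zero j
  have herr : ∀ n, ∫⁻ z, ‖q n z‖ₑ * ‖H z - χ j z‖ₑ ∂(lamT T lam) ≤
      ENNReal.ofReal (ε / (2 * R)) := fun n => by
    refine (hq.lintegral_enorm_mul_le (fun z => H z - χ j z) hκ n).trans ?_
    calc ENNReal.ofReal κ⁻¹ * (∫⁻ z, ENNReal.ofReal (Ψ (κ * ‖H z - χ j z‖)) ∂(lamT T lam) + M)
        ≤ ENNReal.ofReal κ⁻¹ * ENNReal.ofReal (1 + M) := by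
          rw [ENNReal.ofReal_add zero_le_one M.coe_nonneg, ENNReal.ofReal_one,
            ENNReal.ofReal_coe_nnreal]
          gcongr
      _ = ENNReal.ofReal (ε / (2 * R)) := by
          rw [← ENNReal.ofReal_mul (by positivity)]
          congr 1
          rw [hκdef, inv_div, add_comm]
          field_simp
  have hI : ∀ n, Integrable (fun z => q n z * inner ℝ (H z) (w n z.1)) (lamT T lam) ∧
      Integrable (fun z => q n z * inner ℝ (H z - χ j z) (w n z.1)) (lamT T lam) := fun n => by
    have hwm : Measurable fun z : Set.Icc (0 : ℝ) T × E => w n z.1 :=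
      (hw.cont n).measurable.comp measurable_fst
    have hgen : ∀ k : Set.Icc (0 : ℝ) T × E → X, Measurable k →
        ∫⁻ z, ‖q n z‖ₑ * ‖k z‖ₑ ∂(lamT T lam) < ∞ →
        Integrable (fun z => q n z * inner ℝ (k z) (w n z.1)) (lamT T lam) := by
      intro k hk hfin
      have hk1 : Integrable (fun z => q n z • k z) (lamT T lam) := by
        refine ⟨((hq.meas n).smul hk).aestronglyMeasurable, ?_⟩
        simp only [hasFiniteIntegral_iff_enorm, enorm_smul]
        exact hfin
      refine (hk1.norm.mul_const R).mono'
        ((hq.meas n).mul (hk.inner hwm)).aestronglyMeasurable (Eventually.of_forall fun z => ?_)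
      rw [norm_mul, norm_smul, mul_assoc]
      refine mul_le_mul_of_nonneg_left ((norm_inner_le_norm _ _).trans ?_) (norm_nonneg _)
      exact mul_le_mul_of_nonneg_left (hwR n z.1) (norm_nonneg _)
    refine ⟨hgen H hH ?_, hgen _ (hH.sub (χ j).measurable) ((herr n).trans_lt ENNReal.ofReal_lt_top)⟩
    refine (hq.lintegral_enorm_mul_le H one_pos n).trans_lt ?_
    exact ENNReal.mul_lt_top ENNReal.ofReal_lt_top
      (ENNReal.add_lt_top.2 ⟨hHΨ 1 one_pos, ENNReal.coe_lt_top⟩)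
  filter_upwards [eventually_simple_kernel hq hw hconv (χ j) (SimpleFunc.approxOn_mem hH h0 j)
    (fun x hx => SimpleFunc.measure_preimage_lt_top_of_memLp two_ne_zero ENNReal.ofNat_ne_top (χ j)
      hχ2 x hx) (half_pos hε)] with n hn t
  have h1 : ∀ z, q n z * inner ℝ (χ j z) (w n z.1) = q n z * inner ℝ (H z) (w n z.1) -
      q n z * inner ℝ (H z - χ j z) (w n z.1) := fun z => by
    rw [inner_sub_left]; ring
  have h2 := hn t
  simp only [h1] at h2
  rw [integral_sub (hI n).1.integrableOn (hI n).2.integrableOn] at h2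
  have h3 : |∫ z in Prod.fst ⁻¹' Set.Iic t, q n z * inner ℝ (H z - χ j z) (w n z.1) ∂(lamT T lam)| ≤
      ε / 2 := by
    have h4 := enorm_integral_le_lintegral_enorm
      (μ := (lamT T lam).restrict (Prod.fst ⁻¹' Set.Iic t))
      (fun z => q n z * inner ℝ (H z - χ j z) (w n z.1))
    have h5 : ∫⁻ z in Prod.fst ⁻¹' Set.Iic t, ‖q n z * inner ℝ (H z - χ j z) (w n z.1)‖ₑ
        ∂(lamT T lam) ≤ ENNReal.ofReal (ε / 2) := by
      calc _ ≤ ∫⁻ z, ‖q n z * inner ℝ (H z - χ j z) (w n z.1)‖ₑ ∂(lamT T lam) :=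
            setLIntegral_le_lintegral _ _
        _ ≤ ∫⁻ z, ENNReal.ofReal R * (‖q n z‖ₑ * ‖H z - χ j z‖ₑ) ∂(lamT T lam) := by
            refine lintegral_mono fun z => ?_
            rw [← ofReal_norm, ← ofReal_norm, ← ofReal_norm, ← ENNReal.ofReal_mul (norm_nonneg _),
              ← ENNReal.ofReal_mul hR.le]
            refine ENNReal.ofReal_le_ofReal ?_
            rw [norm_mul, mul_left_comm]
            refine mul_le_mul_of_nonneg_left ((norm_inner_le_norm _ _).trans ?_) (norm_nonneg _)
            rw [mul_comm]
            exact mul_le_mul_of_nonneg_right (hwR n z.1) (norm_nonneg _)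
        _ ≤ ENNReal.ofReal R * ENNReal.ofReal (ε / (2 * R)) := by
            rw [lintegral_const_mul' _ _ ENNReal.ofReal_ne_top]
            exact mul_le_mul_right (herr n) _
        _ = ENNReal.ofReal (ε / 2) := by
            rw [← ENNReal.ofReal_mul hR.le]
            congr 1
            field_simp
    have h6 := h4.trans h5
    rw [← ofReal_norm, ENNReal.ofReal_le_ofReal_iff (half_pos hε).le] at h6
    exact h6
  rw [abs_le] at h2 h3 ⊢
  constructor <;> linarith [h2.1, h2.2, h3.1, h3.2]

variable [CompleteSpace X]

/-- Kernels integrated against densities that converge weakly to zero vanish when tested against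
paths of bounded variation, uniformly in the final time. -/
theorem eventually_kernel_integral (hD : Dense D) (h0 : (0 : X) ∈ D)
    (hconv : ∀ B, MeasurableSet B → lamT T lam B < ∞ →
      Tendsto (fun n => ∫ z in B, q n z ∂(lamT T lam)) atTop (𝓝 0))
    {H : Set.Icc (0 : ℝ) T × E → X} (hH : Measurable H) (hH2 : MemLp H 2 (lamT T lam))
    (hHΨ : ∀ κ > 0, ∫⁻ z, ENNReal.ofReal (Ψ (κ * ‖H z‖)) ∂(lamT T lam) < ∞) {ε : ℝ} (hε : 0 < ε) :
    ∀ᶠ n in atTop, ∀ t : Set.Icc (0 : ℝ) T,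
      |∫ s in Set.Iic t, inner ℝ (∫ ξ, q n (s, ξ) • H (s, ξ) ∂lam) (w n s) ∂(timeVol T)| ≤ ε := by
  obtain ⟨R, hR, hwR⟩ := hw.bound
  filter_upwards [eventually_kernel hq hw hD h0 hconv hH hH2 hHΨ hε] with n hn t
  have hqH : Integrable (fun z => q n z • H z) (lamT T lam) :=
    hq.integrable_mul hH.aestronglyMeasurable (hHΨ 1 one_pos) n
  have hwm : Measurable fun z : Set.Icc (0 : ℝ) T × E => w n z.1 :=
    (hw.cont n).measurable.comp measurable_fst
  have hint : Integrable (fun z => q n z * inner ℝ (H z) (w n z.1)) (lamT T lam) := by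
    refine (hqH.norm.mul_const R).mono'
      ((hq.meas n).mul (hH.inner hwm)).aestronglyMeasurable (Eventually.of_forall fun z => ?_)
    rw [norm_mul, norm_smul, mul_assoc]
    refine mul_le_mul_of_nonneg_left ((norm_inner_le_norm _ _).trans ?_) (norm_nonneg _)
    exact mul_le_mul_of_nonneg_left (hwR n z.1) (norm_nonneg _)
  refine le_of_eq_of_le ?_ (hn t)
  rw [← Set.prod_univ]
  have h1 := setIntegral_prod (μ := timeVol T) (ν := lam) (s := Set.Iic t) (t := Set.univ)
    (fun z => q n z * inner ℝ (H z) (w n z.1)) hint.integrableOn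
  rw [show (timeVol T).prod lam = lamT T lam from rfl] at h1
  rw [h1]
  congr 1
  refine setIntegral_congr_ae measurableSet_Iic ?_
  filter_upwards [Integrable.prod_right_ae (μ := timeVol T) (ν := lam) hqH] with s hs _
  rw [Measure.restrict_univ, real_inner_comm, ← integral_inner hs]
  refine integral_congr_ae (Eventually.of_forall fun ξ => ?_)
  simp only [real_inner_smul_right, real_inner_comm]

end Paths

end FracSkeleton

namespace FracSkeleton

/-! ### Differences of solutions are test paths -/

section TestPath
variable {d : ℕ} {O : Set (Space d)} {γ p T : ℝ} {F : ℝ → ℝ} [hpf : Fact (1 < p)]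
  (hA : Ambient O γ p F) (hT : 0 < T)
include hA hT

lemma exists_primitive_bound (u₀ : HSpace O) (Mb : ℝ) {x : HSpace O} (hx : x ∈ boundedV O γ) :
    ∃ C ≥ 0, ∀ {G : ℝ → HSpace O → HSpace O} {m : ℝ → ℝ} {ℓ : ℝ → ℝ → ℝ}, IsSource T G m ℓ →
      ∫ s in (0 : ℝ)..T, m s ≤ Mb → ∀ {u : ℝ → HSpace O},
      IsWeakSol γ p F T u₀ (fun s => G s (u s)) u → ∃ φ : ℝ → ℝ, IntegrableOn φ (Set.Ioc 0 T) ∧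
        ∫ s in (0 : ℝ)..T, |φ s| ≤ C ∧
        ∀ t ∈ Set.Icc 0 T, inner ℝ (u t) x = inner ℝ u₀ x + ∫ s in (0 : ℝ)..t, φ s := by
  obtain ⟨R, hR, hap⟩ := source_a_priori hA hT u₀ Mb
  obtain ⟨k, hk, hFk⟩ := hA.condF.2.1
  obtain ⟨hxV, Rx, hxR⟩ := hx
  have hxP : powInt p x < ∞ := powInt_lt_top_of_bddBy hA.finite hxR
  have h0 : (0 : ℝ) ∈ Set.Icc 0 T := ⟨le_rfl, hT.le⟩
  have hTm : T ∈ Set.Icc 0 T := ⟨hT.le, le_rfl⟩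
  set c := ‖Dop γ x‖ ^ 2 + k * (volume.real O + 2 * (powInt p x).toReal) with hc
  have hc0 : 0 ≤ c := by positivity
  refine ⟨|Mb| * ((1 + R) * ‖x‖) + R + k * R + T * c, by positivity,
    fun {G m ℓ} hG hm {u} hu => ?_⟩
  obtain ⟨hu1, hu2, hu3⟩ := hap hG hm hu
  have hf := hG.integrableOn hu.cont
  have hφ := hu.integrand hA hf hxP
  refine ⟨_, hφ, ?_, fun t ht => hu.eqn t ht x hxV hxP⟩
  have i1 : IntegrableOn (fun s => m s * ((1 + R) * ‖x‖)) (Set.Ioc 0 T) := hG.m_int.mul_const _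
  have i2 := integrableOn_norm_Dop_sq hA hu.cont hu.memV
  have i3 : IntegrableOn (fun s => k * (powInt p (u s)).toReal) (Set.Ioc 0 T) :=
    (integrableOn_powInt hu.cont hu.memP).const_mul k
  have i4 : IntegrableOn (fun _ : ℝ => c) (Set.Ioc 0 T) := integrableOn_const (by simp)
  have i12 : IntegrableOn (fun s => m s * ((1 + R) * ‖x‖) + ‖Dop γ (u s)‖ ^ 2) (Set.Ioc 0 T) :=
    i1.add i2
  have i13 : IntegrableOn (fun s => m s * ((1 + R) * ‖x‖) + ‖Dop γ (u s)‖ ^ 2 +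
      k * (powInt p (u s)).toReal) (Set.Ioc 0 T) := i12.add i3
  have i14 : IntegrableOn (fun s => m s * ((1 + R) * ‖x‖) + ‖Dop γ (u s)‖ ^ 2 +
      k * (powInt p (u s)).toReal + c) (Set.Ioc 0 T) := i13.add i4
  have h1 := intervalIntegral_mono_ae_Ioc hφ.abs i14 (by
    filter_upwards [hG.growth, ae_powInt hu.cont hu.memP, ae_restrict_mem measurableSet_Ioc]
      with s hs hsP hsT
    have h2 := abs_pairF_le hA.isOpen.measurableSet hA.finite hA.condF.1.continuous hk.le hFk hsP hxP
    have h3 : |(inner ℝ (G s (u s)) x : ℝ)| ≤ m s * ((1 + R) * ‖x‖) := by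
      refine (abs_real_inner_le_norm _ _).trans ?_
      rw [← mul_assoc]
      refine mul_le_mul_of_nonneg_right ((hs _).trans ?_) (norm_nonneg _)
      have := hu1 s ⟨hsT.1.le, hsT.2⟩
      exact mul_le_mul_of_nonneg_left (by linarith) (hG.m_nonneg s)
    have h4 : |(inner ℝ (Dop γ (u s)) (Dop γ x) : ℝ)| ≤ ‖Dop γ (u s)‖ ^ 2 + ‖Dop γ x‖ ^ 2 := by
      refine (abs_real_inner_le_norm _ _).trans ?_
      nlinarith [sq_nonneg (‖Dop γ (u s)‖ - ‖Dop γ x‖), norm_nonneg (Dop γ (u s)),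
        norm_nonneg (Dop γ x)]
    have h5 := abs_sub (inner ℝ (G s (u s)) x - inner ℝ (Dop γ (u s)) (Dop γ x)) (pairF F (u s) x)
    have h6 := abs_sub (inner ℝ (G s (u s)) x : ℝ) (inner ℝ (Dop γ (u s)) (Dop γ x))
    rw [hc]
    linarith) hTm
  refine h1.trans ?_
  have ii := fun {f : ℝ → ℝ} (h : IntegrableOn f (Set.Ioc 0 T)) =>
    intervalIntegrable_of_integrableOn h h0 hTm
  rw [intervalIntegral.integral_add (ii i13) (ii i4), intervalIntegral.integral_add (ii i12) (ii i3),
    intervalIntegral.integral_add (ii i1) (ii i2), intervalIntegral.integral_mul_const,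
    intervalIntegral.integral_const_mul, intervalIntegral.integral_const, smul_eq_mul, sub_zero]
  have h7 := mul_le_mul_of_nonneg_right (hm.trans (le_abs_self Mb))
    (by positivity : 0 ≤ (1 + R) * ‖x‖)
  have h8 := mul_le_mul_of_nonneg_left hu3 hk.le
  linarith

omit hpf hA hT in
lemma integrable_coe_timeVol {φ : ℝ → ℝ} (hφ : IntegrableOn φ (Set.Ioc 0 T)) :
    Integrable (fun s : Set.Icc (0 : ℝ) T => φ s) (timeVol T) := by
  have h1 : IntegrableOn φ (Set.Icc 0 T) := (integrableOn_Icc_iff_integrableOn_Ioc (by simp)).2 hφ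
  rw [IntegrableOn, ← map_comap_subtype_coe measurableSet_Icc] at h1
  exact ((MeasurableEmbedding.subtype_coe measurableSet_Icc).integrable_map_iff).1 h1

lemma isTestPath_sub {u₀ : HSpace O} {Mb : ℝ} {G : ℕ → ℝ → HSpace O → HSpace O} {m : ℕ → ℝ → ℝ}
    {ℓ : ℕ → ℝ → ℝ → ℝ} {u : ℕ → ℝ → HSpace O} {G' : ℝ → HSpace O → HSpace O} {m' : ℝ → ℝ}
    {ℓ' : ℝ → ℝ → ℝ} {v : ℝ → HSpace O} (hG : ∀ n, IsSource T (G n) (m n) (ℓ n))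
    (hm : ∀ n, ∫ s in (0 : ℝ)..T, m n s ≤ Mb) (hG' : IsSource T G' m' ℓ')
    (hm' : ∫ s in (0 : ℝ)..T, m' s ≤ Mb)
    (hu : ∀ n, IsWeakSol γ p F T u₀ (fun s => G n s (u n s)) (u n))
    (hv : IsWeakSol γ p F T u₀ (fun s => G' s (v s)) v) :
    IsTestPath T (boundedV O γ) fun n (t : Set.Icc (0 : ℝ) T) => u n t - v t where
  cont n := ((hu n).cont.sub hv.cont).comp continuous_subtype_val
  bound := by
    obtain ⟨R, hR, hap⟩ := source_a_priori hA hT u₀ Mb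
    refine ⟨2 * R, by positivity, fun n t => (norm_sub_le _ _).trans ?_⟩
    linarith [(hap (hG n) (hm n) (hu n)).1 t t.2, (hap hG' hm' hv).1 t t.2]
  prim x hx := by
    obtain ⟨C, hC, hpr⟩ := exists_primitive_bound hA hT u₀ Mb hx
    have h0 : (0 : ℝ) ∈ Set.Icc 0 T := ⟨le_rfl, hT.le⟩
    have hTm : T ∈ Set.Icc 0 T := ⟨hT.le, le_rfl⟩
    refine ⟨2 * C, by positivity, fun n => ?_⟩
    obtain ⟨φ, hφ, hφC, hφu⟩ := hpr (hG n) (hm n) (hu n)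
    obtain ⟨ψ, hψ, hψC, hψv⟩ := hpr hG' hm' hv
    have hproj : ∀ t ∈ Set.Icc 0 T, ∀ s ∈ Set.uIcc 0 t,
        ((Set.projIcc 0 T hT.le s : Set.Icc (0 : ℝ) T) : ℝ) = s := fun t ht s hs => by
      rw [Set.uIcc_of_le ht.1] at hs
      rw [Set.projIcc_of_mem hT.le ⟨hs.1, hs.2.trans ht.2⟩]
    have hd : IntegrableOn (fun s => φ s - ψ s) (Set.Ioc 0 T) := hφ.sub hψ
    refine ⟨fun s => φ s - ψ s, integrable_coe_timeVol hd, ?_, fun t => ?_⟩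
    · rw [integral_timeVol hT]
      rw [intervalIntegral.integral_congr (g := fun s => |φ s - ψ s|)
        fun s hs => by simp only [hproj T hTm s hs]]
      have i3 : IntegrableOn (fun s => |φ s| + |ψ s|) (Set.Ioc 0 T) := hφ.abs.add hψ.abs
      have h1 := intervalIntegral_mono_ae_Ioc hd.abs i3
        (Eventually.of_forall fun s => abs_sub (φ s) (ψ s)) hTm
      rw [intervalIntegral.integral_add (intervalIntegrable_of_integrableOn hφ.abs h0 hTm)
        (intervalIntegrable_of_integrableOn hψ.abs h0 hTm)] at h1
      linarith
    · rw [setIntegral_congr_set Iio_ae_eq_Iic, setIntegral_timeVol hT]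
      rw [intervalIntegral.integral_congr (g := fun s => φ s - ψ s)
        fun s hs => by simp only [hproj t t.2 s hs]]
      rw [intervalIntegral.integral_sub (intervalIntegrable_of_integrableOn hφ h0 t.2)
        (intervalIntegrable_of_integrableOn hψ h0 t.2), real_inner_comm, inner_sub_left,
        hφu t t.2, hψv t t.2]
      ring

end TestPath

/-! ### Weak convergence of the controls -/

section Entropy
variable {Z : Type*} [MeasurableSpace Z] {m : Measure Z} {Υ : ℕ} {ρs : ℕ → Z → ℝ≥0} {ρ : Z → ℝ≥0}

lemma integrableOn_of_klFun (hρ : Measurable ρ)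
    (hk : ∫⁻ z, ENNReal.ofReal (InformationTheory.klFun (ρ z)) ∂m ≤ Υ) {B : Set Z}
    (hBf : m B < ∞) : IntegrableOn (fun z => (ρ z : ℝ)) B m := by
  refine ⟨hρ.coe_nnreal_real.aestronglyMeasurable, ?_⟩
  have hpt : ∀ z, ‖(ρ z : ℝ)‖ₑ ≤
      ENNReal.ofReal (InformationTheory.klFun (ρ z)) + ENNReal.ofReal (1 + expGap 1) := fun z => by
    rw [← ofReal_norm, ← ENNReal.ofReal_add (InformationTheory.klFun_nonneg (ρ z).coe_nonneg)
      (by have := expGap_nonneg 1; positivity)]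
    refine ENNReal.ofReal_le_ofReal ?_
    have h1 := mul_sub_one_le_expGap_add_klFun 1 (ρ z).coe_nonneg
    rw [Real.norm_of_nonneg (ρ z).coe_nonneg]
    linarith
  refine (lintegral_mono hpt).trans_lt ?_
  rw [lintegral_add_right _ measurable_const, setLIntegral_const]
  refine ENNReal.add_lt_top.2 ⟨?_, ENNReal.mul_lt_top ENNReal.ofReal_lt_top hBf⟩
  exact ((setLIntegral_le_lintegral _ _).trans hk).trans_lt (ENNReal.natCast_lt_top Υ)

lemma isYoungBounded_sub (hρs : ∀ n, Measurable (ρs n)) (hρ : Measurable ρ)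
    (hks : ∀ n, ∫⁻ z, ENNReal.ofReal (InformationTheory.klFun (ρs n z)) ∂m ≤ Υ)
    (hk : ∫⁻ z, ENNReal.ofReal (InformationTheory.klFun (ρ z)) ∂m ≤ Υ) :
    IsYoungBounded m (fun x => 2 * expGap x) (2 * Υ) fun n z => (ρs n z : ℝ) - ρ z where
  young := isYoung_two_mul_expGap
  meas n := (hρs n).coe_nnreal_real.sub hρ.coe_nnreal_real
  bound n := by
    have h0 : ∀ b : ℝ≥0, 0 ≤ InformationTheory.klFun b := fun b =>
      InformationTheory.klFun_nonneg b.2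
    refine ⟨fun z => InformationTheory.klFun (ρs n z) + InformationTheory.klFun (ρ z), ?_,
      fun z => add_nonneg (h0 _) (h0 _), fun z x hx => ?_, ?_⟩
    · exact (InformationTheory.measurable_klFun.comp (hρs n).coe_nnreal_real).add
        (InformationTheory.measurable_klFun.comp hρ.coe_nnreal_real)
    · have h1 := mul_abs_sub_one_le_expGap_add_klFun hx (ρs n z).coe_nonneg
      have h2 := mul_abs_sub_one_le_expGap_add_klFun hx (ρ z).coe_nonneg
      have h3 : |(ρs n z : ℝ) - ρ z| ≤ |(ρs n z : ℝ) - 1| + |(ρ z : ℝ) - 1| := by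
        have := abs_sub ((ρs n z : ℝ) - 1) ((ρ z : ℝ) - 1)
        rwa [sub_sub_sub_cancel_right] at this
      have h4 := mul_le_mul_of_nonneg_left h3 hx
      linarith
    · simp only [ENNReal.ofReal_add (h0 _) (h0 _)]
      rw [lintegral_add_right _ (measurable_klFun_coe hρ)]
      refine (add_le_add (hks n) hk).trans (le_of_eq ?_)
      push_cast
      rw [two_mul]

/-- Vague convergence of `ρₙ m`, together with an entropy bound, gives convergence of the masses of
all sets of finite measure. -/
lemma tendsto_setIntegral_of_vagueTendsto [TopologicalSpace Z] [BorelSpace Z] [R1Space Z] [NormalSpace Z]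
    [WeaklyLocallyCompactSpace Z] [m.Regular] (hρs : ∀ n, Measurable (ρs n)) (hρ : Measurable ρ)
    (hks : ∀ n, ∫⁻ z, ENNReal.ofReal (InformationTheory.klFun (ρs n z)) ∂m ≤ Υ)
    (hk : ∫⁻ z, ENNReal.ofReal (InformationTheory.klFun (ρ z)) ∂m ≤ Υ)
    (hv : VagueTendsto (fun n => m.withDensity fun z => (ρs n z : ℝ≥0∞))
      (m.withDensity fun z => (ρ z : ℝ≥0∞))) {B : Set Z} (hB : MeasurableSet B) (hBf : m B < ∞) :
    Tendsto (fun n => ∫ z in B, ((ρs n z : ℝ) - ρ z) ∂m) atTop (𝓝 0) := by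
  have hq := isYoungBounded_sub hρs hρ hks hk
  rw [Metric.tendsto_atTop']
  intro ε hε
  obtain ⟨η, hη, hsmall⟩ := hq.exists_small (half_pos hε)
  have hBi : Integrable (B.indicator fun _ => (1 : ℝ)) m :=
    (integrable_indicator_iff hB).2 (integrableOn_const hBf.ne)
  obtain ⟨f, hfc, hfB, hfcont, hfi⟩ := hBi.exists_hasCompactSupport_lintegral_sub_le
    (ENNReal.ofReal_pos.2 hη).ne'
  let f' : Z →C_c ℝ := ⟨⟨fun z => max 0 (min (f z) 1), by fun_prop⟩,
    hfc.comp_left (g := fun r => max 0 (min r 1)) (by simp)⟩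
  have hf'01 : ∀ z, 0 ≤ f' z ∧ f' z ≤ 1 := fun z =>
    ⟨le_max_left _ _, max_le zero_le_one (min_le_right _ _)⟩
  have hclip : ∀ b r : ℝ, b = 0 ∨ b = 1 → |b - max 0 (min r 1)| ≤ |b - r| := by
    rintro b r (rfl | rfl)
    · rcases le_total r 0 with h | h
      · rw [min_eq_left (h.trans zero_le_one), max_eq_left h]
        simp
      · rw [max_eq_right (le_min h zero_le_one), zero_sub, zero_sub, abs_neg, abs_neg,
          abs_of_nonneg h, abs_of_nonneg (le_min h zero_le_one)]
        exact min_le_left _ _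
    · rcases le_total r 1 with h | h
      · rw [min_eq_left h, abs_of_nonneg (sub_nonneg.2 (max_le zero_le_one h)),
          abs_of_nonneg (sub_nonneg.2 h)]
        linarith [le_max_right 0 r]
      · rw [min_eq_right h, max_eq_right zero_le_one]
        simp
  set a : Z → ℝ := fun z => B.indicator (fun _ => (1 : ℝ)) z - f' z with ha
  have hBv : ∀ z, B.indicator (fun _ => (1 : ℝ)) z = 0 ∨ B.indicator (fun _ => (1 : ℝ)) z = 1 :=
    fun z => by by_cases hz : z ∈ B <;> simp [hz]
  have ha1 : ∀ z, ‖a z‖ ≤ 1 := fun z => by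
    have := hf'01 z
    rw [Real.norm_eq_abs, abs_le]
    rcases hBv z with h | h <;> simp only [ha, h] <;> constructor <;> linarith
  have haη : ∫⁻ z, ‖a z‖ₑ ∂m ≤ ENNReal.ofReal η := by
    refine (lintegral_mono fun z => ?_).trans hfB
    rw [enorm_le_iff_norm_le]
    exact hclip _ _ (hBv z)
  have herr := hsmall a ha1 haη
  have hci : ∀ b : Z → ℝ≥0, Measurable b →
      ∫⁻ z, ENNReal.ofReal (InformationTheory.klFun (b z)) ∂m ≤ Υ →
      Integrable (fun z => (b z : ℝ) * f' z) m := by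
    intro b hb hbk
    have h1 : IntegrableOn (fun z => (b z : ℝ)) (tsupport f') m :=
      integrableOn_of_klFun hb hbk f'.hasCompactSupport.measure_lt_top
    have h2 : IntegrableOn (fun z => (b z : ℝ) * f' z) (tsupport f') m :=
      h1.mul_bdd (c := 1) f'.continuous.aestronglyMeasurable (Eventually.of_forall fun z => by
        rw [Real.norm_of_nonneg (hf'01 z).1]
        exact (hf'01 z).2)
    refine (integrableOn_iff_integrable_of_support_subset fun z hz => ?_).1 h2
    exact subset_tsupport _ (right_ne_zero_of_mul hz)
  have hint := fun n => (hci _ (hρs n) (hks n)).sub (hci _ hρ hk)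
  have hlim : Tendsto (fun n => ∫ z, ((ρs n z : ℝ) - ρ z) * f' z ∂m) atTop (𝓝 0) := by
    have h1 := hv f'
    simp only [integral_withDensity_eq_integral_smul (hρs _), integral_withDensity_eq_integral_smul hρ,
      NNReal.smul_def, smul_eq_mul] at h1
    have h2 := h1.sub_const (∫ z, (ρ z : ℝ) * f' z ∂m)
    rw [sub_self] at h2
    refine h2.congr fun n => ?_
    rw [← integral_sub (hci _ (hρs n) (hks n)) (hci _ hρ hk)]
    simp only [sub_mul]
  obtain ⟨N, hN⟩ := Metric.tendsto_atTop.1 hlim (ε / 2) (half_pos hε)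
  refine ⟨N, fun n hn => ?_⟩
  have h1 := hN n hn.le
  rw [dist_zero_right, Real.norm_eq_abs] at h1 ⊢
  have hqf : Integrable (fun z => ((ρs n z : ℝ) - ρ z) * f' z) m := by
    refine (hint n).congr (Eventually.of_forall fun z => ?_)
    simp only [Pi.sub_apply, sub_mul]
  have hqa : Integrable (fun z => ((ρs n z : ℝ) - ρ z) * a z) m := by
    refine ⟨(hq.meas n).aestronglyMeasurable.mul
      ((measurable_const.indicator hB).sub f'.continuous.measurable).aestronglyMeasurable, ?_⟩
    simp only [hasFiniteIntegral_iff_enorm, enorm_mul]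
    exact (herr n).trans_lt ENNReal.ofReal_lt_top
  have h2 : ∫ z in B, ((ρs n z : ℝ) - ρ z) ∂m = ∫ z, ((ρs n z : ℝ) - ρ z) * f' z ∂m +
      ∫ z, ((ρs n z : ℝ) - ρ z) * a z ∂m := by
    rw [← integral_add hqf hqa, ← integral_indicator hB]
    refine integral_congr_ae (Eventually.of_forall fun z => ?_)
    by_cases hz : z ∈ B <;> simp [ha, hz]
    ring
  have h3 : |∫ z, ((ρs n z : ℝ) - ρ z) * a z ∂m| ≤ ε / 2 := by
    have h4 := (enorm_integral_le_lintegral_enorm (μ := m)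
      (fun z => ((ρs n z : ℝ) - ρ z) * a z)).trans (by simpa only [enorm_mul] using herr n)
    rwa [← ofReal_norm, ENNReal.ofReal_le_ofReal_iff (half_pos hε).le] at h4
  rw [h2]
  refine (abs_add_le _ _).trans_lt ?_
  linarith

end Entropy

section Gaussian
variable {ι U : Type*} [Countable ι] [MeasurableSpace ι] [MeasurableSingletonClass ι]
  [NormedAddCommGroup U] [InnerProductSpace ℝ U] (a : HilbertBasis ι ℝ U) {T : ℝ}

/-- The components of `σₙ - σ` in the basis. -/
def ctrlCoeff (σs : ℕ → L2Time T U) (σ : L2Time T U) (n : ℕ) (z : Set.Icc (0 : ℝ) T × ι) : ℝ :=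
  inner ℝ (a z.2) ((σs n - σ : L2Time T U) z.1)

variable {σs : ℕ → L2Time T U} {σ : L2Time T U}

lemma measurable_ctrlCoeff (n : ℕ) : Measurable (ctrlCoeff a σs σ n) := by
  refine measurable_from_prod_countable_left fun i => ?_
  have h : StronglyMeasurable fun s => (inner ℝ (a i) ((σs n - σ : L2Time T U) s) : ℝ) :=
    stronglyMeasurable_const.inner (Lp.stronglyMeasurable (σs n - σ))
  exact h.measurable

lemma isYoungBounded_ctrlCoeff {M : ℝ≥0} (hM : ∀ n, ‖σs n - σ‖ ^ 2 ≤ M) :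
    IsYoungBounded (lamT T Measure.count) (fun x => x ^ 2) M (ctrlCoeff a σs σ) where
  young := isYoung_sq
  meas := measurable_ctrlCoeff a
  bound n := by
    have hm : Measurable fun z => ctrlCoeff a σs σ n z ^ 2 :=
      (measurable_ctrlCoeff a n).pow_const 2
    refine ⟨fun z => ctrlCoeff a σs σ n z ^ 2, hm, fun z => sq_nonneg _, fun z x hx => ?_, ?_⟩
    · simp only
      rw [← sq_abs (ctrlCoeff a σs σ n z)]
      nlinarith [sq_nonneg (x - |ctrlCoeff a σs σ n z|), abs_nonneg (ctrlCoeff a σs σ n z)]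
    · rw [lamT, lintegral_prod _ hm.ennreal_ofReal.aemeasurable]
      have h1 : ∀ s, ∫⁻ i, ENNReal.ofReal (ctrlCoeff a σs σ n (s, i) ^ 2) ∂Measure.count ≤
          ENNReal.ofReal (‖(σs n - σ : L2Time T U) s‖ ^ 2) := fun s => by
        rw [lintegral_count]
        rw [ENNReal.tsum_eq_iSup_sum]
        refine iSup_le fun S => ?_
        rw [← ENNReal.ofReal_sum_of_nonneg fun i _ => sq_nonneg _]
        refine ENNReal.ofReal_le_ofReal (le_trans (le_of_eq ?_)
          (a.orthonormal.sum_inner_products_le (s := S) ((σs n - σ : L2Time T U) s)))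
        simp [ctrlCoeff]
      refine (lintegral_mono h1).trans ?_
      rw [← ofReal_integral_eq_lintegral_ofReal
        ((Lp.memLp (σs n - σ)).integrable_norm_pow two_ne_zero)
        (Eventually.of_forall fun s => by positivity)]
      have h2 : ∫ s, ‖(σs n - σ : L2Time T U) s‖ ^ 2 ∂(timeVol T) = ‖σs n - σ‖ ^ 2 := by
        rw [← real_inner_self_eq_norm_sq, L2.inner_def]
        simp only [real_inner_self_eq_norm_sq]
      rw [h2]
      exact ENNReal.ofReal_le_of_le_toReal (hM n)

lemma tendsto_setIntegral_ctrlCoeff {M : ℝ≥0} (hM : ∀ n, ‖σs n - σ‖ ^ 2 ≤ M)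
    (hσ : ∀ φ : L2Time T U, Tendsto (fun n => inner ℝ (σs n) φ) atTop (𝓝 (inner ℝ σ φ)))
    {B : Set (Set.Icc (0 : ℝ) T × ι)} (hB : MeasurableSet B)
    (hBf : lamT T (Measure.count : Measure ι) B < ∞) :
    Tendsto (fun n => ∫ z in B, ctrlCoeff a σs σ n z ∂(lamT T Measure.count)) atTop (𝓝 0) := by
  classical
  have hq := isYoungBounded_ctrlCoeff a hM
  have hline : ∀ i, Tendsto (fun n => ∫ z in B ∩ Prod.snd ⁻¹' {i}, ctrlCoeff a σs σ n z
      ∂(lamT T Measure.count)) atTop (𝓝 0) := by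
    intro i
    set Bi : Set (Set.Icc (0 : ℝ) T) := (fun s => (s, i)) ⁻¹' B with hBi
    have hBim : MeasurableSet Bi := measurable_prodMk_right hB
    have hset : B ∩ Prod.snd ⁻¹' {i} = Bi ×ˢ {i} := by
      ext ⟨s, j⟩
      simp only [Set.mem_inter_iff, Set.mem_preimage, Set.mem_singleton_iff, Set.mem_prod, hBi]
      constructor
      · rintro ⟨h, rfl⟩; exact ⟨h, rfl⟩
      · rintro ⟨h, rfl⟩; exact ⟨h, rfl⟩
    have h1 := ((hσ (indicatorConstLp 2 hBim (measure_ne_top _ _) (a i))).sub_const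
      (inner ℝ σ (indicatorConstLp 2 hBim (measure_ne_top _ _) (a i))))
    rw [sub_self] at h1
    refine h1.congr fun n => ?_
    rw [← inner_sub_left, real_inner_comm, L2.inner_indicatorConstLp_eq_setIntegral_inner, hset]
    have hint := (hq.integrableOn hB hBf n).mono_set
      (Set.inter_subset_left (t := Prod.snd ⁻¹' {i}))
    rw [hset] at hint
    have h2 := setIntegral_prod (μ := timeVol T) (ν := Measure.count) (ctrlCoeff a σs σ n) hint
    rw [show (timeVol T).prod (Measure.count : Measure ι) = lamT T Measure.count from rfl] at h2
    rw [h2]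
    refine integral_congr_ae (Eventually.of_forall fun s => ?_)
    simp [ctrlCoeff]
  have hfinite : ∀ S : Finset ι, Tendsto (fun n => ∫ z in B ∩ Prod.snd ⁻¹' (S : Set ι),
      ctrlCoeff a σs σ n z ∂(lamT T Measure.count)) atTop (𝓝 0) := by
    intro S
    have h1 := tendsto_finsetSum S fun i _ => hline i
    rw [Finset.sum_const_zero] at h1
    refine h1.congr fun n => ?_
    have h2 : B ∩ Prod.snd ⁻¹' (S : Set ι) =
        ⋃ i ∈ S, B ∩ (Prod.snd ⁻¹' {i} : Set (Set.Icc (0 : ℝ) T × ι)) := by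
      ext z
      simp
    rw [h2, integral_biUnion_finset S
      (fun i _ => hB.inter (measurable_snd (measurableSet_singleton i))) ?_
      fun i _ => (hq.integrableOn hB hBf n).mono_set Set.inter_subset_left]
    intro i _ j _ hij
    refine Set.disjoint_left.2 fun z hz hz' => hij ?_
    exact hz.2.symm.trans hz'.2
  rw [Metric.tendsto_atTop']
  intro ε hε
  obtain ⟨η, hη, hsmall⟩ := hq.exists_small (half_pos hε)
  obtain ⟨S, hS⟩ : ∃ S : Finset ι, lamT T (Measure.count : Measure ι)
      (B ∩ Prod.snd ⁻¹' (S : Set ι)ᶜ) ≤ ENNReal.ofReal η := by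
    have h1 := tendsto_measure_iInter_atTop (μ := lamT T (Measure.count : Measure ι))
      (s := fun S : Finset ι => B ∩ Prod.snd ⁻¹' (S : Set ι)ᶜ)
      (fun S => (hB.inter (measurable_snd S.measurableSet.compl)).nullMeasurableSet)
      (fun S S' h => Set.inter_subset_inter_right _ (Set.preimage_mono
        (Set.compl_subset_compl.2 (Finset.coe_subset.2 h))))
      ⟨∅, ((measure_mono Set.inter_subset_left).trans_lt hBf).ne⟩
    have h2 : ⋂ S : Finset ι, B ∩ (Prod.snd ⁻¹' (S : Set ι)ᶜ : Set (Set.Icc (0 : ℝ) T × ι)) = ∅ := by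
      refine Set.eq_empty_of_forall_notMem fun z hz => ?_
      have h3 := (Set.mem_iInter.1 hz {z.2}).2
      simp at h3
    rw [h2, measure_empty] at h1
    exact (h1.eventually (ge_mem_nhds (ENNReal.ofReal_pos.2 hη))).exists
  obtain ⟨N, hN⟩ := Metric.tendsto_atTop.1 (hfinite S) (ε / 2) (half_pos hε)
  refine ⟨N, fun n hn => ?_⟩
  have h1 := hN n hn.le
  rw [dist_zero_right, Real.norm_eq_abs] at h1 ⊢
  have hSm : MeasurableSet (Prod.snd ⁻¹' (S : Set ι) : Set (Set.Icc (0 : ℝ) T × ι)) :=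
    measurable_snd S.measurableSet
  have hC : MeasurableSet (B ∩ Prod.snd ⁻¹' (S : Set ι)ᶜ) := hB.inter hSm.compl
  have h2 := integral_inter_add_sdiff hSm (hq.integrableOn hB hBf n)
  have h3 : |∫ z in B ∩ Prod.snd ⁻¹' (S : Set ι)ᶜ, ctrlCoeff a σs σ n z ∂(lamT T Measure.count)| ≤
      ε / 2 := by
    have h4 := hsmall ((B ∩ Prod.snd ⁻¹' (S : Set ι)ᶜ).indicator fun _ => (1 : ℝ))
      (fun z => by
        refine (norm_indicator_le_norm_self _ _).trans ?_
        simp)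
      (by
        refine le_trans (le_of_eq ?_) hS
        rw [← lintegral_indicator_one hC]
        refine lintegral_congr fun z => ?_
        by_cases hz : z ∈ B ∩ Prod.snd ⁻¹' (S : Set ι)ᶜ
        · rw [Set.indicator_of_mem hz, Set.indicator_of_mem hz, enorm_one, Pi.one_apply]
        · rw [Set.indicator_of_notMem hz, Set.indicator_of_notMem hz, enorm_zero]) n
    have h5 := (enorm_integral_le_lintegral_enorm (ctrlCoeff a σs σ n)
      (μ := (lamT T Measure.count).restrict (B ∩ Prod.snd ⁻¹' (S : Set ι)ᶜ))).trans
      (le_trans (le_of_eq ?_) h4)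
    · rwa [← ofReal_norm, ENNReal.ofReal_le_ofReal_iff (half_pos hε).le] at h5
    · rw [← lintegral_indicator hC]
      refine lintegral_congr fun z => ?_
      by_cases hz : z ∈ B ∩ Prod.snd ⁻¹' (S : Set ι)ᶜ
      · rw [Set.indicator_of_mem hz, Set.indicator_of_mem hz, enorm_one, mul_one]
      · rw [Set.indicator_of_notMem hz, Set.indicator_of_notMem hz, enorm_zero, mul_zero]
  rw [← h2, Set.sdiff_eq]
  refine (abs_add_le _ _).trans_lt ?_
  rw [Set.preimage_compl] at h3
  linarith

end Gaussian

end FracSkeleton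

namespace FracSkeleton

/-! ### The skeleton equation as an equation with a state-dependent source -/

section
variable {d : ℕ} {O : Set (Space d)} {γ p δ T : ℝ} {F : ℝ → ℝ}

lemma Ambient.add_linear [hpf : Fact (1 < p)] (hA : Ambient O γ p F) (hδ : 0 ≤ δ) :
    Ambient O γ p fun r => F r + δ * r :=
  { hA with condF := condF_add_linear hpf.out hA.condF hδ }

lemma pairF_add_linear [hpf : Fact (1 < p)] (hA : Ambient O γ p F) {u v : HSpace O}
    (hu : powInt p u < ∞) (hv : powInt p v < ∞) :
    pairF (fun r => F r + δ * r) u v = pairF F u v + δ * inner ℝ u v := by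
  obtain ⟨k, hk, hFk⟩ := hA.condF.2.1
  have h1 := (pairF_bound hA.isOpen.measurableSet hA.finite hA.condF.1.continuous hk.le hFk hu hv).1
  rw [pairF, pairF, inner_eq_integral, ← integral_const_mul,
    ← integral_add h1 ((integrable_rep_mul u v).const_mul δ)]
  refine integral_congr_ae (Eventually.of_forall fun x => ?_)
  simp only
  ring

variable {ι U : Type*} [NormedAddCommGroup U] [InnerProductSpace ℝ U]
  {E : Type*} [MeasurableSpace E] [Countable ι] {a : HilbertBasis ι ℝ U}
  {g : Set.Icc (0 : ℝ) T → HSpace O → U →L[ℝ] HSpace O}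
  {lam : Measure E} [SigmaFinite lam] {h : Set.Icc (0 : ℝ) T → HSpace O → E → HSpace O}
  {Υ : ℕ} {σ : L2Time T U} {ρ : Set.Icc (0 : ℝ) T × E → ℝ≥0} {u₀ : HSpace O}

section
variable (hT : 0 < T) (hh : CondH T lam h) (hexp₀ : ExpIntegrable (lamT T lam) (hNorm0 h))
  (hexp₁ : ExpIntegrable (lamT T lam) (hNorm1 h)) (hS : MemS lam Υ σ ρ)
include hT hh hexp₀ hexp₁ hS

omit [Countable ι] in
lemma integrableOn_jumpSource (u : C(Set.Icc (0 : ℝ) T, HSpace O)) :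
    IntegrableOn (fun s => jumpSource lam h ρ (Set.projIcc 0 T hT.le s) (Set.IccExtend hT.le u s))
      (Set.Ioc 0 T) := by
  obtain ⟨Θ, hΘ⟩ := exists_jumpSource_bound (U := U) hh hT hexp₀ hexp₁
  obtain ⟨m, hm0, hmi, -, -, hgr, -⟩ := hΘ Υ σ ρ hS
  have h1 : Integrable (fun s => jumpSource lam h ρ s (u s)) (timeVol T) := by
    refine (hmi.mul_const (1 + ‖u‖)).mono'
      (aestronglyMeasurable_jumpSource hh u.continuous hS.2.1) ?_
    filter_upwards [hgr] with s hs
    refine (hs _).trans (mul_le_mul_of_nonneg_left ?_ (hm0 s))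
    linarith [u.norm_coe_le_norm s]
  exact (measurePreserving_projIcc hT).integrable_comp_of_integrable h1

lemma integrableOn_diffusion (hg : CondG T a g) (u : C(Set.Icc (0 : ℝ) T, HSpace O)) :
    IntegrableOn (fun s => g (Set.projIcc 0 T hT.le s) (Set.IccExtend hT.le u s)
      (σ (Set.projIcc 0 T hT.le s))) (Set.Ioc 0 T) := by
  obtain ⟨Mb, Lb, hsrc⟩ := exists_isSource hh hT hg hexp₀ hexp₁ Υ
  obtain ⟨m, ℓ, hG, -⟩ := hsrc σ ρ hS
  have h1 := (hG.integrableOn (u := Set.IccExtend hT.le u) u.continuous.Icc_extend').sub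
    (integrableOn_jumpSource hT hh hexp₀ hexp₁ hS u)
  refine h1.congr (Eventually.of_forall fun s => ?_)
  simp only [skelSource, Pi.sub_apply, add_sub_cancel_right]

theorem isSkeletonSolution_iff [hpf : Fact (1 < p)] (hA : Ambient O γ p F) (hg : CondG T a g)
    (u : C(Set.Icc (0 : ℝ) T, HSpace O)) :
    IsSkeletonSolution γ δ p F g lam h u₀ σ ρ u ↔
      IsWeakSol γ p (fun r => F r + δ * r) T u₀
        (fun s => skelSource g lam h σ ρ (Set.projIcc 0 T hT.le s) (Set.IccExtend hT.le u s))
        (Set.IccExtend hT.le u) := by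
  have huc : Continuous (Set.IccExtend hT.le u) := u.continuous.Icc_extend'
  have hV : ∫⁻ t, gagliardoSq γ (u t) ∂(timeVol T) =
      ∫⁻ s in Set.Ioc 0 T, gagliardoSq γ (Set.IccExtend hT.le u s) := lintegral_timeVol hT _
  have hP : ∫⁻ t, (∫⁻ x, ‖rep (u t) x‖ₑ ^ (p + 1)) ∂(timeVol T) =
      ∫⁻ s in Set.Ioc 0 T, powInt p (Set.IccExtend hT.le u s) := lintegral_timeVol hT _
  have key : ∫⁻ s in Set.Ioc 0 T, gagliardoSq γ (Set.IccExtend hT.le u s) < ∞ →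
      ∫⁻ s in Set.Ioc 0 T, powInt p (Set.IccExtend hT.le u s) < ∞ →
      ∀ (t : Set.Icc (0 : ℝ) T) (v : HSpace O), MemV γ v → powInt p v < ∞ →
      inner ℝ u₀ v
        - ∫ s in Set.Iic t, formA γ δ (u s) v ∂(timeVol T)
        - ∫ s in Set.Iic t, (∫ x, F (rep (u s) x) * rep v x) ∂(timeVol T)
        + ∫ s in Set.Iic t, inner ℝ (g s (u s) (σ s)) v ∂(timeVol T)
        + ∫ s in Set.Iic t, (∫ ξ, inner ℝ (h s (u s) ξ) v * ((ρ (s, ξ) : ℝ) - 1) ∂lam)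
            ∂(timeVol T) =
      inner ℝ u₀ v + ∫ s in (0 : ℝ)..t, (inner ℝ (skelSource g lam h σ ρ
        (Set.projIcc 0 T hT.le s) (Set.IccExtend hT.le u s)) v -
        inner ℝ (Dop γ (Set.IccExtend hT.le u s)) (Dop γ v) -
        pairF (fun r => F r + δ * r) (Set.IccExtend hT.le u s) v) := by
    intro hV' hP' t v hv hv'
    rw [setIntegral_timeVol hT, setIntegral_timeVol hT, setIntegral_timeVol hT,
      setIntegral_timeVol hT]
    set w := Set.IccExtend hT.le u with hw
    set π := Set.projIcc 0 T hT.le with hπ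
    change inner ℝ u₀ v - (∫ s in (0 : ℝ)..t, formA γ δ (w s) v) -
      (∫ s in (0 : ℝ)..t, pairF F (w s) v) + (∫ s in (0 : ℝ)..t, inner ℝ (g (π s) (w s) (σ (π s))) v) +
      (∫ s in (0 : ℝ)..t, ∫ ξ, inner ℝ (h (π s) (w s) ξ) v * ((ρ (π s, ξ) : ℝ) - 1) ∂lam) = _
    have i1 : IntegrableOn (fun s => δ * inner ℝ (w s) v + inner ℝ (Dop γ (w s)) (Dop γ v))
        (Set.Ioc 0 T) :=
      (continuous_const.mul (huc.inner continuous_const)).integrableOn_Ioc.add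
        (integrableOn_inner_Dop hA huc hV' _)
    have e1 : ∀ᵐ s ∂(volume.restrict (Set.Ioc 0 T)),
        δ * inner ℝ (w s) v + inner ℝ (Dop γ (w s)) (Dop γ v) = formA γ δ (w s) v := by
      filter_upwards [ae_memV hA.γ_pos hA.γ_lt huc hV'] with s hs
      rw [formA_eq hA.γ_pos hA.γ_lt δ hs hv]
    have j1 : IntegrableOn (fun s => formA γ δ (w s) v) (Set.Ioc 0 T) := i1.congr e1
    have j2 := integrableOn_pairF hA huc hP' hv'
    have j3 : IntegrableOn (fun s => (inner ℝ (g (π s) (w s) (σ (π s))) v : ℝ)) (Set.Ioc 0 T) :=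
      integrableOn_inner_continuous (integrableOn_diffusion hT hh hexp₀ hexp₁ hS hg u)
        continuous_const
    have i4 : IntegrableOn (fun s => (inner ℝ (jumpSource lam h ρ (π s) (w s)) v : ℝ))
        (Set.Ioc 0 T) :=
      integrableOn_inner_continuous (integrableOn_jumpSource hT hh hexp₀ hexp₁ hS u)
        continuous_const
    have e4 : ∀ᵐ s ∂(volume.restrict (Set.Ioc 0 T)), inner ℝ (jumpSource lam h ρ (π s) (w s)) v =
        ∫ ξ, inner ℝ (h (π s) (w s) ξ) v * ((ρ (π s, ξ) : ℝ) - 1) ∂lam := by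
      obtain ⟨Θ, hΘ⟩ := exists_jumpSource_bound (U := U) hh hT hexp₀ hexp₁
      obtain ⟨m, -, -, -, hint, -⟩ := hΘ Υ σ ρ hS
      filter_upwards [(measurePreserving_projIcc hT).quasiMeasurePreserving.ae hint] with s hs
      rw [jumpSource, real_inner_comm, ← integral_inner (hs (w s))]
      refine integral_congr_ae (Eventually.of_forall fun ξ => ?_)
      simp only
      rw [inner_smul_right_hSpace, real_inner_comm, mul_comm]
    have j4 : IntegrableOn (fun s => ∫ ξ, inner ℝ (h (π s) (w s) ξ) v * ((ρ (π s, ξ) : ℝ) - 1) ∂lam)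
        (Set.Ioc 0 T) := i4.congr e4
    have h0 : (0 : ℝ) ∈ Set.Icc 0 T := ⟨le_rfl, hT.le⟩
    have ii := fun {f : ℝ → ℝ} (hf : IntegrableOn f (Set.Ioc 0 T)) =>
      intervalIntegrable_of_integrableOn hf h0 t.2
    have j34 : IntervalIntegrable (fun s => inner ℝ (g (π s) (w s) (σ (π s))) v +
        ∫ ξ, inner ℝ (h (π s) (w s) ξ) v * ((ρ (π s, ξ) : ℝ) - 1) ∂lam) volume 0 t :=
      (ii j3).add (ii j4)
    have j341 : IntervalIntegrable (fun s => inner ℝ (g (π s) (w s) (σ (π s))) v +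
        (∫ ξ, inner ℝ (h (π s) (w s) ξ) v * ((ρ (π s, ξ) : ℝ) - 1) ∂lam) -
        formA γ δ (w s) v) volume 0 t := j34.sub (ii j1)
    have hsum : ∫ s in (0 : ℝ)..t, (inner ℝ (skelSource g lam h σ ρ (π s) (w s)) v -
        inner ℝ (Dop γ (w s)) (Dop γ v) - pairF (fun r => F r + δ * r) (w s) v) =
        ∫ s in (0 : ℝ)..t, (inner ℝ (g (π s) (w s) (σ (π s))) v +
          (∫ ξ, inner ℝ (h (π s) (w s) ξ) v * ((ρ (π s, ξ) : ℝ) - 1) ∂lam) -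
          formA γ δ (w s) v - pairF F (w s) v) := by
      rw [intervalIntegral.integral_of_le t.2.1, intervalIntegral.integral_of_le t.2.1]
      refine integral_congr_ae (ae_Ioc_of_ae t.2 ?_)
      filter_upwards [e1, e4, ae_powInt huc hP'] with s h1 h4 h5
      rw [← h1, ← h4, skelSource, inner_add_left, pairF_add_linear hA h5 hv']
      ring
    rw [hsum, intervalIntegral.integral_sub j341 (ii j2), intervalIntegral.integral_sub j34 (ii j1),
      intervalIntegral.integral_add (ii j3) (ii j4)]
    ring
  constructor
  · intro hu
    have hV' := hV ▸ hu.mem_L2V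
    have hP' := hP ▸ hu.mem_Lp
    refine ⟨huc, hV', hP', fun t ht v hv hv' => ?_⟩
    rw [← key hV' hP' ⟨t, ht⟩ v hv hv', Set.IccExtend_of_mem hT.le _ ht]
    exact hu.eqn ⟨t, ht⟩ v hv ((memLp_iff_powInt v).2 hv')
  · intro hu
    refine ⟨hV.symm ▸ hu.memV, hP.symm ▸ hu.memP, fun t v hv hv' => ?_⟩
    have hv'' := (memLp_iff_powInt v).1 hv'
    rw [key hu.memV hu.memP t v hv hv'', ← hu.eqn t t.2 v hv hv'', Set.IccExtend_val]

/-! ### Existence and uniqueness for the skeleton equation -/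

variable [hpf : Fact (1 < p)] (hA : Ambient O γ p F) (hδ : 0 ≤ δ) (hg : CondG T a g)
include hA hδ hg

theorem exists_isSkeletonSolution (u₀ : HSpace O) :
    ∃ u, IsSkeletonSolution γ δ p F g lam h u₀ σ ρ u := by
  obtain ⟨Mb, Lb, hsrc⟩ := exists_isSource hh hT hg hexp₀ hexp₁ Υ
  obtain ⟨m, ℓ, hG, -⟩ := hsrc σ ρ hS
  obtain ⟨u, hu⟩ := source_exists (hA.add_linear hδ) hT hG u₀
  exact ⟨u, (isSkeletonSolution_iff hT hh hexp₀ hexp₁ hS hA hg u).2 hu⟩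

theorem IsSkeletonSolution.unique {u v : C(Set.Icc (0 : ℝ) T, HSpace O)}
    (hu : IsSkeletonSolution γ δ p F g lam h u₀ σ ρ u)
    (hv : IsSkeletonSolution γ δ p F g lam h u₀ σ ρ v) : u = v := by
  obtain ⟨Mb, Lb, hsrc⟩ := exists_isSource hh hT hg hexp₀ hexp₁ Υ
  obtain ⟨m, ℓ, hG, -⟩ := hsrc σ ρ hS
  have h1 := source_unique (hA.add_linear hδ) hT hG
    ((isSkeletonSolution_iff hT hh hexp₀ hexp₁ hS hA hg u).1 hu)
    ((isSkeletonSolution_iff hT hh hexp₀ hexp₁ hS hA hg v).1 hv)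
  ext1 t
  have h2 := h1 t.2
  rwa [Set.IccExtend_val, Set.IccExtend_val] at h2

end

/-! ### The solution map is well defined -/

omit [Countable ι] in
lemma primitive_injective [CompleteSpace U] (hT : 0 < T) :
    Function.Injective (primitive : L2Time T U → C(Set.Icc (0 : ℝ) T, U)) := by
  intro σ σ' h
  have hi : ∀ τ : L2Time T U, IntervalIntegrable (fun s => τ (Set.projIcc 0 T hT.le s)) volume 0 T :=
    fun τ => (intervalIntegrable_iff_integrableOn_Ioc_of_le hT.le).2
      ((measurePreserving_projIcc hT).integrable_comp_of_integrable
        ((Lp.memLp τ).integrable one_le_two))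
  have hsub : ∀ t ∈ Set.Icc 0 T, ∫ s in (0 : ℝ)..t, σ (Set.projIcc 0 T hT.le s) =
      ∫ s in (0 : ℝ)..t, σ' (Set.projIcc 0 T hT.le s) := fun t ht => by
    have h1 := DFunLike.congr_fun h ⟨t, ht⟩
    have h2 := setIntegral_timeVol hT (fun s => σ s) ⟨t, ht⟩
    have h3 := setIntegral_timeVol hT (fun s => σ' s) ⟨t, ht⟩
    exact h2.symm.trans (h1.trans h3)
  have hae : ∀ᵐ s ∂(volume.restrict (Set.Ioc 0 T)),
      σ (Set.projIcc 0 T hT.le s) = σ' (Set.projIcc 0 T hT.le s) := by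
    rw [ae_restrict_iff' measurableSet_Ioc]
    have hT0 : ∀ᵐ s : ℝ, s ≠ T := by simp [ae_iff]
    filter_upwards [(hi σ).ae_hasDerivAt_integral, (hi σ').ae_hasDerivAt_integral, hT0]
      with s h1 h2 h3 hs
    have hmem : s ∈ Set.uIcc 0 T := by
      rw [Set.uIcc_of_le hT.le]
      exact ⟨hs.1.le, hs.2⟩
    have h0 : (0 : ℝ) ∈ Set.uIcc 0 T := Set.left_mem_uIcc
    have hnhds : Set.Icc 0 T ∈ 𝓝 s := Icc_mem_nhds hs.1 (lt_of_le_of_ne hs.2 h3)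
    have h4 := h2 hmem 0 h0
    refine (h1 hmem 0 h0).unique (h4.congr_of_eventuallyEq ?_)
    filter_upwards [hnhds] with t ht using hsub t ht
  refine Lp.ext ?_
  have hm : MeasurableSet {s | σ s = σ' s} :=
    (Lp.stronglyMeasurable σ).measurableSet_eq_fun (Lp.stronglyMeasurable σ')
  change timeVol T {s | σ s = σ' s}ᶜ = 0
  rw [← (measurePreserving_projIcc hT).measure_preimage hm.compl.nullMeasurableSet]
  exact hae

omit [Countable ι] in
lemma IsSkeletonSolution.congr_ae {ρ' : Set.Icc (0 : ℝ) T × E → ℝ≥0} (hρ : ρ =ᵐ[lamT T lam] ρ')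
    {u : C(Set.Icc (0 : ℝ) T, HSpace O)} (hu : IsSkeletonSolution γ δ p F g lam h u₀ σ ρ u) :
    IsSkeletonSolution γ δ p F g lam h u₀ σ ρ' u := by
  refine ⟨hu.mem_L2V, hu.mem_Lp, fun t v hv hv' => ?_⟩
  rw [hu.eqn t v hv hv']
  congr 1
  refine setIntegral_congr_ae measurableSet_Iic ?_
  filter_upwards [Measure.ae_ae_of_ae_prod hρ] with s hs _
  refine integral_congr_ae ?_
  filter_upwards [hs] with ξ hξ
  rw [hξ]

theorem isSkeletonSolution_iff_eq_skeletonMap [CompleteSpace U] [hpf : Fact (1 < p)]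
    (hA : Ambient O γ p F) (hδ : 0 ≤ δ) (hT : 0 < T) (hg : CondG T a g) (hh : CondH T lam h)
    (hexp₀ : ExpIntegrable (lamT T lam) (hNorm0 h))
    (hexp₁ : ExpIntegrable (lamT T lam) (hNorm1 h)) (hS : MemS lam Υ σ ρ)
    (u : C(Set.Icc (0 : ℝ) T, HSpace O)) :
    IsSkeletonSolution γ δ p F g lam h u₀ σ ρ u ↔
      u = skeletonMap γ δ p F g lam h u₀ (primitive σ) (ctrlMeasure lam ρ) := by
  obtain ⟨v, hv⟩ := exists_isSkeletonSolution hT hh hexp₀ hexp₁ hS hA hδ hg u₀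
  have hmap : IsSkeletonSolution γ δ p F g lam h u₀ σ ρ
      (skeletonMap γ δ p F g lam h u₀ (primitive σ) (ctrlMeasure lam ρ)) := by
    obtain ⟨Υ', σ', ρ', hS', hσ', hρ', hsol⟩ := Classical.epsilon_spec
      (p := fun u => ∃ (Υ : ℕ) (σ' : L2Time T U) (ρ' : Set.Icc (0 : ℝ) T × E → ℝ≥0),
        MemS lam Υ σ' ρ' ∧ primitive σ = primitive σ' ∧ ctrlMeasure lam ρ = ctrlMeasure lam ρ' ∧
        IsSkeletonSolution γ δ p F g lam h u₀ σ' ρ' u)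
      ⟨v, Υ, σ, ρ, hS, rfl, rfl, hv⟩
    have h1 := primitive_injective hT hσ'
    have h2 := (withDensity_eq_iff_of_sigmaFinite hS.2.1.coe_nnreal_ennreal.aemeasurable
      hS'.2.1.coe_nnreal_ennreal.aemeasurable).1 hρ'
    obtain rfl := h1
    refine IsSkeletonSolution.congr_ae ?_ hsol
    filter_upwards [h2] with z hz
    exact (ENNReal.coe_inj.1 hz).symm
  constructor
  · intro hu
    exact hu.unique hT hh hexp₀ hexp₁ hS hA hδ hg hmap
  · rintro rfl
    exact hmap

end

end FracSkeleton

namespace FracSkeleton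

/-! ### Continuity of the solution map -/

lemma integral_inner_smul_apply {ι U K : Type*} [NormedAddCommGroup U] [InnerProductSpace ℝ U]
    [NormedAddCommGroup K] [InnerProductSpace ℝ K] [CompleteSpace K] [Countable ι]
    [MeasurableSpace ι] [MeasurableSingletonClass ι] (a : HilbertBasis ι ℝ U) {G : U →L[ℝ] K}
    {M : ℝ} (hM : 0 ≤ M) (h : hsNormSq a G ≤ ENNReal.ofReal M) (y : U) :
    ∫ i, (inner ℝ (a i) y : ℝ) • G (a i) ∂Measure.count = G y := by
  have h1 : Integrable (fun i => (inner ℝ (a i) y : ℝ) • G (a i)) Measure.count :=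
    integrable_count_iff.2 (summable_of_sum_le (fun i => norm_nonneg _)
      (sum_abs_mul_norm_le a hM h y))
  rw [integral_countable h1]
  have h2 : ∀ i : ι, (Measure.count : Measure ι).real {i} = 1 := fun i => by simp
  simp only [h2, one_smul]
  exact (hasSum_inner_smul_apply a G y).tsum_eq

section
variable {d : ℕ} {O : Set (Space d)} {γ p δ T : ℝ} {F : ℝ → ℝ}
  {ι U : Type*} [NormedAddCommGroup U] [InnerProductSpace ℝ U] {E : Type*} [MeasurableSpace E]
  [Countable ι] {a : HilbertBasis ι ℝ U} {g : Set.Icc (0 : ℝ) T → HSpace O → U →L[ℝ] HSpace O}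
  {lam : Measure E} {h : Set.Icc (0 : ℝ) T → HSpace O → E → HSpace O} {Υ : ℕ}
  {σs : ℕ → L2Time T U} {ρs : ℕ → Set.Icc (0 : ℝ) T × E → ℝ≥0} {σ : L2Time T U}
  {ρ : Set.Icc (0 : ℝ) T × E → ℝ≥0} {u₀ : HSpace O}

omit [Countable ι] in
lemma MemS.norm_sq_le (hS : MemS lam Υ σ ρ) : ‖σ‖ ^ 2 ≤ 2 * Υ := by
  have h1 : ‖σ‖ ^ 2 = ∫ t, ‖σ t‖ ^ 2 ∂(timeVol T) := by
    rw [← real_inner_self_eq_norm_sq, L2.inner_def]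
    simp only [real_inner_self_eq_norm_sq]
  have h2 := hS.1
  rw [h1]
  linarith

omit [Countable ι] in
lemma MemS.norm_sub_sq_le {σ' : L2Time T U} {ρ' : Set.Icc (0 : ℝ) T × E → ℝ≥0}
    (hS : MemS lam Υ σ ρ) (hS' : MemS lam Υ σ' ρ') : ‖σ - σ'‖ ^ 2 ≤ (8 * Υ : ℝ≥0) := by
  have h1 := hS.norm_sq_le
  have h2 := hS'.norm_sq_le
  have h3 := pow_le_pow_left₀ (norm_nonneg _) (norm_sub_le σ σ') 2
  push_cast
  nlinarith [sq_nonneg (‖σ‖ - ‖σ'‖)]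

lemma CondG.eventually_diffusion (hg : CondG T a g) {M : ℝ≥0} (hM : ∀ n, ‖σs n - σ‖ ^ 2 ≤ M)
    (hσ : ∀ φ : L2Time T U, Tendsto (fun n => inner ℝ (σs n) φ) atTop (𝓝 (inner ℝ σ φ)))
    {D : Set (HSpace O)} (hD : Dense D) (h0 : 0 ∈ D) {w : ℕ → Set.Icc (0 : ℝ) T → HSpace O}
    (hw : IsTestPath T D w) (u : C(Set.Icc (0 : ℝ) T, HSpace O)) {ε : ℝ} (hε : 0 < ε) :
    ∀ᶠ n in atTop, ∀ t : Set.Icc (0 : ℝ) T,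
      |∫ s in Set.Iic t, inner ℝ (g s (u s) (σs n s) - g s (u s) (σ s)) (w n s) ∂(timeVol T)| ≤
        ε := by
  let _ : MeasurableSpace ι := ⊤
  obtain ⟨C, hC, hgr⟩ := hg.2.1
  have hHm : Measurable fun z : Set.Icc (0 : ℝ) T × ι => g z.1 (u z.1) (a z.2) :=
    measurable_from_prod_countable_left fun i =>
      (hg.measurable (a i)).comp (measurable_id.prodMk u.continuous.measurable)
  have hH2 : ∫⁻ z : Set.Icc (0 : ℝ) T × ι, ‖g z.1 (u z.1) (a z.2)‖ₑ ^ 2 ∂(lamT T Measure.count)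
      < ∞ := by
    rw [lamT, lintegral_prod _ (hHm.enorm.pow_const 2).aemeasurable]
    refine (lintegral_mono (g := fun _ => ENNReal.ofReal (C * (1 + ‖u‖ ^ 2))) fun s => ?_).trans_lt
      (by rw [lintegral_const]; exact ENNReal.mul_lt_top ENNReal.ofReal_lt_top (measure_lt_top _ _))
    rw [lintegral_count]
    refine (hgr s (u s)).trans (ENNReal.ofReal_le_ofReal ?_)
    have := u.norm_coe_le_norm s
    gcongr
  have hHΨ : ∀ κ > 0, ∫⁻ z : Set.Icc (0 : ℝ) T × ι,
      ENNReal.ofReal ((κ * ‖g z.1 (u z.1) (a z.2)‖) ^ 2) ∂(lamT T Measure.count) < ∞ := fun κ hκ => by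
    have h1 : ∀ z : Set.Icc (0 : ℝ) T × ι, ENNReal.ofReal ((κ * ‖g z.1 (u z.1) (a z.2)‖) ^ 2) =
        ENNReal.ofReal (κ ^ 2) * ‖g z.1 (u z.1) (a z.2)‖ₑ ^ 2 := fun z => by
      rw [mul_pow, ENNReal.ofReal_mul (sq_nonneg _), ENNReal.ofReal_pow (norm_nonneg _), ofReal_norm]
    simp only [h1]
    rw [lintegral_const_mul' _ _ ENNReal.ofReal_ne_top]
    exact ENNReal.mul_lt_top ENNReal.ofReal_lt_top hH2
  filter_upwards [eventually_kernel_integral (isYoungBounded_ctrlCoeff a hM) hw hD h0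
    (fun B hB hBf => tendsto_setIntegral_ctrlCoeff a hM hσ hB hBf) hHm
    ((memLp_two_iff hHm.aestronglyMeasurable).2 hH2) hHΨ hε] with n hn t
  refine le_of_eq_of_le (congrArg _ (setIntegral_congr_ae measurableSet_Iic ?_)) (hn t)
  filter_upwards [Lp.coeFn_sub (σs n) σ] with s hs _
  have h1 := integral_inner_smul_apply a (by positivity) (hgr s (u s)) ((σs n - σ : L2Time T U) s)
  have h2 : g s (u s) ((σs n - σ : L2Time T U) s) = g s (u s) (σs n s) - g s (u s) (σ s) := by
    rw [hs, Pi.sub_apply, map_sub]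
  exact congrArg (fun x => (inner ℝ x (w n s) : ℝ)) (h2.symm.trans h1.symm)

lemma CondH.eventually_jump [TopologicalSpace E] [PolishSpace E] [LocallyCompactSpace E]
    [BorelSpace E] [IsFiniteMeasureOnCompacts lam] (hT : 0 < T) (hh : CondH T lam h)
    (hexp₀ : ExpIntegrable (lamT T lam) (hNorm0 h)) (hexp₁ : ExpIntegrable (lamT T lam) (hNorm1 h))
    (hSs : ∀ n, MemS lam Υ (σs n) (ρs n)) (hS : MemS lam Υ σ ρ)
    (hρ : VagueTendsto (fun n => ctrlMeasure lam (ρs n)) (ctrlMeasure lam ρ))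
    {D : Set (HSpace O)} (hD : Dense D) (h0 : 0 ∈ D) {w : ℕ → Set.Icc (0 : ℝ) T → HSpace O}
    (hw : IsTestPath T D w) (u : C(Set.Icc (0 : ℝ) T, HSpace O)) {ε : ℝ} (hε : 0 < ε) :
    ∀ᶠ n in atTop, ∀ t : Set.Icc (0 : ℝ) T,
      |∫ s in Set.Iic t, inner ℝ (jumpSource lam h (ρs n) s (u s) - jumpSource lam h ρ s (u s))
        (w n s) ∂(timeVol T)| ≤ ε := by
  obtain ⟨C, hC, hgr⟩ := hh.2.2
  have hreg : (lamT T lam).Regular := by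
    rw [lamT]; infer_instance
  set H : Set.Icc (0 : ℝ) T × E → HSpace O := fun z => h z.1 (u z.1) z.2 with hHdef
  have hHm : Measurable H := hh.1.comp (measurable_fst.prodMk
    ((u.continuous.measurable.comp measurable_fst).prodMk measurable_snd))
  have hH2 : ∫⁻ z, ‖H z‖ₑ ^ 2 ∂(lamT T lam) < ∞ := by
    rw [lamT, lintegral_prod _ (hHm.enorm.pow_const 2).aemeasurable]
    refine (lintegral_mono (g := fun _ => ENNReal.ofReal (C * (1 + ‖u‖ ^ 2))) fun s => ?_).trans_lt
      (by rw [lintegral_const]; exact ENNReal.mul_lt_top ENNReal.ofReal_lt_top (measure_lt_top _ _))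
    refine (hgr s (u s)).trans (ENNReal.ofReal_le_ofReal ?_)
    have := u.norm_coe_le_norm s
    gcongr
  have hHΨ : ∀ κ > 0, ∫⁻ z, ENNReal.ofReal (2 * expGap (κ * ‖H z‖)) ∂(lamT T lam) < ∞ := by
    intro κ hκ
    obtain ⟨δ', hδ', K, hK, N, hN, hNN, hfin⟩ := hexp₀.exists_weight hT
    set r := 1 + ‖u‖ with hr
    have hr0 : 0 < r := by positivity
    have hpt : ∀ᵐ z ∂(lamT T lam), ENNReal.ofReal (2 * expGap (κ * ‖H z‖)) ≤
        ENNReal.ofReal 2 * (ENNReal.ofReal ((κ * r) ^ 2 * Real.exp (κ * r * K)) *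
          (ENNReal.ofReal (r⁻¹ ^ 2) * ‖H z‖ₑ ^ 2) +
        ENNReal.ofReal (Real.exp ((κ * r) ^ 2 / (4 * δ'))) *
          (Set.Ioi (ENNReal.ofReal K)).indicator (expWeight δ') (N z)) := by
      filter_upwards [hNN] with z hz
      have h1 : ENNReal.ofReal (r⁻¹ * ‖H z‖) ≤ N z := by
        have h2 : ‖H z‖ₑ ≤ ENNReal.ofReal r * hNorm0 h z :=
          (enorm_le_mul_hNorm0 z.1 (u z.1) z.2).trans (mul_le_mul_left
            (ENNReal.ofReal_le_ofReal (add_le_add le_rfl (u.norm_coe_le_norm z.1))) _)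
        rw [ENNReal.ofReal_mul (by positivity), ofReal_norm, ENNReal.ofReal_inv_of_pos hr0,
          mul_comm, ← div_eq_mul_inv, ← hz]
        exact ENNReal.div_le_of_le_mul' h2
      have h3 := expGap_le_add_expWeight hδ' (by positivity : 0 ≤ r⁻¹ * ‖H z‖)
        (by positivity : 0 ≤ κ * r) hK h1
      rw [show κ * r * (r⁻¹ * ‖H z‖) = κ * ‖H z‖ by field_simp,
        ENNReal.ofReal_mul (by positivity : 0 ≤ r⁻¹), mul_pow (ENNReal.ofReal r⁻¹), ofReal_norm,
        ← ENNReal.ofReal_pow (by positivity : 0 ≤ r⁻¹)] at h3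
      rw [ENNReal.ofReal_mul zero_le_two]
      exact mul_le_mul_right h3 _
    refine (lintegral_mono_ae hpt).trans_lt ?_
    rw [lintegral_const_mul' _ _ ENNReal.ofReal_ne_top,
      lintegral_add_left (((hHm.enorm.pow_const 2).const_mul _).const_mul _),
      lintegral_const_mul' _ _ ENNReal.ofReal_ne_top,
      lintegral_const_mul' _ _ ENNReal.ofReal_ne_top,
      lintegral_const_mul' _ _ ENNReal.ofReal_ne_top]
    have hmt := fun {x : ℝ} {y : ℝ≥0∞} (hy : y < ∞) =>
      ENNReal.mul_lt_top (ENNReal.ofReal_lt_top (r := x)) hy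
    exact hmt (ENNReal.add_lt_top.2 ⟨hmt (hmt hH2), hmt hfin⟩)
  have hρm := fun n => (hSs n).2.1
  have hρk := fun n => (hSs n).2.2
  obtain ⟨Θ, hΘ⟩ := exists_jumpSource_bound (U := U) hh hT hexp₀ hexp₁
  obtain ⟨-, -, -, -, hint, -⟩ := hΘ Υ σ ρ hS
  filter_upwards [eventually_kernel_integral (isYoungBounded_sub hρm hS.2.1 hρk hS.2.2) hw hD h0
    (fun B hB hBf => tendsto_setIntegral_of_vagueTendsto hρm hS.2.1 hρk hS.2.2 hρ hB hBf) hHm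
    ((memLp_two_iff hHm.aestronglyMeasurable).2 hH2) hHΨ hε] with n hn t
  obtain ⟨-, -, -, -, hintn, -⟩ := hΘ Υ (σs n) (ρs n) (hSs n)
  refine le_of_eq_of_le (congrArg _ (setIntegral_congr_ae measurableSet_Iic ?_)) (hn t)
  filter_upwards [hint, hintn] with s h1 h2 _
  rw [jumpSource, jumpSource, ← integral_sub (h2 (u s)) (h1 (u s))]
  simp only [← sub_smul, sub_sub_sub_cancel_right, hHdef]

theorem tendsto_of_ctrlTendsto [TopologicalSpace E] [PolishSpace E] [LocallyCompactSpace E]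
    [BorelSpace E] [IsFiniteMeasureOnCompacts lam] [hpf : Fact (1 < p)] (hA : Ambient O γ p F)
    (hδ : 0 ≤ δ) (hT : 0 < T) (hg : CondG T a g) (hh : CondH T lam h)
    (hexp₀ : ExpIntegrable (lamT T lam) (hNorm0 h)) (hexp₁ : ExpIntegrable (lamT T lam) (hNorm1 h))
    (hSs : ∀ n, MemS lam Υ (σs n) (ρs n)) (hS : MemS lam Υ σ ρ)
    (hconv : CtrlTendsto lam σs ρs σ ρ) {us : ℕ → C(Set.Icc (0 : ℝ) T, HSpace O)}
    {u : C(Set.Icc (0 : ℝ) T, HSpace O)}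
    (hus : ∀ n, IsSkeletonSolution γ δ p F g lam h u₀ (σs n) (ρs n) (us n))
    (hu : IsSkeletonSolution γ δ p F g lam h u₀ σ ρ u) : Tendsto us atTop (𝓝 u) := by
  have hA' := hA.add_linear hδ
  obtain ⟨Mb, Lb, hsrc⟩ := exists_isSource hh hT hg hexp₀ hexp₁ Υ
  choose m ℓ hG hm hℓ using fun n => hsrc (σs n) (ρs n) (hSs n)
  obtain ⟨m', ℓ', hG', hm', -⟩ := hsrc σ ρ hS
  have hws := fun n => (isSkeletonSolution_iff hT hh hexp₀ hexp₁ (hSs n) hA hg (us n)).1 (hus n)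
  have hwu := (isSkeletonSolution_iff hT hh hexp₀ hexp₁ hS hA hg u).1 hu
  obtain ⟨R, hR, hap⟩ := source_a_priori hA' hT u₀ Mb
  obtain ⟨κ, hκ, hst⟩ := source_stability (p := p) hA' hT
  obtain ⟨N, hN⟩ := exists_nat_ge (2 * (2 * κ * T + 2 * Lb R))
  have hpath := isTestPath_sub hA' hT hG hm hG' hm' hws hwu
  have hpath' : IsTestPath T (boundedV O γ) fun n t => us n t - u t := by
    simpa only [Set.IccExtend_val] using hpath
  have hD := dense_boundedV (O := O) hA.isOpen hA.d_pos hA.γ_pos hA.γ_lt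
  have h0D : (0 : HSpace O) ∈ boundedV O γ := ⟨(memV_zero hA.γ_pos hA.γ_lt).1, 0, bddBy_zero⟩
  rw [Metric.tendsto_nhds]
  intro ε hε
  set η : ℝ := (ε / 2) ^ 2 / (2 ^ N * 4) with hη
  have hη0 : 0 < η := by positivity
  filter_upwards [hg.eventually_diffusion (fun n => (hSs n).norm_sub_sq_le hS) hconv.1 hD h0D hpath'
    u hη0, hh.eventually_jump hT hexp₀ hexp₁ hSs hS hconv.2 hD h0D hpath' u hη0] with n hn₁ hn₂
  have hdiff : ∀ t ∈ Set.Icc 0 T, ‖Set.IccExtend hT.le (us n) t - Set.IccExtend hT.le u t‖ ^ 2 ≤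
      2 ^ N * (2 * (2 * η)) := by
    refine hst (hG n) hG' (hws n) hwu (hap (hG n) (hm n) (hws n)).1 (hap hG' hm' hwu).1
      (by positivity) (fun t ht => ?_) (by linarith [hℓ n R])
    have h1 := hn₁ ⟨t, ht⟩
    have h2 := hn₂ ⟨t, ht⟩
    rw [setIntegral_timeVol hT] at h1 h2
    have hwc : Continuous fun s => Set.IccExtend hT.le (us n) s - Set.IccExtend hT.le u s :=
      (hws n).cont.sub hwu.cont
    have h0 : (0 : ℝ) ∈ Set.Icc 0 T := ⟨le_rfl, hT.le⟩
    have i1 := intervalIntegrable_of_integrableOn (integrableOn_inner_continuous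
      ((integrableOn_diffusion hT hh hexp₀ hexp₁ (hSs n) hg u).sub
        (integrableOn_diffusion hT hh hexp₀ hexp₁ hS hg u)) hwc) h0 ht
    have i2 := intervalIntegrable_of_integrableOn (integrableOn_inner_continuous
      ((integrableOn_jumpSource hT hh hexp₀ hexp₁ (hSs n) u).sub
        (integrableOn_jumpSource hT hh hexp₀ hexp₁ hS u)) hwc) h0 ht
    have h3 := intervalIntegral.integral_add i1 i2
    have h4 : ∀ s, inner ℝ
        (skelSource g lam h (σs n) (ρs n) (Set.projIcc 0 T hT.le s) (Set.IccExtend hT.le u s) -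
          skelSource g lam h σ ρ (Set.projIcc 0 T hT.le s) (Set.IccExtend hT.le u s))
        (Set.IccExtend hT.le (us n) s - Set.IccExtend hT.le u s) = _ := fun s => by
      rw [skelSource, skelSource, add_sub_add_comm, inner_add_left]
    simp only [h4]
    refine h3.trans_le ?_
    rw [two_mul]
    exact add_le_add (le_of_abs_le h1) (le_of_abs_le h2)
  rw [dist_eq_norm]
  refine lt_of_le_of_lt ((ContinuousMap.norm_le _ (half_pos hε).le).2 fun t => ?_) (half_lt_self hε)
  have h5 := hdiff t t.2
  rw [Set.IccExtend_val, Set.IccExtend_val] at h5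
  refine abs_le_of_sq_le_sq' (a := ‖us n t - u t‖) (le_trans h5 (le_of_eq ?_)) (half_pos hε).le |>.2
  rw [hη]
  field_simp
  ring

end

end FracSkeleton

end

theorem proposition6p14
    {d : ℕ} (γ δ p T : ℝ) (hγ₀ : 0 < γ) (hγ₁ : γ < 1) (hd : 2 * γ < d) (hδ : 0 < δ)
    (hp₁ : 2 < p + 1) (hp₂ : p + 1 ≤ 2 * d / (d - 2 * γ)) (hT : 0 < T)
    (O : Set (FracSkeleton.Space d)) (hO : IsOpen O) (hOb : Bornology.IsBounded O)
    {ι U : Type*} [Countable ι] [NormedAddCommGroup U] [InnerProductSpace ℝ U] [CompleteSpace U]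
    (a : HilbertBasis ι ℝ U)
    {E : Type*} [TopologicalSpace E] [PolishSpace E] [LocallyCompactSpace E]
    [MeasurableSpace E] [BorelSpace E]
    (lam : Measure E) [IsFiniteMeasureOnCompacts lam]
    (F : ℝ → ℝ) (hF : FracSkeleton.CondF p F)
    (g : Set.Icc (0 : ℝ) T → FracSkeleton.HSpace O → U →L[ℝ] FracSkeleton.HSpace O)
    (hg : FracSkeleton.CondG T a g)
    (h : Set.Icc (0 : ℝ) T → FracSkeleton.HSpace O → E → FracSkeleton.HSpace O)
    (hh : FracSkeleton.CondH T lam h)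
    (hexp₀ : FracSkeleton.ExpIntegrable (FracSkeleton.lamT T lam) (FracSkeleton.hNorm0 h))
    (hexp₁ : FracSkeleton.ExpIntegrable (FracSkeleton.lamT T lam) (FracSkeleton.hNorm1 h))
    (u₀ : FracSkeleton.HSpace O) (Υ : ℕ) :
    -- on `S^Υ`, the value of `𝒢⁰` is the unique solution of the skeleton equation
    (∀ (σ : FracSkeleton.L2Time T U) (ρ : Set.Icc (0 : ℝ) T × E → ℝ≥0),
      FracSkeleton.MemS lam Υ σ ρ →
      ∀ u : C(Set.Icc (0 : ℝ) T, FracSkeleton.HSpace O),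
        FracSkeleton.IsSkeletonSolution γ δ p F g lam h u₀ σ ρ u ↔
          u = FracSkeleton.skeletonMap γ δ p F g lam h u₀
            (FracSkeleton.primitive σ) (FracSkeleton.ctrlMeasure lam ρ)) ∧
    -- and `𝒢⁰` is continuous along convergent sequences of controls
    ∀ (σs : ℕ → FracSkeleton.L2Time T U) (ρs : ℕ → Set.Icc (0 : ℝ) T × E → ℝ≥0)
      (σ : FracSkeleton.L2Time T U) (ρ : Set.Icc (0 : ℝ) T × E → ℝ≥0),
      (∀ n, FracSkeleton.MemS lam Υ (σs n) (ρs n)) → FracSkeleton.MemS lam Υ σ ρ →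
      FracSkeleton.CtrlTendsto lam σs ρs σ ρ →
      Tendsto
        (fun n => FracSkeleton.skeletonMap γ δ p F g lam h u₀
          (FracSkeleton.primitive (σs n)) (FracSkeleton.ctrlMeasure lam (ρs n)))
        atTop
        (𝓝 (FracSkeleton.skeletonMap γ δ p F g lam h u₀
          (FracSkeleton.primitive σ) (FracSkeleton.ctrlMeasure lam ρ))) := by
  have : Fact (1 < p) := ⟨by linarith⟩
  have hd₀ : 0 < d := by
    have h1 : (0 : ℝ) < d := by linarith
    exact_mod_cast h1
  have hA : FracSkeleton.Ambient O γ p F := ⟨hγ₀, hγ₁, hd₀, hO, hOb.measure_lt_top, hF⟩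
  have key := fun σ ρ hS => FracSkeleton.isSkeletonSolution_iff_eq_skeletonMap (U := U) (a := a)
    (u₀ := u₀) (Υ := Υ) (σ := σ) (ρ := ρ) hA hδ.le hT hg hh hexp₀ hexp₁ hS
  exact ⟨key, fun σs ρs σ ρ hSs hS hconv => FracSkeleton.tendsto_of_ctrlTendsto hA hδ.le hT hg hh
    hexp₀ hexp₁ hSs hS hconv (fun n => (key _ _ (hSs n) _).2 rfl) ((key _ _ hS _).2 rfl)⟩
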